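/- **Setting.** Let $n\ge 1$, label the vertices of an $(n+3)$-gon by $\mathbb Z/(n+3)$ counter-clockwise, and let $T$ be a triangulation (a maximal set of pairwise non-crossing internal diagonals, called arcs) no triangle of which has all three sides in $T$. Then $T$ has exactly two ears; let $s$ be the vertex such that $\{s-1,s,s+1\}$ is a chosen one of them. It is the source of the longest arc, which crosses all arcs of $T$, in the order $\gamma_1=(s-1,s+1),\gamma_2,\dots,\gamma_n$. **Super lambda lengths.** Let $R$ be an ordered field in which every non-negative element is a square (for instance $\mathbb R$, or the real closure of an ordered field $\mathbb R(x_1,\dots,x_n)$ in which the $x_i$ are positive indeterminates). Fix elements $x_i=x_{\gamma_i}=(\sqrt{x_i})^2$ of $R$ with $\sqrt{x_i}>0$ for the arcs of $T$, and let $\mathcal G$ be the Grassmann algebra over $R$ with one odd generator $\theta_\Delta$ for each triangle $\Delta$ of $T$. Square roots of even elements of $\mathcal G$ with positive degree-zero part are even with positive degree-zero part. Give $T$ the default orientation: $\gamma_i$ is directed away from its common vertex with $\gamma_{i-1}$ for $i\ge2$, and $\gamma_1$ away from its common vertex with $\gamma_2$ (if $n=1$, away from $s-1$). Assign $x_i$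 to $\gamma_i$, $1$ to the boundary segments, and the $\mu$-invariant $\theta_\Delta$ to $\Delta$. A flip of an arc $e$ directed from $l$ to $r$, in the quadrilateral with counter-clockwise vertices $l,w,r,u$, replaces $e$ by the arc $f$ directed from $w$ to $u$, reverses the direction of $(u,r)$, and, writing $a,b,c,d$ for the lambda lengths of $(u,l),(u,r),(r,w),(l,w)$ and $\theta,\sigma$ for the $\mu$-invariants of the triangles $\{l,r,u\},\{l,r,w\}$, assigns new values by $$ef=ac+bd+\sqrt{acbd}\,\sigma\theta,\qquad \sigma'=\frac{\sigma\sqrt{bd}-\theta\sqrt{ac}}{\sqrt{ac+bd}},\qquad \theta'=\frac{\theta\sqrt{bd}+\sigma\sqrt{ac}}{\sqrt{ac+bd}},$$ where $\sigma',\theta'$ belong to the triangles $\{u,r,w\},\{u,l,w\}$. The super lambda length $x_\gamma\in\mathcal G$ of an arc $\gamma$ is the value at $\gamma$ after a sequence of flips that leads from $T$ to a triangulation containing $\gamma$. **Modules.** Let $Q_T$ be the quiver with vertex set $T$ and an arrow $e\to f$ whenever $e,f$ are two sides of a triangle of $T$ and the angle from $e$ to $f$ in it is clockwise. Let $\Lambda$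 be the Jacobian algebra of $T$ over $K=\mathbb C$ (here the path algebra of $Q_T$), and $\widetilde\Lambda=\Lambda\otimes_KK[\epsilon]/(\epsilon^2)$, with simple modules $S_i$ and indecomposable injectives $I_i$; modules are representations of quivers. For an arc $\gamma\notin T$ let $M_\gamma$ be the string $\Lambda$-module with $K$ at every arc of $T$ crossed by $\gamma$ and identity maps along the arrows between these, and $\widetilde M_\gamma=M_\gamma\otimes_KK[\epsilon]/(\epsilon^2)$. The index is $\mathrm{ind}_{\widetilde\Lambda}(M)=[N^1]-[N^0]\in\mathbb Z^n$ for a minimal injective resolution $0\to M\to N^0\to N^1$, where $[\bigoplus I_i^{m_i}]=(m_i)_i$. Put $\langle M,N\rangle=\dim\mathrm{Hom}(M,N)-\dim\mathrm{Hom}(N,M)-\dim\mathrm{Ext}^1(M,N)+\dim\mathrm{Ext}^1(N,M)$ over $\widetilde\Lambda$. Let $\mathrm{Gr}_{\mathbf e}(M)$ be the variety of submodules of $M$ of dimension vector $\mathbf e$, and $\chi$ the Euler–Poincaré characteristic. **The odd terms.** An arc $\gamma$ is said to lie on a triangle $\{i,j,k\}$ (counter-clockwise) of $T$ if, up to rotation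 of $i,j,k$, $\gamma=(i,m)$ with $m$ in the closed counter-clockwise interval from $j$ to $k$; every arc lies on exactly two triangles of $T$. Let $\Delta_1=\{s-1,s,s+1\}$ and, for $2\le a\le n+1$, let $\Delta_a\neq\Delta_1$ be the other triangle on which $(s,s+a)$ lies. With $\theta_a=\theta_{\Delta_a}$ put $\theta_1>\theta_2>\dots>\theta_{n+1}$ if the projective $\Lambda$-module $P_1$ at $\gamma_1$ is simple, and $\theta_2>\dots>\theta_{n+1}>\theta_1$ otherwise. For an arc $\gamma'\notin T$ let $\mu(M_{\gamma'})=\theta_\Delta\theta_{\Delta'}$, where $\Delta,\Delta'$ are the two triangles on which $\gamma'$ lies and $\theta_\Delta>\theta_{\Delta'}$, and $\mu(\bigoplus_kM_{\gamma_k'})=\prod_k\mu(M_{\gamma_k'})$. For a submodule $N\subseteq\widetilde M_\gamma$ let $F(N)=N/\widetilde{N\epsilon}$ be its quotient by its largest induced submodule, a $\Lambda$-module. Let $\mu_{\mathbf e}=\mu(F(N))$ if there is a submodule $N\subseteq\widetilde M_\gamma$ of dimension vector $\mathbf e$ (it is then unique), and $\mu_{\mathbf e}=0$ otherwise. **Theorem.**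 For every arc $\gamma\notin T$ the super lambda length $x_\gamma$ exists, does not depend on the sequence of flips, and $$x_\gamma=X^{\mathrm{ind}_{\widetilde\Lambda}(\widetilde M_\gamma)}\sum_{\mathbf e\in\mathbb N^n}\chi(\mathrm{Gr}_{\mathbf e}(\widetilde M_\gamma))\prod_{i=1}^n\sqrt{x_i}^{\,\langle S_i,\bigoplus_jS_j^{e_j}\rangle_{\widetilde\Lambda}}\,\mu_{\mathbf e},$$ where $X^g=\prod_ix_i^{g_i}$. -/

import Mathlib

open CategoryTheory
open scoped TensorProduct

noncomputable section

namespace SuperCC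

/-! ### Triangulations of the `(n+3)`-gon

The vertices are `Fin (n + 3)`, numbered counter-clockwise, so that `sbtw i j k` says that
`i, j, k` are distinct and met in this order when going counter-clockwise around the boundary. -/

section Polygon

variable {n : ℕ}

/-- `e` is a boundary segment of the polygon. -/
def IsSide (e : Sym2 (Fin (n + 3))) : Prop := ∃ i, e = s(i, i + 1)

/-- `e` is an arc, that is, an internal diagonal of the polygon. -/
def IsArc (e : Sym2 (Fin (n + 3))) : Prop := ¬ e.IsDiag ∧ ¬ IsSide e

/-- The two diagonals cross in the interior of the polygon. -/
def Crosses (e f : Sym2 (Fin (n + 3))) : Prop :=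
  ∃ i j k l, e = s(i, j) ∧ f = s(k, l) ∧ sbtw i k j ∧ sbtw j l i

/-- A triangulation is a maximal set of pairwise non-crossing arcs. -/
structure IsTriangulation (T : Finset (Sym2 (Fin (n + 3)))) : Prop where
  isArc : ∀ e ∈ T, IsArc e
  noncrossing : ∀ e ∈ T, ∀ f ∈ T, ¬ Crosses e f
  maximal : ∀ e, IsArc e → (∀ f ∈ T, ¬ Crosses e f) → e ∈ T

/-- `e` is an arc of `T` or a boundary segment. -/
def IsEdge (T : Finset (Sym2 (Fin (n + 3)))) (e : Sym2 (Fin (n + 3))) : Prop :=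
  e ∈ T ∨ IsSide e

/-- `t` is the set of vertices of a triangle of `T`. -/
def IsTriangle (T : Finset (Sym2 (Fin (n + 3)))) (t : Finset (Fin (n + 3))) : Prop :=
  ∃ i j k, sbtw i j k ∧ t = {i, j, k} ∧
    IsEdge T s(i, j) ∧ IsEdge T s(j, k) ∧ IsEdge T s(k, i)

/-- No triangle of `T` has all its three sides in `T`. -/
def NoInternalTriangle (T : Finset (Sym2 (Fin (n + 3)))) : Prop :=
  ∀ i j k, ¬ (s(i, j) ∈ T ∧ s(j, k) ∈ T ∧ s(k, i) ∈ T)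

end Polygon

/-! ### The Jacobian algebra and its modules -/

section Algebra

variable {n : ℕ} (T : Finset (Sym2 (Fin (n + 3))))

/-- There is an arrow `e ⟶ f` in the adjacency quiver `Q_T`: the arcs `e = (v, a)` and `f = (v, b)`
are two sides of a triangle of `T`, and turning around `v` from `e` to `f` inside this triangle is
clockwise. (In a polygon there is at most one arrow from `e` to `f`.) -/
def Arrow (e f : T) : Prop :=
  ∃ v a b, e.1 = s(v, a) ∧ f.1 = s(v, b) ∧ sbtw v b a ∧ IsEdge T s(a, b)

/-- The vertices and the arrows of `Q_T`, generators of the path algebra. -/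
inductive Gen : Type
  | vertex (e : T) : Gen
  | arrow (e f : T) (h : Arrow T e f) : Gen

/-- The trivial path at `e`, before passing to the quotient. -/
def preVertex (e : T) : FreeAlgebra ℂ (Gen T) := FreeAlgebra.ι ℂ (Gen.vertex e)

/-- The arrow from `e` to `f`, before passing to the quotient. -/
def preArrow (e f : T) (h : Arrow T e f) : FreeAlgebra ℂ (Gen T) :=
  FreeAlgebra.ι ℂ (Gen.arrow e f h)

/-- The relations of the path algebra of `Q_T`, and those of its Jacobian ideal: two consecutive
arrows in an internal triangle compose to zero. An arrow `e ⟶ f` is a map from the vertex `e` to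
the vertex `f`, and `β * α` is "first `α`, then `β`", so that left modules over this algebra
are representations of `Q_T`. -/
inductive JacRel : FreeAlgebra ℂ (Gen T) → FreeAlgebra ℂ (Gen T) → Prop
  | idem (e : T) : JacRel (preVertex T e * preVertex T e) (preVertex T e)
  | orth (e f : T) (h : e ≠ f) : JacRel (preVertex T e * preVertex T f) 0
  | unit : JacRel (∑ e : T, preVertex T e) 1
  | target (e f : T) (h : Arrow T e f) :
      JacRel (preVertex T f * preArrow T e f h) (preArrow T e f h)
  | source (e f : T) (h : Arrow T e f) :
      JacRel (preArrow T e f h * preVertex T e) (preArrow T e f h)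
  | internal (e f g : T) (hef : Arrow T e f) (hfg : Arrow T f g)
      (h : ∃ i j k, e.1 = s(i, j) ∧ f.1 = s(j, k) ∧ g.1 = s(k, i)) :
      JacRel (preArrow T f g hfg * preArrow T e f hef) 0

/-- The Jacobian algebra `Λ` of the triangulation `T`, over `ℂ`. -/
def Jac : Type := RingQuot (JacRel T)

instance : Ring (Jac T) := inferInstanceAs (Ring (RingQuot (JacRel T)))

instance : Algebra ℂ (Jac T) := inferInstanceAs (Algebra ℂ (RingQuot (JacRel T)))

/-- The quotient map from the free algebra on the vertices and arrows of `Q_T`. -/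
def Jac.mk : FreeAlgebra ℂ (Gen T) →ₐ[ℂ] Jac T := RingQuot.mkAlgHom ℂ (JacRel T)

variable {T} in
/-- Algebra maps out of the Jacobian algebra. -/
def Jac.lift {B : Type} [Ring B] [Algebra ℂ B] (f : FreeAlgebra ℂ (Gen T) →ₐ[ℂ] B)
    (hf : ∀ ⦃x y⦄, JacRel T x y → f x = f y) : Jac T →ₐ[ℂ] B :=
  RingQuot.liftAlgHom ℂ ⟨f, hf⟩

/-- The trivial path (primitive idempotent) at the vertex `e` of `Q_T`. -/
def vertexIdem (e : T) : Jac T := Jac.mk T (preVertex T e)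

/-- The algebra `Λ ⊗ ℂ[ε]/(ε²)`. -/
def JacD : Type := Jac T ⊗[ℂ] DualNumber ℂ

instance : Ring (JacD T) := inferInstanceAs (Ring (Jac T ⊗[ℂ] DualNumber ℂ))

instance : Algebra ℂ (JacD T) := inferInstanceAs (Algebra ℂ (Jac T ⊗[ℂ] DualNumber ℂ))

/-- `Λ ⊗ ℂ[ε]/(ε²)` is the tensor product of algebras. -/
def JacD.equiv : JacD T ≃ₐ[ℂ] Jac T ⊗[ℂ] DualNumber ℂ where
  toFun x := x
  invFun x := x
  left_inv _ := rfl
  right_inv _ := rfl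
  map_mul' _ _ := rfl
  map_add' _ _ := rfl
  commutes' _ := rfl

/-- The idempotent of `Λ ⊗ ℂ[ε]/(ε²)` at the vertex `e`. -/
def idemD (e : T) : JacD T := (JacD.equiv T).symm (vertexIdem T e ⊗ₜ[ℂ] (1 : DualNumber ℂ))

/-- The central element `1 ⊗ ε`. -/
def epsD : JacD T := (JacD.equiv T).symm ((1 : Jac T) ⊗ₜ[ℂ] (DualNumber.eps : DualNumber ℂ))

/-- The quotient map `Λ ⊗ ℂ[ε]/(ε²) → Λ`, killing `1 ⊗ ε`. A `Λ`-module is regarded through it as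
a `Λ ⊗ ℂ[ε]/(ε²)`-module on which `1 ⊗ ε` acts as zero. -/
def killEps : JacD T →ₐ[ℂ] Jac T :=
  (Algebra.TensorProduct.lift (AlgHom.id ℂ (Jac T))
    ((Algebra.ofId ℂ (Jac T)).comp (TrivSqZeroExt.fstHom ℂ ℂ ℂ))
    (fun x y => (Algebra.commutes (TrivSqZeroExt.fst y) x).symm)).comp (JacD.equiv T).toAlgHom

end Algebra

section Modules

/-- The module given by an action `ρ` of `A` on the vector space `V`. -/
def AsModule {A V : Type} [Ring A] [Algebra ℂ A] [AddCommGroup V] [Module ℂ V]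
    (_ρ : A →ₐ[ℂ] Module.End ℂ V) : Type := V

variable {A V : Type} [Ring A] [Algebra ℂ A] [AddCommGroup V] [Module ℂ V]
  (ρ : A →ₐ[ℂ] Module.End ℂ V)

instance : AddCommGroup (AsModule ρ) := inferInstanceAs (AddCommGroup V)

instance : Module ℂ (AsModule ρ) := inferInstanceAs (Module ℂ V)

instance : Module A (AsModule ρ) := Module.compHom V ρ.toRingHom

instance : IsScalarTower ℂ A (AsModule ρ) where
  smul_assoc c a v := by
    exact (LinearMap.congr_fun (map_smul ρ c a) (show V from v)).trans (LinearMap.smul_apply ..)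

/-- An element of `V` as an element of the module. -/
def toModule (v : V) : AsModule ρ := v

/-- The antisymmetrized bilinear form
`dim Hom(M, N) - dim Hom(N, M) - dim Ext¹(M, N) + dim Ext¹(N, M)`. -/
def antisymForm (M N : ModuleCat.{0} A) : ℤ :=
  (Module.finrank ℂ (M ⟶ N) : ℤ) - Module.finrank ℂ (N ⟶ M)
    - Module.finrank ℂ (Abelian.Ext M N 1) + Module.finrank ℂ (Abelian.Ext N M 1)

/-- The action of `A` on its dual space: `(b f)(a) = f (a b)`. -/
def dualAction (A : Type) [Ring A] [Algebra ℂ A] :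
    A →ₐ[ℂ] Module.End ℂ (Module.Dual ℂ A) :=
  AlgHom.ofLinearMap
    { toFun := fun b =>
        { toFun := fun f => f ∘ₗ LinearMap.mulRight ℂ b
          map_add' := fun _ _ => rfl
          map_smul' := fun _ _ => rfl }
      map_add' := fun b c => by ext f a; simp [mul_add]
      map_smul' := fun r b => by ext f a; simp }
    (by ext f a; simp)
    (fun b c => by ext f a; simp [mul_assoc])

/-- The injective module `D(e A)` attached to `e` (for a primitive idempotent `e`, the injective
envelope of the simple module at `e`), realized as the functionals `f` on `A` with
`f (e a) = f a` for all `a`. -/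
def injModule (e : A) : Submodule A (AsModule (dualAction A)) where
  carrier := {f | ∀ a : A, (show Module.Dual ℂ A from f) (e * a) = (show Module.Dual ℂ A from f) a}
  zero_mem' := fun _ => rfl
  add_mem' := fun {f g} hf hg a => congrArg₂ (· + ·) (hf a) (hg a)
  smul_mem' := fun b f hf a => by
    change (show Module.Dual ℂ A from f) (e * a * b) = (show Module.Dual ℂ A from f) (a * b)
    rw [mul_assoc]
    exact hf (a * b)

/-- A submodule that meets every nonzero submodule nontrivially. -/
def IsEssential {X : Type} [AddCommGroup X] [Module A X] (N : Submodule A X) : Prop :=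
  ∀ Y : Submodule A X, Y ⊓ N = ⊥ → Y = ⊥

/-- `g = [N¹] - [N⁰]` for a minimal injective resolution `0 → X → N⁰ → N¹`, with
`N⁰ = ⨁ I_i ^ (a i)` and `N¹ = ⨁ I_i ^ (b i)`, where `I_i` is the injective module at the
idempotent `e i`. -/
def IsIndex {ι : Type} (e : ι → A) (X : Type) [AddCommGroup X] [Module A X] (g : ι → ℤ) : Prop :=
  ∃ (a b : ι → ℕ) (u : X →ₗ[A] ((i : ι) → Fin (a i) → injModule (e i)))
    (v : ((i : ι) → Fin (a i) → injModule (e i)) →ₗ[A] ((i : ι) → Fin (b i) → injModule (e i))),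
    Function.Injective u ∧ IsEssential (LinearMap.range u) ∧
    LinearMap.ker v = LinearMap.range u ∧ IsEssential (LinearMap.range v) ∧
    ∀ i, g i = (b i : ℤ) - (a i : ℤ)

/-- The index of a module. -/
def index {ι : Type} (e : ι → A) (X : Type) [AddCommGroup X] [Module A X] : ι → ℤ :=
  Classical.epsilon (IsIndex e X)

end Modules

/-! ### Submodule Grassmannians and Euler characteristic -/

section Grassmannian

/-- The Grassmannian of `k`-dimensional subspaces of `V`. -/
def Gr (V : Type) [AddCommGroup V] [Module ℂ V] (k : ℕ) : Type :=
  {W : Submodule ℂ V // Module.finrank ℂ W = k}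

/-- The subspace spanned by a linearly independent family. -/
def Gr.ofFrame (V : Type) [AddCommGroup V] [Module ℂ V] (k : ℕ)
    (f : {f : Fin k → V // LinearIndependent ℂ f}) : Gr V k :=
  ⟨Submodule.span ℂ (Set.range f.1), by simpa using finrank_span_eq_card f.2⟩

/-- The complex topology of the Grassmannian, as a quotient of the space of linearly independent
families of `k` vectors. -/
instance (V : Type) [AddCommGroup V] [Module ℂ V] (k : ℕ) : TopologicalSpace (Gr V k) :=
  letI : TopologicalSpace V := moduleTopology ℂ V
  TopologicalSpace.coinduced (Gr.ofFrame V k) inferInstance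

variable {A : Type} [Ring A] [Algebra ℂ A] {ι : Type} (e : ι → A)
  {X : Type} [AddCommGroup X] [Module ℂ X] [Module A X] [IsScalarTower ℂ A X]

/-- The space `e_i X` of the module `X` at the vertex `i`. -/
def vertexSpace (X : Type) [AddCommGroup X] [Module ℂ X] [Module A X] [IsScalarTower ℂ A X]
    (i : ι) : Submodule ℂ X :=
  LinearMap.range (Algebra.lsmul ℂ ℂ X (e i))

/-- The space `N_i ⊆ X_i` of a submodule `N ⊆ X` at the vertex `i`. -/
def vertexPart (N : Submodule A X) (i : ι) : Submodule ℂ (vertexSpace e X i) :=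
  (N.restrictScalars ℂ).comap (vertexSpace e X i).subtype

/-- `N` has dimension vector `d`. -/
def HasDimVec (N : Submodule A X) (d : ι → ℕ) : Prop :=
  ∀ i, Module.finrank ℂ (vertexPart e N i) = d i

/-- The submodule Grassmannian of `X` for the dimension vector `d`. -/
def SubGr (X : Type) [AddCommGroup X] [Module ℂ X] [Module A X] [IsScalarTower ℂ A X]
    (d : ι → ℕ) : Type :=
  {N : Submodule A X // HasDimVec e N d}

/-- The submodule Grassmannian as a subspace of the product of the Grassmannians of the `X_i`. -/
instance (d : ι → ℕ) : TopologicalSpace (SubGr e X d) :=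
  TopologicalSpace.induced
    (fun (N : SubGr e X d) (i : ι) =>
      (show Gr (vertexSpace e X i) (d i) from ⟨vertexPart e N.1 i, N.2 i⟩))
    inferInstance

/-- The Euler–Poincaré characteristic of a topological space, from its singular homology with
rational coefficients. -/
def eulerChar (Y : Type) [TopologicalSpace Y] : ℤ :=
  (((AlgebraicTopology.singularChainComplexFunctor (ModuleCat.{0} ℚ)).obj
    (ModuleCat.of ℚ ℚ)).obj (TopCat.of Y)).homologyEulerChar

end Grassmannian

/-! ### Modules over the Jacobian algebra -/

section JacModules

variable {n : ℕ} {T : Finset (Sym2 (Fin (n + 3)))}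

open Classical in
/-- The simple `Λ`-module at the vertex `i`, as a character of `Λ`. -/
def simpleChar (i : T) : Jac T →ₐ[ℂ] ℂ :=
  Jac.lift (FreeAlgebra.lift ℂ (fun x : Gen T => match x with
    | Gen.vertex e => if e = i then 1 else 0
    | Gen.arrow _ _ _ => 0)) (by
      intro x y h
      cases h with
      | idem e => simp [preVertex]
      | orth e f h =>
        by_cases h1 : e = i
        · by_cases h2 : f = i
          · exact absurd (h1.trans h2.symm) h
          · simp [preVertex, h2]
        · simp [preVertex, h1]
      | unit => simp [preVertex]
      | target e f h => simp [preArrow]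
      | source e f h => simp [preArrow]
      | internal e f g hef hfg h => simp [preArrow])

/-- The simple `Λ ⊗ ℂ[ε]/(ε²)`-module at the vertex `i`. -/
abbrev Simple (i : T) : Type :=
  AsModule ((Algebra.lmul ℂ ℂ).comp ((simpleChar i).comp (killEps T)))

/-- The underlying space of `M_γ`: one copy of `ℂ` for each arc of `T` crossed by `γ`. -/
abbrev ArcSpace (T : Finset (Sym2 (Fin (n + 3)))) (γ : Sym2 (Fin (n + 3))) : Type :=
  {e : T // Crosses e.1 γ} → ℂ

open Classical in
/-- The action of the trivial path at `e` on `M_γ`: the projection to the copy of `ℂ` at `e`. -/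
def vertexMap (γ : Sym2 (Fin (n + 3))) (e : T) : Module.End ℂ (ArcSpace T γ) where
  toFun w := fun g => if g.1 = e then w g else 0
  map_add' w w' := by ext g; by_cases h : g.1 = e <;> simp [h]
  map_smul' c w := by ext g; by_cases h : g.1 = e <;> simp [h]

open Classical in
/-- The action of an arrow `e ⟶ f` on `M_γ`: the identity `ℂ → ℂ` from the copy at `e` to the copy
at `f` if `γ` crosses both `e` and `f`, and zero otherwise. -/
def arrowMap (γ : Sym2 (Fin (n + 3))) (e f : T) : Module.End ℂ (ArcSpace T γ) where
  toFun w := fun g => if g.1 = f then (if h : Crosses e.1 γ then w ⟨e, h⟩ else 0) else 0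
  map_add' w w' := by
    ext g; by_cases h : g.1 = f <;> by_cases h' : Crosses e.1 γ <;> simp [h, h']
  map_smul' c w := by
    ext g; by_cases h : g.1 = f <;> by_cases h' : Crosses e.1 γ <;> simp [h, h']

/-- The string module `M_γ` over `Λ`. -/
def arcRep (hI : NoInternalTriangle T) (γ : Sym2 (Fin (n + 3))) :
    Jac T →ₐ[ℂ] Module.End ℂ (ArcSpace T γ) :=
  Jac.lift (FreeAlgebra.lift ℂ (fun x : Gen T => match x with
    | Gen.vertex e => vertexMap γ e
    | Gen.arrow e f _ => arrowMap γ e f)) (by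
      intro x y h
      cases h with
      | idem e =>
        simp only [preVertex, map_mul, FreeAlgebra.lift_ι_apply]
        refine LinearMap.ext fun w => funext fun g => ?_
        by_cases hg : g.1 = e <;> simp [vertexMap, hg]
      | orth e f h =>
        simp only [preVertex, map_mul, FreeAlgebra.lift_ι_apply, map_zero]
        refine LinearMap.ext fun w => funext fun g => ?_
        by_cases hg : g.1 = e
        · have : g.1 ≠ f := fun h' => h (hg.symm.trans h')
          simp [vertexMap, this]
        · simp [vertexMap, hg]
      | unit =>
        simp only [preVertex, map_sum, FreeAlgebra.lift_ι_apply, map_one]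
        refine LinearMap.ext fun w => funext fun g => ?_
        simp [vertexMap, LinearMap.sum_apply, Finset.sum_apply]
      | target e f h =>
        simp only [preVertex, preArrow, map_mul, FreeAlgebra.lift_ι_apply]
        refine LinearMap.ext fun w => funext fun g => ?_
        by_cases hg : g.1 = f <;> simp [vertexMap, arrowMap, hg]
      | source e f h =>
        simp only [preVertex, preArrow, map_mul, FreeAlgebra.lift_ι_apply]
        refine LinearMap.ext fun w => funext fun g => ?_
        by_cases hg : g.1 = f <;> simp [vertexMap, arrowMap, hg]
      | internal e f g hef hfg h =>
        obtain ⟨i, j, k, he, hf, hg⟩ := h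
        exact absurd ⟨he ▸ e.2, hf ▸ f.2, hg ▸ g.2⟩ (hI i j k))

/-- The `Λ`-module `M_γ`, regarded as a `Λ ⊗ ℂ[ε]/(ε²)`-module on which `1 ⊗ ε` acts as zero. -/
abbrev ArcModule (hI : NoInternalTriangle T) (γ : Sym2 (Fin (n + 3))) : Type :=
  AsModule ((arcRep hI γ).comp (killEps T))

/-- The action of `Λ ⊗ ℂ[ε]/(ε²)` on the module `M ⊗ ℂ[ε]/(ε²)` induced from the `Λ`-module `M`:
`(a ⊗ c) (m ⊗ c') = (a m) ⊗ (c c')`. -/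
def inducedRep {V : Type} [AddCommGroup V] [Module ℂ V] (ρ : Jac T →ₐ[ℂ] Module.End ℂ V) :
    JacD T →ₐ[ℂ] Module.End ℂ (V ⊗[ℂ] DualNumber ℂ) :=
  ((Module.endTensorEndAlgHom (R := ℂ) (S := ℂ) (A := ℂ) (M := V) (N := DualNumber ℂ)).comp
    (Algebra.TensorProduct.map ρ (Algebra.lmul ℂ (DualNumber ℂ)))).comp (JacD.equiv T).toAlgHom

/-- The induced module `M_γ ⊗ ℂ[ε]/(ε²)`. -/
abbrev IndModule (hI : NoInternalTriangle T) (γ : Sym2 (Fin (n + 3))) : Type :=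
  AsModule (inducedRep (arcRep hI γ))

/-- The largest induced submodule of a submodule `N` of `M ⊗ ℂ[ε]/(ε²)`, that is, the module
induced from `N ε`: it is generated by the `m ⊗ 1` with `m ⊗ ε ∈ N ε`. -/
def inducedPart {V : Type} [AddCommGroup V] [Module ℂ V] (ρ : Jac T →ₐ[ℂ] Module.End ℂ V)
    (N : Submodule (JacD T) (AsModule (inducedRep ρ))) :
    Submodule (JacD T) (AsModule (inducedRep ρ)) :=
  Submodule.span (JacD T) {x | ∃ m : V, x = toModule (inducedRep ρ) (m ⊗ₜ[ℂ] 1) ∧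
    ∃ y ∈ N, epsD T • y = toModule (inducedRep ρ) (m ⊗ₜ[ℂ] (DualNumber.eps : DualNumber ℂ))}

/-- The quotient `F(N)` of `N` by its largest induced submodule. -/
abbrev FMod {V : Type} [AddCommGroup V] [Module ℂ V] (ρ : Jac T →ₐ[ℂ] Module.End ℂ V)
    (N : Submodule (JacD T) (AsModule (inducedRep ρ))) : Type :=
  N ⧸ (inducedPart ρ N).comap N.subtype

end JacModules

/-! ### The super algebra and super lambda lengths -/

section Super

variable {n : ℕ}

/-- The Grassmann algebra over `R` with one odd generator for each triangle of `T`. -/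
abbrev Super (T : Finset (Sym2 (Fin (n + 3)))) (R : Type*) [CommRing R] :=
  ExteriorAlgebra R ({t : Finset (Fin (n + 3)) // IsTriangle T t} →₀ R)

/-- The odd variable of a triangle of `T`. -/
def theta {T : Finset (Sym2 (Fin (n + 3)))} {R : Type*} [CommRing R]
    (t : {t : Finset (Fin (n + 3)) // IsTriangle T t}) : Super T R :=
  ExteriorAlgebra.ι R (Finsupp.single t 1)

variable (T : Finset (Sym2 (Fin (n + 3)))) (R : Type*) [Field R] [LinearOrder R]
  [IsStrictOrderedRing R]

/-- `r` is the positive square root of `a`: `r` is even, its body (degree zero part) is positive,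
and `r² = a`. -/
def IsPosSqrt {T : Finset (Sym2 (Fin (n + 3)))} {R : Type*} [Field R] [LinearOrder R]
    [IsStrictOrderedRing R] (r a : Super T R) : Prop :=
  r ∈ CliffordAlgebra.even
      (0 : QuadraticForm R ({t : Finset (Fin (n + 3)) // IsTriangle T t} →₀ R)) ∧
    0 < ExteriorAlgebra.algebraMapInv r ∧ r * r = a

/-- Coordinates of a point of the decorated super Teichmüller space of the polygon with respect to
an oriented triangulation: `dir i j` says that `(i, j)` is an arc of the triangulation, directed
from `i` to `j`; `lam` gives the super lambda lengths of the arcs and boundary segments and `mu`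
the `μ`-invariants of the triangles. (Values outside the triangulation have no meaning and
are never used; orientations of boundary segments play no role and are not recorded.) -/
structure Chart where
  dir : Fin (n + 3) → Fin (n + 3) → Prop
  lam : Sym2 (Fin (n + 3)) → Super T R
  mu : Finset (Fin (n + 3)) → Super T R

variable {T R}

/-- `(i, j)` is an arc of the triangulation of the chart, or a boundary segment. -/
def Chart.HasEdge (C : Chart T R) (i j : Fin (n + 3)) : Prop :=
  IsSide s(i, j) ∨ C.dir i j ∨ C.dir j i

/-- `C'` arises from `C` by the flip of the arc `E`, directed from `l` to `r`, in the quadrilateral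
with vertices `l`, `d`, `r`, `u` (counter-clockwise, so `u` is on the left of `E` and `d` on the
right). Write `A = (u, l)`, `B = (u, r)`, `C = (r, d)`, `D = (l, d)` for its sides, and `θ`, `σ` for
the `μ`-invariants of the triangles on the left and on the right of `E`. The new arc `F` is
directed from `d` to `u`; let `θ'`, `σ'` be the `μ`-invariants of the triangles on its left and
right. The super Ptolemy relations are
`E F = A C + B D + √(A C B D) σ θ`, `σ' √(A C + B D) = σ √(B D) - θ √(A C)` and
`θ' √(A C + B D) = θ √(B D) + σ √(A C)`. The direction of `B` is reversed. -/
def Flip (C C' : Chart T R) : Prop :=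
  ∃ l r u d : Fin (n + 3),
    C.dir l r ∧ sbtw l r u ∧ sbtw l d r ∧
    C.HasEdge u l ∧ C.HasEdge u r ∧ C.HasEdge r d ∧ C.HasEdge l d ∧
    (∀ i j, C'.dir i j ↔ (i = d ∧ j = u) ∨ (s(i, j) = s(u, r) ∧ C.dir j i) ∨
      (s(i, j) ≠ s(u, r) ∧ s(i, j) ≠ s(l, r) ∧ C.dir i j)) ∧
    (∀ e, e ≠ s(d, u) → C'.lam e = C.lam e) ∧
    (∀ t, t ≠ {u, l, d} → t ≠ {u, r, d} → C'.mu t = C.mu t) ∧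
    ∃ sac sbd sacbd ssum : Super T R,
      IsPosSqrt sac (C.lam s(u, l) * C.lam s(r, d)) ∧
      IsPosSqrt sbd (C.lam s(u, r) * C.lam s(l, d)) ∧
      IsPosSqrt sacbd (C.lam s(u, l) * C.lam s(r, d) * (C.lam s(u, r) * C.lam s(l, d))) ∧
      IsPosSqrt ssum (C.lam s(u, l) * C.lam s(r, d) + C.lam s(u, r) * C.lam s(l, d)) ∧
      C.lam s(l, r) * C'.lam s(d, u) =
        C.lam s(u, l) * C.lam s(r, d) + C.lam s(u, r) * C.lam s(l, d)
          + sacbd * C.mu {l, r, d} * C.mu {l, r, u} ∧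
      C'.mu {u, r, d} * ssum = C.mu {l, r, d} * sbd - C.mu {l, r, u} * sac ∧
      C'.mu {u, l, d} * ssum = C.mu {l, r, u} * sbd + C.mu {l, r, d} * sac

/-- `i` and `j` lie strictly on the same side of the line through `p` and `q`. -/
def SameSide (p q i j : Fin (n + 3)) : Prop :=
  (sbtw p i q ∧ sbtw p j q) ∨ (sbtw q i p ∧ sbtw q j p)

/-- The default orientation of a triangulation without internal triangles, where the longest arc
has source `src` and crosses the arcs of `T` in the order `γ₁, …, γₙ`. Consecutive arcs
`γᵢ, γᵢ₊₁` share a vertex, which is the fan centre of the small triangle that they cut out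
together with the longest arc; the fan centres are `c₁, …, c_N` in this order. An arc inside a fan
is directed away from its centre, and the arc where two fans meet is directed `c_k → c_{k+1}`.
In both cases `γᵢ` with `i > 1` is directed away from its common vertex with `γᵢ₋₁`, which is the
first alternative, and `γ₁` is directed away from its common vertex with `γ₂`, which is the
second one. If `γ₁ = (src - 1, src + 1)` is the only arc, then both of its ends could
serve as the centre of the fan; it is then directed away from `src - 1`. -/
def defaultDir (T : Finset (Sym2 (Fin (n + 3)))) (src p q : Fin (n + 3)) : Prop :=
  s(p, q) ∈ T ∧
    ((∃ w, SameSide p q w src ∧ s(p, w) ∈ T ∧ IsEdge T s(q, w)) ∨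
      (s(p, q) = s(src - 1, src + 1) ∧
        ((∃ w, w ≠ p ∧ w ≠ q ∧ ¬ SameSide p q w src ∧ s(p, w) ∈ T ∧ IsEdge T s(q, w)) ∨
          (T = {s(p, q)} ∧ p = src - 1))))

/-- The initial chart: the triangulation `T` with its default orientation, lambda lengths
`x_e = (q e)²` for `e ∈ T` and `1` for boundary segments, and the odd variables as
`μ`-invariants. -/
structure IsInitialChart (src : Fin (n + 3)) (q : T → R) (C : Chart T R) : Prop where
  dir : ∀ i j, C.dir i j ↔ defaultDir T src i j
  lam_arc : ∀ e : T, C.lam e = algebraMap R (Super T R) (q e ^ 2)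
  lam_side : ∀ e, IsSide e → C.lam e = 1
  mu : ∀ t : {t : Finset (Fin (n + 3)) // IsTriangle T t}, C.mu t = theta t

/-- `y` is a super lambda length of the arc `γ`, that is, the one found at `γ` in some chart that
is reached from the initial one by a sequence of flips. -/
def IsSuperLambdaLength (src : Fin (n + 3)) (q : T → R) (γ : Sym2 (Fin (n + 3)))
    (y : Super T R) : Prop :=
  ∃ C₀ C : Chart T R, IsInitialChart src q C₀ ∧ Relation.ReflTransGen Flip C₀ C ∧
    (∃ i j, γ = s(i, j) ∧ C.dir i j) ∧ C.lam γ = y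

/-! ### The super Caldero–Chapoton expression -/

/-- The object `γ` of the Frobenius cluster category lies on the triangle of sectional paths given
by the triangle `t` of the polygon: for `t = {i, j, k}` counter-clockwise these are the
paths `(i, j) → (i, j + 1) → ⋯ → (i, k)` and their cyclic rotations. -/
def OnTriangle (γ : Sym2 (Fin (n + 3))) (t : Finset (Fin (n + 3))) : Prop :=
  ∃ i j k, sbtw i j k ∧ t = {i, j, k} ∧ ∃ m, btw j m k ∧ γ = s(i, m)

/-- `t` is the triangle `Δ_a` in the labelling attached to the source `src` of the longest arc:
`Δ_1` is the ear at `src`, and for `2 ≤ a ≤ n + 1` the triangle `Δ_a` is the one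
different from `Δ_1` that contains the object `(src, src + a)`. -/
def IsDelta (src : Fin (n + 3)) (a : ℕ) (t : Finset (Fin (n + 3))) : Prop :=
  (a = 1 ∧ t = {src - 1, src, src + 1}) ∨
    (2 ≤ a ∧ a ≤ n + 1 ∧ t ≠ {src - 1, src, src + 1} ∧ OnTriangle s(src, src + Fin.ofNat (n + 3) a) t)

/-- The projective `Λ`-module `P_e` is simple. -/
def ProjSimple (T : Finset (Sym2 (Fin (n + 3)))) (e : T) : Prop :=
  IsSimpleModule (Jac T) (Submodule.span (Jac T) {vertexIdem T e})

/-- `θ_t > θ_t'` in the `Δ`-positive ordering. Here `e₁ = (src - 1, src + 1)` is the first arc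
crossed by the longest arc; the ordering is `θ_1 > θ_2 > ⋯ > θ_{n+1}` if `P_1` is simple and
`θ_2 > ⋯ > θ_{n+1} > θ_1` otherwise. -/
def DeltaGT (src : Fin (n + 3)) (t t' : Finset (Fin (n + 3))) : Prop :=
  ∃ (e₁ : T) (a b : ℕ), e₁.1 = s(src - 1, src + 1) ∧ IsDelta src a t ∧ IsDelta src b t' ∧
    ((ProjSimple T e₁ ∧ a < b) ∨ (¬ ProjSimple T e₁ ∧ 2 ≤ a ∧ (a < b ∨ b = 1)))

/-- `z = μ(M_γ)`, the product in the `Δ`-positive ordering of the odd variables of the two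
triangles that contain `γ`. -/
def IsMuArc (src : Fin (n + 3)) (γ : Sym2 (Fin (n + 3))) (z : Super T R) : Prop :=
  ∃ t t' : {t : Finset (Fin (n + 3)) // IsTriangle T t},
    OnTriangle γ t ∧ OnTriangle γ t' ∧ DeltaGT (T := T) src t t' ∧ z = theta t * theta t'

/-- `y = μ(Y)` for the `Λ`-module `Y`: the product of the `μ(M_{γ_k})`, if `Y` is the direct sum of
the indecomposable modules `M_{γ_k}`. -/
def IsMu (hI : NoInternalTriangle T) (src : Fin (n + 3)) (Y : Type) [AddCommGroup Y]
    [Module (JacD T) Y] (y : Super T R) : Prop :=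
  ∃ (m : ℕ) (γ : Fin m → Sym2 (Fin (n + 3))) (z : Fin m → Super T R),
    (∀ k, IsArc (γ k) ∧ γ k ∉ T ∧ IsMuArc src (γ k) (z k)) ∧
    Nonempty (Y ≃ₗ[JacD T] ((k : Fin m) → ArcModule hI (γ k))) ∧
    y = (List.ofFn z).prod

open Classical in
/-- `μ_d = μ(F(N))` if the induced module `M_γ ⊗ ℂ[ε]/(ε²)` has a submodule `N` of dimension vector
`d` (which is then unique), and zero otherwise. -/
def muDim (hI : NoInternalTriangle T) (src : Fin (n + 3)) (γ : Sym2 (Fin (n + 3)))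
    (d : T → ℕ) : Super T R :=
  if h : ∃ (y : Super T R) (N : Submodule (JacD T) (IndModule hI γ)),
      HasDimVec (idemD T) N d ∧ IsMu hI src (FMod (arcRep hI γ) N) y
  then h.choose else 0

/-- The super Caldero–Chapoton expression of the induced module `M_γ ⊗ ℂ[ε]/(ε²)`, where
`x_i = (q i)²`. -/
def superCC (hI : NoInternalTriangle T) (src : Fin (n + 3)) (q : T → R)
    (γ : Sym2 (Fin (n + 3))) : Super T R :=
  (∏ i : T, (q i ^ 2) ^ (index (idemD T) (IndModule hI γ) i)) •
    ∑ᶠ d : T → ℕ,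
      (((eulerChar (SubGr (idemD T) (IndModule hI γ) d) : ℤ) : R) *
        ∏ i : T, q i ^ antisymForm (ModuleCat.of (JacD T) (Simple i))
          (ModuleCat.of (JacD T) ((j : T) → Fin (d j) → Simple j))) •
      (muDim hI src γ d : Super T R)

end Super

end SuperCC

end

open CategoryTheory
open scoped TensorProduct

noncomputable section

set_option linter.unusedSectionVars false

namespace SuperCC

/-! ### Super vectors over a supercommutative pair -/

section OddPairing

/-! To each vertex of the polygon a super vector `(x, y | ξ)` over the even and the odd part of the
Grassmann algebra is attached. Such vectors have an orthosymplectic pairing `br`, and triples of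
them an odd invariant `tri`. Four super vectors satisfy a three-term relation for `tri`
(`OddPairing.br_smul_tri`) and a Ptolemy relation for `br` whose defect is a product of two values
of `tri` (`OddPairing.br_mul_ptolemy`). If lambda lengths are read as `±br`, and `μ`-invariants as
`±tri` divided by the roots of the three sides, these identities become the formulas of a flip.
Hence the property `Compat` of coming from a fixed family of super vectors survives every flip
(`Compat.flip`), the signs of the triangles recording the change of orientation. The lambda length
of an arc is then the pairing of its ends up to sign, whatever the sequence of flips.

A triangulation without internal triangles is a zigzag encoded by a Boolean word `w`
(`isZig_zigWord`): `w k` tells which end of the `k`-th arc moves to give the next arc. The triangles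
form a chain, so super vectors that realise the initial chart can be chosen one triangle at a time
(`exists_zVec`), and positivity of their pairings provides the roots. The arcs outside `T` are the
`ar p k`, which cross exactly the arcs `p + 1, …, k`. With `u` the vector at the first end of such
an arc, the quantities `br u a`, `tri u a b`, `br u b` at the successive crossed arcs `(a, b)` are
carried through a triangle by a triangular `3 × 3` matrix (`tstate_succ`). Expanding the product of
these matrices gives the lambda length as a sum over sequences of states in `{0, 1, 2}` that weakly
increase or decrease at each step as `w` prescribes (`tstate_eq_sum`). An odd factor appears exactly
where a run of ones begins or ends.

The same sequences parametrise the submodules of the induced module. At a crossed arc this module is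
a copy of `ℂ[ε]/(ε²)`, whose `ε`-stable subspaces form a chain with one member in each dimension `0,
1, 2`. So a submodule is determined by its dimension vector, a nonempty Grassmannian is a point, and
the dimension vectors that occur are those that are monotone along the arrows. The quotient `F(N)`
lives where the dimension is one and is the sum of one string module for each run of ones
(`IsCut.nonempty_equiv`). Every other decomposition into string modules cuts out the same runs
(`IsCut.of_equiv`), so `μ` is a product over runs of the two odd variables at the ends of the run;
the chosen order of the triangles reproduces the signs of the transfer matrices
(`IsZig.isMuArc_iff`).

There remain the exponents. The index and the antisymmetrised form both reduce to spaces of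
homomorphisms from the kernel of the map from the regular module to `S_i` (`index_eq`,
`finrank_ext_simple`), and such a homomorphism is described by its values on explicit generators
(`augEquiv`). Only the arrows at `i` survive the count, so the total exponent splits into
contributions of single triangles, and these are the weights of the steps (`IsZig.prod_exponents`).
-/

/-- The multiplication of odd elements of a supercommutative algebra with even part `E` and odd
part `O`. -/
structure OddPairing (E O : Type*) [CommRing E] [AddCommGroup O] [Module E O] where
  om : O →ₗ[E] O →ₗ[E] E
  self : ∀ a, om a a = 0
  assoc : ∀ a b c, om a b • c = om b c • a

variable {E O : Type*} [CommRing E] [AddCommGroup O] [Module E O] (S : OddPairing E O)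

namespace OddPairing

lemma swap (a b : O) : S.om b a = -S.om a b := by
  have h := S.self (a + b)
  simp only [map_add, LinearMap.add_apply, S.self] at h
  linear_combination h

lemma smul_left (a b : O) : S.om a b • a = 0 := by
  rw [S.swap b a, neg_smul, S.assoc, S.self, zero_smul, neg_zero]

lemma smul_right (a b : O) : S.om a b • b = 0 := by
  rw [S.swap b a, neg_smul, S.smul_left, neg_zero]

lemma mul_om (a b c d : O) : S.om a b * S.om c d = S.om (S.om a b • c) d := by
  simp

lemma mul_left (a b c : O) : S.om a b * S.om a c = 0 := by
  rw [mul_om, smul_left, map_zero, LinearMap.zero_apply]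

lemma mul_swap (a b c d : O) : S.om a b * S.om c d = -(S.om a c * S.om b d) := by
  rw [mul_om, S.assoc a b c, S.swap c b, mul_om, S.assoc a c b]; simp

/-- A vector with two even coordinates and an odd one. -/
@[ext]
structure _root_.SuperCC.SVec (E O : Type*) where
  x : E
  y : E
  ξ : O

/-- The orthosymplectic form. -/
def br (v w : SVec E O) : E := v.x * w.y - v.y * w.x - S.om v.ξ w.ξ

/-- The odd invariant of three vectors. -/
def tri (u v w : SVec E O) : O :=
  S.br u v • w.ξ + S.br v w • u.ξ + S.br w u • v.ξ + S.om u.ξ v.ξ • w.ξ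

lemma br_swap (v w : SVec E O) : S.br w v = -S.br v w := by
  simp only [br, S.swap v.ξ w.ξ]; ring

lemma tri_rot (u v w : SVec E O) : S.tri v w u = S.tri u v w := by
  simp only [tri, S.assoc u.ξ v.ξ w.ξ]; abel

lemma tri_swap (u v w : SVec E O) : S.tri v u w = -S.tri u v w := by
  simp only [tri, S.br_swap u v, S.br_swap w u, S.br_swap v w, S.swap u.ξ v.ξ, neg_smul]; abel

lemma tri_swap_right (u v w : SVec E O) : S.tri u w v = -S.tri u v w := by
  rw [← S.tri_rot u w v, S.tri_swap v w u, S.tri_rot u v w]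

instance : Neg (SVec E O) := ⟨fun v => ⟨-v.x, -v.y, -v.ξ⟩⟩

lemma br_neg_left (v w : SVec E O) : S.br (-v) w = -S.br v w := by
  change -v.x * w.y - -v.y * w.x - S.om (-v.ξ) w.ξ = _
  simp only [br, map_neg, LinearMap.neg_apply]; ring

lemma br_neg_right (v w : SVec E O) : S.br v (-w) = -S.br v w := by
  rw [S.br_swap (-w) v, br_neg_left, S.br_swap v w, neg_neg]

lemma tri_neg (u v w : SVec E O) : S.tri (-u) v w = -S.tri u v w := by
  change S.br (-u) v • w.ξ + S.br v w • -u.ξ + S.br w (-u) • v.ξ + S.om (-u.ξ) v.ξ • w.ξ = _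
  simp only [tri, br_neg_left, br_neg_right, map_neg, LinearMap.neg_apply, neg_smul, smul_neg]
  abel

/-- The three-term relation for the odd invariants. -/
lemma br_smul_tri (l r u d : SVec E O) :
    S.br l r • S.tri u r d = S.br u r • S.tri l r d + S.br r d • S.tri l r u := by
  -- Products with a repeated odd coordinate vanish. Once these are known, the relation follows from
  -- `assoc` and linear algebra in the remaining odd terms.
  have q1 : S.om l.ξ r.ξ * S.om r.ξ d.ξ = 0 := by rw [S.swap r.ξ l.ξ, neg_mul, mul_left, neg_zero]
  have q2 : S.om u.ξ r.ξ * S.om r.ξ d.ξ = 0 := by rw [S.swap r.ξ u.ξ, neg_mul, mul_left, neg_zero]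
  have q3 : S.om r.ξ d.ξ * S.om r.ξ u.ξ = 0 := S.mul_left _ _ _
  have v1 := S.smul_right l.ξ r.ξ
  have v2 := S.smul_right u.ξ r.ξ
  have v3 := S.smul_left r.ξ d.ξ
  have v4 := S.swap u.ξ r.ξ
  simp only [tri, br]
  linear_combination (norm := module) (-(l.x * r.y - l.y * r.x)) • S.assoc d.ξ u.ξ r.ξ
    + (u.x * r.y - u.y * r.x) • S.assoc d.ξ l.ξ r.ξ
    + (r.x * d.y - r.y * d.x) • S.assoc u.ξ l.ξ r.ξ
    + (r.x * d.y - r.y * d.x) • v4 • l.ξ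
    + (-(d.x * u.y - d.y * u.x) + S.om d.ξ u.ξ) • v1
    + (d.x * l.y - d.y * l.x - S.om d.ξ l.ξ) • v2
    + (u.x * l.y - u.y * l.x - S.om u.ξ l.ξ) • v3
    + q1 • u.ξ - q2 • l.ξ - q3 • l.ξ

/-- The super Ptolemy relation. -/
lemma br_mul_ptolemy (l r u d : SVec E O) :
    S.br l r * (S.br l r * S.br d u - S.br l d * S.br r u + S.br l u * S.br r d) =
      -S.om (S.tri l r d) (S.tri l r u) := by
  simp only [tri, map_add, LinearMap.add_apply, map_smul, LinearMap.smul_apply, smul_eq_mul]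
  have e1 := S.self l.ξ
  have e2 := S.self r.ξ
  have e3 := S.swap l.ξ r.ξ
  have e4 := S.swap l.ξ u.ξ
  have e5 := S.swap l.ξ d.ξ
  have e7 := S.swap r.ξ d.ξ
  have z1 : S.om l.ξ r.ξ * S.om l.ξ u.ξ = 0 := S.mul_left _ _ _
  have z2 : S.om l.ξ r.ξ * S.om l.ξ d.ξ = 0 := S.mul_left _ _ _
  have z0 : S.om l.ξ r.ξ * S.om l.ξ r.ξ = 0 := S.mul_left _ _ _
  have z3 : S.om l.ξ r.ξ * S.om r.ξ u.ξ = 0 := by rw [S.swap r.ξ l.ξ, neg_mul, mul_left, neg_zero]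
  have z4 : S.om l.ξ r.ξ * S.om r.ξ d.ξ = 0 := by rw [S.swap r.ξ l.ξ, neg_mul, mul_left, neg_zero]
  have z5 : S.om l.ξ d.ξ * S.om r.ξ u.ξ = -(S.om l.ξ r.ξ * S.om d.ξ u.ξ) := S.mul_swap _ _ _ _
  have z6 : S.om l.ξ u.ξ * S.om r.ξ d.ξ = S.om l.ξ r.ξ * S.om d.ξ u.ξ := by
    rw [S.mul_swap l.ξ u.ξ, S.swap d.ξ u.ξ, mul_neg, neg_neg]
  simp only [br, e1, e2, e3, e4, e5, e7]
  -- Every product of odd coordinates is now a polynomial in six commuting even elements. The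
  -- relations `z0`–`z6` between them suffice for a polynomial identity.
  generalize S.om l.ξ r.ξ = a at *
  generalize S.om l.ξ u.ξ = b at *
  generalize S.om l.ξ d.ξ = c at *
  generalize S.om r.ξ u.ξ = f at *
  generalize S.om r.ξ d.ξ = g at *
  generalize S.om d.ξ u.ξ = h at *
  clear e1 e2 e3 e4 e5 e7
  grind

end OddPairing
end OddPairing

/-! ### The even and the odd part of a Grassmann algebra -/

section Exterior

variable {R : Type*} [Field R] [LinearOrder R] [IsStrictOrderedRing R]
  {M : Type*} [AddCommGroup M] [Module R M]

variable (R M) in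
/-- The even part of the Grassmann algebra. -/
abbrev Ev : Type _ := CliffordAlgebra.even (0 : QuadraticForm R M)

variable (R M) in
/-- The odd part of the Grassmann algebra. -/
abbrev Od : Type _ := CliffordAlgebra.evenOdd (0 : QuadraticForm R M) 1

/-- A product of two generators is central, since moving a third generator past it changes the sign
twice. The even part is generated by such products. -/
lemma even_comm {x : ExteriorAlgebra R M} (hx : x ∈ CliffordAlgebra.even (0 : QuadraticForm R M))
    (g : ExteriorAlgebra R M) : x * g = g * x := by
  have hs : ∀ a b : M, ExteriorAlgebra.ι R a * ExteriorAlgebra.ι R b =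
      -(ExteriorAlgebra.ι R b * ExteriorAlgebra.ι R a) := fun a b =>
    eq_neg_of_add_eq_zero_left (ExteriorAlgebra.ι_add_mul_swap a b)
  have h2 : ∀ (a b : M) (g : ExteriorAlgebra R M),
      ExteriorAlgebra.ι R a * ExteriorAlgebra.ι R b * g =
        g * (ExteriorAlgebra.ι R a * ExteriorAlgebra.ι R b) := by
    intro a b g
    induction g using ExteriorAlgebra.induction with
    | algebraMap r => exact (Algebra.commutes r _).symm
    | ι m => rw [mul_assoc, hs b m, mul_neg, ← mul_assoc, hs a m, neg_mul, neg_neg, mul_assoc]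
    | mul x y hx hy => rw [← mul_assoc, hx, mul_assoc, hy, mul_assoc]
    | add x y hx hy => rw [mul_add, hx, hy, add_mul]
  refine CliffordAlgebra.even_induction (Q := (0 : QuadraticForm R M))
    (motive := fun x _ => ∀ g : ExteriorAlgebra R M, x * g = g * x) ?_ ?_ ?_ x hx g
  · intro r g; exact Algebra.commutes r g
  · intro x y _ _ hx hy g; rw [add_mul, hx, hy, mul_add]
  · intro a b x _ hx g
    have := h2 a b
    change ExteriorAlgebra.ι R a * ExteriorAlgebra.ι R b * x * g =
      g * (ExteriorAlgebra.ι R a * ExteriorAlgebra.ι R b * x)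
    rw [mul_assoc, hx, ← mul_assoc, this, mul_assoc]

/-- The odd part is spanned by single generators multiplied by pairs of generators. The pairs are
central by `even_comm`, so only the sign rule for two generators is left. -/
lemma odd_swap {x y : ExteriorAlgebra R M}
    (hx : x ∈ CliffordAlgebra.evenOdd (0 : QuadraticForm R M) 1)
    (hy : y ∈ CliffordAlgebra.evenOdd (0 : QuadraticForm R M) 1) : x * y = -(y * x) := by
  have hc : ∀ (a b : M) (g : ExteriorAlgebra R M),
      ExteriorAlgebra.ι R a * ExteriorAlgebra.ι R b * g =
        g * (ExteriorAlgebra.ι R a * ExteriorAlgebra.ι R b) := fun a b g =>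
    even_comm (CliffordAlgebra.ι_mul_ι_mem_evenOdd_zero (0 : QuadraticForm R M) a b) g
  have h1 : ∀ (v : M) (y : ExteriorAlgebra R M),
      y ∈ CliffordAlgebra.evenOdd (0 : QuadraticForm R M) 1 →
      ExteriorAlgebra.ι R v * y = -(y * ExteriorAlgebra.ι R v) := by
    intro v y hy
    refine CliffordAlgebra.odd_induction (Q := (0 : QuadraticForm R M))
      (P := fun y _ => ExteriorAlgebra.ι R v * y = -(y * ExteriorAlgebra.ι R v)) ?_ ?_ ?_ y hy
    · intro w; exact eq_neg_of_add_eq_zero_left (ExteriorAlgebra.ι_add_mul_swap v w)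
    · intro x y _ _ hx hy; rw [mul_add, hx, hy, add_mul, neg_add]
    · intro a b x _ hx
      change ExteriorAlgebra.ι R v * (ExteriorAlgebra.ι R a * ExteriorAlgebra.ι R b * x) =
        -(ExteriorAlgebra.ι R a * ExteriorAlgebra.ι R b * x * ExteriorAlgebra.ι R v)
      rw [← mul_assoc, ← hc a b, mul_assoc _ _ x, hx, mul_neg, ← mul_assoc]
  refine CliffordAlgebra.odd_induction (Q := (0 : QuadraticForm R M))
    (P := fun x _ => x * y = -(y * x)) ?_ ?_ ?_ x hx
  · intro w; exact h1 w y hy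
  · intro x z _ _ hx hz; rw [add_mul, hx, hz, mul_add, neg_add]
  · intro a b x _ hx
    change ExteriorAlgebra.ι R a * ExteriorAlgebra.ι R b * x * y =
        -(y * (ExteriorAlgebra.ι R a * ExteriorAlgebra.ι R b * x))
    rw [mul_assoc, hx, mul_neg, ← mul_assoc, hc a b, mul_assoc]

instance : CommRing (Ev R M) :=
  { (inferInstance : Ring (Ev R M)) with
    mul_comm := fun a b => Subtype.ext (even_comm a.2 b.1) }

lemma even_mul_odd {x y : ExteriorAlgebra R M}
    (hx : x ∈ CliffordAlgebra.even (0 : QuadraticForm R M))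
    (hy : y ∈ CliffordAlgebra.evenOdd (0 : QuadraticForm R M) 1) :
    x * y ∈ CliffordAlgebra.evenOdd (0 : QuadraticForm R M) 1 := by
  have h := SetLike.mul_mem_graded (A := CliffordAlgebra.evenOdd (0 : QuadraticForm R M))
    (i := 0) hx hy
  rwa [zero_add] at h

lemma odd_mul_odd {x y : ExteriorAlgebra R M}
    (hx : x ∈ CliffordAlgebra.evenOdd (0 : QuadraticForm R M) 1)
    (hy : y ∈ CliffordAlgebra.evenOdd (0 : QuadraticForm R M) 1) :
    x * y ∈ CliffordAlgebra.even (0 : QuadraticForm R M) := by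
  have h := SetLike.mul_mem_graded (A := CliffordAlgebra.evenOdd (0 : QuadraticForm R M)) hx hy
  rwa [show (1 : ZMod 2) + 1 = 0 from rfl] at h

instance : Module (Ev R M) (Od R M) where
  smul a ξ := ⟨a.1 * ξ.1, even_mul_odd a.2 ξ.2⟩
  one_smul ξ := Subtype.ext (one_mul ξ.1)
  mul_smul a b ξ := Subtype.ext (mul_assoc a.1 b.1 ξ.1)
  smul_zero a := Subtype.ext (mul_zero a.1)
  smul_add a ξ η := Subtype.ext (mul_add a.1 ξ.1 η.1)
  add_smul a b ξ := Subtype.ext (add_mul a.1 b.1 ξ.1)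
  zero_smul ξ := Subtype.ext (zero_mul ξ.1)

lemma coe_smul_od (a : Ev R M) (ξ : Od R M) :
    ((a • ξ : Od R M) : ExteriorAlgebra R M) = a.1 * ξ.1 := rfl

variable (R M) in
/-- The multiplication of odd elements of the Grassmann algebra. -/
def oddPairing : OddPairing (Ev R M) (Od R M) where
  om := LinearMap.mk₂ (Ev R M) (fun ξ η => ⟨ξ.1 * η.1, odd_mul_odd ξ.2 η.2⟩)
    (fun a b c => Subtype.ext (add_mul a.1 b.1 c.1))
    (fun a b c => Subtype.ext (mul_assoc a.1 b.1 c.1))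
    (fun a b c => Subtype.ext (mul_add a.1 b.1 c.1))
    (fun a b c => Subtype.ext (by
      change b.1 * (a.1 * c.1) = a.1 * (b.1 * c.1)
      rw [← mul_assoc, ← even_comm a.2, mul_assoc]))
  self a := Subtype.ext (by
    have h : a.1 * a.1 = -(a.1 * a.1) := odd_swap a.2 a.2
    change a.1 * a.1 = 0
    have h2 : (2 : R) • (a.1 * a.1) = 0 := by
      rw [two_smul]; nth_rewrite 1 [h]; exact neg_add_cancel _
    exact (smul_eq_zero.mp h2).resolve_left two_ne_zero)
  assoc a b c := Subtype.ext (by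
    change a.1 * b.1 * c.1 = b.1 * c.1 * a.1
    rw [mul_assoc, even_comm (odd_mul_odd b.2 c.2)])

lemma coe_om (ξ η : Od R M) :
    (((oddPairing R M).om ξ η : Ev R M) : ExteriorAlgebra R M) = ξ.1 * η.1 := rfl

variable (R M) in
/-- The degree zero part of an even element. -/
def body : Ev R M →+* R :=
  (ExteriorAlgebra.algebraMapInv (R := R) (M := M)).toRingHom.comp
    (CliffordAlgebra.even (0 : QuadraticForm R M)).val.toRingHom

lemma body_apply (a : Ev R M) : body R M a = ExteriorAlgebra.algebraMapInv a.1 := rfl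

lemma body_algebraMap (r : R) : body R M (algebraMap R (Ev R M) r) = r :=
  ExteriorAlgebra.algebraMap_leftInverse M r

/-- A product of two generators squares to zero and has no degree zero part, and sums of commuting
nilpotents are nilpotent. This reduces questions on units and square roots to the field `R`. -/
lemma isNilpotent_sub_body (a : Ev R M) :
    IsNilpotent (a - algebraMap R (Ev R M) (body R M a)) := by
  obtain ⟨x, hx⟩ := a
  refine CliffordAlgebra.even_induction (Q := (0 : QuadraticForm R M))
    (motive := fun x hx => IsNilpotent ((⟨x, hx⟩ : Ev R M) -
      algebraMap R (Ev R M) (body R M ⟨x, hx⟩))) ?_ ?_ ?_ x hx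
  · intro r
    have : (⟨algebraMap R _ r, SetLike.algebraMap_mem_graded _ _⟩ : Ev R M) =
      algebraMap R (Ev R M) r := rfl
    rw [this, body_algebraMap, sub_self]; exact IsNilpotent.zero
  · intro x y hx hy h1 h2
    have h := Commute.isNilpotent_add (Commute.all _ _) h1 h2
    have : (⟨x + y, Submodule.add_mem _ hx hy⟩ : Ev R M) = ⟨x, hx⟩ + ⟨y, hy⟩ := rfl
    rw [this, map_add, map_add, add_sub_add_comm]
    exact h
  · intro a b x hx _
    set e : Ev R M := ⟨_, CliffordAlgebra.ι_mul_ι_mem_evenOdd_zero (0 : QuadraticForm R M) a b⟩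
    have h1 : (⟨_, (zero_add (0 : ZMod 2) ▸ SetLike.mul_mem_graded
      (CliffordAlgebra.ι_mul_ι_mem_evenOdd_zero (0 : QuadraticForm R M) a b) hx)⟩ : Ev R M) =
      e * ⟨x, hx⟩ := rfl
    have h2 : body R M e = 0 := by
      change ExteriorAlgebra.algebraMapInv (ExteriorAlgebra.ι R a * ExteriorAlgebra.ι R b) = 0
      simp [ExteriorAlgebra.algebraMapInv]
    have h3 : e * e = 0 := Subtype.ext (by
      change ExteriorAlgebra.ι R a * ExteriorAlgebra.ι R b *
        (ExteriorAlgebra.ι R a * ExteriorAlgebra.ι R b) = 0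
      have hs : ExteriorAlgebra.ι R a * ExteriorAlgebra.ι R b =
        -(ExteriorAlgebra.ι R b * ExteriorAlgebra.ι R a) :=
          eq_neg_of_add_eq_zero_left (ExteriorAlgebra.ι_add_mul_swap a b)
      nth_rewrite 1 [hs]
      rw [neg_mul, mul_assoc, ← mul_assoc (ExteriorAlgebra.ι R a), ExteriorAlgebra.ι_sq_zero,
        zero_mul, mul_zero, neg_zero])
    rw [h1, map_mul, h2, zero_mul, map_zero, sub_zero]
    exact ⟨2, by rw [pow_two, mul_mul_mul_comm, h3, zero_mul]⟩

lemma isUnit_of_body {a : Ev R M} (h : body R M a ≠ 0) : IsUnit a := by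
  have h1 := isNilpotent_sub_body a
  have h2 : IsUnit (algebraMap R (Ev R M) (body R M a)) := (isUnit_iff_ne_zero.mpr h).map _
  have := h1.isUnit_add_right_of_commute h2 (Commute.all _ _)
  rwa [sub_add_cancel] at this

lemma body_eq_zero_of_isNilpotent {a : Ev R M} (h : IsNilpotent a) : body R M a = 0 :=
  (h.map (body R M)).eq_zero

/-- Newton's method for `X² - a`, started at the positive root `c` of the body: the value there is
nilpotent and the derivative `2c` is a unit. -/
lemma exists_sqrt (hR : ∀ a : R, 0 ≤ a → IsSquare a) {a : Ev R M} (h : 0 < body R M a) :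
    ∃ r : Ev R M, 0 < body R M r ∧ r * r = a := by
  obtain ⟨c, hc⟩ := hR _ h.le
  obtain ⟨c, hc0, hc⟩ : ∃ c : R, 0 < c ∧ body R M a = c * c := by
    refine ⟨|c|, abs_pos.mpr ?_, by rw [abs_mul_abs_self, hc]⟩
    rintro rfl
    rw [hc, mul_zero] at h
    exact lt_irrefl _ h
  have h2 : (2 : R) ≠ 0 := two_ne_zero
  have key := Polynomial.existsUnique_nilpotent_sub_and_aeval_eq_zero (R := Ev R M) (S := Ev R M)
    (P := Polynomial.X ^ 2 - Polynomial.C a) (x := algebraMap R (Ev R M) c) ?_ ?_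
  · obtain ⟨r, ⟨h1, h2⟩, _⟩ := key
    refine ⟨r, ?_, ?_⟩
    · have := body_eq_zero_of_isNilpotent h1
      rw [map_sub, body_algebraMap, sub_eq_zero] at this
      rwa [← this]
    · simp only [map_sub, map_pow, Polynomial.aeval_X, Polynomial.aeval_C, sub_eq_zero,
        Algebra.algebraMap_self, RingHom.id_apply] at h2
      rw [← pow_two, h2]
  · have := (isNilpotent_sub_body a).neg
    rw [hc, map_mul] at this
    convert this using 1
    simp [pow_two]
  · have : IsUnit (algebraMap R (Ev R M) (2 * c)) :=
      (isUnit_iff_ne_zero.mpr (mul_ne_zero h2 hc0.ne')).map _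
    convert this using 1
    simp only [map_sub, map_mul, Polynomial.derivative_X_sq,
      Polynomial.derivative_C, sub_zero, Polynomial.aeval_C, Polynomial.aeval_X,
      Algebra.algebraMap_self, RingHom.id_apply]
    congr 1

/-- The factor `a + b` of `a² - b² = 0` has positive body, so it is a unit. -/
lemma sqrt_unique {a b : Ev R M} (ha : 0 < body R M a) (hb : 0 < body R M b) (h : a * a = b * b) :
    a = b := by
  have hu : IsUnit (a + b) := isUnit_of_body (by rw [map_add]; positivity)
  have : (a + b) * (a - b) = 0 := by linear_combination h
  exact sub_eq_zero.mp ((hu.mul_right_eq_zero).mp this)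

end Exterior

/-! ### The super Ptolemy transformation of super vectors -/

section FlipAlgebra

variable {E O : Type*} [CommRing E] [AddCommGroup O] [Module E O]

/-- Super vectors at the vertices `l, d, r, u` of a quadrilateral, with square roots of the
lambda lengths and the `μ`-invariants of the two triangles next to the diagonal `(l, r)`. The signs
`p`, `q`, `t` are those of `(l, d)`, `(d, r)`, `(r, u)`. -/
structure FlipData (S : OddPairing E O) (l d r u : SVec E O) (ρe ρa ρb ρc ρd ρf p q t ε₁ ε₂ : E)
    (σ θ : O) : Prop where
  hp : p * p = 1
  hq : q * q = 1
  ht : t * t = 1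
  hε₁ : ε₁ * ε₁ = 1
  hε : ε₁ * ε₂ = q * t
  ue : IsUnit ρe
  he : ρe * ρe = p * q * S.br l r
  ha : ρa * ρa = p * q * t * S.br l u
  hb : ρb * ρb = t * S.br r u
  hc : ρc * ρc = q * S.br d r
  hd : ρd * ρd = p * S.br l d
  hf : ρf * ρf = q * t * S.br d u
  hσ : (ρe * ρc * ρd) • σ = ε₁ • S.tri l d r
  hθ : (ρe * ρa * ρb) • θ = ε₂ • S.tri l r u

namespace FlipData

/-- The three-term relation with every pairing and triple written in the cyclic order `l, d, r, u`,
the order to which the signs `p`, `q`, `t` of the quadrilateral refer. -/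
lemma tri_right (S : OddPairing E O) (l d r u : SVec E O) :
    S.br l r • S.tri d r u = S.br d r • S.tri l r u - S.br r u • S.tri l d r := by
  have := S.br_smul_tri l r u d
  rw [← S.tri_rot u r d, S.tri_swap d r u, S.tri_swap_right l d r, S.br_swap r u, S.br_swap d r,
    smul_neg, neg_smul, neg_smul, smul_neg] at this
  rw [← neg_inj, this]; abel

lemma tri_left (S : OddPairing E O) (l d r u : SVec E O) :
    S.br l r • S.tri l d u = S.br l u • S.tri l d r + S.br l d • S.tri l r u := by
  have := S.br_smul_tri r l u d
  rw [← S.tri_rot u l d, ← S.tri_rot r l d, S.tri_swap l r u, S.br_swap l u, S.br_swap l r,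
    smul_neg, neg_smul, neg_smul] at this
  rw [← neg_inj, this]; abel

variable {S : OddPairing E O} {l d r u : SVec E O} {ρe ρa ρb ρc ρd ρf p q t ε₁ ε₂ : E} {σ θ : O}
  (h : FlipData S l d r u ρe ρa ρb ρc ρd ρf p q t ε₁ ε₂ σ θ)
include h

/-- Multiplication by the unit `ρe²`, which is `±br l r`, turns this into
`OddPairing.br_mul_ptolemy`. The product of `hσ` and `hθ` identifies the odd term. -/
lemma ptolemy : ρe * ρe * (ρf * ρf) =
    ρa * ρa * (ρc * ρc) + ρb * ρb * (ρd * ρd) + ρa * ρb * ρc * ρd * S.om σ θ := by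
  have hu : IsUnit (ρe * ρe) := h.ue.mul h.ue
  refine hu.mul_left_cancel ?_
  have h1 := S.br_mul_ptolemy l r u d
  have h2 : (ρe * ρc * ρd) * ((ρe * ρa * ρb) * S.om σ θ) =
      ε₁ * ε₂ * S.om (S.tri l d r) (S.tri l r u) := by
    have : S.om ((ρe * ρc * ρd) • σ) ((ρe * ρa * ρb) • θ) =
      S.om (ε₁ • S.tri l d r) (ε₂ • S.tri l r u) := by rw [h.hσ, h.hθ]
    simp only [map_smul, LinearMap.smul_apply, smul_eq_mul] at this
    linear_combination this
  rw [S.tri_swap_right l d r, map_neg, LinearMap.neg_apply] at h1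
  rw [S.br_swap d r] at h1
  rw [h.hε] at h2
  have hp : p ^ 2 = 1 := by rw [pow_two, h.hp]
  have hq : q ^ 2 = 1 := by rw [pow_two, h.hq]
  have h3 : ρe * ρe * (ρa * ρb * ρc * ρd * S.om σ θ) =
      q * t * S.om (S.tri l d r) (S.tri l r u) := by rw [← h2]; ring
  rw [mul_add, h3, mul_add, h.he, h.ha, h.hb, h.hc, h.hd, h.hf]
  linear_combination (q * t) * h1
    + S.br l r * q * t *
        (S.br l r * S.br d u * q ^ 2 - S.br l u * S.br d r * q ^ 2 - S.br r u * S.br l d) * hp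
      + S.br l r * q * t * (S.br l r * S.br d u - S.br l u * S.br d r) * hq

/-- The relation `√(ef) D = √(ac + bd) D` for an odd element `D` that is a combination of `σ`, `θ`. -/
lemma smul_eq {s x y : E} {D : O} (hs : s * s = ρa * ρa * (ρc * ρc) + ρb * ρb * (ρd * ρd))
    (hu : IsUnit (ρe * ρf + s)) (hD : S.br l r • D = x • σ + y • θ) :
    (ρe * ρf) • D = s • D := by
  -- The squares of `ρe ρf` and `s` differ by a multiple of `σθ`, which kills `σ` and `θ` and hence
  -- `D`. Dividing by the unit `ρe ρf + s` gives the claim.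
  have h0 : S.om σ θ • D = 0 := by
    refine (h.ue.mul h.ue).smul_left_cancel.mp ?_
    have e : S.om σ θ • (p * q) • (x • σ + y • θ) =
      (p * q * x) • S.om σ θ • σ + (p * q * y) • S.om σ θ • θ := by module
    rw [smul_zero, h.he, smul_comm, mul_smul, hD, e, S.smul_left, S.smul_right, smul_zero,
      smul_zero, add_zero]
  have h1 := h.ptolemy
  refine sub_eq_zero.mp (hu.smul_left_cancel.mp ?_)
  rw [smul_zero, ← sub_smul, smul_smul]
  have : (ρe * ρf + s) * (ρe * ρf - s) = (ρa * ρb * ρc * ρd) * S.om σ θ := by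
    linear_combination h1 - hs
  rw [this, mul_smul, h0, smul_zero]

lemma ε₂_eq : ε₂ = q * t * ε₁ := by
  linear_combination ε₁ * h.hε - ε₂ * h.hε₁

lemma tri₁ : S.tri l d r = (ε₁ * (ρe * ρc * ρd)) • σ := by
  rw [mul_smul, h.hσ, smul_smul, h.hε₁, one_smul]

lemma tri₂ : S.tri l r u = (ε₂ * (ρe * ρa * ρb)) • θ := by
  rw [mul_smul, h.hθ, smul_smul]
  have : ε₂ * ε₂ = 1 := by
    rw [h.ε₂_eq]; linear_combination t * t * ε₁ * ε₁ * h.hq + ε₁ * ε₁ * h.ht + h.hε₁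
  rw [this, one_smul]

/-- A flip divides by `s = √(ac + bd)`, whereas the normalisation by super vectors divides by `√(ef)
= ρe ρf`. The two differ by a nilpotent that does not affect the odd invariant (`smul_eq`), so only
the sign `-pqtε₁` has to be recorded. -/
lemma mu_right {s : E} {m : O} (hs : s * s = ρa * ρa * (ρc * ρc) + ρb * ρb * (ρd * ρd))
    (us : IsUnit s) (hu : IsUnit (ρe * ρf + s)) (hm : s • m = (ρb * ρd) • σ - (ρa * ρc) • θ) :
    (ρc * ρb * ρf) • m = (-(p * q * t) * ε₁) • S.tri d r u := by
  have hD := tri_right S l d r u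
  have h1 : (ρe * ρf) • S.tri d r u = s • S.tri d r u := by
    refine h.smul_eq (x := -(S.br r u * (ε₁ * (ρe * ρc * ρd))))
      (y := S.br d r * (ε₂ * (ρe * ρa * ρb))) hs hu ?_
    rw [hD, h.tri₁, h.tri₂]; module
  refine (us.mul h.ue).smul_left_cancel.mp ?_
  calc (s * ρe) • (ρc * ρb * ρf) • m = (ρe * ρc * ρb * ρf) • s • m := by module
    _ = (ρf * (ρb * ρb)) • (ρe * ρc * ρd) • σ - (ρf * (ρc * ρc)) • (ρe * ρa * ρb) • θ := by
      rw [hm]; module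
    _ = (ρf * ε₁ * t) • (S.br r u • S.tri l d r - (q * q) • S.br d r • S.tri l r u) := by
      rw [h.hσ, h.hθ, h.hb, h.hc, h.ε₂_eq]; module
    _ = -((ρf * ε₁ * t) • S.br l r • S.tri d r u) := by
      rw [h.hq, one_smul, hD]; module
    _ = (-(p * q * t) * ε₁ * ρe) • (ρe * ρf) • S.tri d r u := by
      have e : -(p * q * t) * ε₁ * ρe * (ρe * ρf) = -(ρf * ε₁ * t * S.br l r) := by
        linear_combination (-(p * q * t) * ε₁ * ρf) * h.he
          - ρf * ε₁ * t * S.br l r * (q * q * h.hp + h.hq)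
      rw [smul_smul, smul_smul, e, neg_smul]
    _ = (s * ρe) • (-(p * q * t) * ε₁) • S.tri d r u := by rw [h1]; module

lemma mu_left {s : E} {m : O} (hs : s * s = ρa * ρa * (ρc * ρc) + ρb * ρb * (ρd * ρd))
    (us : IsUnit s) (hu : IsUnit (ρe * ρf + s)) (hm : s • m = (ρb * ρd) • θ + (ρa * ρc) • σ) :
    (ρd * ρf * ρa) • m = (t * ε₁) • S.tri l d u := by
  have hD := tri_left S l d r u
  have h1 : (ρe * ρf) • S.tri l d u = s • S.tri l d u := by
    refine h.smul_eq (x := S.br l u * (ε₁ * (ρe * ρc * ρd)))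
      (y := S.br l d * (ε₂ * (ρe * ρa * ρb))) hs hu ?_
    rw [hD, h.tri₁, h.tri₂]; module
  refine (us.mul h.ue).smul_left_cancel.mp ?_
  calc (s * ρe) • (ρd * ρf * ρa) • m = (ρe * ρd * ρf * ρa) • s • m := by module
    _ = (ρf * (ρd * ρd)) • (ρe * ρa * ρb) • θ + (ρf * (ρa * ρa)) • (ρe * ρc * ρd) • σ := by
      rw [hm]; module
    _ = (ρf * (p * q * t) * ε₁) • (S.br l u • S.tri l d r + S.br l d • S.tri l r u) := by
      rw [h.hσ, h.hθ, h.hd, h.ha, h.ε₂_eq]; module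
    _ = (t * ε₁ * ρe) • (ρe * ρf) • S.tri l d u := by
      have e : t * ε₁ * ρe * (ρe * ρf) = ρf * (p * q * t) * ε₁ * S.br l r := by
        linear_combination (t * ε₁ * ρf) * h.he
      rw [smul_smul, ← hD, smul_smul, e]
    _ = (s * ρe) • (t * ε₁) • S.tri l d u := by rw [h1]; module

end FlipData
end FlipAlgebra

/-! ### Positions of the vertices relative to a base vertex -/

section Positions

variable {n : ℕ} (src : Fin (n + 3))

/-- The number of boundary segments from `src` to `v`, counter-clockwise. -/
def pos (v : Fin (n + 3)) : ℕ := (v - src).val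

/-- The vertex `p` boundary segments after `src`. -/
def vtx (p : ℕ) : Fin (n + 3) := src + Fin.ofNat (n + 3) p

/-- Subtraction modulo `n + 3` is unfolded once here, so that afterwards all statements on the
cyclic order become linear arithmetic for `omega`. -/
lemma pos_cases (v : Fin (n + 3)) :
    (src.val ≤ v.val ∧ pos src v + src.val = v.val) ∨
      (v.val < src.val ∧ pos src v + src.val = v.val + (n + 3)) := by
  have h1 := src.isLt
  have h2 := v.isLt
  simp only [pos, Fin.sub_def]
  rcases le_or_gt src.val v.val with h | h
  · left
    refine ⟨h, ?_⟩
    rw [show n + 3 - src.val + v.val = v.val - src.val + (n + 3) by omega, Nat.add_mod_right,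
      Nat.mod_eq_of_lt (by omega)]
    omega
  · right
    refine ⟨h, ?_⟩
    rw [Nat.mod_eq_of_lt (by omega)]
    omega

lemma pos_lt (v : Fin (n + 3)) : pos src v < n + 3 := (v - src).isLt

lemma pos_inj {u v : Fin (n + 3)} : pos src u = pos src v ↔ u = v := by
  constructor
  · intro h
    exact sub_left_inj.mp (Fin.ext h)
  · rintro rfl; rfl

lemma pos_vtx {p : ℕ} (hp : p < n + 3) : pos src (vtx src p) = p := by
  simp [pos, vtx, Nat.mod_eq_of_lt hp]

lemma vtx_pos (v : Fin (n + 3)) : vtx src (pos src v) = v := by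
  rw [← pos_inj src, pos_vtx src (pos_lt src v)]

lemma pos_src : pos src src = 0 := by simp [pos]

lemma eq_vtx {v : Fin (n + 3)} {p : ℕ} (h : pos src v = p) : v = vtx src p := by
  rw [← h, vtx_pos]

/-- Cutting the circle at `src` makes the cyclic order linear; the three alternatives say where the
cut falls. -/
lemma sbtw_iff_pos (i j k : Fin (n + 3)) : sbtw i j k ↔
    (pos src i < pos src j ∧ pos src j < pos src k) ∨
    (pos src j < pos src k ∧ pos src k < pos src i) ∨
    (pos src k < pos src i ∧ pos src i < pos src j) := by
  have hi := pos_cases src i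
  have hj := pos_cases src j
  have hk := pos_cases src k
  have := i.isLt
  have := j.isLt
  have := k.isLt
  change ((i < j ∧ j < k) ∨ (j < k ∧ k < i) ∨ (k < i ∧ i < j)) ↔ _
  simp only [Fin.lt_def]
  omega

lemma btw_iff_pos (i j k : Fin (n + 3)) : btw i j k ↔
    (pos src i ≤ pos src j ∧ pos src j ≤ pos src k) ∨
    (pos src j ≤ pos src k ∧ pos src k ≤ pos src i) ∨
    (pos src k ≤ pos src i ∧ pos src i ≤ pos src j) := by
  rw [btw_iff_not_sbtw, sbtw_iff_pos src]
  omega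

lemma pos_add_one (i : Fin (n + 3)) :
    pos src (i + 1) = if pos src i = n + 2 then 0 else pos src i + 1 := by
  have h1 : (i + 1 - src) = (i - src) + 1 := add_sub_right_comm _ _ _
  rw [pos, h1, pos]
  rw [Fin.val_add_one]
  simp [Fin.ext_iff]

lemma isSide_iff_pos (i j : Fin (n + 3)) : IsSide s(i, j) ↔
    pos src i + 1 = pos src j ∨ pos src j + 1 = pos src i ∨
    (pos src i = 0 ∧ pos src j = n + 2) ∨ (pos src j = 0 ∧ pos src i = n + 2) := by
  have hi := pos_lt src i
  have hj := pos_lt src j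
  constructor
  · rintro ⟨k, hk⟩
    have h := pos_add_one src k
    have hkl := pos_lt src k
    rcases Sym2.eq_iff.mp hk with ⟨rfl, rfl⟩ | ⟨rfl, rfl⟩ <;> split_ifs at h <;> omega
  · have key : ∀ a b : Fin (n + 3), pos src a + 1 = pos src b ∨
        (pos src b = 0 ∧ pos src a = n + 2) → b = a + 1 := by
      intro a b h
      rw [← pos_inj src, pos_add_one]
      have := pos_lt src b
      split_ifs <;> omega
    rintro (h | h | h | h)
    · exact ⟨i, by rw [key i j (Or.inl h)]⟩
    · exact ⟨j, by rw [Sym2.eq_swap, key j i (Or.inl h)]⟩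
    · exact ⟨j, by rw [Sym2.eq_swap, key j i (Or.inr h)]⟩
    · exact ⟨i, by rw [key i j (Or.inr h)]⟩

lemma sbtw_rot {i j k : Fin (n + 3)} (h : sbtw i j k) : sbtw j k i := by
  rw [sbtw_iff_pos i] at *
  omega

/-- The sign of a pair of vertices, as an element of the ring `E`. -/
def sg (E : Type*) [CommRing E] (i j : Fin (n + 3)) : E := if pos src i < pos src j then 1 else -1

variable {E : Type*} [CommRing E]

lemma sg_sq (i j : Fin (n + 3)) : sg src E i j * sg src E i j = 1 := by
  unfold sg; split_ifs <;> simp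

lemma sg_swap {i j : Fin (n + 3)} (h : i ≠ j) : sg src E j i = -sg src E i j := by
  have : pos src i ≠ pos src j := fun h' => h ((pos_inj src).mp h')
  unfold sg; split_ifs <;> first | omega | simp

/-- Going once around a cyclic triple, exactly one of the three steps is a descent in the linear
order starting at `src`. So the three signs have product `-1`, and reversing the last pair removes
the sign. -/
lemma sg_mul {i j k : Fin (n + 3)} (h : sbtw i j k) :
    sg src E i j * sg src E j k = sg src E i k := by
  rw [sbtw_iff_pos src] at h
  unfold sg; split_ifs <;> first | omega | simp

end Positions

/-! ### Charts that come from super vectors -/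

section Compat

variable {n : ℕ} {T : Finset (Sym2 (Fin (n + 3)))} {R : Type*} [Field R] [LinearOrder R]
  [IsStrictOrderedRing R]

lemma Chart.HasEdge.symm {C : Chart T R} {i j : Fin (n + 3)} (h : C.HasEdge i j) :
    C.HasEdge j i := by
  unfold Chart.HasEdge at *
  rw [Sym2.eq_swap]
  tauto

variable (T R) in
/-- The even part of the Grassmann algebra of `T`. -/
abbrev EvT : Type _ := Ev R ({t : Finset (Fin (n + 3)) // IsTriangle T t} →₀ R)

variable (T R) in
/-- The odd part of the Grassmann algebra of `T`. -/
abbrev OdT : Type _ := Od R ({t : Finset (Fin (n + 3)) // IsTriangle T t} →₀ R)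

variable (T R) in
/-- The multiplication of odd elements of the Grassmann algebra of `T`. -/
abbrev pairT : OddPairing (EvT T R) (OdT T R) := oddPairing R _

variable (T R) in
/-- The degree zero part of an even element of the Grassmann algebra of `T`. -/
abbrev bodyT : EvT T R →+* R := body R _

/-- `ρ i j` is the positive square root of the lambda length of `(i, j)` that is defined by the
super vectors `f i` and `f j`. -/
structure IsRoots (src : Fin (n + 3)) (f : Fin (n + 3) → SVec (EvT T R) (OdT T R))
    (ρ : Fin (n + 3) → Fin (n + 3) → EvT T R) : Prop where
  body_pos : ∀ i j, i ≠ j → 0 < bodyT T R (ρ i j)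
  sq : ∀ i j, i ≠ j → ρ i j * ρ i j = sg src (EvT T R) i j * (pairT T R).br (f i) (f j)

variable {src : Fin (n + 3)} {f : Fin (n + 3) → SVec (EvT T R) (OdT T R)}
  {ρ : Fin (n + 3) → Fin (n + 3) → EvT T R}

lemma IsRoots.symm (h : IsRoots src f ρ) {i j : Fin (n + 3)} (hij : i ≠ j) : ρ j i = ρ i j := by
  refine sqrt_unique (h.body_pos j i hij.symm) (h.body_pos i j hij) ?_
  rw [h.sq _ _ hij, h.sq _ _ hij.symm, sg_swap src hij, (pairT T R).br_swap (f i) (f j)]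
  ring

lemma IsRoots.isUnit (h : IsRoots src f ρ) {i j : Fin (n + 3)} (hij : i ≠ j) : IsUnit (ρ i j) :=
  isUnit_of_body (h.body_pos i j hij).ne'

/-- The `μ`-invariant `x` of the triangle `i, j, k` is the one given by the super vectors, up to
the sign `ε`. -/
def IsMuInv (f : Fin (n + 3) → SVec (EvT T R) (OdT T R)) (ρ : Fin (n + 3) → Fin (n + 3) → EvT T R)
    (ε : EvT T R) (x : Super T R) (i j k : Fin (n + 3)) : Prop :=
  ∃ m : OdT T R, x = m.1 ∧ (ρ i j * ρ j k * ρ k i) • m = ε • (pairT T R).tri (f i) (f j) (f k)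

lemma IsMuInv.rot {ε : EvT T R} {x : Super T R} {i j k : Fin (n + 3)}
    (h : IsMuInv f ρ ε x i j k) : IsMuInv f ρ ε x j k i := by
  obtain ⟨m, hm, h⟩ := h
  refine ⟨m, hm, ?_⟩
  rw [(pairT T R).tri_rot, ← h]
  congr 1; ring

/-- The chart `C` comes from the super vectors `f`, with signs given by an orientation that is
equivalent to the standard one. -/
structure Compat (src : Fin (n + 3)) (f : Fin (n + 3) → SVec (EvT T R) (OdT T R))
    (ρ : Fin (n + 3) → Fin (n + 3) → EvT T R) (ε : Finset (Fin (n + 3)) → EvT T R)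
    (C : Chart T R) : Prop where
  ne : ∀ i j, C.dir i j → i ≠ j
  ns : ∀ i j, C.dir i j → ¬ IsSide s(i, j)
  nc : ∀ i j k l, C.HasEdge i j → C.HasEdge k l → sbtw i k j → ¬ sbtw j l i
  lam : ∀ i j, C.HasEdge i j → C.lam s(i, j) = (ρ i j * ρ i j : EvT T R).1
  sign : ∀ t, ε t * ε t = 1
  mu : ∀ i j k, sbtw i j k → C.HasEdge i j → C.HasEdge j k → C.HasEdge k i →
    IsMuInv f ρ (ε {i, j, k}) (C.mu {i, j, k}) i j k
  orient : ∀ l r d u, C.dir l r → sbtw l d r → sbtw l r u → C.HasEdge l d → C.HasEdge d r →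
    C.HasEdge r u → C.HasEdge u l → ε {l, r, d} * ε {l, r, u} = sg src (EvT T R) d u

lemma sbtw_ne {i j k : Fin (n + 3)} (h : sbtw i j k) : i ≠ j ∧ j ≠ k ∧ i ≠ k := by
  rw [sbtw_iff_pos i] at h
  refine ⟨?_, ?_, ?_⟩ <;> rintro rfl <;> omega

/-- The edges of the flipped triangulation. -/
lemma Flip.hasEdge_iff {C C' : Chart T R} {l r u d : Fin (n + 3)}
    (hns : ¬ IsSide s(l, r))
    (hdir : ∀ i j, C'.dir i j ↔ (i = d ∧ j = u) ∨ (s(i, j) = s(u, r) ∧ C.dir j i) ∨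
      (s(i, j) ≠ s(u, r) ∧ s(i, j) ≠ s(l, r) ∧ C.dir i j)) (hul : u ≠ l) (hlr' : l ≠ r)
      (i j : Fin (n + 3)) :
    C'.HasEdge i j ↔ s(i, j) = s(d, u) ∨ (C.HasEdge i j ∧ s(i, j) ≠ s(l, r)) := by
  have hne : s(u, r) ≠ s(l, r) := by
    intro h
    rcases Sym2.eq_iff.mp h with ⟨h, _⟩ | ⟨h1, h2⟩
    · exact hul h
    · exact hlr' h2.symm
  unfold Chart.HasEdge
  rw [hdir, hdir, show s(j, i) = s(i, j) from Sym2.eq_swap]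
  have h1 : ((i = d ∧ j = u) ∨ (j = d ∧ i = u)) ↔ s(i, j) = s(d, u) := by
    rw [Sym2.eq_iff]; tauto
  rw [← h1]
  by_cases h2 : s(i, j) = s(u, r)
  · simp only [h2, ne_eq, not_true_eq_false, true_and, false_and, or_false, hne, not_false_eq_true,
      and_true]
    generalize IsSide s(u, r) = a, C.dir i j = b, C.dir j i = c, (i = d ∧ j = u) = e,
      (j = d ∧ i = u) = g
    tauto
  · by_cases h3 : s(i, j) = s(l, r)
    · simp only [h3, ne_eq, not_true_eq_false, and_false, false_and, or_false, hne.symm, hns,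
        false_or]
    · simp only [h2, h3, ne_eq, not_false_eq_true, true_and, false_and, false_or, and_true]
      generalize IsSide s(i, j) = a, C.dir i j = b, C.dir j i = c, (i = d ∧ j = u) = e,
        (j = d ∧ i = u) = g
      tauto

/-- Two different apexes on the same side of an edge would give two crossing sides, one joined to
`i` and the other to `j`. -/
lemma unique_apex {C : Chart T R}
    (nc : ∀ i j k l, C.HasEdge i j → C.HasEdge k l → sbtw i k j → ¬ sbtw j l i)
    {i j a b : Fin (n + 3)} (ha : sbtw i j a) (hb : sbtw i j b)
    (hja : C.HasEdge j a) (hai : C.HasEdge a i) (hjb : C.HasEdge j b) (hbi : C.HasEdge b i) :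
    a = b := by
  by_contra hab
  have h0 : pos i a ≠ pos i b := fun h => hab ((pos_inj i).mp h)
  have hi := pos_src i
  have h1 := nc j b a i hjb hai
  have h2 := nc j a b i hja hbi
  simp only [sbtw_iff_pos i] at ha hb h1 h2
  omega

lemma sbtw_eq_rot {i j k a b c : Fin (n + 3)} (h : sbtw i j k) (h' : sbtw a b c)
    (he : ({i, j, k} : Finset (Fin (n + 3))) = {a, b, c}) :
    (i = a ∧ j = b ∧ k = c) ∨ (i = b ∧ j = c ∧ k = a) ∨ (i = c ∧ j = a ∧ k = b) := by
  have hi : i ∈ ({a, b, c} : Finset (Fin (n + 3))) := he ▸ by simp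
  have hj : j ∈ ({a, b, c} : Finset (Fin (n + 3))) := he ▸ by simp
  have hk : k ∈ ({a, b, c} : Finset (Fin (n + 3))) := he ▸ by simp
  simp only [Finset.mem_insert, Finset.mem_singleton] at hi hj hk
  rw [sbtw_iff_pos i] at h h'
  rcases hi with rfl | rfl | rfl <;> rcases hj with rfl | rfl | rfl <;>
    rcases hk with rfl | rfl | rfl <;> omega

/-- A quadrilateral of the chart `C` around the arc directed from `l` to `r`, with `d` on its right
and `u` on its left. -/
structure IsQuad (C : Chart T R) (l r u d : Fin (n + 3)) : Prop where
  lr : C.dir l r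
  lru : sbtw l r u
  ldr : sbtw l d r
  ul : C.HasEdge u l
  ur : C.HasEdge u r
  rd : C.HasEdge r d
  ld : C.HasEdge l d

namespace IsQuad

variable {C : Chart T R} {l r u d : Fin (n + 3)} (h : IsQuad C l r u d)
include h

lemma pos_lt : 0 < pos l d ∧ pos l d < pos l r ∧ pos l r < pos l u := by
  have h1 := h.lru
  have h2 := h.ldr
  have h3 := pos_src l
  simp only [sbtw_iff_pos l] at h1 h2
  omega

lemma dru : sbtw d r u := by
  have := h.pos_lt
  rw [sbtw_iff_pos l]; omega

lemma ldu : sbtw l d u := by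
  have := h.pos_lt
  have := pos_src l
  rw [sbtw_iff_pos l]; omega

lemma edge : C.HasEdge l r := Or.inr (Or.inl h.lr)

/-- The data of a flip in the even and odd part of the Grassmann algebra. -/
lemma flipData (hρ : IsRoots src f ρ) {ε : Finset (Fin (n + 3)) → EvT T R}
    (hC : Compat src f ρ ε C) : ∃ σ θ : OdT T R, C.mu {l, r, d} = σ.1 ∧ C.mu {l, r, u} = θ.1 ∧
    FlipData (pairT T R) (f l) (f d) (f r) (f u) (ρ l r) (ρ l u) (ρ r u) (ρ d r) (ρ l d) (ρ d u)
      (sg src _ l d) (sg src _ d r) (sg src _ r u) (ε {l, r, d}) (ε {l, r, u}) σ θ := by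
  obtain ⟨h1, h2, h3⟩ := sbtw_ne h.lru
  obtain ⟨h4, h5, h6⟩ := sbtw_ne h.dru
  have h7 := (sbtw_ne h.ldr).1
  have e1 : ({l, d, r} : Finset (Fin (n + 3))) = {l, r, d} := by
    ext x; simp only [Finset.mem_insert, Finset.mem_singleton]; tauto
  obtain ⟨σ, hσ, hσ'⟩ := hC.mu l d r h.ldr h.ld h.rd.symm h.edge.symm
  obtain ⟨θ, hθ, hθ'⟩ := hC.mu l r u h.lru h.edge h.ur.symm h.ul
  rw [e1] at hσ hσ'
  refine ⟨σ, θ, hσ, hθ, ?_⟩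
  refine ⟨sg_sq src _ _, sg_sq src _ _, sg_sq src _ _, hC.sign _, ?_, hρ.isUnit h1, ?_, ?_, ?_, ?_,
    ?_, ?_, ?_, ?_⟩
  · rw [hC.orient l r d u h.lr h.ldr h.lru h.ld h.rd.symm h.ur.symm h.ul, sg_mul src h.dru]
  · rw [hρ.sq _ _ h1, sg_mul src h.ldr]
  · rw [hρ.sq _ _ h3, sg_mul src h.ldr, sg_mul src h.lru]
  · rw [hρ.sq _ _ h2]
  · rw [hρ.sq _ _ h4]
  · rw [hρ.sq _ _ h7]
  · rw [hρ.sq _ _ h6, sg_mul src h.dru]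
  · rw [← hσ', hρ.symm h1]; congr 1; ring
  · rw [← hθ', hρ.symm h3]; congr 1; ring

/-- Edges of the flipped triangulation do not cross. -/
lemma flip_nc {C' : Chart T R}
    (nc : ∀ i j k l, C.HasEdge i j → C.HasEdge k l → sbtw i k j → ¬ sbtw j l i)
    (hE : ∀ i j, C'.HasEdge i j ↔ s(i, j) = s(d, u) ∨ (C.HasEdge i j ∧ s(i, j) ≠ s(l, r)))
    (i j k m : Fin (n + 3)) (hij : C'.HasEdge i j) (hkm : C'.HasEdge k m) (h1 : sbtw i k j) :
    ¬ sbtw j m i := by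
  -- An old edge that crosses the new diagonal but none of the four sides of the quadrilateral has
  -- both ends among its vertices, so it is the old diagonal.
  have key : ∀ k m, C.HasEdge k m → s(k, m) ≠ s(l, r) → sbtw d k u → ¬ sbtw u m d := by
    intro k m hkm hne h1 h2
    have hp := h.pos_lt
    have a1 := nc d r k m h.rd.symm hkm
    have a2 := nc r u k m h.ur.symm hkm
    have a3 := nc u l m k h.ul hkm.symm
    have a4 := nc l d m k h.ld hkm.symm
    have hl := pos_src l
    have b1 : ¬ (pos l k = pos l r ∧ pos l m = pos l l) := by
      rw [pos_inj, pos_inj]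
      rintro ⟨rfl, rfl⟩
      exact hne Sym2.eq_swap
    have := SuperCC.pos_lt l m
    simp only [sbtw_iff_pos l] at h1 h2 a1 a2 a3 a4
    omega
  intro h2
  rw [hE] at hij hkm
  rcases hij with hij | ⟨hij, hij'⟩ <;> rcases hkm with hkm | ⟨hkm, hkm'⟩
  · have := hij.trans hkm.symm
    rw [sbtw_iff_pos i] at h1 h2
    rcases Sym2.eq_iff.mp this with ⟨rfl, rfl⟩ | ⟨rfl, rfl⟩ <;> omega
  · rcases Sym2.eq_iff.mp hij with ⟨rfl, rfl⟩ | ⟨rfl, rfl⟩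
    · exact key k m hkm hkm' h1 h2
    · exact key m k hkm.symm (by rwa [Sym2.eq_swap]) h2 h1
  · rcases Sym2.eq_iff.mp hkm with ⟨rfl, rfl⟩ | ⟨rfl, rfl⟩
    · rw [sbtw_iff_pos i] at h1 h2
      refine key j i hij.symm (by rwa [Sym2.eq_swap]) ?_ ?_ <;> rw [sbtw_iff_pos i] <;> omega
    · rw [sbtw_iff_pos i] at h1 h2
      refine key i j hij hij' ?_ ?_ <;> rw [sbtw_iff_pos i] <;> omega
  · exact nc i j k m hij hkm h1 h2

end IsQuad

end Compat

/-! ### Invariance of compatibility under a flip -/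

section CompatFlip

variable {n : ℕ} {T : Finset (Sym2 (Fin (n + 3)))} {R : Type*} [Field R] [LinearOrder R]
  [IsStrictOrderedRing R] {src : Fin (n + 3)} {f : Fin (n + 3) → SVec (EvT T R) (OdT T R)}
  {ρ : Fin (n + 3) → Fin (n + 3) → EvT T R}

/-- Roots in a flip are arbitrary elements of the Grassmann algebra subject to conditions;
uniqueness of positive roots replaces them by expressions in the `ρ i j`. -/
lemma isPosSqrt_unique {s x : Super T R} {y : EvT T R} (hs : IsPosSqrt s x)
    (hy : 0 < bodyT T R y) (hx : x = (y * y).1) : s = y.1 := by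
  obtain ⟨h1, h2, h3⟩ := hs
  exact congrArg Subtype.val (sqrt_unique (a := ⟨s, h1⟩) (b := y) h2 hy
    (Subtype.ext (h3.trans hx)))

open Classical in
/-- The signs of the triangles after a flip. -/
def flipSign (src l r u d : Fin (n + 3)) (ε : Finset (Fin (n + 3)) → EvT T R)
    (t : Finset (Fin (n + 3))) : EvT T R :=
  if t = {u, r, d} then -(sg src _ l u) * ε {l, r, d}
  else if t = {u, l, d} then sg src _ r u * ε {l, r, d} else ε t

lemma triple_eq (a b c : Fin (n + 3)) : ({a, b, c} : Finset (Fin (n + 3))) = {b, c, a} := by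
  ext x; simp only [Finset.mem_insert, Finset.mem_singleton]; tauto

lemma triple_swap (a b c : Fin (n + 3)) : ({a, b, c} : Finset (Fin (n + 3))) = {b, a, c} := by
  ext x; simp only [Finset.mem_insert, Finset.mem_singleton]; tauto

lemma coe_unit_cancel {a : EvT T R} (ha : IsUnit a) {x y : Super T R} (h : x * a.1 = y * a.1) :
    x = y := by
  have : IsUnit a.1 := ha.map (CliffordAlgebra.even
    (0 : QuadraticForm R ({t : Finset (Fin (n + 3)) // IsTriangle T t} →₀ R))).val
  exact this.mul_right_cancel h

lemma sym2_ne {a b c d : Fin (n + 3)} (h : (a ≠ c ∧ a ≠ d) ∨ (b ≠ c ∧ b ≠ d)) :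
    s(a, b) ≠ s(c, d) := by
  rw [Ne, Sym2.eq_iff]; tauto

lemma sym2_of_triple {i j c x y z : Fin (n + 3)} (hij : i ≠ j)
    (h : ({i, j, c} : Finset (Fin (n + 3))) = {x, y, z}) :
    s(i, j) = s(x, y) ∨ s(i, j) = s(y, z) ∨ s(i, j) = s(x, z) := by
  have hi : i ∈ ({x, y, z} : Finset (Fin (n + 3))) := h ▸ by simp
  have hj : j ∈ ({x, y, z} : Finset (Fin (n + 3))) := h ▸ by simp
  simp only [Finset.mem_insert, Finset.mem_singleton] at hi hj
  simp only [Sym2.eq_iff]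
  rcases hi with rfl | rfl | rfl <;> rcases hj with rfl | rfl | rfl <;> simp at hij ⊢

lemma triple_swap_right (a b c : Fin (n + 3)) : ({a, b, c} : Finset (Fin (n + 3))) = {a, c, b} := by
  rw [Finset.pair_comm]

lemma triple_rev (a b c : Fin (n + 3)) : ({a, b, c} : Finset (Fin (n + 3))) = {c, b, a} := by
  rw [triple_swap, triple_eq, triple_eq, triple_eq, triple_eq]

/-- The roots of `ac`, `bd` and `acbd` are products of the roots of the sides, so the flip relations
are those treated in `FlipData`. The root of `ac + bd` is not such a product; for it only the square
and the positivity are used. -/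
lemma IsQuad.flip_values {ε : Finset (Fin (n + 3)) → EvT T R} {C C' : Chart T R}
    {l r u d : Fin (n + 3)} (hρ : IsRoots src f ρ) (hC : Compat src f ρ ε C)
    (Q : IsQuad C l r u d) {sac sbd sacbd ssum : Super T R}
    (hac : IsPosSqrt sac (C.lam s(u, l) * C.lam s(r, d)))
    (hbd : IsPosSqrt sbd (C.lam s(u, r) * C.lam s(l, d)))
    (hacbd : IsPosSqrt sacbd
      (C.lam s(u, l) * C.lam s(r, d) * (C.lam s(u, r) * C.lam s(l, d))))
    (hsum : IsPosSqrt ssum (C.lam s(u, l) * C.lam s(r, d) + C.lam s(u, r) * C.lam s(l, d)))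
    (e1 : C.lam s(l, r) * C'.lam s(d, u) =
        C.lam s(u, l) * C.lam s(r, d) + C.lam s(u, r) * C.lam s(l, d)
          + sacbd * C.mu {l, r, d} * C.mu {l, r, u})
    (e2 : C'.mu {u, r, d} * ssum = C.mu {l, r, d} * sbd - C.mu {l, r, u} * sac)
    (e3 : C'.mu {u, l, d} * ssum = C.mu {l, r, u} * sbd + C.mu {l, r, d} * sac) :
    C'.lam s(d, u) = (ρ d u * ρ d u).1 ∧
    IsMuInv f ρ (-(sg src _ l u) * ε {l, r, d}) (C'.mu {u, r, d}) d r u ∧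
    IsMuInv f ρ (sg src _ r u * ε {l, r, d}) (C'.mu {u, l, d}) l d u := by
  obtain ⟨n1, n2, n3⟩ := sbtw_ne Q.lru
  obtain ⟨n4, n5, n6⟩ := sbtw_ne Q.dru
  have n7 := (sbtw_ne Q.ldr).1
  obtain ⟨σ, θ, hσ, hθ, D⟩ := Q.flipData hρ hC
  have h4 := Q.ul
  have h5 := Q.ur
  have h6 := Q.rd
  have h7 := Q.ld
  have la : C.lam s(u, l) = (ρ l u * ρ l u).1 := by rw [Sym2.eq_swap]; exact hC.lam l u h4.symm
  have lb : C.lam s(u, r) = (ρ r u * ρ r u).1 := by rw [Sym2.eq_swap]; exact hC.lam r u h5.symm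
  have lc : C.lam s(r, d) = (ρ d r * ρ d r).1 := by rw [Sym2.eq_swap]; exact hC.lam d r h6.symm
  have ld : C.lam s(l, d) = (ρ l d * ρ l d).1 := hC.lam l d h7
  have le : C.lam s(l, r) = (ρ l r * ρ l r).1 := hC.lam l r Q.edge
  have pa := hρ.body_pos l u n3
  have pb := hρ.body_pos r u n2
  have pc := hρ.body_pos d r n4
  have pd := hρ.body_pos l d n7
  have pe := hρ.body_pos l r n1
  have pf := hρ.body_pos d u n6
  simp only [la, lb, lc, ld] at hac hbd hacbd hsum e1
  have hac' : sac = (ρ l u * ρ d r : EvT T R).1 := isPosSqrt_unique hac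
    (by rw [map_mul]; positivity) (congrArg Subtype.val (show ρ l u * ρ l u * (ρ d r * ρ d r) =
      ρ l u * ρ d r * (ρ l u * ρ d r) by ring))
  have hbd' : sbd = (ρ r u * ρ l d : EvT T R).1 := isPosSqrt_unique hbd
    (by rw [map_mul]; positivity) (congrArg Subtype.val (show ρ r u * ρ r u * (ρ l d * ρ l d) =
      ρ r u * ρ l d * (ρ r u * ρ l d) by ring))
  have hacbd' : sacbd = (ρ l u * ρ d r * (ρ r u * ρ l d) : EvT T R).1 := isPosSqrt_unique hacbd
    (by rw [map_mul, map_mul, map_mul]; positivity)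
    (congrArg Subtype.val (show ρ l u * ρ l u * (ρ d r * ρ d r) *
      (ρ r u * ρ r u * (ρ l d * ρ l d)) =
      ρ l u * ρ d r * (ρ r u * ρ l d) * (ρ l u * ρ d r * (ρ r u * ρ l d)) by ring))
  obtain ⟨s1, s2, s3⟩ := hsum
  obtain ⟨s, rfl⟩ : ∃ s : EvT T R, s.1 = ssum := ⟨⟨ssum, s1⟩, rfl⟩
  have hs : s * s = ρ l u * ρ l u * (ρ d r * ρ d r) + ρ r u * ρ r u * (ρ l d * ρ l d) :=
    Subtype.ext s3
  have us : IsUnit s := isUnit_of_body s2.ne'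
  have hu : IsUnit (ρ l r * ρ d u + s) := isUnit_of_body (by
    have : 0 < bodyT T R s := s2
    rw [map_add, map_mul]; positivity)
  have hlam' : C'.lam s(d, u) = (ρ d u * ρ d u).1 := by
    have hp := D.ptolemy
    have hp' : (ρ d u * ρ d u) * (ρ l r * ρ l r) = ρ l u * ρ l u * (ρ d r * ρ d r) +
      ρ r u * ρ r u * (ρ l d * ρ l d) + ρ l u * ρ d r * (ρ r u * ρ l d) * (pairT T R).om σ θ := by
      linear_combination hp
    refine coe_unit_cancel (a := ρ l r * ρ l r) ((hρ.isUnit n1).mul (hρ.isUnit n1)) ?_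
    rw [le] at e1
    rw [← even_comm (ρ l r * ρ l r).2, e1]
    refine Eq.trans ?_ (congrArg Subtype.val hp').symm
    rw [hacbd', hσ, hθ, mul_assoc (ρ l u * ρ d r * (ρ r u * ρ l d) : EvT T R).1]
    rfl
  obtain ⟨us, rfl⟩ := us
  -- The new `μ`-invariants are a priori only elements of the Grassmann algebra. Dividing the flip
  -- relations by the unit `√(ac + bd)` exhibits them as odd elements.
  set m₁ : OdT T R := (us⁻¹.1 : EvT T R) • ((ρ r u * ρ l d) • σ - (ρ l u * ρ d r) • θ) with hm₁
  set m₂ : OdT T R := (us⁻¹.1 : EvT T R) • ((ρ r u * ρ l d) • θ + (ρ l u * ρ d r) • σ) with hm₂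
  have hm₁' : (us.1 : EvT T R) • m₁ = (ρ r u * ρ l d) • σ - (ρ l u * ρ d r) • θ := by
    rw [hm₁, smul_smul, Units.mul_inv, one_smul]
  have hm₂' : (us.1 : EvT T R) • m₂ = (ρ r u * ρ l d) • θ + (ρ l u * ρ d r) • σ := by
    rw [hm₂, smul_smul, Units.mul_inv, one_smul]
  have hmu₁ : C'.mu {u, r, d} = m₁.1 := by
    refine coe_unit_cancel us.isUnit ?_
    rw [e2, ← even_comm us.1.2 m₁.1, ← coe_smul_od, hm₁', hσ, hθ, hac', hbd',
      ← even_comm (Subtype.prop _), ← even_comm (Subtype.prop _)]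
    rfl
  have hmu₂ : C'.mu {u, l, d} = m₂.1 := by
    refine coe_unit_cancel us.isUnit ?_
    rw [e3, ← even_comm us.1.2 m₂.1, ← coe_smul_od, hm₂', hσ, hθ, hac', hbd',
      ← even_comm (Subtype.prop _), ← even_comm (Subtype.prop _)]
    rfl
  have hr := D.mu_right hs us.isUnit hu hm₁'
  have hl := D.mu_left hs us.isUnit hu hm₂'
  rw [sg_mul src Q.ldr, sg_mul src Q.lru] at hr
  exact ⟨hlam', ⟨m₁, hmu₁, by rw [hρ.symm n6, hr]⟩, ⟨m₂, hmu₂, by rw [hρ.symm n3, hl]⟩⟩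

/-- The orientation of the flipped chart. -/
lemma IsQuad.flip_orient {ε : Finset (Fin (n + 3)) → EvT T R} {C C' : Chart T R}
    {l r u d : Fin (n + 3)} (hC : Compat src f ρ ε C) (Q : IsQuad C l r u d)
    (hdir : ∀ i j, C'.dir i j ↔ (i = d ∧ j = u) ∨ (s(i, j) = s(u, r) ∧ C.dir j i) ∨
      (s(i, j) ≠ s(u, r) ∧ s(i, j) ≠ s(l, r) ∧ C.dir i j))
    (hE : ∀ i j, C'.HasEdge i j ↔ s(i, j) = s(d, u) ∨ (C.HasEdge i j ∧ s(i, j) ≠ s(l, r)))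
    (hnc : ∀ i j k l, C'.HasEdge i j → C'.HasEdge k l → sbtw i k j → ¬ sbtw j l i)
    (htri : ∀ i j k, sbtw i j k → C'.HasEdge i j → C'.HasEdge j k → C'.HasEdge k i →
      ({i, j, k} : Finset (Fin (n + 3))) ≠ {u, r, d} →
      ({i, j, k} : Finset (Fin (n + 3))) ≠ {u, l, d} → C.HasEdge i j)
    (hld' : C'.HasEdge l d) (hrd' : C'.HasEdge r d) (hru' : C'.HasEdge u r)
    (hul' : C'.HasEdge u l) (hdu' : C'.HasEdge d u)
    (i j a b : Fin (n + 3)) (hij : C'.dir i j) (ha : sbtw i a j) (hb : sbtw i j b)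
    (hia : C'.HasEdge i a) (haj : C'.HasEdge a j) (hjb : C'.HasEdge j b) (hbi : C'.HasEdge b i) :
    flipSign src l r u d ε {i, j, a} * flipSign src l r u d ε {i, j, b} =
      sg src (EvT T R) a b := by
  obtain ⟨n1, n2, n3⟩ := sbtw_ne Q.lru
  obtain ⟨n4, n5, n6⟩ := sbtw_ne Q.dru
  have n7 := (sbtw_ne Q.ldr).1
  have hp := Q.pos_lt
  have hl0 := pos_src l
  have hdiff : ({u, l, d} : Finset (Fin (n + 3))) ≠ {u, r, d} := by
    intro h
    have : l ∈ ({u, r, d} : Finset (Fin (n + 3))) := h ▸ by simp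
    simp only [Finset.mem_insert, Finset.mem_singleton] at this
    rcases this with h | h | h
    exacts [n3 h, n1 h, n7 h]
  have hε₁ : flipSign src l r u d ε {u, r, d} = -(sg src _ l u) * ε {l, r, d} := if_pos rfl
  have hε₂ : flipSign src l r u d ε {u, l, d} = sg src _ r u * ε {l, r, d} := by
    rw [flipSign, if_neg hdiff, if_pos rfl]
  have hε₃ : ∀ t, t ≠ {u, r, d} → t ≠ {u, l, d} → flipSign src l r u d ε t = ε t := by
    intro t ht ht'
    rw [flipSign, if_neg ht, if_neg ht']
  have hO := hC.orient l r d u Q.lr Q.ldr Q.lru Q.ld Q.rd.symm Q.ur.symm Q.ul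
  have hε := hC.sign {l, r, d}
  have hεu := hC.sign {l, r, u}
  -- an apex that is not a vertex of the quadrilateral
  have out : ∀ x y c, c ≠ l → c ≠ r → c ≠ u → c ≠ d →
      flipSign src l r u d ε {x, y, c} = ε {x, y, c} := by
    intro x y c h1 h2 h3 h4
    apply hε₃ <;> intro h
    · have : c ∈ ({u, r, d} : Finset (Fin (n + 3))) := h ▸ by simp
      simp only [Finset.mem_insert, Finset.mem_singleton] at this
      rcases this with h | h | h
      exacts [h3 h, h2 h, h4 h]
    · have : c ∈ ({u, l, d} : Finset (Fin (n + 3))) := h ▸ by simp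
      simp only [Finset.mem_insert, Finset.mem_singleton] at this
      rcases this with h | h | h
      exacts [h3 h, h1 h, h4 h]
  have outE : ∀ x c, c ≠ u → c ≠ d → C'.HasEdge x c → C.HasEdge x c := by
    intro x c h3 h4 h
    rcases (hE x c).mp h with h | h
    · rcases Sym2.eq_iff.mp h with ⟨_, h⟩ | ⟨_, h⟩
      exacts [absurd h h3, absurd h h4]
    · exact h.1
  -- The apex of a triangle on the outer side of a side of the quadrilateral is none of its four
  -- vertices, so that triangle is untouched by the flip.
  have gap : ∀ x y c, sbtw x c y →
      (x = l ∧ y = d) ∨ (x = d ∧ y = r) ∨ (x = r ∧ y = u) ∨ (x = u ∧ y = l) →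
      c ≠ l ∧ c ≠ r ∧ c ≠ u ∧ c ≠ d := by
    intro x y c h hxy
    rw [sbtw_iff_pos l] at h
    rcases hxy with ⟨rfl, rfl⟩ | ⟨rfl, rfl⟩ | ⟨rfl, rfl⟩ | ⟨rfl, rfl⟩ <;>
      refine ⟨?_, ?_, ?_, ?_⟩ <;> rintro rfl <;> omega
  -- The directed arc is the new diagonal, the reversed side `(u, r)`, another side, or an arc away
  -- from the quadrilateral. Across a side, one triangle is new and the other keeps its sign; the
  -- old condition `key` across that side, together with `hO` across the old diagonal, gives the new
  -- condition. Reversing `(u, r)` accounts for the single side where the sign would otherwise be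
  -- wrong.
  rcases (hdir i j).mp hij with ⟨rfl, rfl⟩ | ⟨hs, h⟩ | ⟨hs, hs', h⟩
  · obtain rfl : r = a := unique_apex hnc (sbtw_rot (sbtw_rot Q.dru)) (sbtw_rot (sbtw_rot ha))
      hrd'.symm hru'.symm hia haj
    obtain rfl : l = b := unique_apex hnc (sbtw_rot Q.ldu) hb hul' hld' hjb hbi
    rw [triple_eq i j r, triple_eq i j l, hε₁, hε₂, sg_swap src n1]
    have e1 := sg_mul src (E := EvT T R) Q.lru
    have e2 := sg_sq (E := EvT T R) src r j
    linear_combination (-sg src _ l j * sg src _ r j) * hε + sg src _ r j * e1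
      - sg src _ l r * e2
  · rcases Sym2.eq_iff.mp hs.symm with ⟨rfl, rfl⟩ | ⟨rfl, rfl⟩
    · obtain ⟨o1, o2, o3, o4⟩ := gap r u b (sbtw_rot hb) (by simp)
      obtain rfl : d = a := unique_apex hnc (sbtw_rot Q.dru) (sbtw_rot (sbtw_rot ha)) hdu'.symm hrd'.symm hia haj
      have e2 := outE _ _ o3 o4 hjb
      have e3 := (outE _ _ o3 o4 hbi.symm).symm
      have key := hC.orient r u b l h (sbtw_rot hb) (sbtw_rot Q.lru) e2 e3 Q.ul Q.edge
      rw [out _ _ _ o1 o2 o3 o4, hε₁]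
      rw [← triple_eq l r u, triple_swap r u b] at key
      have s1 := sg_mul (E := EvT T R) src (show sbtw l d u by rw [sbtw_iff_pos l] at *; omega)
      have s2 := sg_mul (E := EvT T R) src (show sbtw l d b by rw [sbtw_iff_pos l] at *; omega)
      have s3 := sg_sq (E := EvT T R) src l d
      have s4 := sg_sq (E := EvT T R) src d u
      rw [sg_swap src o1.symm] at key
      have e4 : ε {l, r, d} = sg src _ d u * ε {l, r, u} := by linear_combination ε {l, r, u} * hO - ε {l, r, d} * hεu
      rw [e4, ← s1]
      linear_combination (-(sg src _ l d * (sg src _ d u * sg src _ d u))) * key + sg src _ l d * sg src _ l b * s4 - sg src _ l d * s2 + sg src _ d b * s3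
    · obtain ⟨o1, o2, o3, o4⟩ := gap r u a ha (by simp)
      obtain rfl : d = b := unique_apex hnc (sbtw_rot Q.dru) hb hdu'.symm hrd'.symm hjb hbi
      have e2 := outE _ _ o3 o4 hia
      have e3 := (outE _ _ o3 o4 haj.symm).symm
      have key := hC.orient u r l a h (sbtw_rot (sbtw_rot Q.lru)) (sbtw_rot (sbtw_rot ha)) Q.ul Q.edge e2 e3
      rw [out _ _ _ o1 o2 o3 o4, triple_swap r u d, hε₁]
      rw [triple_rev u r l] at key
      have s1 := sg_mul (E := EvT T R) src (show sbtw l d u by rw [sbtw_iff_pos l] at *; omega)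
      have s2 := sg_mul (E := EvT T R) src (show sbtw l d a by rw [sbtw_iff_pos l] at *; omega)
      have s3 := sg_sq (E := EvT T R) src l d
      have s4 := sg_sq (E := EvT T R) src d u
      rw [sg_swap src o4.symm]
      have e4 : ε {l, r, d} = sg src _ d u * ε {l, r, u} := by linear_combination ε {l, r, u} * hO - ε {l, r, d} * hεu
      rw [e4, triple_swap r u a, ← s1]
      linear_combination (-(sg src _ l d * (sg src _ d u * sg src _ d u))) * key - sg src _ l d * sg src _ l a * s4 + sg src _ l d * s2 - sg src _ d a * s3
  · have e4 : ε {l, r, d} = sg src _ d u * ε {l, r, u} := by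
      linear_combination ε {l, r, u} * hO - ε {l, r, d} * hεu
    by_cases h1 : s(i, j) = s(u, l)
    · rcases Sym2.eq_iff.mp h1.symm with ⟨rfl, rfl⟩ | ⟨rfl, rfl⟩
      · obtain ⟨o1, o2, o3, o4⟩ := gap u l a ha (by simp)
        obtain rfl : d = b := unique_apex hnc (sbtw_rot (sbtw_rot Q.ldu)) hb hld' hdu' hjb hbi
        have e2 := outE _ _ o3 o4 hia
        have e3 := (outE _ _ o3 o4 haj.symm).symm
        have key := hC.orient u l a r h ha (sbtw_rot (sbtw_rot Q.lru)) e2 e3 Q.edge Q.ur.symm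
        rw [out _ _ _ o1 o2 o3 o4, hε₂, e4]
        rw [triple_eq u l r] at key
        have s1 := sg_mul (E := EvT T R) src (show sbtw d r u by rw [sbtw_iff_pos l] at *; omega)
        have s2 := sg_mul (E := EvT T R) src (show sbtw a d r by rw [sbtw_iff_pos l] at *; omega)
        have s3 := sg_sq (E := EvT T R) src d r
        have s4 := sg_sq (E := EvT T R) src r u
        rw [← s1]
        linear_combination (sg src _ d r * (sg src _ r u * sg src _ r u)) * key + sg src _ d r * sg src _ a r * s4 - sg src _ d r * s2 + sg src _ a d * s3
      · obtain ⟨o1, o2, o3, o4⟩ := gap u l b (sbtw_rot hb) (by simp)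
        obtain rfl : d = a := unique_apex hnc (sbtw_rot (sbtw_rot Q.ldu)) (sbtw_rot (sbtw_rot ha)) hld' hdu' hia haj
        have e2 := outE _ _ o3 o4 hjb
        have e3 := (outE _ _ o3 o4 hbi.symm).symm
        have key := hC.orient l u r b h Q.lru hb Q.edge Q.ur.symm e2 e3
        rw [out _ _ _ o1 o2 o3 o4, triple_swap l u d, hε₂, e4]
        rw [triple_swap_right l u r] at key
        have s1 := sg_mul (E := EvT T R) src (show sbtw d r u by rw [sbtw_iff_pos l] at *; omega)
        have s2 := sg_mul (E := EvT T R) src (show sbtw d r b by rw [sbtw_iff_pos l] at *; omega)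
        have s3 := sg_sq (E := EvT T R) src d r
        have s4 := sg_sq (E := EvT T R) src r u
        rw [← s1]
        linear_combination (sg src _ d r * (sg src _ r u * sg src _ r u)) * key + sg src _ d r * sg src _ r b * s4 + s2
    by_cases h2 : s(i, j) = s(l, d)
    · rcases Sym2.eq_iff.mp h2.symm with ⟨rfl, rfl⟩ | ⟨rfl, rfl⟩
      · obtain ⟨o1, o2, o3, o4⟩ := gap l d a ha (by simp)
        obtain rfl : u = b := unique_apex hnc Q.ldu hb hdu' hul' hjb hbi
        have e2 := outE _ _ o3 o4 hia
        have e3 := (outE _ _ o3 o4 haj.symm).symm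
        have key := hC.orient l d a r h ha Q.ldr e2 e3 Q.rd.symm Q.edge.symm
        rw [out _ _ _ o1 o2 o3 o4, ← triple_eq u l d, hε₂]
        rw [triple_swap_right l d r] at key
        have s1 := sg_mul (E := EvT T R) src (show sbtw a r u by rw [sbtw_iff_pos l] at *; omega)
        linear_combination sg src _ r u * key + s1
      · obtain ⟨o1, o2, o3, o4⟩ := gap l d b (sbtw_rot hb) (by simp)
        obtain rfl : u = a := unique_apex hnc Q.ldu (sbtw_rot (sbtw_rot ha)) hdu' hul' hia haj
        have e2 := outE _ _ o3 o4 hjb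
        have e3 := (outE _ _ o3 o4 hbi.symm).symm
        have key := hC.orient d l r b h (sbtw_rot Q.ldr) hb Q.rd.symm Q.edge.symm e2 e3
        rw [out _ _ _ o1 o2 o3 o4, triple_rev d l u, hε₂]
        rw [triple_eq d l r] at key
        have s1 := sg_mul (E := EvT T R) src (show sbtw r u b by rw [sbtw_iff_pos l] at *; omega)
        have s3 := sg_sq (E := EvT T R) src r u
        linear_combination sg src _ r u * key - sg src _ r u * s1 + sg src _ u b * s3
    by_cases h3 : s(i, j) = s(r, d)
    · rcases Sym2.eq_iff.mp h3.symm with ⟨rfl, rfl⟩ | ⟨rfl, rfl⟩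
      · obtain ⟨o1, o2, o3, o4⟩ := gap d r b (sbtw_rot hb) (by simp)
        obtain rfl : u = a := unique_apex hnc Q.dru (sbtw_rot (sbtw_rot ha)) hru'.symm hdu'.symm hia haj
        have e2 := outE _ _ o3 o4 hjb
        have e3 := (outE _ _ o3 o4 hbi.symm).symm
        have key := hC.orient r d l b h (sbtw_rot (sbtw_rot Q.ldr)) hb Q.edge.symm Q.ld e2 e3
        rw [out _ _ _ o1 o2 o3 o4, ← triple_eq u r d, hε₁]
        rw [← triple_eq l r d] at key
        have s1 := sg_mul (E := EvT T R) src (show sbtw u l b by rw [sbtw_iff_pos l] at *; omega)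
        rw [sg_swap src n3] at s1
        linear_combination (-sg src _ l u) * key + s1
      · obtain ⟨o1, o2, o3, o4⟩ := gap d r a ha (by simp)
        obtain rfl : u = b := unique_apex hnc Q.dru hb hru'.symm hdu'.symm hjb hbi
        have e2 := outE _ _ o3 o4 hia
        have e3 := (outE _ _ o3 o4 haj.symm).symm
        have key := hC.orient d r a l h ha (sbtw_rot Q.ldr) e2 e3 Q.edge.symm Q.ld
        rw [out _ _ _ o1 o2 o3 o4, triple_rev d r u, hε₁]
        rw [triple_rev d r l] at key
        have s1 := sg_mul (E := EvT T R) src (show sbtw a u l by rw [sbtw_iff_pos l] at *; omega)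
        have s3 := sg_sq (E := EvT T R) src l u
        rw [sg_swap src n3] at s1
        linear_combination (-sg src _ l u) * key + sg src _ l u * s1 + sg src _ a u * s3
    have hne : i ≠ j := hC.ne _ _ h
    have hdu : s(i, j) ≠ s(d, u) := by
      intro h4
      rcases Sym2.eq_iff.mp h4.symm with ⟨rfl, rfl⟩ | ⟨rfl, rfl⟩
      · exact hC.nc d u r l (Or.inr (Or.inl h)) Q.edge.symm Q.dru (sbtw_rot (sbtw_rot Q.ldu))
      · exact hC.nc d u r l (Or.inr (Or.inr h)) Q.edge.symm Q.dru (sbtw_rot (sbtw_rot Q.ldu))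
    have t1 : ∀ c, ({i, j, c} : Finset (Fin (n + 3))) ≠ {u, r, d} := by
      intro c hc
      rcases sym2_of_triple hne hc with h5 | h5 | h5
      exacts [hs h5, h3 h5, hdu (h5.trans Sym2.eq_swap)]
    have t2 : ∀ c, ({i, j, c} : Finset (Fin (n + 3))) ≠ {u, l, d} := by
      intro c hc
      rcases sym2_of_triple hne hc with h5 | h5 | h5
      exacts [h1 h5, h2 h5, hdu (h5.trans Sym2.eq_swap)]
    have hij' : C'.HasEdge i j := Or.inr (Or.inl hij)
    have t3 : ∀ x y c, ({x, y, c} : Finset (Fin (n + 3))) = {i, j, a} ∨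
        ({x, y, c} : Finset (Fin (n + 3))) = {i, j, b} → sbtw x y c → C'.HasEdge x y →
        C'.HasEdge y c → C'.HasEdge c x → C.HasEdge x y := by
      intro x y c hxyc h5 h6 h7 h8
      refine htri x y c h5 h6 h7 h8 ?_ ?_ <;> rcases hxyc with h9 | h9 <;> rw [h9]
      exacts [t1 _, t1 _, t2 _, t2 _]
    rw [hε₃ _ (t1 _) (t2 _), hε₃ _ (t1 _) (t2 _)]
    exact hC.orient i j a b h ha hb
      (t3 i a j (Or.inl (triple_swap_right _ _ _)) ha hia haj hij'.symm)
      (t3 a j i (Or.inl (triple_rev _ _ _)) (sbtw_rot ha) haj hij'.symm hia)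
      (t3 j b i (Or.inr (triple_eq _ _ _).symm) (sbtw_rot hb) hjb hbi hij')
      (t3 b i j (Or.inr (triple_eq _ _ _)) (sbtw_rot (sbtw_rot hb)) hbi hij' hjb)

/-- The super vectors stay fixed while only the signs of the two new triangles change. This is the
reason why lambda lengths do not depend on the sequence of flips. -/
lemma Compat.flip {ε : Finset (Fin (n + 3)) → EvT T R} {C C' : Chart T R}
    (hρ : IsRoots src f ρ) (hC : Compat src f ρ ε C) (hF : Flip C C') :
    ∃ ε', Compat src f ρ ε' C' := by
  obtain ⟨l, r, u, d, h1, h2, h3, h4, h5, h6, h7, hdir, hlam, hmu, sac, sbd, sacbd, ssum,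
    hac, hbd, hacbd, hsum, e1, e2, e3⟩ := hF
  have Q : IsQuad C l r u d := ⟨h1, h2, h3, h4, h5, h6, h7⟩
  obtain ⟨n1, n2, n3⟩ := sbtw_ne h2
  obtain ⟨n4, n5, n6⟩ := sbtw_ne Q.dru
  have n7 := (sbtw_ne Q.ldr).1
  have hE := Flip.hasEdge_iff (hC.ns _ _ h1) hdir n3.symm n1
  have hnc := Q.flip_nc hC.nc hE
  obtain ⟨hlam', a1, a2⟩ := Q.flip_values hρ hC hac hbd hacbd hsum e1 e2 e3
  clear hac hbd hacbd hsum e1 e2 e3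
  have hdiff : ({u, l, d} : Finset (Fin (n + 3))) ≠ {u, r, d} := by
    intro h
    have : l ∈ ({u, r, d} : Finset (Fin (n + 3))) := h ▸ by simp
    simp only [Finset.mem_insert, Finset.mem_singleton] at this
    rcases this with h | h | h
    exacts [n3 h, n1 h, n7 h]
  have hε₁ : flipSign src l r u d ε {u, r, d} = -(sg src _ l u) * ε {l, r, d} := if_pos rfl
  have hε₂ : flipSign src l r u d ε {u, l, d} = sg src _ r u * ε {l, r, d} := by
    rw [flipSign, if_neg hdiff, if_pos rfl]
  have hε₃ : ∀ t, t ≠ {u, r, d} → t ≠ {u, l, d} → flipSign src l r u d ε t = ε t := by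
    intro t ht ht'
    rw [flipSign, if_neg ht, if_neg ht']
  have hnewE : C'.HasEdge d u := (hE d u).mpr (Or.inl rfl)
  have hold : ∀ i j, C.HasEdge i j → s(i, j) ≠ s(l, r) → C'.HasEdge i j := fun i j h h' =>
    (hE i j).mpr (Or.inr ⟨h, h'⟩)
  have n8 : d ≠ l := n7.symm
  have hrd' : C'.HasEdge r d := hold _ _ h6 (sym2_ne (by tauto))
  have hru' : C'.HasEdge u r := hold _ _ h5 (sym2_ne (by tauto))
  have hul' : C'.HasEdge u l := hold _ _ h4 (sym2_ne (by tauto))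
  have hld' : C'.HasEdge l d := hold _ _ h7 (sym2_ne (by tauto))
  -- triangles of the new chart
  have htri : ∀ i j k, sbtw i j k → C'.HasEdge i j → C'.HasEdge j k → C'.HasEdge k i →
      ({i, j, k} : Finset (Fin (n + 3))) ≠ {u, r, d} → ({i, j, k} : Finset (Fin (n + 3))) ≠ {u, l, d} →
      C.HasEdge i j := by
    intro i j k hijk hij hjk hki t1 t2
    rcases (hE i j).mp hij with h | h
    · exfalso
      rcases Sym2.eq_iff.mp h with ⟨rfl, rfl⟩ | ⟨rfl, rfl⟩
      · have := unique_apex hnc hijk (sbtw_rot Q.ldu) hjk hki hul' hld'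
        subst this
        exact t2 (by rw [triple_eq])
      · have := unique_apex hnc hijk (sbtw_rot (sbtw_rot Q.dru)) hjk hki hrd'.symm hru'.symm
        subst this
        exact t1 (by rw [triple_eq, triple_rev])
    · exact h.1
  refine ⟨flipSign src l r u d ε, ?_, ?_, hnc, ?_, ?_, ?_, ?_⟩
  · intro i j hij
    rcases (hdir i j).mp hij with ⟨rfl, rfl⟩ | ⟨_, h⟩ | ⟨_, _, h⟩
    · exact n6
    · exact (hC.ne _ _ h).symm
    · exact hC.ne _ _ h
  · intro i j hij
    rcases (hdir i j).mp hij with ⟨rfl, rfl⟩ | ⟨_, h⟩ | ⟨_, _, h⟩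
    · rw [isSide_iff_pos l]
      have := Q.pos_lt
      omega
    · rw [Sym2.eq_swap]; exact hC.ns _ _ h
    · exact hC.ns _ _ h
  · intro i j hij
    rcases (hE i j).mp hij with h | h
    · rw [h, hlam']
      rcases Sym2.eq_iff.mp h with ⟨rfl, rfl⟩ | ⟨rfl, rfl⟩
      · rfl
      · rw [hρ.symm n6]
    · by_cases h' : s(i, j) = s(d, u)
      · rw [h', hlam']
        rcases Sym2.eq_iff.mp h' with ⟨rfl, rfl⟩ | ⟨rfl, rfl⟩
        · rfl
        · rw [hρ.symm n6]
      · rw [hlam _ h', hC.lam _ _ h.1]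
  · intro t
    have hsg : ∀ a b (x : EvT T R), x * x = 1 → (sg src (EvT T R) a b * x) * (sg src (EvT T R) a b * x) = 1 := by
      intro a b x hx
      rw [mul_mul_mul_comm, sg_sq, hx, one_mul]
    rw [flipSign]
    split_ifs
    · rw [neg_mul, neg_mul_neg]; exact hsg _ _ _ (hC.sign _)
    · exact hsg _ _ _ (hC.sign _)
    · exact hC.sign _
  · intro i j k hijk hij hjk hki
    by_cases t1 : ({i, j, k} : Finset (Fin (n + 3))) = {u, r, d}
    · rw [t1, hε₁]
      rcases sbtw_eq_rot hijk Q.dru (t1.trans (triple_rev _ _ _)) with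
        ⟨rfl, rfl, rfl⟩ | ⟨rfl, rfl, rfl⟩ | ⟨rfl, rfl, rfl⟩
      · exact a1
      · exact a1.rot
      · exact a1.rot.rot
    by_cases t2 : ({i, j, k} : Finset (Fin (n + 3))) = {u, l, d}
    · rw [t2, hε₂]
      rcases sbtw_eq_rot hijk Q.ldu (t2.trans (triple_eq _ _ _)) with
        ⟨rfl, rfl, rfl⟩ | ⟨rfl, rfl, rfl⟩ | ⟨rfl, rfl, rfl⟩
      · exact a2
      · exact a2.rot
      · exact a2.rot.rot
    rw [hε₃ _ t1 t2, hmu _ t2 t1]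
    refine hC.mu i j k hijk (htri i j k hijk hij hjk hki t1 t2)
      (htri j k i (sbtw_rot hijk) hjk hki hij ?_ ?_)
      (htri k i j (sbtw_rot (sbtw_rot hijk)) hki hij hjk ?_ ?_)
    · rwa [← triple_eq]
    · rwa [← triple_eq]
    · rwa [triple_eq]
    · rwa [triple_eq]
  · exact Q.flip_orient hC hdir hE hnc htri hld' hrd' hru' hul' hnewE

end CompatFlip

/-! ### Existence of flips and charts reached by flips -/

section FlipExists

variable {n : ℕ} {T : Finset (Sym2 (Fin (n + 3)))} {R : Type*} [Field R] [LinearOrder R]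
  [IsStrictOrderedRing R] {src : Fin (n + 3)} {f : Fin (n + 3) → SVec (EvT T R) (OdT T R)}
  {ρ : Fin (n + 3) → Fin (n + 3) → EvT T R}

/-- Charts reached by flips come from the same super vectors. -/
lemma Compat.reachable {ε : Finset (Fin (n + 3)) → EvT T R} {C C' : Chart T R}
    (hρ : IsRoots src f ρ) (hC : Compat src f ρ ε C) (hF : Relation.ReflTransGen Flip C C') :
    ∃ ε', Compat src f ρ ε' C' := by
  induction hF with
  | refl => exact ⟨ε, hC⟩
  | tail _ hF ih =>
    obtain ⟨ε', h⟩ := ih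
    exact h.flip hρ hF

open Classical in
/-- Every arc of a chart that comes from super vectors can be flipped. -/
lemma IsQuad.exists_flip (hR : ∀ a : R, 0 ≤ a → IsSquare a)
    {ε : Finset (Fin (n + 3)) → EvT T R} {C : Chart T R} {l r u d : Fin (n + 3)}
    (hρ : IsRoots src f ρ) (hC : Compat src f ρ ε C) (Q : IsQuad C l r u d) :
    ∃ C', Flip C C' ∧ ∀ i j, C'.HasEdge i j ↔
      s(i, j) = s(d, u) ∨ (C.HasEdge i j ∧ s(i, j) ≠ s(l, r)) := by
  obtain ⟨n1, n2, n3⟩ := sbtw_ne Q.lru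
  obtain ⟨n4, n5, n6⟩ := sbtw_ne Q.dru
  have n7 := (sbtw_ne Q.ldr).1
  have la : C.lam s(u, l) = (ρ l u * ρ l u).1 := by rw [Sym2.eq_swap]; exact hC.lam l u Q.ul.symm
  have lb : C.lam s(u, r) = (ρ r u * ρ r u).1 := by rw [Sym2.eq_swap]; exact hC.lam r u Q.ur.symm
  have lc : C.lam s(r, d) = (ρ d r * ρ d r).1 := by rw [Sym2.eq_swap]; exact hC.lam d r Q.rd.symm
  have ld : C.lam s(l, d) = (ρ l d * ρ l d).1 := hC.lam l d Q.ld
  have le : C.lam s(l, r) = (ρ l r * ρ l r).1 := hC.lam l r Q.edge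
  have pa := hρ.body_pos l u n3
  have pb := hρ.body_pos r u n2
  have pc := hρ.body_pos d r n4
  have pd := hρ.body_pos l d n7
  obtain ⟨t, ht, htt⟩ := exists_sqrt hR (a := ρ l u * ρ l u * (ρ d r * ρ d r) +
    ρ r u * ρ r u * (ρ l d * ρ l d)) (by
      simp only [map_add, map_mul]; positivity)
  obtain ⟨t, rfl⟩ : IsUnit t := isUnit_of_body ht.ne'
  obtain ⟨e, he⟩ := (hρ.isUnit n1).mul (hρ.isUnit n1)
  have hdiff : ({u, l, d} : Finset (Fin (n + 3))) ≠ {u, r, d} := by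
    intro h
    have : l ∈ ({u, r, d} : Finset (Fin (n + 3))) := h ▸ by simp
    simp only [Finset.mem_insert, Finset.mem_singleton] at this
    rcases this with h | h | h
    exacts [n3 h, n1 h, n7 h]
  have cancel : ∀ (a : (EvT T R)ˣ) (x : Super T R), x * (a⁻¹.1 : EvT T R).1 * a.1.1 = x := by
    intro a x
    rw [mul_assoc]
    have : (a⁻¹.1 : EvT T R).1 * a.1.1 = 1 := congrArg Subtype.val a.inv_mul
    rw [this, mul_one]
  -- The flip relations are solved for the new values; the lambda length of the old diagonal and the
  -- root of `ac + bd` are units.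
  let C' : Chart T R :=
    { dir := fun i j => (i = d ∧ j = u) ∨ (s(i, j) = s(u, r) ∧ C.dir j i) ∨
        (s(i, j) ≠ s(u, r) ∧ s(i, j) ≠ s(l, r) ∧ C.dir i j)
      lam := fun g => if g = s(d, u) then (C.lam s(u, l) * C.lam s(r, d) + C.lam s(u, r) * C.lam s(l, d)
          + (ρ l u * ρ d r * (ρ r u * ρ l d) : EvT T R).1 * C.mu {l, r, d} * C.mu {l, r, u}) *
            (e⁻¹.1 : EvT T R).1 else C.lam g
      mu := fun g => if g = {u, r, d} then (C.mu {l, r, d} * (ρ r u * ρ l d : EvT T R).1 -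
            C.mu {l, r, u} * (ρ l u * ρ d r : EvT T R).1) * (t⁻¹.1 : EvT T R).1
          else if g = {u, l, d} then (C.mu {l, r, u} * (ρ r u * ρ l d : EvT T R).1 +
            C.mu {l, r, d} * (ρ l u * ρ d r : EvT T R).1) * (t⁻¹.1 : EvT T R).1 else C.mu g }
  refine ⟨C', ⟨l, r, u, d, Q.lr, Q.lru, Q.ldr, Q.ul, Q.ur, Q.rd, Q.ld, fun i j => Iff.rfl,
    fun g hg => if_neg hg, fun g hg hg' => (if_neg hg').trans (if_neg hg),
    (ρ l u * ρ d r : EvT T R).1, (ρ r u * ρ l d : EvT T R).1,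
    (ρ l u * ρ d r * (ρ r u * ρ l d) : EvT T R).1, t.1.1, ?_, ?_, ?_, ?_, ?_, ?_, ?_⟩,
    Flip.hasEdge_iff (hC.ns _ _ Q.lr) (fun i j => Iff.rfl) n3.symm n1⟩
  · refine ⟨Subtype.prop _, ?_, ?_⟩
    · rw [← body_apply, map_mul]; positivity
    · rw [la, lc]
      exact congrArg Subtype.val (show ρ l u * ρ d r * (ρ l u * ρ d r) =
        ρ l u * ρ l u * (ρ d r * ρ d r) by ring)
  · refine ⟨Subtype.prop _, ?_, ?_⟩
    · rw [← body_apply, map_mul]; positivity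
    · rw [lb, ld]
      exact congrArg Subtype.val (show ρ r u * ρ l d * (ρ r u * ρ l d) =
        ρ r u * ρ r u * (ρ l d * ρ l d) by ring)
  · refine ⟨Subtype.prop _, ?_, ?_⟩
    · rw [← body_apply, map_mul, map_mul, map_mul]; positivity
    · rw [la, lb, lc, ld]
      exact congrArg Subtype.val (show ρ l u * ρ d r * (ρ r u * ρ l d) *
        (ρ l u * ρ d r * (ρ r u * ρ l d)) =
        ρ l u * ρ l u * (ρ d r * ρ d r) * (ρ r u * ρ r u * (ρ l d * ρ l d)) by ring)
  · refine ⟨Subtype.prop _, ht, ?_⟩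
    rw [la, lb, lc, ld]
    exact congrArg Subtype.val htt
  · have h1 : C'.lam s(d, u) = _ := if_pos rfl
    rw [h1, le, even_comm (Subtype.prop _), ← he, cancel]
  · have h1 : C'.mu {u, r, d} = _ := if_pos rfl
    rw [h1, cancel]
  · have h1 : C'.mu {u, l, d} = _ := (if_neg hdiff).trans (if_pos rfl)
    rw [h1, cancel]

/-- Every arc of a chart that comes from super vectors can be flipped, whatever its direction. -/
lemma Compat.exists_flip (hR : ∀ a : R, 0 ≤ a → IsSquare a)
    {ε : Finset (Fin (n + 3)) → EvT T R} {C : Chart T R} {x y z w : Fin (n + 3)}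
    (hρ : IsRoots src f ρ) (hC : Compat src f ρ ε C) (hxyz : sbtw x y z) (hxzw : sbtw x z w)
    (hxz : C.HasEdge x z) (hns : ¬ IsSide s(x, z)) (hxy : C.HasEdge x y) (hyz : C.HasEdge y z)
    (hzw : C.HasEdge z w) (hwx : C.HasEdge w x) :
    ∃ C', Flip C C' ∧ ∀ i j, C'.HasEdge i j ↔
      s(i, j) = s(y, w) ∨ (C.HasEdge i j ∧ s(i, j) ≠ s(x, z)) := by
  rcases hxz with h | h | h
  · exact absurd h hns
  · exact IsQuad.exists_flip hR hρ hC ⟨h, hxzw, hxyz, hwx, hzw.symm, hyz.symm, hxy⟩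
  · obtain ⟨C', h1, h2⟩ := IsQuad.exists_flip hR hρ hC (l := z) (r := x) (u := y) (d := w)
      ⟨h, sbtw_rot (sbtw_rot hxyz), sbtw_rot hxzw, hyz, hxy.symm, hwx.symm, hzw⟩
    refine ⟨C', h1, fun i j => ?_⟩
    rw [h2, Sym2.eq_swap (a := w), Sym2.eq_swap (a := z)]

end FlipExists

/-! ### Triangulations without internal triangles as zigzags -/

section Zigzag

/-- The position of the end of the `k`-th arc of the zigzag `w` that moves away counter-clockwise
from the base vertex. -/
def rp (w : ℕ → Bool) : ℕ → ℕ
  | 0 => 0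
  | k + 1 => rp w k + if w k then 1 else 0

/-- The position of the other end of the `k`-th arc. -/
def lp (n : ℕ) (w : ℕ → Bool) (k : ℕ) : ℕ := rp w k + (n + 2 - k)

/-- The position of the vertex of the `k`-th triangle opposite to the `k`-th arc. -/
def zp (n : ℕ) (w : ℕ → Bool) (k : ℕ) : ℕ := if w k then rp w k + 1 else lp n w k - 1

/-- The position of the vertex of the `k`-th triangle opposite to the `(k + 1)`-st arc. -/
def cp (n : ℕ) (w : ℕ → Bool) (k : ℕ) : ℕ := if w k then rp w k else lp n w k

variable {n : ℕ} {w : ℕ → Bool}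

lemma rp_succ_true {k : ℕ} (h : w k = true) : rp w (k + 1) = rp w k + 1 := by simp [rp, h]

lemma rp_succ_false {k : ℕ} (h : w k = false) : rp w (k + 1) = rp w k := by simp [rp, h]

lemma rp_succ_le (k : ℕ) : rp w k ≤ rp w (k + 1) ∧ rp w (k + 1) ≤ rp w k + 1 := by
  cases h : w k
  · rw [rp_succ_false h]; omega
  · rw [rp_succ_true h]; omega

/-- Each step moves exactly one of the two ends inwards by one. Consequently the intervals between
the ends of the successive arcs are nested, the fact on which most later `omega` calls rest. -/
lemma rp_bounds {j k : ℕ} (h : j ≤ k) : rp w j ≤ rp w k ∧ rp w k + j ≤ rp w j + k := by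
  induction k, h using Nat.le_induction with
  | base => simp
  | succ k _ ih =>
    have := rp_succ_le (w := w) k
    omega

lemma rp_zero : rp w 0 = 0 := rfl

lemma rp_one (h : w 0 = true) : rp w 1 = 1 := rp_succ_true h

/-- The cases for the position data at step `k`. -/
lemma step_cases (k : ℕ) :
    (w k = true ∧ rp w (k + 1) = rp w k + 1 ∧ zp n w k = rp w k + 1 ∧ cp n w k = rp w k) ∨
    (w k = false ∧ rp w (k + 1) = rp w k ∧ zp n w k = rp w k + (n + 2 - k) - 1 ∧
      cp n w k = rp w k + (n + 2 - k)) := by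
  cases h : w k
  · exact Or.inr ⟨rfl, rp_succ_false h, by simp [zp, h, lp], by simp [cp, h, lp]⟩
  · exact Or.inl ⟨rfl, rp_succ_true h, by simp [zp, h], by simp [cp, h]⟩

/-- The `k`-th arc of the zigzag `w`. -/
def gm (src : Fin (n + 3)) (w : ℕ → Bool) (k : ℕ) : Sym2 (Fin (n + 3)) :=
  s(vtx src (rp w k), vtx src (lp n w k))

/-- The `k`-th triangle of the zigzag `w`. -/
def tg (src : Fin (n + 3)) (w : ℕ → Bool) (k : ℕ) : Finset (Fin (n + 3)) :=
  {vtx src (rp w k), vtx src (zp n w k), vtx src (lp n w k)}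

/-- The arc that crosses exactly the arcs `p + 1, …, q` of the zigzag `w`. -/
def ar (src : Fin (n + 3)) (w : ℕ → Bool) (p q : ℕ) : Sym2 (Fin (n + 3)) :=
  s(vtx src (cp n w p), vtx src (zp n w q))

lemma eq_vtx_iff {src v : Fin (n + 3)} {p : ℕ} (hp : p < n + 3) :
    v = vtx src p ↔ pos src v = p :=
  ⟨fun h => by rw [h, pos_vtx src hp], eq_vtx src⟩

lemma crosses_mk_iff (i j k l : Fin (n + 3)) :
    Crosses s(i, j) s(k, l) ↔ (sbtw i k j ∧ sbtw j l i) ∨ (sbtw i l j ∧ sbtw j k i) := by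
  constructor
  · rintro ⟨a, b, c, d, h1, h2, h3, h4⟩
    rcases Sym2.eq_iff.mp h1 with ⟨rfl, rfl⟩ | ⟨rfl, rfl⟩ <;>
      rcases Sym2.eq_iff.mp h2 with ⟨rfl, rfl⟩ | ⟨rfl, rfl⟩
    · exact Or.inl ⟨h3, h4⟩
    · exact Or.inr ⟨h3, h4⟩
    · exact Or.inr ⟨h4, h3⟩
    · exact Or.inl ⟨h4, h3⟩
  · rintro (⟨h3, h4⟩ | ⟨h3, h4⟩)
    · exact ⟨i, j, k, l, rfl, rfl, h3, h4⟩
    · exact ⟨i, j, l, k, rfl, Sym2.eq_swap, h3, h4⟩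

lemma crosses_vtx_iff {src : Fin (n + 3)} {a b : ℕ} (hab : a < b) (hb : b < n + 3)
    (i j : Fin (n + 3)) : Crosses s(vtx src a, vtx src b) s(i, j) ↔
      (a < pos src i ∧ pos src i < b ∧ (pos src j < a ∨ b < pos src j)) ∨
      (a < pos src j ∧ pos src j < b ∧ (pos src i < a ∨ b < pos src i)) := by
  rw [crosses_mk_iff]
  simp only [sbtw_iff_pos src]
  rw [pos_vtx src hb, pos_vtx src (by omega)]
  omega

lemma add_one_eq_vtx (src : Fin (n + 3)) : src + 1 = vtx src 1 := by
  rw [vtx]; rfl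

lemma sub_one_eq_vtx (src : Fin (n + 3)) : src - 1 = vtx src (n + 2) := by
  rw [← pos_inj src, pos_vtx src (by omega)]
  have h := pos_add_one src (src - 1)
  rw [sub_add_cancel, pos_src] at h
  have := pos_lt src (src - 1)
  split_ifs at h <;> omega

lemma gm_one {src : Fin (n + 3)} (h : w 0 = true) : gm src w 1 = s(src - 1, src + 1) := by
  rw [add_one_eq_vtx, sub_one_eq_vtx, gm, lp, rp_one h, Sym2.eq_swap,
    show 1 + (n + 2 - 1) = n + 2 by omega]

/-- The triangulation `T` is the zigzag `w` with first ear at `src`. -/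
structure IsZig (T : Finset (Sym2 (Fin (n + 3)))) (src : Fin (n + 3)) (w : ℕ → Bool) : Prop where
  one_le : 1 ≤ n
  first : w 0 = true
  last : w n = true
  mem_iff : ∀ e, e ∈ T ↔ ∃ k, 1 ≤ k ∧ k ≤ n ∧ e = gm src w k

lemma eq_gm_iff {src i j : Fin (n + 3)} {k : ℕ} (hk : k ≤ n + 1) : s(i, j) = gm src w k ↔
    (pos src i = rp w k ∧ pos src j = rp w k + (n + 2 - k)) ∨
    (pos src j = rp w k ∧ pos src i = rp w k + (n + 2 - k)) := by
  have := rp_bounds (w := w) (Nat.zero_le k)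
  simp only [rp_zero] at this
  rw [gm, Sym2.eq_iff, eq_vtx_iff (by omega), eq_vtx_iff (by rw [lp]; omega),
    eq_vtx_iff (by rw [lp]; omega), eq_vtx_iff (by omega), lp]
  tauto

namespace IsZig

variable {T : Finset (Sym2 (Fin (n + 3)))} {src : Fin (n + 3)} (Z : IsZig T src w)
include Z

lemma mem_iff_pos (i j : Fin (n + 3)) : s(i, j) ∈ T ↔ ∃ k, 1 ≤ k ∧ k ≤ n ∧
    ((pos src i = rp w k ∧ pos src j = rp w k + (n + 2 - k)) ∨
      (pos src j = rp w k ∧ pos src i = rp w k + (n + 2 - k))) := by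
  rw [Z.mem_iff]
  constructor
  · rintro ⟨k, h1, h2, h⟩
    exact ⟨k, h1, h2, (eq_gm_iff (by omega)).mp h⟩
  · rintro ⟨k, h1, h2, h⟩
    exact ⟨k, h1, h2, (eq_gm_iff (by omega)).mpr h⟩

lemma isEdge_iff_pos (i j : Fin (n + 3)) : IsEdge T s(i, j) ↔
    pos src i + 1 = pos src j ∨ pos src j + 1 = pos src i ∨ ∃ k, k ≤ n ∧
    ((pos src i = rp w k ∧ pos src j = rp w k + (n + 2 - k)) ∨
      (pos src j = rp w k ∧ pos src i = rp w k + (n + 2 - k))) := by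
  rw [IsEdge, Z.mem_iff_pos, isSide_iff_pos src]
  constructor
  · rintro (⟨k, -, h2, h⟩ | h | h | h | h)
    · exact Or.inr (Or.inr ⟨k, h2, h⟩)
    · exact Or.inl h
    · exact Or.inr (Or.inl h)
    · exact Or.inr (Or.inr ⟨0, by omega, by simp only [rp_zero]; omega⟩)
    · exact Or.inr (Or.inr ⟨0, by omega, by simp only [rp_zero]; omega⟩)
  · rintro (h | h | ⟨k, h2, h⟩)
    · exact Or.inr (Or.inl h)
    · exact Or.inr (Or.inr (Or.inl h))
    · rcases Nat.eq_zero_or_pos k with rfl | hk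
      · simp only [rp_zero] at h
        right; right; right
        omega
      · exact Or.inl ⟨k, hk, h2, h⟩

lemma rp_pos {k : ℕ} (hk : 1 ≤ k) : 1 ≤ rp w k := by
  have h1 := rp_one Z.first
  have h2 := rp_bounds (w := w) hk
  omega

/-- The two ends of arcs never meet. -/
lemma rp_lt_lp {j k : ℕ} (hj : j ≤ n + 1) (hk : k ≤ n + 1) :
    rp w j < rp w k + (n + 2 - k) := by
  have h1 := rp_bounds (w := w) hj
  have h2 := rp_bounds (w := w) hk
  omega

lemma gm_mem {k : ℕ} (h1 : 1 ≤ k) (h2 : k ≤ n) : gm src w k ∈ T :=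
  (Z.mem_iff _).mpr ⟨k, h1, h2, rfl⟩

/-- The position of the ends of the arcs are less than `n + 3`. -/
lemma lp_lt {k : ℕ} (hk : k ≤ n + 1) : rp w k + (n + 2 - k) < n + 3 := by
  have := rp_bounds (w := w) (Nat.zero_le k)
  simp only [rp_zero] at this
  omega

lemma gm_inj {j k : ℕ} (hj : j ≤ n + 1) (hk : k ≤ n + 1) (h : gm src w j = gm src w k) :
    j = k := by
  rw [gm, eq_gm_iff hk] at h
  have h1 := Z.rp_lt_lp hj hj
  have h2 := Z.rp_lt_lp hk hk
  have h3 := Z.lp_lt hj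
  rw [lp, pos_vtx src (by omega), pos_vtx src (by omega)] at h
  omega

lemma crosses_gm_iff {k : ℕ} (hk : k ≤ n + 1) (i j : Fin (n + 3)) :
    Crosses (gm src w k) s(i, j) ↔
      (rp w k < pos src i ∧ pos src i < rp w k + (n + 2 - k) ∧
        (pos src j < rp w k ∨ rp w k + (n + 2 - k) < pos src j)) ∨
      (rp w k < pos src j ∧ pos src j < rp w k + (n + 2 - k) ∧
        (pos src i < rp w k ∨ rp w k + (n + 2 - k) < pos src i)) := by
  exact crosses_vtx_iff (Z.rp_lt_lp hk hk) (Z.lp_lt hk) i j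

/-- Where the ends of the arc `ar p q` are. -/
lemma ar_bounds {p q : ℕ} (hpq : p < q) (hq : q ≤ n) :
    (∀ k, k ≤ p → rp w k ≤ cp n w p ∧ cp n w p ≤ rp w k + (n + 2 - k)) ∧
    (∀ k, p < k → k ≤ n + 1 → cp n w p < rp w k ∨ rp w k + (n + 2 - k) < cp n w p) ∧
    (∀ k, k ≤ q → rp w k < zp n w q ∧ zp n w q < rp w k + (n + 2 - k)) ∧
    (∀ k, q < k → k ≤ n + 1 → zp n w q ≤ rp w k ∨ rp w k + (n + 2 - k) ≤ zp n w q) ∧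
    cp n w p < n + 3 ∧ zp n w q < n + 3 := by
  have hp := step_cases (n := n) (w := w) p
  have hq' := step_cases (n := n) (w := w) q
  have h0 := Z.lp_lt (k := p) (by omega)
  have h1 := Z.lp_lt (k := q) (by omega)
  refine ⟨?_, ?_, ?_, ?_, ?_, ?_⟩
  · intro k hk
    have := rp_bounds (w := w) hk
    omega
  · intro k hk hk'
    have := rp_bounds (w := w) (show p + 1 ≤ k by omega)
    omega
  · intro k hk
    have := rp_bounds (w := w) hk
    omega
  · intro k hk hk'
    have := rp_bounds (w := w) (show q + 1 ≤ k by omega)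
    omega
  · omega
  · omega

/-- The vertex `cp p` belongs to the closed intervals of the arcs up to `p` and lies outside all
later ones, while `zp q` is strictly inside the intervals up to `q` and no further. The two are
separated by exactly the arcs in between. -/
lemma crosses_ar_iff {k p q : ℕ} (hk : k ≤ n + 1) (hpq : p < q) (hq : q ≤ n) :
    Crosses (gm src w k) (ar src w p q) ↔ p < k ∧ k ≤ q := by
  obtain ⟨h1, h2, h3, h4, h5, h6⟩ := Z.ar_bounds hpq hq
  rw [ar, Z.crosses_gm_iff hk, pos_vtx src h5, pos_vtx src h6]
  have a1 := h1 k
  have a2 := h2 k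
  have a3 := h3 k
  have a4 := h4 k
  omega

/-- The interior vertex that becomes an end in step `k` is `zp k`, and the other interior vertices
stay interior. The last interval has a single interior vertex, so all of them are exhausted. -/
lemma exists_zp {y k : ℕ} (hk : k ≤ n) (h1 : rp w k < y) (h2 : y < rp w k + (n + 2 - k)) :
    ∃ q, k ≤ q ∧ q ≤ n ∧ zp n w q = y := by
  have hc := step_cases (n := n) (w := w) k
  induction hm : n - k generalizing k with
  | zero => exact ⟨k, le_rfl, hk, by omega⟩
  | succ m ih =>
    by_cases h : zp n w k = y
    · exact ⟨k, le_rfl, hk, h⟩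
    · obtain ⟨q, h3, h4, h5⟩ := ih (k := k + 1) (by omega) (by omega) (by omega)
        (step_cases _) (by omega)
      exact ⟨q, by omega, h4, h5⟩

/-- Every arc outside of the zigzag is one of the `ar p q`. -/
lemma exists_ar {γ : Sym2 (Fin (n + 3))} (hγ : IsArc γ) (hT : γ ∉ T) :
    ∃ p q, p < q ∧ q ≤ n ∧ γ = ar src w p q := by
  obtain ⟨i, j⟩ := γ
  have hne : pos src i ≠ pos src j := fun h => hγ.1 ((pos_inj src).mp h)
  have hs := hγ.2
  change s(i, j) ∉ T at hT
  change ¬ IsSide s(i, j) at hs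
  rw [isSide_iff_pos src] at hs
  rw [Z.mem_iff_pos] at hT
  change ∃ p q, p < q ∧ q ≤ n ∧ s(i, j) = ar src w p q
  have hi := pos_lt src i
  have hj := pos_lt src j
  have hn := Z.one_le
  -- the first step at which an end is cut off
  have main : ∀ k, k ≤ n + 1 →
      (∃ p, p < k ∧ p ≤ n ∧ ∃ i' j', s(i, j) = s(i', j') ∧ pos src i' = cp n w p ∧
        rp w (p + 1) < pos src j' ∧ pos src j' < rp w (p + 1) + (n + 2 - (p + 1))) ∨
      (rp w k ≤ pos src i ∧ pos src i ≤ rp w k + (n + 2 - k) ∧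
       rp w k ≤ pos src j ∧ pos src j ≤ rp w k + (n + 2 - k)) := by
    intro k
    induction k with
    | zero => intro _; right; simp only [rp_zero]; omega
    | succ k ih =>
      intro hk
      have ih' := ih (by omega)
      clear ih
      rcases ih' with ⟨p, h1, h2, h3⟩ | h
      · exact Or.inl ⟨p, by omega, h2, h3⟩
      have hc := step_cases (n := n) (w := w) k
      have hg : ¬ ((pos src i = rp w k ∧ pos src j = rp w k + (n + 2 - k)) ∨
          (pos src j = rp w k ∧ pos src i = rp w k + (n + 2 - k))) := by
        intro hg
        rcases Nat.eq_zero_or_pos k with rfl | hk0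
        · simp only [rp_zero] at hg; omega
        · exact hT ⟨k, hk0, by omega, hg⟩
      by_cases h1 : pos src i = cp n w k
      · exact Or.inl ⟨k, by omega, by omega, i, j, rfl, h1, by omega, by omega⟩
      by_cases h2 : pos src j = cp n w k
      · exact Or.inl ⟨k, by omega, by omega, j, i, Sym2.eq_swap, h2, by omega, by omega⟩
      right; omega
  rcases main (n + 1) le_rfl with ⟨p, -, hp, i', j', he, h1, h2, h3⟩ | h
  · have hpn : p + 1 ≤ n := by omega
    obtain ⟨q, h4, h5, h6⟩ := Z.exists_zp hpn h2 h3
    refine ⟨p, q, by omega, h5, ?_⟩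
    rw [he, ar, ← h1, h6, vtx_pos, vtx_pos]
  -- At `n + 1` the interval has length one, so an arc never cut off would be a boundary segment.
  · omega

end IsZig

end Zigzag

/-! ### Every triangulation without internal triangles is a zigzag -/

section ZigzagExists

variable {n : ℕ} {T : Finset (Sym2 (Fin (n + 3)))} {src : Fin (n + 3)}

open Classical in
/-- The ends of the successive arcs of a triangulation, from the ear at `src` on. -/
def zigState (T : Finset (Sym2 (Fin (n + 3)))) (src : Fin (n + 3)) : ℕ → ℕ
  | 0 => 0
  | k + 1 => zigState T src k +
      if k = n ∨ s(vtx src (zigState T src k + 1), vtx src (zigState T src k + (n + 2 - k))) ∈ T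
      then 1 else 0

open Classical in
/-- The word of a triangulation without internal triangles. -/
def zigWord (T : Finset (Sym2 (Fin (n + 3)))) (src : Fin (n + 3)) (k : ℕ) : Bool :=
  decide (k = n ∨
    s(vtx src (zigState T src k + 1), vtx src (zigState T src k + (n + 2 - k))) ∈ T)

lemma rp_zigWord (k : ℕ) : rp (zigWord T src) k = zigState T src k := by
  induction k with
  | zero => rfl
  | succ k ih => simp only [rp, zigState, ih, zigWord, decide_eq_true_eq]

lemma zigWord_iff (k : ℕ) : zigWord T src k = true ↔ k = n ∨
    s(vtx src (rp (zigWord T src) k + 1), vtx src (rp (zigWord T src) k + (n + 2 - k))) ∈ T := by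
  rw [rp_zigWord, zigWord, decide_eq_true_eq]

lemma IsTriangulation.edge_not_crosses (hT : IsTriangulation T) {e f : Sym2 (Fin (n + 3))}
    (he : IsEdge T e) (hf : f ∈ T) : ¬ Crosses e f := by
  rcases he with he | ⟨i, rfl⟩
  · exact hT.noncrossing e he f hf
  · obtain ⟨k, l⟩ := f
    change ¬ Crosses s(i, i + 1) s(k, l)
    rw [crosses_mk_iff]
    simp only [sbtw_iff_pos i]
    have := pos_src i
    have h := pos_add_one i i
    have := pos_lt i k
    have := pos_lt i l
    split_ifs at h <;> omega

/-- The third vertex of the triangle on the inner side of the edge with ends `a < b`. -/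
lemma IsTriangulation.exists_apex (hT : IsTriangulation T) {a b : ℕ} (hab : a + 2 ≤ b)
    (hb : b < n + 3) (he : IsEdge T s(vtx src a, vtx src b)) :
    ∃ z, a < z ∧ z < b ∧ IsEdge T s(vtx src a, vtx src z) ∧ IsEdge T s(vtx src z, vtx src b) := by
  classical
  have side : ∀ x, x + 1 < n + 3 → IsEdge T s(vtx src x, vtx src (x + 1)) := by
    intro x hx
    right
    rw [isSide_iff_pos src, pos_vtx src (by omega), pos_vtx src hx]
    omega
  have hex : ∃ z, z < b ∧ a < z ∧ IsEdge T s(vtx src a, vtx src z) :=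
    ⟨a + 1, by omega, by omega, side a (by omega)⟩
  -- The apex is the last vertex `z` before `b` that is joined to `a`. An arc crossing `(z, b)`
  -- would cross `(a, z)` or `(a, b)`, or join `a` to a vertex beyond `z`; hence `(z, b)` is a
  -- boundary segment or, by maximality, an arc of `T`.
  obtain ⟨z, ⟨hz1, hz2, hz3⟩, hmax⟩ : ∃ z, (z < b ∧ a < z ∧ IsEdge T s(vtx src a, vtx src z)) ∧
      ∀ y, z < y → y < b → ¬ IsEdge T s(vtx src a, vtx src y) := by
    obtain ⟨z0, hz0⟩ := hex
    refine ⟨Nat.findGreatest (fun z => z < b ∧ a < z ∧ IsEdge T s(vtx src a, vtx src z)) b,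
      Nat.findGreatest_spec (P := fun z => z < b ∧ a < z ∧ IsEdge T s(vtx src a, vtx src z))
        hz0.1.le hz0, ?_⟩
    intro y hy hyb hE
    have := Nat.le_findGreatest (P := fun z => z < b ∧ a < z ∧ IsEdge T s(vtx src a, vtx src z))
      hyb.le ⟨hyb, by
        have := (Nat.findGreatest_spec
          (P := fun z => z < b ∧ a < z ∧ IsEdge T s(vtx src a, vtx src z)) hz0.1.le hz0).2.1
        omega, hE⟩
    omega
  refine ⟨z, hz2, hz1, hz3, ?_⟩
  rcases Nat.lt_or_ge (z + 1) b with h | h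
  · left
    refine hT.maximal _ ⟨?_, ?_⟩ ?_
    · intro h'
      have h' : vtx src z = vtx src b := h'
      have := congrArg (pos src) h'
      rw [pos_vtx src (by omega), pos_vtx src hb] at this
      omega
    · rw [isSide_iff_pos src, pos_vtx src (by omega), pos_vtx src hb]
      omega
    · rintro ⟨k, l⟩ hf hcr
      change s(k, l) ∈ T at hf
      change Crosses s(_, _) s(k, l) at hcr
      have c1 := hT.edge_not_crosses he hf
      have c2 := hT.edge_not_crosses hz3 hf
      have key : ∀ k l, s(k, l) ∈ T → z < pos src k → pos src k < b → pos src l ≠ a := by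
        intro k l hf h1 h2 h3
        refine hmax (pos src k) h1 h2 (Or.inl ?_)
        rw [← h3, vtx_pos, vtx_pos, Sym2.eq_swap]
        exact hf
      have k1 := key k l hf
      have k2 := key l k (by rwa [Sym2.eq_swap])
      clear key
      rw [crosses_mk_iff] at hcr c1 c2
      simp only [sbtw_iff_pos src, pos_vtx src hb, pos_vtx src (show z < n + 3 by omega),
        pos_vtx src (show a < n + 3 by omega)] at hcr c1 c2
      omega
  · obtain rfl : b = z + 1 := by omega
    exact side z hb

/-- The triangle on the inner side of an arc has at least one boundary segment among its other two
sides, since it is not internal. So its apex is next to one end of the arc, and its remaining side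
is the next arc of the zigzag. The apex is moved to as long as the interval is large enough, and
nothing else can belong to `T` without crossing one of these arcs. -/
lemma isZig_zigWord (hT : IsTriangulation T) (hI : NoInternalTriangle T)
    (hsrc : s(src - 1, src + 1) ∈ T) : IsZig T src (zigWord T src) := by
  set w := zigWord T src with hw
  have hs1 := add_one_eq_vtx src
  have hs2 := sub_one_eq_vtx src
  rw [hs1, hs2] at hsrc
  have hn : 1 ≤ n := by
    by_contra h
    obtain rfl : n = 0 := by omega
    have := (hT.isArc _ hsrc).2
    rw [isSide_iff_pos src, pos_vtx src (by omega), pos_vtx src (by omega)] at this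
    omega
  have hf : w 0 = true := by
    rw [hw, zigWord_iff]
    right
    simp only [rp_zero]
    rw [Sym2.eq_swap]
    simpa using hsrc
  -- The last triangle is an ear, whose two other sides are both boundary segments, so the last
  -- letter is a free choice. The value `true` also agrees with the default direction of the only
  -- arc if `n = 1`.
  have hl : w n = true := by rw [hw, zigWord_iff]; exact Or.inl rfl
  have hlp : ∀ k, k ≤ n + 1 → rp w k + (n + 2 - k) < n + 3 := by
    intro k hk
    have := rp_bounds (w := w) (Nat.zero_le k)
    simp only [rp_zero] at this
    omega
  have hrp : ∀ k, 1 ≤ k → 1 ≤ rp w k := by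
    intro k hk
    have h1 := rp_one hf
    have h2 := rp_bounds (w := w) hk
    omega
  have hmem : ∀ k, 1 ≤ k → k ≤ n → gm src w k ∈ T := by
    intro k hk
    induction k, hk using Nat.le_induction with
    | base =>
      intro _
      rw [gm_one hf, hs1, hs2]
      exact hsrc
    | succ k hk ih =>
      intro hkn
      have ih := ih (by omega)
      cases hwk : w k with
      | true =>
        have := (zigWord_iff k).mp hwk
        rw [gm, lp, rp_succ_true hwk,
          show rp w k + 1 + (n + 2 - (k + 1)) = rp w k + (n + 2 - k) by omega]
        exact this.resolve_left (by omega)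
      | false =>
        have hnot : ¬ s(vtx src (rp w k + 1), vtx src (rp w k + (n + 2 - k))) ∈ T := by
          intro h
          have := (zigWord_iff (T := T) (src := src) k).mpr (Or.inr h)
          rw [← hw, hwk] at this
          cases this
        have hb := hlp k (by omega)
        obtain ⟨z, h1, h2, h3, h4⟩ := hT.exists_apex (src := src) (a := rp w k)
          (b := rp w k + (n + 2 - k)) (by omega) hb (Or.inl ih)
        have hr := hrp k hk
        have h5 := hI (vtx src (rp w k)) (vtx src z) (vtx src (rp w k + (n + 2 - k)))
        rw [gm, lp, rp_succ_false hwk]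
        rcases h3 with h3 | h3
        · rcases h4 with h4 | h4
          · exact absurd ⟨h3, h4, by rw [Sym2.eq_swap]; exact ih⟩ h5
          · rw [isSide_iff_pos src, pos_vtx src (by omega), pos_vtx src hb] at h4
            obtain rfl : z = rp w k + (n + 2 - (k + 1)) := by omega
            exact h3
        · rw [isSide_iff_pos src, pos_vtx src (by omega), pos_vtx src (by omega)] at h3
          obtain rfl : z = rp w k + 1 := by omega
          rcases h4 with h4 | h4
          · exact absurd h4 hnot
          · rw [isSide_iff_pos src, pos_vtx src (by omega), pos_vtx src hb] at h4
            omega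
  refine ⟨hn, hf, hl, fun e => ⟨fun he => ?_, ?_⟩⟩
  · obtain ⟨i, j⟩ := e
    change s(i, j) ∈ T at he
    change ∃ k, 1 ≤ k ∧ k ≤ n ∧ s(i, j) = gm src w k
    have hi := pos_lt src i
    have hj := pos_lt src j
    have hne : pos src i ≠ pos src j := fun h => (hT.isArc _ he).1 ((pos_inj src).mp h)
    have hs := (hT.isArc _ he).2
    rw [isSide_iff_pos src] at hs
    by_contra hno
    have hno' : ∀ k, 1 ≤ k → k ≤ n →
        ¬ ((pos src i = rp w k ∧ pos src j = rp w k + (n + 2 - k)) ∨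
          (pos src j = rp w k ∧ pos src i = rp w k + (n + 2 - k))) := by
      intro k h1 h2 h3
      exact hno ⟨k, h1, h2, (eq_gm_iff (by omega)).mpr h3⟩
    -- An arc of `T` different from all `gm k` crosses none of them and is squeezed into the
    -- successive intervals; the interval of `gm n` leaves room only for boundary segments and `gm
    -- n` itself.
    have main : ∀ k, k ≤ n → rp w k ≤ pos src i ∧ pos src i ≤ rp w k + (n + 2 - k) ∧
       rp w k ≤ pos src j ∧ pos src j ≤ rp w k + (n + 2 - k) := by
      intro k
      induction k with
      | zero => intro _; simp only [rp_zero]; omega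
      | succ k ih =>
        intro hk
        have ih := ih (by omega)
        have hc := step_cases (n := n) (w := w) k
        have hb := hlp (k + 1) (by omega)
        have hnc := hT.noncrossing _ (hmem (k + 1) (by omega) hk) _ he
        rw [gm, lp, crosses_vtx_iff (by omega) hb] at hnc
        have h0 : k = 0 ∨ 1 ≤ k := by omega
        rcases h0 with rfl | h0
        · simp only [rp_zero, zero_add] at ih hc
          omega
        · have := hno' k h0 (by omega)
          omega
    have h1 := main n le_rfl
    have h2 := hno' n hn le_rfl
    omega
  · rintro ⟨k, h1, h2, rfl⟩
    exact hmem k h1 h2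

end ZigzagExists

/-! ### Triangles, quiver and default orientation of a zigzag -/

section Triangles

variable {n : ℕ} {T : Finset (Sym2 (Fin (n + 3)))} {src : Fin (n + 3)} {w : ℕ → Bool}

namespace IsZig

variable (Z : IsZig T src w)
include Z

lemma zp_bounds {k : ℕ} (hk : k ≤ n) : rp w k < zp n w k ∧ zp n w k < rp w k + (n + 2 - k) := by
  have := step_cases (n := n) (w := w) k
  omega

lemma isEdge_gm {k : ℕ} (hk : k ≤ n + 1) : IsEdge T s(vtx src (rp w k), vtx src (lp n w k)) := by
  have h1 := Z.lp_lt hk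
  rw [Z.isEdge_iff_pos, lp, pos_vtx src h1, pos_vtx src (by omega)]
  rcases Nat.lt_or_ge k (n + 1) with h | h
  · exact Or.inr (Or.inr ⟨k, by omega, Or.inl ⟨rfl, rfl⟩⟩)
  · left; omega

lemma tg_edges {k : ℕ} (hk : k ≤ n) : IsEdge T s(vtx src (rp w k), vtx src (zp n w k)) ∧
    IsEdge T s(vtx src (zp n w k), vtx src (lp n w k)) := by
  have h1 := Z.lp_lt (k := k) (by omega)
  have h2 := Z.isEdge_gm (k := k + 1) (by omega)
  have hz := Z.zp_bounds hk
  have side : ∀ x, x + 1 < n + 3 → IsEdge T s(vtx src x, vtx src (x + 1)) := by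
    intro x hx
    right
    rw [isSide_iff_pos src, pos_vtx src (by omega), pos_vtx src hx]
    omega
  rw [lp] at *
  rcases step_cases (n := n) (w := w) k with ⟨_, h4, h5, _⟩ | ⟨_, h4, h5, _⟩
  · rw [h5]
    refine ⟨side _ (by omega), ?_⟩
    rwa [h4, show rp w k + 1 + (n + 2 - (k + 1)) = rp w k + (n + 2 - k) by omega] at h2
  · rw [h5]
    refine ⟨?_, ?_⟩
    · rwa [h4, show rp w k + (n + 2 - (k + 1)) = rp w k + (n + 2 - k) - 1 by omega] at h2
    · have := side (rp w k + (n + 2 - k) - 1) (by omega)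
      rwa [show rp w k + (n + 2 - k) - 1 + 1 = rp w k + (n + 2 - k) by omega] at this

lemma sbtw_tg {k : ℕ} (hk : k ≤ n) :
    sbtw (vtx src (rp w k)) (vtx src (zp n w k)) (vtx src (lp n w k)) := by
  have h1 := Z.lp_lt (k := k) (by omega)
  have hz := Z.zp_bounds hk
  rw [sbtw_iff_pos src, lp, pos_vtx src (by omega), pos_vtx src (by omega), pos_vtx src h1]
  omega

lemma isTriangle_tg {k : ℕ} (hk : k ≤ n) : IsTriangle T (tg src w k) :=
  ⟨_, _, _, Z.sbtw_tg hk, rfl, (Z.tg_edges hk).1, (Z.tg_edges hk).2, by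
    rw [Sym2.eq_swap]; exact Z.isEdge_gm (by omega)⟩

/-- The edges at the end of the arc `k` that is cut off next. -/
lemma edge_cases {k : ℕ} (hk : k ≤ n) {i j : Fin (n + 3)} (h : IsEdge T s(i, j))
    (h1 : pos src i = cp n w k) (h2 : rp w k ≤ pos src j) (h3 : pos src j ≤ rp w k + (n + 2 - k)) :
    pos src j = rp w k ∨ pos src j = zp n w k ∨ pos src j = rp w k + (n + 2 - k) := by
  have hc := step_cases (n := n) (w := w) k
  rw [Z.isEdge_iff_pos] at h
  rcases h with h | h | ⟨m, hm, h⟩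
  · omega
  · omega
  · have h4 := Z.rp_lt_lp (j := m) (k := k) (by omega) (by omega)
    have h5 := Z.rp_lt_lp (j := k) (k := m) (by omega) (by omega)
    rcases Nat.lt_or_ge k m with hkm | hkm
    · have := rp_bounds (w := w) (show k + 1 ≤ m by omega)
      omega
    · have := rp_bounds (w := w) hkm
      omega

/-- Within the interval of arc `m`, the vertex cut off at step `m` is joined only to the two other
vertices of the `m`-th triangle. A triangle that uses it is therefore the `m`-th one, and any other
triangle passes to the next interval. The final interval has too few vertices. -/
lemma triangle_pos {i j k : Fin (n + 3)} (hij : pos src i < pos src j)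
    (hjk : pos src j < pos src k) (e1 : IsEdge T s(i, j)) (e2 : IsEdge T s(j, k))
    (e3 : IsEdge T s(k, i)) : ∃ m, m ≤ n ∧ pos src i = rp w m ∧ pos src j = zp n w m ∧
      pos src k = rp w m + (n + 2 - m) := by
  by_contra hno
  have hno' : ∀ m, m ≤ n → ¬ (pos src i = rp w m ∧ pos src j = zp n w m ∧
      pos src k = rp w m + (n + 2 - m)) := fun m hm h => hno ⟨m, hm, h⟩
  have hk := pos_lt src k
  have main : ∀ m, m ≤ n + 1 → rp w m ≤ pos src i ∧ pos src k ≤ rp w m + (n + 2 - m) := by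
    intro m
    induction m with
    | zero => intro _; simp only [rp_zero]; omega
    | succ m ih =>
      intro hm
      have ih := ih (by omega)
      have hc := step_cases (n := n) (w := w) m
      have h1 := Z.edge_cases (k := m) (by omega) e1
      have h2 := Z.edge_cases (k := m) (by omega) e3
      have h3 := Z.edge_cases (k := m) (by omega) (show IsEdge T s(i, k) by rwa [Sym2.eq_swap])
      have h4 := Z.edge_cases (k := m) (by omega) (show IsEdge T s(k, j) by rwa [Sym2.eq_swap])
      have h5 := hno' m (by omega)
      omega
  have := main (n + 1) le_rfl
  omega

lemma isTriangle_iff (t : Finset (Fin (n + 3))) :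
    IsTriangle T t ↔ ∃ k, k ≤ n ∧ t = tg src w k := by
  constructor
  · rintro ⟨i, j, k, h, rfl, e1, e2, e3⟩
    have key : ∀ i j k : Fin (n + 3), pos src i < pos src j → pos src j < pos src k →
        IsEdge T s(i, j) → IsEdge T s(j, k) → IsEdge T s(k, i) →
        ∃ m, m ≤ n ∧ ({i, j, k} : Finset (Fin (n + 3))) = tg src w m := by
      intro i j k h1 h2 e1 e2 e3
      obtain ⟨m, hm, a1, a2, a3⟩ := Z.triangle_pos h1 h2 e1 e2 e3
      refine ⟨m, hm, ?_⟩
      rw [tg, lp, ← a3, ← a1, ← a2, vtx_pos, vtx_pos, vtx_pos]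
    rw [sbtw_iff_pos src] at h
    rcases h with h | h | h
    · exact key i j k h.1 h.2 e1 e2 e3
    · rw [triple_eq]; exact key j k i h.1 h.2 e2 e3 e1
    · rw [← triple_eq]; exact key k i j h.1 h.2 e3 e1 e2
  · rintro ⟨k, hk, rfl⟩
    exact Z.isTriangle_tg hk

/-- The positions of the vertices of the `k`-th triangle. -/
lemma pos_tg {k : ℕ} (hk : k ≤ n) : pos src (vtx src (rp w k)) = rp w k ∧
    pos src (vtx src (zp n w k)) = zp n w k ∧
    pos src (vtx src (lp n w k)) = rp w k + (n + 2 - k) := by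
  have h1 := Z.lp_lt (k := k) (by omega)
  have hz := Z.zp_bounds hk
  exact ⟨pos_vtx src (by omega), pos_vtx src (by omega), pos_vtx src h1⟩

lemma tg_inj {j k : ℕ} (hj : j ≤ n) (hk : k ≤ n) (h : tg src w j = tg src w k) : j = k := by
  obtain ⟨a1, a2, a3⟩ := Z.pos_tg hj
  obtain ⟨b1, b2, b3⟩ := Z.pos_tg hk
  have hz := Z.zp_bounds hj
  have hz := Z.zp_bounds hk
  rcases sbtw_eq_rot (Z.sbtw_tg hj) (Z.sbtw_tg hk) h with ⟨h1, h2, h3⟩ | ⟨h1, h2, h3⟩ | ⟨h1, h2, h3⟩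
  all_goals
    rw [← pos_inj src] at h1 h2 h3
    omega

/-- Consecutive arcs share the end that does not move, and the letter of `w` decides whether turning
around it to the next arc is clockwise. The quiver is thus an orientation of a line. -/
lemma arrow_iff {a b : ℕ} (ha : 1 ≤ a) (ha' : a ≤ n) (hb : 1 ≤ b) (hb' : b ≤ n) (e f : T)
    (he : e.1 = gm src w a) (hf : f.1 = gm src w b) :
    Arrow T e f ↔ (b + 1 = a ∧ w b = true) ∨ (a + 1 = b ∧ w a = false) := by
  have l1 := Z.lp_lt (k := a) (by omega)
  have l2 := Z.lp_lt (k := b) (by omega)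
  have l3 := Z.rp_lt_lp (j := a) (k := b) (by omega) (by omega)
  have l4 := Z.rp_lt_lp (j := b) (k := a) (by omega) (by omega)
  have l5 := Z.rp_lt_lp (j := a) (k := a) (by omega) (by omega)
  have l6 := Z.rp_lt_lp (j := b) (k := b) (by omega) (by omega)
  constructor
  · rintro ⟨v, x, y, h1, h2, h3, h4⟩
    rw [he, eq_comm, eq_gm_iff (by omega)] at h1
    rw [hf, eq_comm, eq_gm_iff (by omega)] at h2
    rw [sbtw_iff_pos src] at h3
    rw [Z.isEdge_iff_pos] at h4
    -- Every edge of the zigzag that is not a short boundary segment joins a lower end to an upper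
    -- end. Two arcs with a common end have their other ends of the same kind, so the third side
    -- must be a boundary segment.
    have h5 : pos src x + 1 = pos src y ∨ pos src y + 1 = pos src x := by
      rcases h4 with h4 | h4 | ⟨m, hm, h4⟩
      · exact Or.inl h4
      · exact Or.inr h4
      · exfalso
        have m1 := Z.rp_lt_lp (j := a) (k := m) (by omega) (by omega)
        have m2 := Z.rp_lt_lp (j := b) (k := m) (by omega) (by omega)
        have m3 := Z.rp_lt_lp (j := m) (k := a) (by omega) (by omega)
        have m4 := Z.rp_lt_lp (j := m) (k := b) (by omega) (by omega)
        omega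
    clear h4
    have hc := step_cases (n := n) (w := w) a
    have hc' := step_cases (n := n) (w := w) b
    have hab : b + 1 = a ∨ a + 1 = b := by omega
    rcases hab with rfl | rfl
    · left
      exact ⟨rfl, by rcases hc' with h | h <;> [exact h.1; omega]⟩
    · right
      exact ⟨rfl, by rcases hc with h | h <;> [omega; exact h.1]⟩
  · rintro (⟨rfl, hw⟩ | ⟨rfl, hw⟩)
    · have hr := rp_succ_true hw
      refine ⟨vtx src (lp n w b), vtx src (rp w (b + 1)), vtx src (rp w b), ?_, ?_, ?_, ?_⟩
      · rw [he, gm, lp, lp, hr, show rp w b + 1 + (n + 2 - (b + 1)) = rp w b + (n + 2 - b) by omega,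
          Sym2.eq_swap]
      · rw [hf, gm, Sym2.eq_swap]
      · rw [sbtw_iff_pos src, lp, pos_vtx src (by omega), pos_vtx src (by omega),
          pos_vtx src (by omega)]
        omega
      · right
        rw [isSide_iff_pos src, pos_vtx src (by omega), pos_vtx src (by omega)]
        omega
    · have hr := rp_succ_false hw
      refine ⟨vtx src (rp w a), vtx src (lp n w a), vtx src (lp n w (a + 1)), ?_, ?_, ?_, ?_⟩
      · rw [he, gm]
      · rw [hf, gm, hr]
      · rw [sbtw_iff_pos src, lp, lp, pos_vtx src (by omega), pos_vtx src (by omega),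
          pos_vtx src (by omega)]
        omega
      · right
        rw [isSide_iff_pos src, lp, lp, pos_vtx src (by omega), pos_vtx src (by omega)]
        omega

lemma onTriangle_tg_iff {m : ℕ} (hm : m ≤ n) (i j : Fin (n + 3)) :
    OnTriangle s(i, j) (tg src w m) ↔
      ∃ x y, s(i, j) = s(x, y) ∧
        ((pos src x = rp w m ∧ zp n w m ≤ pos src y ∧ pos src y ≤ rp w m + (n + 2 - m)) ∨
         (pos src x = zp n w m ∧ (rp w m + (n + 2 - m) ≤ pos src y ∨ pos src y ≤ rp w m)) ∨
         (pos src x = rp w m + (n + 2 - m) ∧ rp w m ≤ pos src y ∧ pos src y ≤ zp n w m)) := by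
  obtain ⟨a1, a2, a3⟩ := Z.pos_tg hm
  have hz := Z.zp_bounds hm
  constructor
  · rintro ⟨x, b, c, h1, h2, y, h3, h4⟩
    refine ⟨x, y, h4, ?_⟩
    rw [btw_iff_pos src] at h3
    rcases sbtw_eq_rot h1 (Z.sbtw_tg hm) h2.symm with
      ⟨rfl, rfl, rfl⟩ | ⟨rfl, rfl, rfl⟩ | ⟨rfl, rfl, rfl⟩ <;> omega
  · rintro ⟨x, y, h4, h | h | h⟩
    · refine ⟨x, vtx src (zp n w m), vtx src (lp n w m), ?_, ?_, y, ?_, h4⟩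
      · rw [eq_vtx src h.1]; exact Z.sbtw_tg hm
      · rw [eq_vtx src h.1, tg]
      · rw [btw_iff_pos src]; omega
    · refine ⟨x, vtx src (lp n w m), vtx src (rp w m), ?_, ?_, y, ?_, h4⟩
      · rw [eq_vtx src h.1]; exact sbtw_rot (Z.sbtw_tg hm)
      · rw [eq_vtx src h.1, tg, triple_eq]
      · rw [btw_iff_pos src]; omega
    · refine ⟨x, vtx src (rp w m), vtx src (zp n w m), ?_, ?_, y, ?_, h4⟩
      · rw [eq_vtx src h.1, ← lp]; exact sbtw_rot (sbtw_rot (Z.sbtw_tg hm))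
      · rw [eq_vtx src h.1, tg, ← lp, ← triple_eq]
      · rw [btw_iff_pos src]; omega

/-- The arc leaves the vertex `cp p` of triangle `p` through the opposite side and arrives at the
vertex `zp q` of triangle `q`. In the triangles between, it passes from one side to another without
meeting a vertex. -/
lemma onTriangle_ar_iff {m p q : ℕ} (hm : m ≤ n) (hpq : p < q) (hq : q ≤ n) :
    OnTriangle (ar src w p q) (tg src w m) ↔ m = p ∨ m = q := by
  obtain ⟨h1, h2, h3, h4, h5, h6⟩ := Z.ar_bounds hpq hq
  have e1 := pos_vtx src h5
  have e2 := pos_vtx src h6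
  rw [ar, Z.onTriangle_tg_iff hm]
  have hc := step_cases (n := n) (w := w) m
  constructor
  · rintro ⟨x, y, h, hx⟩
    have a1 := h1 m
    have a2 := h2 m
    have a3 := h3 m
    have a4 := h4 m
    have b1 := h1 (m + 1)
    have b2 := h2 (m + 1)
    have b3 := h3 (m + 1)
    have b4 := h4 (m + 1)
    rcases Sym2.eq_iff.mp h with ⟨rfl, rfl⟩ | ⟨rfl, rfl⟩ <;> rw [e1, e2] at hx <;> omega
  · rintro (rfl | rfl)
    · have b3 := h3 (m + 1)
      refine ⟨_, _, rfl, ?_⟩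
      rw [e1, e2]
      omega
    · have a2 := h2 m
      refine ⟨_, _, Sym2.eq_swap, ?_⟩
      rw [e1, e2]
      omega

lemma tg_zero : tg src w 0 = {src - 1, src, src + 1} := by
  have hs1 := add_one_eq_vtx src
  have hs2 := sub_one_eq_vtx src
  have hs3 : src = vtx src 0 := by simp [vtx]
  rw [hs1, hs2, tg, lp, zp, Z.first]
  simp only [rp, if_true, zero_add, Nat.sub_zero]
  rw [← hs3, triple_eq, triple_eq]

/-- The arcs from `src` that are used for the labels are the `ar 0 q`, because `cp 0 = 0`, and such
an arc ends at position `zp q`. So the label of a triangle is the position of its vertex `zp`. -/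
lemma isDelta_iff {a j : ℕ} (hj : j ≤ n) : IsDelta src a (tg src w j) ↔ a = zp n w j := by
  have hs3 : src = vtx src (cp n w 0) := by simp [vtx, cp, Z.first, rp]
  have hz0 : zp n w 0 = 1 := by simp [zp, Z.first, rp]
  have hz := Z.zp_bounds hj
  have hl := Z.lp_lt (k := j) (by omega)
  rw [IsDelta, ← Z.tg_zero]
  have key : ∀ a, 2 ≤ a → a ≤ n + 1 → ∃ q, 0 < q ∧ q ≤ n ∧ zp n w q = a := by
    intro a h1 h2
    obtain ⟨q, -, h3, h4⟩ := Z.exists_zp (y := a) (k := 0) (by omega) (by simp only [rp_zero]; omega)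
      (by simp only [rp_zero]; omega)
    refine ⟨q, ?_, h3, h4⟩
    rcases Nat.eq_zero_or_pos q with rfl | h
    · omega
    · exact h
  have key2 : ∀ a q, 0 < q → q ≤ n → zp n w q = a →
      s(src, src + Fin.ofNat (n + 3) a) = ar src w 0 q := by
    rintro a q - - rfl
    rw [ar, ← hs3, vtx]
  constructor
  · rintro (⟨rfl, h⟩ | ⟨h1, h2, h3, h4⟩)
    · obtain rfl := Z.tg_inj hj (by omega) h
      exact hz0.symm
    · obtain ⟨q, h5, h6, h7⟩ := key a h1 h2
      rw [key2 a q h5 h6 h7, Z.onTriangle_ar_iff hj h5 h6] at h4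
      rcases h4 with rfl | rfl
      · exact absurd rfl h3
      · exact h7.symm
  · rintro rfl
    rcases Nat.eq_zero_or_pos j with rfl | h
    · exact Or.inl ⟨hz0, rfl⟩
    · have := Z.rp_pos h
      refine Or.inr ⟨by omega, by omega, fun h' => ?_, ?_⟩
      · have := Z.tg_inj hj (by omega) h'
        omega
      · rw [key2 _ j h hj rfl, Z.onTriangle_ar_iff hj h hj]
        exact Or.inr rfl

/-- The orientation of the arcs of the zigzag. -/
lemma defaultDir_cases {i j : Fin (n + 3)} (h : defaultDir T src i j) :
    ∃ k, 1 ≤ k ∧ k ≤ n ∧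
      ((w (if k = 1 then 1 else k - 1) = true ∧ pos src i = rp w k + (n + 2 - k) ∧
        pos src j = rp w k) ∨
       (w (if k = 1 then 1 else k - 1) = false ∧ pos src i = rp w k ∧
        pos src j = rp w k + (n + 2 - k))) := by
  obtain ⟨hT, h⟩ := h
  have hs0 := pos_src src
  obtain ⟨k, hk1, hkn, hij⟩ := (Z.mem_iff_pos i j).mp hT
  have hr := Z.rp_pos hk1
  have l1 := Z.lp_lt (k := k) (by omega)
  refine ⟨k, hk1, hkn, ?_⟩
  rcases h with ⟨y, h1, h2, h3⟩ | ⟨h0, h⟩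
  · rw [SameSide] at h1
    simp only [sbtw_iff_pos src] at h1
    obtain ⟨m, hm1, hmn, hm⟩ := (Z.mem_iff_pos i y).mp h2
    have hE := (Z.isEdge_iff_pos j y).mp h3
    have m1 := Z.rp_lt_lp (j := k) (k := m) (by omega) (by omega)
    have m3 := Z.rp_lt_lp (j := m) (k := k) (by omega) (by omega)
    have m5 := Z.rp_lt_lp (j := k) (k := k) (by omega) (by omega)
    have hE' : pos src j + 1 = pos src y ∨ pos src y + 1 = pos src j := by
      rcases hE with h4 | h4 | ⟨v, hv, h4⟩
      · exact Or.inl h4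
      · exact Or.inr h4
      · exfalso
        have v1 := Z.rp_lt_lp (j := k) (k := v) (by omega) (by omega)
        have v2 := Z.rp_lt_lp (j := m) (k := v) (by omega) (by omega)
        have v3 := Z.rp_lt_lp (j := v) (k := k) (by omega) (by omega)
        have v4 := Z.rp_lt_lp (j := v) (k := m) (by omega) (by omega)
        omega
    clear hE
    obtain rfl : k = m + 1 := by
      rcases Nat.lt_or_ge k m with h5 | h5
      · have := rp_bounds (w := w) h5.le; omega
      · have := rp_bounds (w := w) h5; omega
    rw [if_neg (by omega)]
    have hc := step_cases (n := n) (w := w) m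
    rw [Nat.add_sub_cancel]
    rcases hc with hc | hc
    · left; exact ⟨hc.1, by omega⟩
    · right; exact ⟨hc.1, by omega⟩
  · have hg1 := (gm_one (src := src) Z.first).symm
    have hk : k = 1 := by
      have := (eq_gm_iff (by omega)).mpr hij
      exact Z.gm_inj (by omega) (by omega) (this.symm.trans (h0.trans hg1))
    subst hk
    rw [if_pos rfl]
    have h1 := rp_one Z.first
    rcases h with ⟨y, hy1, hy2, hy, h2, h3⟩ | ⟨hT1, rfl⟩
    · rw [SameSide] at hy
      simp only [sbtw_iff_pos src] at hy
      have hy1' : pos src y ≠ pos src i := fun h => hy1 ((pos_inj src).mp h)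
      have hy2' : pos src y ≠ pos src j := fun h => hy2 ((pos_inj src).mp h)
      obtain ⟨m, hm1, hmn, hm⟩ := (Z.mem_iff_pos i y).mp h2
      have hE := (Z.isEdge_iff_pos j y).mp h3
      have m1 := Z.rp_lt_lp (j := 1) (k := m) (by omega) (by omega)
      have m3 := Z.rp_lt_lp (j := m) (k := 1) (by omega) (by omega)
      have m5 := Z.rp_lt_lp (j := 1) (k := 1) (by omega) (by omega)
      have hE' : pos src j + 1 = pos src y ∨ pos src y + 1 = pos src j := by
        rcases hE with h4 | h4 | ⟨v, hv, h4⟩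
        · exact Or.inl h4
        · exact Or.inr h4
        · exfalso
          have v1 := Z.rp_lt_lp (j := 1) (k := v) (by omega) (by omega)
          have v2 := Z.rp_lt_lp (j := m) (k := v) (by omega) (by omega)
          have v3 := Z.rp_lt_lp (j := v) (k := 1) (by omega) (by omega)
          have v4 := Z.rp_lt_lp (j := v) (k := m) (by omega) (by omega)
          omega
      clear hE
      have hb := rp_bounds (w := w) hm1
      obtain rfl : m = 2 := by omega
      have hc := step_cases (n := n) (w := w) 1
      simp only [Nat.reduceAdd] at hc
      rcases hc with hc | hc
      · left; exact ⟨hc.1, by omega⟩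
      · right; exact ⟨hc.1, by omega⟩
    · left
      have hn : n = 1 := by
        by_contra hn1
        have h2 := Z.gm_mem (k := 2) (by omega) (by have := Z.one_le; omega)
        rw [hT1, Finset.mem_singleton, h0, hg1] at h2
        have := Z.gm_inj (by have := Z.one_le; omega) (by omega) h2
        omega
      subst hn
      refine ⟨Z.last, ?_⟩
      have h := pos_add_one src (src - 1)
      rw [sub_add_cancel, pos_src] at h
      have := pos_lt src (src - 1)
      split_ifs at h
      omega

lemma exists_defaultDir {i j : Fin (n + 3)} (h : s(i, j) ∈ T) :
    defaultDir T src i j ∨ defaultDir T src j i := by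
  have hs0 := pos_src src
  have hmem := h
  obtain ⟨k, hk1, hkn, hij⟩ := (Z.mem_iff_pos i j).mp h
  wlog hij' : pos src i = rp w k ∧ pos src j = rp w k + (n + 2 - k) generalizing i j
  · refine (this (i := j) (j := i) (by rwa [Sym2.eq_swap]) (by rwa [Sym2.eq_swap]) ?_ ?_).symm
    · omega
    · omega
  clear hij
  have hr := Z.rp_pos hk1
  have l1 := Z.lp_lt (k := k) (by omega)
  have mem : ∀ m (x y : Fin (n + 3)), 1 ≤ m → m ≤ n → pos src x = rp w m →
      pos src y = rp w m + (n + 2 - m) → s(x, y) ∈ T := by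
    intro m x y h1 h2 h3 h4
    exact (Z.mem_iff_pos x y).mpr ⟨m, h1, h2, Or.inl ⟨h3, h4⟩⟩
  rcases Nat.lt_or_ge 1 k with hk | hk
  · obtain ⟨m, rfl⟩ : ∃ m, k = m + 1 := ⟨k - 1, by omega⟩
    have l2 := Z.lp_lt (k := m) (by omega)
    have hc := step_cases (n := n) (w := w) m
    have hp1 := pos_vtx src (show rp w m < n + 3 by omega)
    have hp2 := pos_vtx src l2
    have hrm := Z.rp_pos (show 1 ≤ m by omega)
    rcases hc with hc | hc
    · right
      refine ⟨by rwa [Sym2.eq_swap], Or.inl ⟨vtx src (rp w m), ?_, ?_, ?_⟩⟩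
      · rw [SameSide]; simp only [sbtw_iff_pos src]; omega
      · rw [Sym2.eq_swap]; exact mem m _ _ (by omega) (by omega) hp1 (by omega)
      · right; rw [isSide_iff_pos src]; omega
    · left
      refine ⟨hmem, Or.inl ⟨vtx src (rp w m + (n + 2 - m)), ?_, ?_, ?_⟩⟩
      · rw [SameSide]; simp only [sbtw_iff_pos src]; omega
      · exact mem m _ _ (by omega) (by omega) (by omega) hp2
      · right; rw [isSide_iff_pos src]; omega
  · obtain rfl : k = 1 := by omega
    have hg1 := (gm_one (src := src) Z.first).symm
    have hs : s(i, j) = s(src - 1, src + 1) := by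
      rw [hg1, eq_gm_iff (by omega)]; exact Or.inl hij'
    have h1 := rp_one Z.first
    rcases Nat.lt_or_ge 1 n with hn | hn
    · have l2 := Z.lp_lt (k := 2) (by omega)
      have hc := step_cases (n := n) (w := w) 1
      simp only [Nat.reduceAdd] at hc
      have hp1 := pos_vtx src (show rp w 2 < n + 3 by omega)
      have hp2 := pos_vtx src l2
      have hpi : ∀ x y, pos src x ≠ pos src y → x ≠ y := by rintro x y h rfl; exact h rfl
      rcases hc with hc | hc
      · right
        refine ⟨by rwa [Sym2.eq_swap], Or.inr ⟨by rwa [Sym2.eq_swap], Or.inl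
          ⟨vtx src (rp w 2), hpi _ _ (by omega), hpi _ _ (by omega), ?_, ?_, ?_⟩⟩⟩
        · rw [SameSide]; simp only [sbtw_iff_pos src]; omega
        · rw [Sym2.eq_swap]; exact mem 2 _ _ (by omega) (by omega) hp1 (by omega)
        · right; rw [isSide_iff_pos src]; omega
      · left
        refine ⟨hmem, Or.inr ⟨hs, Or.inl
          ⟨vtx src (rp w 2 + (n + 2 - 2)), hpi _ _ (by omega), hpi _ _ (by omega), ?_, ?_, ?_⟩⟩⟩
        · rw [SameSide]; simp only [sbtw_iff_pos src]; omega
        · exact mem 2 _ _ (by omega) (by omega) (by omega) hp2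
        · right; rw [isSide_iff_pos src]; omega
    · right
      obtain rfl : n = 1 := by have := Z.one_le; omega
      refine ⟨by rwa [Sym2.eq_swap], Or.inr ⟨by rwa [Sym2.eq_swap], Or.inr ⟨?_, ?_⟩⟩⟩
      · ext e
        rw [Z.mem_iff, Finset.mem_singleton]
        constructor
        · rintro ⟨k, h2, h3, rfl⟩
          obtain rfl : k = 1 := by omega
          rw [Sym2.eq_swap, hs, hg1]
        · rintro rfl
          exact ⟨1, le_rfl, le_rfl, by rw [Sym2.eq_swap, hs, hg1]⟩
      · rw [← pos_inj src]
        have h := pos_add_one src (src - 1)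
        rw [sub_add_cancel, pos_src] at h
        have := pos_lt src (src - 1)
        split_ifs at h
        omega

end IsZig

end Triangles

/-! ### Super vectors at the vertices of a zigzag -/

section Vectors

variable {R : Type*} [Field R] [LinearOrder R] [IsStrictOrderedRing R]
  {M : Type*} [AddCommGroup M] [Module R M]

lemma body_om (ξ η : Od R M) : body R M ((oddPairing R M).om ξ η) = 0 :=
  body_eq_zero_of_isNilpotent ⟨2, by rw [pow_two, (oddPairing R M).mul_left]⟩

/-- A super vector with given pairings with two other ones and given odd invariant. -/
lemma OddPairing.exists_third {E O : Type*} [CommRing E] [AddCommGroup O] [Module E O]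
    (S : OddPairing E O) {a b : SVec E O} (hab : IsUnit (a.x * b.y - a.y * b.x)) (c₁ c₂ : E)
    (m : O) : ∃ z : SVec E O, S.br a z = c₁ ∧ S.br z b = c₂ ∧ S.tri a z b = m := by
  obtain ⟨D, hD⟩ := hab
  set i : E := D⁻¹.1 with hi
  have hDi : (a.x * b.y - a.y * b.x) * i = 1 := by rw [← hD, hi, Units.mul_inv]
  -- In the equation for `tri` the odd terms with two factors cancel, and the odd coordinate `ζ` has
  -- the unit determinant as coefficient up to sign. With `ζ` known, the even coordinates solve a `2
  -- × 2` linear system.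
  set ζ : O := i • (c₁ • b.ξ + c₂ • a.ξ - m) with hζ
  have hζ' : (a.x * b.y - a.y * b.x) • ζ = c₁ • b.ξ + c₂ • a.ξ - m := by
    rw [hζ, smul_smul, hDi, one_smul]
  set p := c₁ + S.om a.ξ ζ with hp
  set r := c₂ + S.om ζ b.ξ with hr
  have h1 : S.br a ⟨i * (p * b.x + r * a.x), i * (p * b.y + r * a.y), ζ⟩ = c₁ := by
    simp only [br]
    linear_combination p * hDi + hp
  have h2 : S.br ⟨i * (p * b.x + r * a.x), i * (p * b.y + r * a.y), ζ⟩ b = c₂ := by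
    simp only [br]
    linear_combination r * hDi + hr
  refine ⟨⟨i * (p * b.x + r * a.x), i * (p * b.y + r * a.y), ζ⟩, h1, h2, ?_⟩
  rw [tri, h1, h2]
  simp only
  have h3 : S.om a.ξ ζ • b.ξ = S.om b.ξ a.ξ • ζ := by rw [S.assoc b.ξ a.ξ ζ]
  have h4 : S.br b a = -(a.x * b.y - a.y * b.x) - S.om b.ξ a.ξ := by simp only [br]; ring
  rw [h3, h4]
  linear_combination (norm := module) -hζ'

/-- The super vectors `g` at the vertices of the zigzag `w` have the lambda lengths `(q k)²` at its
arcs, `1` at the boundary segments, and the odd invariants `η k` in its triangles. -/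
structure IsZVec (n : ℕ) (w : ℕ → Bool) (q : ℕ → R) (η : ℕ → Od R M)
    (g : ℕ → SVec (Ev R M) (Od R M)) (k : ℕ) : Prop where
  br_rl : (oddPairing R M).br (g (rp w k)) (g (lp n w k)) = algebraMap R (Ev R M) (q k ^ 2)
  br_rz : (oddPairing R M).br (g (rp w k)) (g (zp n w k)) =
    if w k then 1 else algebraMap R (Ev R M) (q (k + 1) ^ 2)
  br_zl : (oddPairing R M).br (g (zp n w k)) (g (lp n w k)) =
    if w k then algebraMap R (Ev R M) (q (k + 1) ^ 2) else 1
  tri_eq : (oddPairing R M).tri (g (rp w k)) (g (zp n w k)) (g (lp n w k)) =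
    algebraMap R (Ev R M) (q k * q (k + 1)) • η k

/-- Each triangle adds exactly one new vertex `zp k` to the two ends of arc `k`, whose pairing
already has the nonzero body `q k ^ 2`. `OddPairing.exists_third` supplies the new vector, and the
remaining side becomes the next arc. -/
lemma exists_zVec (n : ℕ) (w : ℕ → Bool) {q : ℕ → R} (hq : ∀ k, 0 < q k) (hq0 : q 0 = 1)
    (η : ℕ → Od R M) : ∃ g, ∀ k ≤ n, IsZVec n w q η g k := by
  have main : ∀ k, k ≤ n + 1 → ∃ g : ℕ → SVec (Ev R M) (Od R M), (∀ j < k, IsZVec n w q η g j) ∧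
      (oddPairing R M).br (g (rp w k)) (g (lp n w k)) = algebraMap R (Ev R M) (q k ^ 2) := by
    intro k
    induction k with
    | zero =>
      intro _
      -- Only the values at the positions `0` and `n + 2`, the ends of the boundary segment numbered
      -- zero, matter; their pairing is one.
      refine ⟨fun p => if p = 0 then ⟨1, 0, 0⟩ else ⟨0, 1, 0⟩, fun j hj => by omega, ?_⟩
      simp [rp, lp, OddPairing.br, hq0]
    | succ k ih =>
      intro hk
      obtain ⟨g, hg, hrl⟩ := ih (by omega)
      obtain ⟨z, h1, h2, h3⟩ := (oddPairing R M).exists_third (a := g (rp w k)) (b := g (lp n w k))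
        (isUnit_of_body (by
          have : body R M ((oddPairing R M).br (g (rp w k)) (g (lp n w k))) = q k ^ 2 := by
            rw [hrl, body_algebraMap]
          rw [OddPairing.br, map_sub, body_om, sub_zero] at this
          rw [this]
          have := hq k
          positivity))
        (if w k then 1 else algebraMap R (Ev R M) (q (k + 1) ^ 2))
        (if w k then algebraMap R (Ev R M) (q (k + 1) ^ 2) else 1)
        (algebraMap R (Ev R M) (q k * q (k + 1)) • η k)
      have hc := step_cases (n := n) (w := w) k
      refine ⟨Function.update g (zp n w k) z, ?_, ?_⟩
      · intro j hj
        have hcj := step_cases (n := n) (w := w) j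
        have hjk := rp_bounds (w := w) (show j ≤ k by omega)
        have e1 : Function.update g (zp n w k) z (rp w j) = g (rp w j) :=
          Function.update_of_ne (by omega) _ _
        have e2 : Function.update g (zp n w k) z (lp n w j) = g (lp n w j) :=
          Function.update_of_ne (by rw [lp]; omega) _ _
        rcases Nat.lt_or_ge j k with h | h
        · have hjk := rp_bounds (w := w) (show j + 1 ≤ k by omega)
          have e3 : Function.update g (zp n w k) z (zp n w j) = g (zp n w j) :=
            Function.update_of_ne (by omega) _ _
          obtain ⟨a1, a2, a3, a4⟩ := hg j h
          exact ⟨by rw [e1, e2, a1], by rw [e1, e3, a2], by rw [e2, e3, a3],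
            by rw [e1, e2, e3, a4]⟩
        · obtain rfl : j = k := by omega
          exact ⟨by rw [e1, e2, hrl], by rw [e1, Function.update_self, h1],
            by rw [e2, Function.update_self, h2], by rw [e1, e2, Function.update_self, h3]⟩
      · rcases hc with ⟨hw, hr, hz, _⟩ | ⟨hw, hr, hz, _⟩
        · rw [hw, if_pos rfl] at h2
          rw [show rp w (k + 1) = zp n w k by omega, Function.update_self,
            show lp n w (k + 1) = lp n w k by simp only [lp]; omega,
            Function.update_of_ne (by rw [lp]; omega), h2]
        · rw [hw, if_neg (by simp)] at h1
          rw [show lp n w (k + 1) = zp n w k by simp only [lp]; omega, Function.update_self, hr,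
            Function.update_of_ne (by omega), h1]
  obtain ⟨g, hg, -⟩ := main (n + 1) le_rfl
  exact ⟨g, fun k hk => hg k (by omega)⟩

variable {n : ℕ} {w : ℕ → Bool} {q : ℕ → R} {η : ℕ → Od R M} {g : ℕ → SVec (Ev R M) (Od R M)}

/-- The vector of the vertex cut off at step `p`, with a sign. -/
def cvec (n : ℕ) (w : ℕ → Bool) (g : ℕ → SVec (Ev R M) (Od R M)) (p : ℕ) : SVec (Ev R M) (Od R M) :=
  if w p then g (cp n w p) else -g (cp n w p)

/-- The Grassmann algebra valued state `V_k(e)` of the transfer process for the vertex cut off at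
step `p`. -/
def tstate (n : ℕ) (w : ℕ → Bool) (q : ℕ → R) (g : ℕ → SVec (Ev R M) (Od R M)) (p k e : ℕ) :
    ExteriorAlgebra R M :=
  if e = 0 then ((oddPairing R M).br (cvec n w g p) (g (rp w k))).1
  else if e = 1 then
    (q k)⁻¹ • ((oddPairing R M).tri (cvec n w g p) (g (rp w k)) (g (lp n w k))).1
  else ((oddPairing R M).br (cvec n w g p) (g (lp n w k))).1

/-- The sign of a step of the zigzag. -/
def tau (R : Type*) [Ring R] (w : ℕ → Bool) (k : ℕ) : R := if w k then 1 else -1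

lemma algebraMap_smul_od (r : R) (ξ : Od R M) : ((algebraMap R (Ev R M) r • ξ : Od R M) : ExteriorAlgebra R M) =
    r • ξ.1 := by
  rw [coe_smul_od, Algebra.smul_def]; rfl

lemma algebraMap_mul_ev (r : R) (a : Ev R M) : ((algebraMap R (Ev R M) r * a : Ev R M) : ExteriorAlgebra R M) =
    r • a.1 := by
  rw [Algebra.smul_def]; rfl

/-- The state just after the vertex is cut off. -/
lemma tstate_first {p : ℕ} (hp : p ≤ n) (h : IsZVec n w q η g p) (hq : ∀ k, 0 < q k) :
    tstate n w q g p (p + 1) 0 = algebraMap R _ (if w p then 1 else q p ^ 2) ∧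
    tstate n w q g p (p + 1) 1 = (tau R w p * q p) • (η p).1 ∧
    tstate n w q g p (p + 1) 2 = algebraMap R _ (if w p then q p ^ 2 else 1) := by
  obtain ⟨h1, h2, h3, h4⟩ := h
  have hne := (hq (p + 1)).ne'
  simp only [tstate, if_true, one_ne_zero, if_false, OfNat.ofNat_ne_zero, OfNat.ofNat_ne_one]
  rcases step_cases (n := n) (w := w) p with ⟨hw, hr, hz, hc⟩ | ⟨hw, hr, hz, hc⟩
  · have e1 : rp w (p + 1) = zp n w p := by omega
    have e2 : lp n w (p + 1) = lp n w p := by simp only [lp]; omega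
    have hw' := hw
    simp only [cvec, hw, if_true] at h2 h3 ⊢
    rw [e1, e2, hc, h2, h1, h4]
    refine ⟨(map_one _).symm, ?_, rfl⟩
    rw [algebraMap_smul_od, smul_smul, tau, hw', if_pos rfl]
    congr 1
    field_simp
  · have e1 : rp w (p + 1) = rp w p := by omega
    have e2 : lp n w (p + 1) = zp n w p := by simp only [lp]; omega
    have e3 : cp n w p = lp n w p := by rw [hc, lp]
    have hw' := hw
    simp only [cvec, hw, Bool.false_eq_true, if_false] at h2 h3 ⊢
    rw [e1, e2, e3, (oddPairing R M).br_neg_left, (oddPairing R M).br_neg_left,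
      (oddPairing R M).tri_neg, ← (oddPairing R M).br_swap, ← (oddPairing R M).br_swap, h1, h3,
      ← (oddPairing R M).tri_rot, h4]
    refine ⟨rfl, ?_, (map_one _).symm⟩
    change (q (p + 1))⁻¹ • -(algebraMap R (Ev R M) (q p * q (p + 1)) • η p : Od R M).1 = _
    rw [algebraMap_smul_od, ← neg_smul, smul_smul, tau, hw', if_neg (by simp)]
    congr 1
    field_simp

lemma ev_eq_of_mul {r : R} (hr : r ≠ 0) {a b : Ev R M} (h : algebraMap R (Ev R M) r * a = b) :
    a.1 = r⁻¹ • b.1 := by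
  rw [← h, algebraMap_mul_ev, smul_smul, inv_mul_cancel₀ hr, one_smul]

lemma od_eq_of_smul {r : R} (hr : r ≠ 0) {a b : Od R M} (h : algebraMap R (Ev R M) r • a = b) :
    a.1 = r⁻¹ • b.1 := by
  rw [← h, algebraMap_smul_od, smul_smul, inv_mul_cancel₀ hr, one_smul]

/-! ### Pairing with the third vertex of a triangle -/

section Third

variable {a b z u : SVec (Ev R M) (Od R M)} {x c₁ c₂ m : R} {ζ : Od R M}

/-- The super Ptolemy relation for `a, b, z, u`, divided by `x²`. With the two lemmas that follow it
expresses the data of `u` on the next side of the triangle `a, z, b` by those on the side `(a, b)`: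
the entries of a transfer matrix. -/
lemma br_third (hx : x ≠ 0)
    (h1 : (oddPairing R M).br a b = algebraMap R (Ev R M) x)
    (h2 : (oddPairing R M).br a z = algebraMap R (Ev R M) c₁)
    (h3 : (oddPairing R M).br z b = algebraMap R (Ev R M) c₂)
    (h4 : (oddPairing R M).tri a z b = algebraMap R (Ev R M) m • ζ) :
    ((oddPairing R M).br u z).1 = (c₂ / x) • ((oddPairing R M).br u a).1 +
      (m / x ^ 2) • (((oddPairing R M).tri u a b).1 * ζ.1) +
      (c₁ / x) • ((oddPairing R M).br u b).1 := by
  set S := oddPairing R M with hS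
  have key := S.br_mul_ptolemy a b z u
  rw [h1, S.br_swap z b, h3, S.br_swap u b, h2, S.br_swap u a, S.tri_swap_right a z b, h4,
    S.tri_rot u a b] at key
  have key2 : algebraMap R (Ev R M) (x ^ 2) * S.br u z =
      algebraMap R (Ev R M) (x * c₂) * S.br u a +
      algebraMap R (Ev R M) m * S.om (S.tri u a b) ζ +
      algebraMap R (Ev R M) (x * c₁) * S.br u b := by
    simp only [map_neg, map_smul, smul_eq_mul, map_mul, map_pow] at key ⊢
    linear_combination key
  rw [ev_eq_of_mul (pow_ne_zero 2 hx) key2]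
  change (x ^ 2)⁻¹ • ((algebraMap R (Ev R M) (x * c₂) * S.br u a : Ev R M).1 +
      (algebraMap R (Ev R M) m * S.om (S.tri u a b) ζ : Ev R M).1 +
      (algebraMap R (Ev R M) (x * c₁) * S.br u b : Ev R M).1) = _
  rw [algebraMap_mul_ev, algebraMap_mul_ev, algebraMap_mul_ev, coe_om]
  simp only [smul_add, smul_smul]
  congr 3 <;> field_simp

lemma tri_third_right (hx : x ≠ 0)
    (h1 : (oddPairing R M).br a b = algebraMap R (Ev R M) x)
    (h3 : (oddPairing R M).br z b = algebraMap R (Ev R M) c₂)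
    (h4 : (oddPairing R M).tri a z b = algebraMap R (Ev R M) m • ζ) :
    ((oddPairing R M).tri u z b).1 = (c₂ / x) • ((oddPairing R M).tri u a b).1 +
      (m / x) • (((oddPairing R M).br u b).1 * ζ.1) := by
  set S := oddPairing R M with hS
  have key := S.br_smul_tri a b u z
  rw [S.tri_swap_right u z b, S.tri_swap_right a z b, h4, h1, S.br_swap z b, h3,
    S.tri_rot u a b] at key
  have key2 : algebraMap R (Ev R M) x • S.tri u z b =
      algebraMap R (Ev R M) c₂ • S.tri u a b + algebraMap R (Ev R M) m • (S.br u b • ζ) := by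
    linear_combination (norm := module) -key
  rw [od_eq_of_smul hx key2]
  change x⁻¹ • ((algebraMap R (Ev R M) c₂ • S.tri u a b : Od R M).1 +
    (algebraMap R (Ev R M) m • (S.br u b • ζ) : Od R M).1) = _
  rw [algebraMap_smul_od, algebraMap_smul_od, coe_smul_od]
  simp only [smul_add, smul_smul, div_eq_inv_mul]

lemma tri_third_left (hx : x ≠ 0)
    (h1 : (oddPairing R M).br a b = algebraMap R (Ev R M) x)
    (h2 : (oddPairing R M).br a z = algebraMap R (Ev R M) c₁)
    (h4 : (oddPairing R M).tri a z b = algebraMap R (Ev R M) m • ζ) :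
    ((oddPairing R M).tri u a z).1 = (c₁ / x) • ((oddPairing R M).tri u a b).1 -
      (m / x) • (((oddPairing R M).br u a).1 * ζ.1) := by
  set S := oddPairing R M with hS
  have key := S.br_smul_tri b a u z
  rw [← S.tri_rot b a z, h4, S.br_swap a b, h1, h2, S.tri_swap a b u, S.tri_rot u a b] at key
  have key2 : algebraMap R (Ev R M) x • S.tri u a z =
      algebraMap R (Ev R M) c₁ • S.tri u a b - algebraMap R (Ev R M) m • (S.br u a • ζ) := by
    linear_combination (norm := module) -key
  rw [od_eq_of_smul hx key2]
  change x⁻¹ • ((algebraMap R (Ev R M) c₁ • S.tri u a b : Od R M).1 -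
    (algebraMap R (Ev R M) m • (S.br u a • ζ) : Od R M).1) = _
  rw [algebraMap_smul_od, algebraMap_smul_od, coe_smul_od]
  simp only [smul_sub, smul_smul, div_eq_inv_mul]

end Third

/-- A step of the transfer process. -/
lemma tstate_succ_true {p k : ℕ} (hk : k ≤ n) (h : IsZVec n w q η g k) (hq : ∀ k, 0 < q k)
    (hw : w k = true) :
    tstate n w q g p (k + 1) 2 = tstate n w q g p k 2 ∧
    tstate n w q g p (k + 1) 1 = (q (k + 1) / q k) • tstate n w q g p k 1 +
      (q k)⁻¹ • (tstate n w q g p k 2 * (η k).1) ∧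
    tstate n w q g p (k + 1) 0 = (q (k + 1) ^ 2 / q k ^ 2) • tstate n w q g p k 0 +
      (q (k + 1) / q k ^ 2) • (tstate n w q g p k 1 * (η k).1) +
      (q k ^ 2)⁻¹ • tstate n w q g p k 2 := by
  obtain ⟨h1, h2, h3, h4⟩ := h
  have hne := (hq (k + 1)).ne'
  have hne' := (hq k).ne'
  rcases step_cases (n := n) (w := w) k with ⟨-, hr, hz, hc⟩ | ⟨hw', -⟩
  swap
  · rw [hw] at hw'; cases hw'
  have e1 : rp w (k + 1) = zp n w k := by omega
  have e2 : lp n w (k + 1) = lp n w k := by simp only [lp]; omega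
  rw [hw, if_pos rfl, ← map_one (algebraMap R (Ev R M))] at h2
  rw [hw, if_pos rfl] at h3
  simp only [tstate, if_true, one_ne_zero, if_false, OfNat.ofNat_ne_zero, OfNat.ofNat_ne_one]
  rw [e1, e2]
  refine ⟨rfl, ?_, ?_⟩
  · rw [tri_third_right (pow_ne_zero 2 hne') h1 h3 h4]
    simp only [smul_add, smul_smul]
    congr 2 <;> field_simp
  · rw [br_third (pow_ne_zero 2 hne') h1 h2 h3 h4]
    simp only [smul_smul, smul_mul_assoc]
    congr 3 <;> field_simp

lemma tstate_succ_false {p k : ℕ} (hk : k ≤ n) (h : IsZVec n w q η g k) (hq : ∀ k, 0 < q k)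
    (hw : w k = false) :
    tstate n w q g p (k + 1) 0 = tstate n w q g p k 0 ∧
    tstate n w q g p (k + 1) 1 = (q (k + 1) / q k) • tstate n w q g p k 1 -
      (q k)⁻¹ • (tstate n w q g p k 0 * (η k).1) ∧
    tstate n w q g p (k + 1) 2 = (q k ^ 2)⁻¹ • tstate n w q g p k 0 +
      (q (k + 1) / q k ^ 2) • (tstate n w q g p k 1 * (η k).1) +
      (q (k + 1) ^ 2 / q k ^ 2) • tstate n w q g p k 2 := by
  obtain ⟨h1, h2, h3, h4⟩ := h
  have hne := (hq (k + 1)).ne'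
  have hne' := (hq k).ne'
  rcases step_cases (n := n) (w := w) k with ⟨hw', -⟩ | ⟨-, hr, hz, hc⟩
  · rw [hw] at hw'; cases hw'
  have e1 : rp w (k + 1) = rp w k := by omega
  have e2 : lp n w (k + 1) = zp n w k := by simp only [lp]; omega
  rw [hw, if_neg (by simp), ← map_one (algebraMap R (Ev R M))] at h3
  rw [hw, if_neg (by simp)] at h2
  simp only [tstate, if_true, one_ne_zero, if_false, OfNat.ofNat_ne_zero, OfNat.ofNat_ne_one]
  rw [e1, e2]
  refine ⟨rfl, ?_, ?_⟩
  · rw [tri_third_left (pow_ne_zero 2 hne') h1 h2 h4]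
    simp only [smul_sub, smul_smul]
    congr 2 <;> field_simp
  · rw [br_third (pow_ne_zero 2 hne') h1 h2 h3 h4]
    simp only [smul_smul, smul_mul_assoc]
    congr 3 <;> field_simp

end Vectors

/-! ### Positivity of the pairings -/

section Positivity

variable {R : Type*} [Field R] [LinearOrder R] [IsStrictOrderedRing R]
  {M : Type*} [AddCommGroup M] [Module R M]
  {n : ℕ} {w : ℕ → Bool} {q : ℕ → R} {η : ℕ → Od R M} {g : ℕ → SVec (Ev R M) (Od R M)}

lemma algebraMapInv_od (ξ : Od R M) :
    ExteriorAlgebra.algebraMapInv (R := R) (M := M) ξ.1 = 0 := by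
  have h : ξ.1 * ξ.1 = 0 := congrArg Subtype.val ((oddPairing R M).self ξ)
  have := congrArg (ExteriorAlgebra.algebraMapInv (R := R) (M := M)) h
  rw [map_mul, map_zero] at this
  exact mul_self_eq_zero.mp this

/-- Odd elements have body zero, so on bodies the middle state drops out. What is left of a transfer
step has nonnegative coefficients and preserves positivity of both outer states. -/
lemma tstate_body_pos (hg : ∀ k ≤ n, IsZVec n w q η g k) (hq : ∀ k, 0 < q k) {p k : ℕ}
    (hp : p < k) (hk : k ≤ n + 1) :
    0 < ExteriorAlgebra.algebraMapInv (R := R) (M := M) (tstate n w q g p k 0) ∧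
    0 < ExteriorAlgebra.algebraMapInv (R := R) (M := M) (tstate n w q g p k 2) := by
  induction k, (show p + 1 ≤ k by omega) using Nat.le_induction with
  | base =>
    obtain ⟨h1, -, h2⟩ := tstate_first (by omega) (hg p (by omega)) hq
    have := hq p
    rw [h1, h2, ExteriorAlgebra.algebraMap_leftInverse, ExteriorAlgebra.algebraMap_leftInverse]
    constructor <;> split_ifs <;> positivity
  | succ k hpk ih =>
    obtain ⟨h0, h2⟩ := ih (by omega) (by omega)
    have := hq k
    have := hq (k + 1)
    cases hw : w k with
    | true =>
      obtain ⟨e2, -, e0⟩ := tstate_succ_true (p := p) (show k ≤ n by omega) (hg k (by omega)) hq hw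
      rw [e2, e0]
      simp only [map_add, map_smul, map_mul, algebraMapInv_od, mul_zero, add_zero,
        smul_eq_mul]
      exact ⟨by positivity, h2⟩
    | false =>
      obtain ⟨e0, -, e2⟩ := tstate_succ_false (p := p) (show k ≤ n by omega) (hg k (by omega)) hq hw
      rw [e2, e0]
      simp only [map_add, map_smul, map_mul, algebraMapInv_od, mul_zero, add_zero,
        smul_eq_mul]
      exact ⟨h0, by positivity⟩

variable {T : Finset (Sym2 (Fin (n + 3)))} {src : Fin (n + 3)}

/-- Every vertex that remains after step `p` is an end of some later arc: it is one of the current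
ends or becomes one when it is the apex `zp k`. There its pairing is an outer state. -/
lemma IsZig.body_cvec_pos (Z : IsZig T src w) (hg : ∀ k ≤ n, IsZVec n w q η g k)
    (hq : ∀ k, 0 < q k) {p y : ℕ} (hp : p ≤ n) (h1 : rp w (p + 1) ≤ y)
    (h2 : y ≤ rp w (p + 1) + (n + 2 - (p + 1))) :
    0 < body R M ((oddPairing R M).br (cvec n w g p) (g y)) := by
  have key : ∃ k, p < k ∧ k ≤ n + 1 ∧ (y = rp w k ∨ y = lp n w k) := by
    by_cases h3 : y = rp w (p + 1)
    · exact ⟨p + 1, by omega, by omega, Or.inl h3⟩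
    by_cases h4 : y = lp n w (p + 1)
    · exact ⟨p + 1, by omega, by omega, Or.inr h4⟩
    rw [lp] at h4
    obtain ⟨k, h5, h6, rfl⟩ := Z.exists_zp (k := p + 1) (y := y) (by omega) (by omega) (by omega)
    refine ⟨k + 1, by omega, by omega, ?_⟩
    have := step_cases (n := n) (w := w) k
    rw [lp]
    omega
  obtain ⟨k, hpk, hk, rfl | rfl⟩ := key
  · exact (tstate_body_pos hg hq hpk hk).1
  · exact (tstate_body_pos hg hq hpk hk).2

/-- The first of the two vertices to be cut off determines the argument. If it is `a`, its signed
vector is `g a`; if it is `b`, the vector is `-g b` and the sign is absorbed by antisymmetry. A pair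
that is never separated is the last edge. -/
lemma IsZig.body_br_pos (Z : IsZig T src w) (hg : ∀ k ≤ n, IsZVec n w q η g k)
    (hq : ∀ k, 0 < q k) {a b : ℕ} (hab : a < b) (hb : b < n + 3) :
    0 < body R M ((oddPairing R M).br (g a) (g b)) := by
  by_contra hno
  have main : ∀ k, k ≤ n + 1 → rp w k ≤ a ∧ b ≤ rp w k + (n + 2 - k) := by
    intro k
    induction k with
    | zero => intro _; simp only [rp_zero]; omega
    | succ k ih =>
      intro hk
      have ih := ih (by omega)
      rcases step_cases (n := n) (w := w) k with ⟨hw, hr, hz, hc⟩ | ⟨hw, hr, hz, hc⟩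
      · by_cases h : a = rp w k
        · exfalso
          have := Z.body_cvec_pos hg hq (p := k) (y := b) (by omega) (by omega) (by omega)
          rw [cvec, hw, if_pos rfl, hc, ← h] at this
          exact hno this
        · omega
      · by_cases h : b = rp w k + (n + 2 - k)
        · exfalso
          have := Z.body_cvec_pos hg hq (p := k) (y := a) (by omega) (by omega) (by omega)
          rw [cvec, hw, if_neg (by simp), hc, ← h, (oddPairing R M).br_neg_left,
            ← (oddPairing R M).br_swap] at this
          exact hno this
        · omega
  -- Now `a` and `b` are the ends of the final interval, which are `zp n` and `lp n` because the
  -- last letter is `true`. Their pairing is the prescribed `q (n + 1) ^ 2`.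
  have h := main (n + 1) le_rfl
  have h1 := (hg n le_rfl).br_zl
  have hc := step_cases (n := n) (w := w) n
  rw [Z.last, if_pos rfl] at h1
  have e : zp n w n = rp w (n + 1) := by
    have := Z.last
    rcases hc with hc | hc
    · omega
    · rw [hc.1] at this; cases this
  rw [e, lp, show rp w (n + 1) = a by omega, show rp w n + (n + 2 - n) = b by
    have := Z.last
    rcases hc with hc | hc
    · omega
    · rw [hc.1] at this; cases this] at h1
  apply hno
  rw [h1, body_algebraMap]
  have := hq (n + 1)
  positivity

/-- A boundary segment is the segment before `src`, or the side at which one of its ends is cut off,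
or the final edge. In each case the pairing was prescribed to be one. -/
lemma IsZig.br_side (Z : IsZig T src w) (hg : ∀ k ≤ n, IsZVec n w q η g k)
    (hq0 : q 0 = 1) (hqn : q (n + 1) = 1) {i j : Fin (n + 3)} (hs : IsSide s(i, j))
    (hij : pos src i < pos src j) :
    (oddPairing R M).br (g (pos src i)) (g (pos src j)) = 1 := by
  rw [isSide_iff_pos src] at hs
  have hj := pos_lt src j
  rcases (show (pos src i = 0 ∧ pos src j = n + 2) ∨ pos src i + 1 = pos src j by omega) with
    ⟨h1, h2⟩ | h
  · have := (hg 0 (by omega)).br_rl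
    rw [rp_zero, lp, rp_zero, hq0, one_pow, map_one] at this
    rw [h1, h2]
    simpa using this
  by_contra hno
  have main : ∀ k, k ≤ n + 1 → rp w k ≤ pos src i ∧ pos src j ≤ rp w k + (n + 2 - k) := by
    intro k
    induction k with
    | zero => intro _; simp only [rp_zero]; omega
    | succ k ih =>
      intro hk
      have ih := ih (by omega)
      rcases step_cases (n := n) (w := w) k with ⟨hw, hr, hz, hc⟩ | ⟨hw, hr, hz, hc⟩
      · by_cases h' : pos src i = rp w k
        · exfalso
          have := (hg k (by omega)).br_rz
          rw [hw, if_pos rfl, hz, ← h', h] at this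
          exact hno this
        · omega
      · by_cases h' : pos src j = rp w k + (n + 2 - k)
        · exfalso
          have := (hg k (by omega)).br_zl
          rw [hw, if_neg (by simp), hz, lp, ← h', ← h, Nat.add_sub_cancel, h] at this
          exact hno this
        · omega
  have hm := main (n + 1) le_rfl
  have h1 := (hg n le_rfl).br_zl
  rw [Z.last, if_pos rfl, hqn, one_pow, map_one] at h1
  rcases step_cases (n := n) (w := w) n with ⟨hw, hr, hz, hc⟩ | ⟨hw, -⟩
  · rw [hz, lp, show rp w n + 1 = pos src i by omega,
      show rp w n + (n + 2 - n) = pos src j by omega] at h1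
    exact hno h1
  · rw [Z.last] at hw; cases hw

lemma IsZig.exists_roots (Z : IsZig T src w) {η : ℕ → OdT T R}
    {g : ℕ → SVec (EvT T R) (OdT T R)} (hg : ∀ k ≤ n, IsZVec n w q η g k)
    (hq : ∀ k, 0 < q k) (hR : ∀ a : R, 0 ≤ a → IsSquare a) :
    ∃ ρ, IsRoots (T := T) (R := R) src (fun v => g (pos src v)) ρ := by
  have key : ∀ i j : Fin (n + 3), ∃ r : EvT T R, i ≠ j → 0 < bodyT T R r ∧
      r * r = sg src (EvT T R) i j * (pairT T R).br (g (pos src i)) (g (pos src j)) := by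
    intro i j
    by_cases hij : i = j
    · exact ⟨0, fun h => absurd hij h⟩
    have hpos : 0 < bodyT T R
        (sg src (EvT T R) i j * (pairT T R).br (g (pos src i)) (g (pos src j))) := by
      have hne : pos src i ≠ pos src j := fun h => hij ((pos_inj src).mp h)
      rw [sg]
      split_ifs with h
      · rw [one_mul]
        exact Z.body_br_pos hg hq h (pos_lt src j)
      · rw [neg_one_mul, ← (pairT T R).br_swap]
        exact Z.body_br_pos hg hq (by omega) (pos_lt src i)
    obtain ⟨r, h1, h2⟩ := exists_sqrt hR hpos
    exact ⟨r, fun _ => ⟨h1, h2⟩⟩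
  choose ρ hρ using key
  exact ⟨ρ, fun i j h => (hρ i j h).1, fun i j h => (hρ i j h).2⟩

end Positivity

/-! ### Compatibility of the initial chart -/

section InitialChart

variable {R : Type*} [Field R] [LinearOrder R] [IsStrictOrderedRing R]
  {n : ℕ} {w : ℕ → Bool} {T : Finset (Sym2 (Fin (n + 3)))} {src : Fin (n + 3)}

open Classical in
/-- The square roots of the lambda lengths of the arcs of a zigzag, by their number. -/
def arcRoot (src : Fin (n + 3)) (w : ℕ → Bool) (q : T → R) (k : ℕ) : R :=
  if h : 1 ≤ k ∧ k ≤ n ∧ gm src w k ∈ T then q ⟨gm src w k, h.2.2⟩ else 1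

lemma arcRoot_pos {q : T → R} (hq : ∀ i, 0 < q i) (k : ℕ) : 0 < arcRoot src w q k := by
  unfold arcRoot
  split_ifs
  · exact hq _
  · exact one_pos

/-- The numbers `0` and `n + 1` stand for the boundary segments at the two ends of the zigzag, which
have lambda length one. -/
lemma arcRoot_of_lt {q : T → R} {k : ℕ} (hk : k = 0 ∨ n < k) : arcRoot src w q k = 1 :=
  dif_neg (by omega)

lemma IsZig.arcRoot_eq (Z : IsZig T src w) {q : T → R} {k : ℕ} (h1 : 1 ≤ k) (h2 : k ≤ n) :
    arcRoot src w q k = q ⟨gm src w k, Z.gm_mem h1 h2⟩ := dif_pos ⟨h1, h2, Z.gm_mem h1 h2⟩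

open Classical in
/-- The odd variable of the `k`-th triangle, as an odd element. -/
def thetaOd (T : Finset (Sym2 (Fin (n + 3)))) (R : Type*) [Field R] [LinearOrder R]
    [IsStrictOrderedRing R] (src : Fin (n + 3)) (w : ℕ → Bool) (k : ℕ) : OdT T R :=
  if h : IsTriangle T (tg src w k) then
    ⟨theta ⟨tg src w k, h⟩, CliffordAlgebra.ι_mem_evenOdd_one _ _⟩ else 0

/-- The sign of the odd variable of the `k`-th triangle. -/
def sgn0 (E : Type*) [Ring E] (w : ℕ → Bool) (k : ℕ) : E := if k = 0 ∧ w 1 = false then -1 else 1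

lemma sgn0_sq {E : Type*} [Ring E] (k : ℕ) : sgn0 E w k * sgn0 E w k = 1 := by
  unfold sgn0; split_ifs <;> simp

/-- The signed odd variable of the `k`-th triangle. -/
def etaOd (T : Finset (Sym2 (Fin (n + 3)))) (R : Type*) [Field R] [LinearOrder R]
    [IsStrictOrderedRing R] (src : Fin (n + 3)) (w : ℕ → Bool) (k : ℕ) : OdT T R :=
  sgn0 (EvT T R) w k • thetaOd T R src w k

lemma IsZig.thetaOd_eq (Z : IsZig T src w) {k : ℕ} (hk : k ≤ n) :
    (thetaOd T R src w k).1 = theta ⟨tg src w k, Z.isTriangle_tg hk⟩ := by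
  rw [thetaOd, dif_pos (Z.isTriangle_tg hk)]

open Classical in
/-- The signs of the triangles for the initial chart. -/
def initSign (E : Type*) [Ring E] (src : Fin (n + 3)) (w : ℕ → Bool) (t : Finset (Fin (n + 3))) :
    E := if t = tg src w 0 ∧ w 1 = false then -1 else 1

lemma IsZig.initSign_tg (Z : IsZig T src w) {E : Type*} [Ring E] {k : ℕ} (hk : k ≤ n) :
    initSign E src w (tg src w k) = sgn0 E w k := by
  have : tg src w k = tg src w 0 ↔ k = 0 :=
    ⟨fun h => Z.tg_inj hk (by omega) h, fun h => by rw [h]⟩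
  simp only [initSign, sgn0, this]

lemma IsZig.hasEdge_iff (Z : IsZig T src w) {q : T → R} {C : Chart T R}
    (hC : IsInitialChart src q C) (i j : Fin (n + 3)) : C.HasEdge i j ↔ IsEdge T s(i, j) := by
  rw [Chart.HasEdge, hC.dir, hC.dir, IsEdge]
  constructor
  · rintro (h | h | h)
    · exact Or.inr h
    · exact Or.inl h.1
    · exact Or.inl (by rw [Sym2.eq_swap]; exact h.1)
  · rintro (h | h)
    · exact Or.inr (Z.exists_defaultDir h)
    · exact Or.inl h

lemma IsTriangulation.edges_not_cross (hT : IsTriangulation T) {i j k l : Fin (n + 3)}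
    (h1 : IsEdge T s(i, j)) (h2 : IsEdge T s(k, l)) (h3 : sbtw i k j) : ¬ sbtw j l i := by
  rcases h2 with h2 | h2
  · have := hT.edge_not_crosses h1 h2
    rw [crosses_mk_iff] at this
    exact fun h4 => this (Or.inl ⟨h3, h4⟩)
  · rw [isSide_iff_pos i] at h2
    simp only [sbtw_iff_pos i, pos_src] at *
    have := pos_lt i k
    have := pos_lt i l
    have := pos_lt i j
    omega

/-- The initial chart comes from the super vectors of the zigzag. -/
lemma IsZig.compat_init (Z : IsZig T src w) (hT : IsTriangulation T) {q : T → R}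
    (hq : ∀ i, 0 < q i) {g : ℕ → SVec (EvT T R) (OdT T R)}
    (hg : ∀ k ≤ n, IsZVec n w (arcRoot src w q) (etaOd T R src w) g k)
    {ρ : Fin (n + 3) → Fin (n + 3) → EvT T R}
    (hρ : IsRoots (T := T) (R := R) src (fun v => g (pos src v)) ρ) {C : Chart T R}
    (hC : IsInitialChart src q C) :
    Compat src (fun v => g (pos src v)) ρ (initSign _ src w) C := by
  have hE := Z.hasEdge_iff hC
  have hq' := arcRoot_pos (src := src) (w := w) hq
  have hnc : ∀ i j k l, C.HasEdge i j → C.HasEdge k l → sbtw i k j → ¬ sbtw j l i := by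
    intro i j k l h1 h2
    exact hT.edges_not_cross ((hE _ _).mp h1) ((hE _ _).mp h2)
  have hne : ∀ i j, C.HasEdge i j → i ≠ j := by
    rintro i j h rfl
    rcases (hE i i).mp h with h | h
    · exact (hT.isArc _ h).1 rfl
    · rw [isSide_iff_pos i] at h; omega
  have hroot : ∀ i j (c : R), pos src i < pos src j → 0 < c →
      (pairT T R).br (g (pos src i)) (g (pos src j)) = algebraMap R (EvT T R) (c ^ 2) →
      ρ i j = algebraMap R (EvT T R) c := by
    intro i j c h hc hbr
    have hij : i ≠ j := by rintro rfl; omega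
    refine sqrt_unique (hρ.body_pos i j hij) (by rwa [body_algebraMap]) ?_
    rw [hρ.sq i j hij, hbr, sg, if_pos h, one_mul, pow_two, map_mul]
  have hlam : ∀ i j, pos src i < pos src j → IsEdge T s(i, j) →
      C.lam s(i, j) = ((pairT T R).br (g (pos src i)) (g (pos src j))).1 := by
    intro i j hij h
    by_cases hs : IsSide s(i, j)
    · rw [hC.lam_side _ hs, Z.br_side hg (arcRoot_of_lt (Or.inl rfl))
        (arcRoot_of_lt (Or.inr (by omega))) hs hij]
      rfl
    · have h := h.resolve_right hs
      obtain ⟨k, h1, h2, h3⟩ := (Z.mem_iff_pos i j).mp h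
      have hb := Z.rp_lt_lp (j := k) (k := k) (by omega) (by omega)
      have h3' : pos src i = rp w k ∧ pos src j = rp w k + (n + 2 - k) := by omega
      have hgm : s(i, j) = gm src w k := (eq_gm_iff (by omega)).mpr (Or.inl h3')
      have := (hg k h2).br_rl
      rw [lp, ← h3'.2, ← h3'.1] at this
      rw [this, hC.lam_arc ⟨s(i, j), h⟩, Z.arcRoot_eq h1 h2]
      simp only [hgm]
      rfl
  refine ⟨fun i j h => hne i j (Or.inr (Or.inl h)), fun i j h => ?_, hnc, fun i j h => ?_, ?_, ?_, ?_⟩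
  · exact (hT.isArc _ ((hC.dir i j).mp h).1).2
  · have hij := hne i j h
    have hp : pos src i ≠ pos src j := fun h => hij ((pos_inj src).mp h)
    have he := (hE i j).mp h
    rw [hρ.sq i j hij, sg]
    split_ifs with h'
    · rw [one_mul, hlam i j h' he]
    · rw [neg_one_mul, ← (pairT T R).br_swap, Sym2.eq_swap, hlam j i (by omega)
        (by rwa [Sym2.eq_swap])]
  · intro t
    rw [initSign]; split_ifs <;> simp
  · have key : ∀ k ≤ n, IsMuInv (fun v => g (pos src v)) ρ (initSign (EvT T R) src w (tg src w k))
        (C.mu (tg src w k)) (vtx src (rp w k)) (vtx src (zp n w k)) (vtx src (lp n w k)) := by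
      intro k hk
      obtain ⟨p1, p2, p3⟩ := Z.pos_tg hk
      have hz := Z.zp_bounds hk
      obtain ⟨h1, h2, h3, h4⟩ := hg k hk
      refine ⟨thetaOd T R src w k, ?_, ?_⟩
      · rw [hC.mu ⟨_, Z.isTriangle_tg hk⟩, Z.thetaOd_eq hk]
      · rw [Z.initSign_tg hk]
        simp only [p1, p2, p3]
        rw [← lp, h4, etaOd, hρ.symm (i := vtx src (rp w k)) (j := vtx src (lp n w k)) (by
          intro h; rw [← pos_inj src] at h; omega)]
        have r1 : ρ (vtx src (rp w k)) (vtx src (lp n w k)) =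
            algebraMap R (EvT T R) (arcRoot src w q k) := by
          refine hroot _ _ _ (by omega) (hq' k) ?_
          rw [p1, p3, ← lp, h1]
        have r2 : ρ (vtx src (rp w k)) (vtx src (zp n w k)) =
            algebraMap R (EvT T R) (if w k then 1 else arcRoot src w q (k + 1)) := by
          refine hroot _ _ _ (by omega) (by split_ifs; exacts [one_pos, hq' _]) ?_
          rw [p1, p2, h2]
          split_ifs <;> simp
        have r3 : ρ (vtx src (zp n w k)) (vtx src (lp n w k)) =
            algebraMap R (EvT T R) (if w k then arcRoot src w q (k + 1) else 1) := by
          refine hroot _ _ _ (by omega) (by split_ifs; exacts [hq' _, one_pos]) ?_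
          rw [p2, p3, ← lp, h3]
          split_ifs <;> simp
        rw [r1, r2, r3, smul_comm (sgn0 (EvT T R) w k), smul_smul (sgn0 (EvT T R) w k), sgn0_sq,
          one_smul, ← map_mul, ← map_mul]
        congr 2
        split_ifs <;> ring
    have key2 : ∀ i j k : Fin (n + 3), pos src i < pos src j → pos src j < pos src k →
        IsEdge T s(i, j) → IsEdge T s(j, k) → IsEdge T s(k, i) →
        IsMuInv (fun v => g (pos src v)) ρ (initSign (EvT T R) src w {i, j, k})
        (C.mu {i, j, k}) i j k := by
      intro i j k h1 h2 e1 e2 e3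
      obtain ⟨m, hm, a1, a2, a3⟩ := Z.triangle_pos h1 h2 e1 e2 e3
      have := key m hm
      rw [tg, lp, ← a3, ← a1, ← a2, vtx_pos, vtx_pos, vtx_pos] at this
      exact this
    intro i j k h e1 e2 e3
    rw [hE] at e1 e2 e3
    rw [sbtw_iff_pos src] at h
    rcases h with h | h | h
    · exact key2 i j k h.1 h.2 e1 e2 e3
    · rw [triple_eq]; exact (key2 j k i h.1 h.2 e2 e3 e1).rot.rot
    · rw [← triple_eq]; exact (key2 k i j h.1 h.2 e3 e1 e2).rot
  · intro l r d u hlr hd hu eld edr eru eul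
    obtain ⟨k, hk1, hkn, hk⟩ := Z.defaultDir_cases ((hC.dir l r).mp hlr)
    obtain ⟨m, rfl⟩ : ∃ m, k = m + 1 := ⟨k - 1, by omega⟩
    have hmn : m ≤ n := by omega
    obtain ⟨p1, p2, p3⟩ := Z.pos_tg hkn
    obtain ⟨o1, o2, o3⟩ := Z.pos_tg hmn
    have hz := Z.zp_bounds hkn
    have hz' := Z.zp_bounds hmn
    have E1 := Z.tg_edges hkn
    have E2 := Z.tg_edges hmn
    have E3 := Z.isEdge_gm (k := m) (by omega)
    set vR := vtx src (rp w (m + 1)) with hvR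
    set vL := vtx src (lp n w (m + 1)) with hvL
    set vz := vtx src (zp n w (m + 1)) with hvz
    -- the vertex cut off at step `m`
    obtain ⟨vc, hcR, hcL, hct, hcp⟩ : ∃ vc, IsEdge T s(vc, vR) ∧ IsEdge T s(vc, vL) ∧
        ({vR, vL, vc} : Finset (Fin (n + 3))) = tg src w m ∧ pos src vc = cp n w m := by
      rcases step_cases (n := n) (w := w) m with ⟨_, hr, hz2, hc⟩ | ⟨_, hr, hz2, hc⟩
      · have e1 : vR = vtx src (zp n w m) := by rw [hvR]; congr 1; omega
        have e2 : vL = vtx src (lp n w m) := by rw [hvL, lp, lp]; congr 1; omega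
        refine ⟨vtx src (rp w m), by rw [e1]; exact E2.1, by rw [e2]; exact E3, ?_, by omega⟩
        rw [tg, e1, e2, ← triple_eq]
      · have e1 : vR = vtx src (rp w m) := by rw [hvR, hr]
        have e2 : vL = vtx src (zp n w m) := by rw [hvL, lp]; congr 1; omega
        refine ⟨vtx src (lp n w m), by rw [e1, Sym2.eq_swap]; exact E3,
          by rw [e2, Sym2.eq_swap]; exact E2.2, ?_, by omega⟩
        rw [tg, e1, e2]
    have hzt : ({vR, vL, vz} : Finset (Fin (n + 3))) = tg src w (m + 1) := by
      rw [tg, triple_swap_right]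
    have hcs := step_cases (n := n) (w := w) m
    have sc : sbtw vR vL vc := by rw [sbtw_iff_pos src]; omega
    have sz : sbtw vL vR vz := by rw [sbtw_iff_pos src]; omega
    have F1 : C.HasEdge vR vz := (hE _ _).mpr E1.1
    have F2 : C.HasEdge vz vL := (hE _ _).mpr E1.2
    have F3 : C.HasEdge vc vR := (hE _ _).mpr hcR
    have F4 : C.HasEdge vc vL := (hE _ _).mpr hcL
    have hs1 : sgn0 (EvT T R) w (m + 1) = 1 := if_neg (by omega)
    have hrp1 := rp_one Z.first
    rcases hk with ⟨hw, hl, hr⟩ | ⟨hw, hl, hr⟩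
    · obtain rfl : l = vL := (pos_inj src).mp (by omega)
      obtain rfl : r = vR := (pos_inj src).mp (by omega)
      obtain rfl : d = vc := unique_apex hnc (sbtw_rot (sbtw_rot hd)) sc eld edr F4.symm F3
      obtain rfl : u = vz := unique_apex hnc hu sz eru eul F1 F2
      rw [triple_swap vL vR d, triple_swap vL vR vz, hct, hzt, Z.initSign_tg hmn, Z.initSign_tg hkn,
        hs1, mul_one]
      rcases Nat.eq_zero_or_pos m with rfl | hm
      · rw [if_pos rfl] at hw
        rw [sgn0, hw, if_neg (by simp), sg, if_pos]
        have : cp n w 0 = 0 := by simp [cp, Z.first, rp]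
        omega
      · rw [if_neg (by omega), Nat.add_sub_cancel] at hw
        rw [sgn0, if_neg (by omega), sg, if_pos]
        rcases hcs with hcs | hcs
        · omega
        · rw [hcs.1] at hw; cases hw
    · obtain rfl : l = vR := (pos_inj src).mp (by omega)
      obtain rfl : r = vL := (pos_inj src).mp (by omega)
      obtain rfl : d = vz := unique_apex hnc (sbtw_rot (sbtw_rot hd)) sz eld edr F1 F2
      obtain rfl : u = vc := unique_apex hnc hu sc eru eul F4.symm F3
      rw [hct, hzt, Z.initSign_tg hmn, Z.initSign_tg hkn, hs1, one_mul]
      rcases Nat.eq_zero_or_pos m with rfl | hm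
      -- The first arc is directed by its common vertex with the second arc instead of by the letter
      -- `w 0`. If `w 1` is `false` this reverses it, and the sign `-1` of the ear at `src`
      -- compensates.
      · rw [if_pos rfl] at hw
        rw [sgn0, hw, if_pos ⟨rfl, rfl⟩, sg, if_neg]
        have : cp n w 0 = 0 := by simp [cp, Z.first, rp]
        omega
      · rw [if_neg (by omega), Nat.add_sub_cancel] at hw
        rw [sgn0, if_neg (by omega), sg, if_pos]
        rcases hcs with hcs | hcs
        · rw [hcs.1] at hw; cases hw
        · omega

end InitialChart

/-! ### Lambda lengths as pairings of super vectors -/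

section LambdaLength

variable {R : Type*} [Field R] [LinearOrder R] [IsStrictOrderedRing R]
  {n : ℕ} {w : ℕ → Bool} {T : Finset (Sym2 (Fin (n + 3)))} {src : Fin (n + 3)}

open Classical in
lemma exists_initialChart (hT : IsTriangulation T) (src : Fin (n + 3)) (q : T → R) :
    ∃ C : Chart T R, IsInitialChart src q C := by
  refine ⟨⟨defaultDir T src, fun e => if h : e ∈ T then algebraMap R _ (q ⟨e, h⟩ ^ 2) else 1,
    fun t => if h : IsTriangle T t then theta ⟨t, h⟩ else 0⟩, fun i j => Iff.rfl, fun e => ?_,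
    fun e he => ?_, fun t => ?_⟩
  · simp
  · exact dif_neg fun h => (hT.isArc e h).2 he
  · exact dif_pos t.2

lemma IsZig.cut_edges (Z : IsZig T src w) {m : ℕ} (hm : m ≤ n) :
    IsEdge T s(vtx src (cp n w m), vtx src (rp w (m + 1))) ∧
    IsEdge T s(vtx src (cp n w m), vtx src (lp n w (m + 1))) := by
  have E2 := Z.tg_edges hm
  have E3 := Z.isEdge_gm (k := m) (by omega)
  rcases step_cases (n := n) (w := w) m with ⟨_, hr, hz, hc⟩ | ⟨_, hr, hz, hc⟩
  · rw [show lp n w (m + 1) = lp n w m by simp only [lp]; omega, hc,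
      show rp w (m + 1) = zp n w m by omega]
    exact ⟨E2.1, E3⟩
  · rw [show lp n w (m + 1) = zp n w m by simp only [lp]; omega, hc, hr, ← lp,
      Sym2.eq_swap (a := vtx src (lp n w m)), Sym2.eq_swap (a := vtx src (lp n w m))]
    exact ⟨E3, E2.2⟩

/-- Flipping the arcs `p + 1, …, k - 1` in this order builds a fan at the vertex `cp p`. Each flip
takes place in the quadrilateral formed by the next triangle and the last triangle of the fan, and
the new diagonal ends at the vertex `zp` of the former. -/
lemma IsZig.exists_chart (Z : IsZig T src w) (hT : IsTriangulation T)
    (hR : ∀ a : R, 0 ≤ a → IsSquare a) {f : Fin (n + 3) → SVec (EvT T R) (OdT T R)}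
    {ρ : Fin (n + 3) → Fin (n + 3) → EvT T R} (hρ : IsRoots src f ρ)
    {ε : Finset (Fin (n + 3)) → EvT T R} {q : T → R} {C₀ : Chart T R}
    (h0 : IsInitialChart src q C₀) (hC₀ : Compat src f ρ ε C₀) {p k : ℕ} (hpk : p < k)
    (hk : k ≤ n + 1) : ∃ C, Relation.ReflTransGen Flip C₀ C ∧
      C.HasEdge (vtx src (cp n w p)) (vtx src (rp w k)) ∧
      C.HasEdge (vtx src (cp n w p)) (vtx src (lp n w k)) ∧
      ∀ i j, IsEdge T s(i, j) → (∀ m, p < m → m < k → s(i, j) ≠ gm src w m) → C.HasEdge i j := by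
  have hE := Z.hasEdge_iff h0
  induction k, (show p + 1 ≤ k by omega) using Nat.le_induction with
  | base =>
    have := Z.cut_edges (show p ≤ n by omega)
    exact ⟨C₀, Relation.ReflTransGen.refl, (hE _ _).mpr this.1, (hE _ _).mpr this.2,
      fun i j h _ => (hE i j).mpr h⟩
  | succ k hk' ih =>
    obtain ⟨C, hr, e1, e2, hold⟩ := ih (by omega) (by omega)
    obtain ⟨ε', hC⟩ := hC₀.reachable hρ hr
    have hkn : k ≤ n := by omega
    obtain ⟨p1, p2, p3⟩ := Z.pos_tg hkn
    have hz := Z.zp_bounds hkn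
    obtain ⟨-, b2, -, -, b5, -⟩ := Z.ar_bounds (show p < k by omega) hkn
    have hc := b2 k (by omega) (by omega)
    have pc := pos_vtx src b5
    set c := vtx src (cp n w p)
    have hedge : ∀ i j, IsEdge T s(i, j) → rp w k ≤ pos src i → pos src i ≤ rp w k + (n + 2 - k) →
        rp w k ≤ pos src j → pos src j ≤ rp w k + (n + 2 - k) → C.HasEdge i j := by
      intro i j h a1 a2 a3 a4
      refine hold i j h fun m hm hmk hg => ?_
      rw [eq_gm_iff (by omega)] at hg
      have := rp_bounds (w := w) hmk.le
      omega
    have E := Z.tg_edges hkn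
    have hgT := Z.gm_mem (show 1 ≤ k by omega) hkn
    obtain ⟨C', hF, hE'⟩ := hC.exists_flip hR hρ (x := vtx src (rp w k)) (y := vtx src (zp n w k))
      (z := vtx src (lp n w k)) (w := c) (Z.sbtw_tg hkn) (by rw [sbtw_iff_pos src]; omega)
      (hedge _ _ (Z.isEdge_gm (by omega)) (by omega) (by omega) (by omega) (by omega))
      (hT.isArc _ hgT).2
      (hedge _ _ E.1 (by omega) (by omega) (by omega) (by omega))
      (hedge _ _ E.2 (by omega) (by omega) (by omega) (by omega)) e2.symm e1
    have ne : ∀ x, s(c, x) ≠ s(vtx src (rp w k), vtx src (lp n w k)) := by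
      intro x h
      change s(c, x) = gm src w k at h
      rw [eq_gm_iff (by omega)] at h
      omega
    have hnew : C'.HasEdge c (vtx src (zp n w k)) := (hE' _ _).mpr (Or.inl Sym2.eq_swap)
    have e1' : C'.HasEdge c (vtx src (rp w k)) := (hE' _ _).mpr (Or.inr ⟨e1, ne _⟩)
    have e2' : C'.HasEdge c (vtx src (lp n w k)) := (hE' _ _).mpr (Or.inr ⟨e2, ne _⟩)
    refine ⟨C', hr.tail hF, ?_, ?_, ?_⟩
    · rcases step_cases (n := n) (w := w) k with ⟨_, hr, hz, hc⟩ | ⟨_, hr, hz, hc⟩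
      · rwa [hr, ← hz]
      · rwa [hr]
    · rcases step_cases (n := n) (w := w) k with ⟨_, hr, hz, hc⟩ | ⟨_, hr, hz, hc⟩
      · rwa [show lp n w (k + 1) = lp n w k by simp only [lp]; omega]
      · rwa [show lp n w (k + 1) = zp n w k by simp only [lp]; omega]
    · intro i j h hm
      exact (hE' i j).mpr (Or.inr ⟨hold i j h fun m h1 h2 => hm m h1 (by omega),
        hm k (by omega) (by omega)⟩)

/-- The super lambda length of an arc outside of the zigzag is the pairing of the super vectors at
its ends. -/
lemma IsZig.isSuperLambdaLength_iff (Z : IsZig T src w) (hT : IsTriangulation T)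
    (hR : ∀ a : R, 0 ≤ a → IsSquare a) {q : T → R} (hq : ∀ i, 0 < q i)
    {g : ℕ → SVec (EvT T R) (OdT T R)}
    (hg : ∀ k ≤ n, IsZVec n w (arcRoot src w q) (etaOd T R src w) g k) {p k : ℕ} (hpk : p < k)
    (hk : k ≤ n) (har : ¬ IsSide (ar src w p k)) (y : Super T R) :
    IsSuperLambdaLength src q (ar src w p k) y ↔
      y = ((pairT T R).br (cvec n w g p) (g (zp n w k))).1 := by
  obtain ⟨ρ, hρ⟩ := Z.exists_roots hg (arcRoot_pos hq) hR
  obtain ⟨b1, b2, b3, b4, b5, b6⟩ := Z.ar_bounds hpk hk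
  have pc := pos_vtx src b5
  have pz := pos_vtx src b6
  have hne : vtx src (cp n w p) ≠ vtx src (zp n w k) := by
    intro h
    rw [← pos_inj src, pc, pz] at h
    have := b3 (p + 1) (by omega)
    have := b2 (p + 1) (by omega) (by omega)
    omega
  -- If `w p` is `false`, then `cp p` comes after `zp k` and the sign of the pair is `-1`. The sign
  -- in `cvec` is the same.
  have val : ∀ {ε} {C : Chart T R}, Compat src (fun v => g (pos src v)) ρ ε C →
      C.HasEdge (vtx src (cp n w p)) (vtx src (zp n w k)) →
      C.lam (ar src w p k) = ((pairT T R).br (cvec n w g p) (g (zp n w k))).1 := by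
    intro ε C hC h
    rw [ar, hC.lam _ _ h, hρ.sq _ _ hne, pc, pz, sg, cvec, pc, pz]
    have := b3 p (by omega)
    rcases step_cases (n := n) (w := w) p with ⟨hw, hr, hz, hc⟩ | ⟨hw, hr, hz, hc⟩
    · rw [if_pos (by omega), hw, if_pos rfl, one_mul]
    · rw [if_neg (by omega), hw, if_neg (by simp), (pairT T R).br_neg_left, neg_one_mul]
  constructor
  · rintro ⟨C₀, C, h0, hr, ⟨i, j, hij, hd⟩, rfl⟩
    obtain ⟨ε, hC⟩ := (Z.compat_init hT hq hg hρ h0).reachable hρ hr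
    refine val hC ?_
    have h : C.HasEdge i j := Or.inr (Or.inl hd)
    rcases Sym2.eq_iff.mp hij with ⟨h1, h2⟩ | ⟨h1, h2⟩
    · rwa [h1, h2]
    · rw [h1, h2]; exact h.symm
  · rintro rfl
    obtain ⟨C₀, h0⟩ := exists_initialChart hT src q
    have hC₀ := Z.compat_init hT hq hg hρ h0
    obtain ⟨C, hr, e1, e2, -⟩ := Z.exists_chart hT hR hρ h0 hC₀ (show p < k + 1 by omega) (by omega)
    have he : C.HasEdge (vtx src (cp n w p)) (vtx src (zp n w k)) := by
      rcases step_cases (n := n) (w := w) k with ⟨_, hr, hz, hc⟩ | ⟨_, hr, hz, hc⟩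
      · rwa [hz, ← hr]
      · rwa [show zp n w k = lp n w (k + 1) by simp only [lp]; omega]
    obtain ⟨ε, hC⟩ := hC₀.reachable hρ hr
    refine ⟨C₀, C, h0, hr, ?_, val hC he⟩
    rcases he with h | h | h
    · exact absurd h har
    · exact ⟨_, _, rfl, h⟩
    · exact ⟨_, _, Sym2.eq_swap, h⟩

end LambdaLength

/-! ### The transfer process as a sum over paths -/

section Paths

variable {R : Type*} [Field R] [LinearOrder R] [IsStrictOrderedRing R]
  {M : Type*} [AddCommGroup M] [Module R M]
  {n : ℕ} {w : ℕ → Bool} {q : ℕ → R} {η : ℕ → Od R M} {g : ℕ → SVec (Ev R M) (Od R M)}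

/-- The states `e`, `e'` may follow each other at step `k`. -/
def Adm (w : ℕ → Bool) (k e e' : ℕ) : Prop := if w k then e' ≤ e else e ≤ e'

instance (w : ℕ → Bool) (k e e' : ℕ) : Decidable (Adm w k e e') := by unfold Adm; infer_instance

/-- The scalar weight of step `k` from state `e` to `e'`. -/
def bw (w : ℕ → Bool) (q : ℕ → R) (k e e' : ℕ) : R :=
  if w k then q (k + 1) ^ (2 - e) * q k ^ e' else q (k + 1) ^ e * q k ^ (2 - e')

/-- The odd factor of step `k` from state `e` to `e'`. -/
def oddf (w : ℕ → Bool) (η : ℕ → Od R M) (k e e' : ℕ) : ExteriorAlgebra R M :=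
  if e = 1 then (if e' = 1 then 1 else (η k).1) else (if e' = 1 then tau R w k • (η k).1 else 1)

/-- The state before the first step. -/
def lb (w : ℕ → Bool) (p : ℕ) : ℕ := if w p then 2 else 0

/-- The state after the last step. -/
def rb (w : ℕ → Bool) (k : ℕ) : ℕ := if w k then 0 else 2

/-- The state just after the cut has the shape of an ordinary transfer step out of the extreme state
`lb`, except that the factor `1 / q²` is missing. -/
lemma tstate_one {p : ℕ} (hp : p ≤ n) (h : IsZVec n w q η g p) (hq : ∀ k, 0 < q k) {e : ℕ}
    (he : e ∈ Finset.range 3) :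
    tstate n w q g p (p + 1) e = bw w q p (lb w p) e • oddf w η p (lb w p) e := by
  obtain ⟨h0, h1, h2⟩ := tstate_first hp h hq
  rw [Finset.mem_range] at he
  have he : e = 0 ∨ e = 1 ∨ e = 2 := by omega
  cases hw : w p <;> simp only [hw, Bool.false_eq_true, if_true, if_false] at h0 h2
  · rcases he with rfl | rfl | rfl
    · simp [bw, lb, oddf, hw, h0, Algebra.algebraMap_eq_smul_one]
    · simp [bw, lb, oddf, hw, h1, tau]
    · simp [bw, lb, oddf, hw, h2]
  · rcases he with rfl | rfl | rfl
    · simp [bw, lb, oddf, hw, h0]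
    · simp [bw, lb, oddf, hw, h1, tau]
    · simp [bw, lb, oddf, hw, h2, Algebra.algebraMap_eq_smul_one]

/-- The two kinds of steps in one form: the transfer matrix is triangular, and the letter of `w`
decides whether it is lower or upper. Its entries factor into a scalar weight and an odd factor. -/
lemma tstate_succ {p k : ℕ} (hk : k ≤ n) (h : IsZVec n w q η g k) (hq : ∀ k, 0 < q k) {e' : ℕ}
    (he : e' ∈ Finset.range 3) :
    tstate n w q g p (k + 1) e' = ∑ e ∈ Finset.range 3,
      (if Adm w k e e' then (q k ^ 2)⁻¹ * bw w q k e e' else 0) •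
        (tstate n w q g p k e * oddf w η k e e') := by
  have hne := (hq (k + 1)).ne'
  have hne' := (hq k).ne'
  rw [Finset.mem_range] at he
  have he : e' = 0 ∨ e' = 1 ∨ e' = 2 := by omega
  simp only [Finset.sum_range_succ, Finset.sum_range_zero, zero_add]
  cases hw : w k with
  | true =>
    obtain ⟨h2, h1, h0⟩ := tstate_succ_true (p := p) hk h hq hw
    rcases he with rfl | rfl | rfl
    · simp [Adm, bw, oddf, hw, h0, div_eq_inv_mul]
    · simp [Adm, bw, oddf, tau, hw, h1, div_eq_inv_mul]
      congr 2 <;> field_simp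
    · simp [Adm, bw, oddf, hw, h2, hne']
  | false =>
    obtain ⟨h0, h1, h2⟩ := tstate_succ_false (p := p) hk h hq hw
    rcases he with rfl | rfl | rfl
    · simp [Adm, bw, oddf, hw, h0, hne']
    · simp [Adm, bw, oddf, tau, hw, h1, div_eq_inv_mul]
      match_scalars <;> field_simp
    · simp [Adm, bw, oddf, hw, h2, div_eq_inv_mul]

open Classical in
/-- The paths of states `e p, …, e (p + j)` with first state `lb`, extended by zero. -/
def paths (w : ℕ → Bool) (p : ℕ) : ℕ → Finset (ℕ → ℕ)
  | 0 => {Function.update (fun _ => 0) p (lb w p)}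
  | j + 1 => (paths w p j ×ˢ Finset.range 3).image fun x => Function.update x.1 (p + (j + 1)) x.2

open Classical in
lemma mem_paths {p j : ℕ} {e : ℕ → ℕ} : e ∈ paths w p j ↔ e p = lb w p ∧
    (∀ m, p < m → m ≤ p + j → e m ≤ 2) ∧ ∀ m, m < p ∨ p + j < m → e m = 0 := by
  induction j generalizing e with
  | zero =>
    rw [paths, Finset.mem_singleton]
    constructor
    · rintro rfl
      refine ⟨by simp, fun m h1 h2 => by omega, fun m h => ?_⟩
      rw [Function.update_of_ne (by omega)]
    · rintro ⟨h1, -, h2⟩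
      funext m
      by_cases h : m = p
      · subst h; simp [h1]
      · rw [Function.update_of_ne h, h2 m (by omega)]
  | succ j ih =>
    rw [paths, Finset.mem_image]
    constructor
    · rintro ⟨⟨e', x⟩, hx, rfl⟩
      rw [Finset.mem_product, ih, Finset.mem_range] at hx
      obtain ⟨⟨h1, h2, h3⟩, h4⟩ := hx
      refine ⟨?_, fun m hm hm' => ?_, fun m hm => ?_⟩
      · rw [Function.update_of_ne (by omega), h1]
      · by_cases h : m = p + (j + 1)
        · subst h; rw [Function.update_self]; simp only at h4; omega
        · rw [Function.update_of_ne h]; exact h2 m hm (by omega)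
      · rw [Function.update_of_ne (by omega)]; exact h3 m (by omega)
    · rintro ⟨h1, h2, h3⟩
      refine ⟨(Function.update e (p + (j + 1)) 0, e (p + (j + 1))), ?_, by simp⟩
      rw [Finset.mem_product, ih, Finset.mem_range]
      dsimp only
      refine ⟨⟨?_, fun m hm hm' => ?_, fun m hm => ?_⟩, ?_⟩
      · rw [Function.update_of_ne (by omega), h1]
      · rw [Function.update_of_ne (by omega)]; exact h2 m hm (by omega)
      · by_cases h : m = p + (j + 1)
        · subst h; simp
        · rw [Function.update_of_ne h]; exact h3 m (by omega)
      · have := h2 (p + (j + 1)) (by omega) (by omega)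
        omega

/-- The scalar weight of a path. -/
def pathScalar (w : ℕ → Bool) (q : ℕ → R) (p j : ℕ) (e : ℕ → ℕ) : R :=
  ∏ m ∈ Finset.range j, (if Adm w (p + m) (e (p + m)) (e (p + m + 1)) then
    (if m = 0 then 1 else (q (p + m) ^ 2)⁻¹) * bw w q (p + m) (e (p + m)) (e (p + m + 1)) else 0)

/-- The odd weight of a path. -/
def pathOdd (w : ℕ → Bool) (η : ℕ → Od R M) (p j : ℕ) (e : ℕ → ℕ) : ExteriorAlgebra R M :=
  ((List.range j).map fun m => oddf w η (p + m) (e (p + m)) (e (p + m + 1))).prod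

lemma pathScalar_congr {p j : ℕ} {e e' : ℕ → ℕ} (h : ∀ m, m ≤ p + j → e m = e' m) :
    pathScalar w q p j e = pathScalar w q p j e' := by
  refine Finset.prod_congr rfl fun m hm => ?_
  rw [Finset.mem_range] at hm
  rw [h (p + m) (by omega), h (p + m + 1) (by omega)]

lemma pathOdd_congr {p j : ℕ} {e e' : ℕ → ℕ} (h : ∀ m, m ≤ p + j → e m = e' m) :
    pathOdd w η p j e = pathOdd w η p j e' := by
  refine congrArg List.prod (List.map_congr_left fun m hm => ?_)
  rw [List.mem_range] at hm
  rw [h (p + m) (by omega), h (p + m + 1) (by omega)]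

-- Expansion of the product of the transfer matrices. Odd factors do not commute, so they are kept
-- as a list product in the order of the steps.
open Classical in
lemma tstate_eq_sum (hg : ∀ k ≤ n, IsZVec n w q η g k) (hq : ∀ k, 0 < q k) {p j x : ℕ}
    (hj : 1 ≤ j) (hpj : p + j ≤ n + 1) (hx : x ∈ Finset.range 3) :
    tstate n w q g p (p + j) x = ∑ e ∈ paths w p j with e (p + j) = x,
      pathScalar w q p j e • pathOdd w η p j e := by
  -- Since paths are zero beyond their last position, a longer path with given last state is the
  -- same as a shorter path, and its weights gain one factor.
  have step : ∀ j x, x ∈ Finset.range 3 →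
      ∑ e ∈ paths w p (j + 1) with e (p + (j + 1)) = x,
        pathScalar w q p (j + 1) e • pathOdd w η p (j + 1) e =
      ∑ e ∈ paths w p j, (pathScalar w q p j e *
        (if Adm w (p + j) (e (p + j)) x then
          (if j = 0 then 1 else (q (p + j) ^ 2)⁻¹) * bw w q (p + j) (e (p + j)) x else 0)) •
        (pathOdd w η p j e * oddf w η (p + j) (e (p + j)) x) := by
    intro j x hx
    symm
    refine Finset.sum_bij (fun e _ => Function.update e (p + (j + 1)) x) ?_ ?_ ?_ ?_
    · intro e he
      rw [Finset.mem_filter]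
      exact ⟨Finset.mem_image.mpr ⟨(e, x), Finset.mem_product.mpr ⟨he, hx⟩, rfl⟩, by simp⟩
    · intro e he e' he' h
      funext m
      by_cases hm : m = p + (j + 1)
      · rw [(mem_paths.mp he).2.2 m (by omega), (mem_paths.mp he').2.2 m (by omega)]
      · have := congrFun h m
        rwa [Function.update_of_ne hm, Function.update_of_ne hm] at this
    · intro e he
      rw [Finset.mem_filter, paths, Finset.mem_image] at he
      obtain ⟨⟨⟨e', y⟩, h1, rfl⟩, h2⟩ := he
      rw [Function.update_self] at h2
      exact ⟨e', (Finset.mem_product.mp h1).1, by simp only at h2 ⊢; rw [h2]⟩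
    · intro e he
      have hc : ∀ m, m ≤ p + j → e m = Function.update e (p + (j + 1)) x m := by
        intro m hm
        rw [Function.update_of_ne (by omega)]
      rw [pathScalar_congr hc, pathOdd_congr hc]
      conv_rhs => rw [pathScalar, pathOdd, Finset.prod_range_succ, List.range_succ, List.map_append,
        List.prod_append]
      rw [List.map_singleton, List.prod_singleton, ← pathScalar, ← pathOdd, ← hc _ le_rfl,
        show p + j + 1 = p + (j + 1) by omega, Function.update_self]
  induction j, hj using Nat.le_induction generalizing x with
  | base =>
    rw [step 0 x hx, tstate_one (by omega) (hg p (by omega)) hq hx]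
    have hlb : Adm w p (lb w p) x := by
      rw [Finset.mem_range] at hx
      unfold Adm lb
      split_ifs <;> omega
    simp [paths, pathScalar, pathOdd, hlb]
  | succ j hj ih =>
    rw [step j x hx, show p + (j + 1) = p + j + 1 by omega,
      tstate_succ (by omega) (hg (p + j) (by omega)) hq hx]
    rw [← Finset.sum_fiberwise_of_maps_to (s := paths w p j) (t := Finset.range 3)
      (g := fun e => e (p + j)) (fun e he => by
        have := (mem_paths.mp he).2.1 (p + j) (by omega) le_rfl
        rw [Finset.mem_range]; omega)]
    refine Finset.sum_congr rfl fun y hy => ?_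
    rw [ih (by omega) hy, Finset.sum_mul, Finset.smul_sum]
    refine Finset.sum_congr rfl fun e he => ?_
    rw [Finset.mem_filter] at he
    rw [he.2, if_neg (show j ≠ 0 by omega), smul_mul_assoc, smul_smul, mul_comm]

/-- The vertex `zp k` is the end of arc `k + 1` that has just moved, so its pairing is one of the
two outer states there; `rb` names which one. -/
lemma br_eq_tstate {p k : ℕ} (hk : k ≤ n + 1) :
    ((oddPairing R M).br (cvec n w g p) (g (zp n w k))).1 =
      tstate n w q g p (k + 1) (rb w k) := by
  rcases step_cases (n := n) (w := w) k with ⟨hw, hr, hz, hc⟩ | ⟨hw, hr, hz, hc⟩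
  · rw [rb, hw, if_pos rfl, tstate, if_pos rfl, hr, hz]
  · rw [rb, hw, if_neg (by simp), tstate, if_neg (by simp), if_neg (by simp), hz, lp, hr,
      show rp w k + (n + 2 - k) - 1 = rp w k + (n + 2 - (k + 1)) by omega]

end Paths

/-! ### Generators of the algebra `Λ ⊗ ℂ[ε]/(ε²)` -/

section Generators

variable {n : ℕ} {T : Finset (Sym2 (Fin (n + 3)))}

/-- An arrow as an element of the Jacobian algebra. -/
def arrowJ (e f : T) (h : Arrow T e f) : Jac T := Jac.mk T (preArrow T e f h)

/-- An arrow as an element of `Λ ⊗ ℂ[ε]/(ε²)`. -/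
def arrowD (e f : T) (h : Arrow T e f) : JacD T :=
  (JacD.equiv T).symm (arrowJ e f h ⊗ₜ[ℂ] (1 : DualNumber ℂ))

lemma Jac.mk_rel {x y : FreeAlgebra ℂ (Gen T)} (h : JacRel T x y) : Jac.mk T x = Jac.mk T y :=
  RingQuot.mkAlgHom_rel ℂ h

lemma Jac.lift_mk {B : Type} [Ring B] [Algebra ℂ B] (f : FreeAlgebra ℂ (Gen T) →ₐ[ℂ] B)
    (hf : ∀ ⦃x y⦄, JacRel T x y → f x = f y) (x : FreeAlgebra ℂ (Gen T)) :
    Jac.lift f hf (Jac.mk T x) = f x :=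
  RingQuot.liftAlgHom_mkAlgHom_apply ..

lemma vertexIdem_mul_self (e : T) : vertexIdem T e * vertexIdem T e = vertexIdem T e := by
  rw [vertexIdem, ← map_mul]; exact Jac.mk_rel (.idem e)

lemma vertexIdem_mul_of_ne {e f : T} (h : e ≠ f) : vertexIdem T e * vertexIdem T f = 0 := by
  rw [vertexIdem, vertexIdem, ← map_mul, ← map_zero (Jac.mk T)]; exact Jac.mk_rel (.orth e f h)

lemma sum_vertexIdem : ∑ e, vertexIdem T e = 1 := by
  simp only [vertexIdem]; rw [← map_sum, ← map_one (Jac.mk T)]; exact Jac.mk_rel .unit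

lemma vertexIdem_mul_arrowJ (e f : T) (h : Arrow T e f) :
    vertexIdem T f * arrowJ e f h = arrowJ e f h := by
  rw [vertexIdem, arrowJ, ← map_mul]; exact Jac.mk_rel (.target e f h)

lemma arrowJ_mul_vertexIdem (e f : T) (h : Arrow T e f) :
    arrowJ e f h * vertexIdem T e = arrowJ e f h := by
  rw [vertexIdem, arrowJ, ← map_mul]; exact Jac.mk_rel (.source e f h)

lemma Jac.mk_surjective : Function.Surjective (Jac.mk T) := RingQuot.mkAlgHom_surjective ℂ (JacRel T)

/-- Induction over the elements of the Jacobian algebra. -/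
lemma Jac.induction {P : Jac T → Prop} (hs : ∀ c : ℂ, P (algebraMap ℂ _ c))
    (hv : ∀ e, P (vertexIdem T e)) (ha : ∀ e f h, P (arrowJ e f h))
    (hadd : ∀ x y, P x → P y → P (x + y)) (hmul : ∀ x y, P x → P y → P (x * y)) (x : Jac T) :
    P x := by
  obtain ⟨x, rfl⟩ := Jac.mk_surjective x
  induction x using FreeAlgebra.induction with
  | grade0 r => rw [AlgHom.commutes]; exact hs r
  | grade1 g =>
    cases g with
    | vertex e => exact hv e
    | arrow e f h => exact ha e f h
  | mul a b h1 h2 => rw [map_mul]; exact hmul _ _ h1 h2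
  | add a b h1 h2 => rw [map_add]; exact hadd _ _ h1 h2

/-- The inclusion `Λ → Λ ⊗ ℂ[ε]/(ε²)`. -/
def JacD.incl : Jac T →ₐ[ℂ] JacD T :=
  (JacD.equiv T).symm.toAlgHom.comp Algebra.TensorProduct.includeLeft

lemma JacD.incl_vertexIdem (e : T) : JacD.incl (vertexIdem T e) = idemD T e := rfl

lemma JacD.incl_arrowJ (e f : T) (h : Arrow T e f) : JacD.incl (arrowJ e f h) = arrowD e f h := rfl

lemma idemD_mul_self (e : T) : idemD T e * idemD T e = idemD T e := by
  simp only [← JacD.incl_vertexIdem, ← map_mul, vertexIdem_mul_self]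

lemma idemD_mul_of_ne {e f : T} (h : e ≠ f) : idemD T e * idemD T f = 0 := by
  simp only [← JacD.incl_vertexIdem, ← map_mul, vertexIdem_mul_of_ne h, map_zero]

lemma sum_idemD : ∑ e, idemD T e = 1 := by
  simp only [← JacD.incl_vertexIdem, ← map_sum, sum_vertexIdem, map_one]

lemma idemD_mul_arrowD (e f : T) (h : Arrow T e f) : idemD T f * arrowD e f h = arrowD e f h := by
  simp only [← JacD.incl_vertexIdem, ← JacD.incl_arrowJ, ← map_mul, vertexIdem_mul_arrowJ]

lemma arrowD_mul_idemD (e f : T) (h : Arrow T e f) : arrowD e f h * idemD T e = arrowD e f h := by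
  simp only [← JacD.incl_vertexIdem, ← JacD.incl_arrowJ, ← map_mul, arrowJ_mul_vertexIdem]

lemma arrowD_mul_idemD_of_ne {e f g : T} (h : Arrow T e f) (hg : e ≠ g) :
    arrowD e f h * idemD T g = 0 := by
  rw [← arrowD_mul_idemD, mul_assoc, idemD_mul_of_ne hg, mul_zero]

lemma epsD_mul_epsD : epsD T * epsD T = 0 := by
  rw [epsD, ← map_mul, Algebra.TensorProduct.tmul_mul_tmul, DualNumber.eps_mul_eps,
    TensorProduct.tmul_zero, map_zero]

lemma commute_epsD_incl (x : Jac T) : epsD T * JacD.incl x = JacD.incl x * epsD T := by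
  change (JacD.equiv T).symm _ * (JacD.equiv T).symm (x ⊗ₜ 1) =
    (JacD.equiv T).symm (x ⊗ₜ 1) * (JacD.equiv T).symm _
  simp [← map_mul]

/-- Induction over the elements of `Λ ⊗ ℂ[ε]/(ε²)`. -/
lemma JacD.induction {P : JacD T → Prop} (hs : ∀ c : ℂ, P (algebraMap ℂ _ c))
    (hv : ∀ e, P (idemD T e)) (ha : ∀ e f h, P (arrowD e f h)) (he : P (epsD T))
    (hadd : ∀ x y, P x → P y → P (x + y)) (hmul : ∀ x y, P x → P y → P (x * y)) (x : JacD T) :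
    P x := by
  have hincl : ∀ y : Jac T, P (JacD.incl y) := fun y => by
    induction y using Jac.induction with
    | hs c => rw [AlgHom.commutes]; exact hs c
    | hv e => exact hv e
    | ha e f h => exact ha e f h
    | hadd x y h1 h2 => rw [map_add]; exact hadd _ _ h1 h2
    | hmul x y h1 h2 => rw [map_mul]; exact hmul _ _ h1 h2
  obtain ⟨x, rfl⟩ := (JacD.equiv T).symm.surjective x
  induction x using TensorProduct.induction_on with
  | zero => rw [map_zero, ← map_zero JacD.incl]; exact hincl 0
  | add x y h1 h2 => rw [map_add]; exact hadd _ _ h1 h2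
  | tmul x y =>
    have h : (JacD.equiv T).symm (x ⊗ₜ[ℂ] y) = JacD.incl x * algebraMap ℂ _ y.fst +
        JacD.incl x * algebraMap ℂ _ y.snd * epsD T := by
      have h1 : y = y.fst • 1 + y.snd • DualNumber.eps := by
        ext <;> simp
      rw [← Algebra.commutes y.snd, ← Algebra.commutes y.fst, ← Algebra.smul_def,
        ← Algebra.smul_def, smul_mul_assoc]
      change _ = y.fst • (JacD.equiv T).symm (x ⊗ₜ 1) +
        y.snd • ((JacD.equiv T).symm (x ⊗ₜ 1) * (JacD.equiv T).symm _)
      rw [← map_mul, ← map_smul, ← map_smul, ← map_add, Algebra.TensorProduct.tmul_mul_tmul,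
        one_mul, mul_one, ← TensorProduct.tmul_smul, ← TensorProduct.tmul_smul,
        ← TensorProduct.tmul_add, ← h1]
    rw [h]
    exact hadd _ _ (hmul _ _ (hincl _) (hs _)) (hmul _ _ (hmul _ _ (hincl _) (hs _)) he)

/-- The relations satisfied by the images of the generators of `Λ ⊗ ℂ[ε]/(ε²)` in a representation,
when `T` has no internal triangle. -/
structure GenRel {B : Type} [Ring B] (v : T → B) (α : ∀ e f, Arrow T e f → B) (ε : B) : Prop where
  idem : ∀ e, v e * v e = v e
  orth : ∀ e f, e ≠ f → v e * v f = 0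
  unit : ∑ e, v e = 1
  target : ∀ e f h, v f * α e f h = α e f h
  source : ∀ e f h, α e f h * v e = α e f h
  sq : ε * ε = 0
  comm_v : ∀ e, v e * ε = ε * v e
  comm_α : ∀ e f h, α e f h * ε = ε * α e f h

variable {B : Type} [Ring B] [Algebra ℂ B] {v : T → B} {α : ∀ e f, Arrow T e f → B} {ε : B}

/-- The algebra map given by the images of the vertices and arrows. -/
def GenRel.jacHom (hI : NoInternalTriangle T) (H : GenRel v α ε) : Jac T →ₐ[ℂ] B :=
  Jac.lift (FreeAlgebra.lift ℂ (fun x : Gen T => match x with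
    | Gen.vertex e => v e
    | Gen.arrow e f h => α e f h)) (by
      intro x y h
      cases h with
      | idem e => simpa [preVertex] using H.idem e
      | orth e f h => simpa [preVertex] using H.orth e f h
      | unit => simpa [preVertex] using H.unit
      | target e f h => simpa [preVertex, preArrow] using H.target e f h
      | source e f h => simpa [preVertex, preArrow] using H.source e f h
      | internal e f g hef hfg h =>
        obtain ⟨i, j, k, he, hf, hg⟩ := h
        exact absurd ⟨he ▸ e.2, hf ▸ f.2, hg ▸ g.2⟩ (hI i j k))

lemma GenRel.jacHom_vertexIdem (hI : NoInternalTriangle T) (H : GenRel v α ε) (e : T) :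
    H.jacHom hI (vertexIdem T e) = v e :=
  (Jac.lift_mk ..).trans (by simp [preVertex])

lemma GenRel.jacHom_arrowJ (hI : NoInternalTriangle T) (H : GenRel v α ε) (e f : T)
    (h : Arrow T e f) : H.jacHom hI (arrowJ e f h) = α e f h :=
  (Jac.lift_mk ..).trans (by simp [preArrow])

/-- The algebra map given by the images of the generators. -/
def GenRel.hom (hI : NoInternalTriangle T) (H : GenRel v α ε) : JacD T →ₐ[ℂ] B :=
  (Algebra.TensorProduct.lift (H.jacHom hI) (DualNumber.lift ⟨(Algebra.ofId ℂ B, ε), H.sq,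
      fun c => by rw [Commute, SemiconjBy]; exact (Algebra.commutes c ε).symm⟩)
    (fun x y => by
      have hx : Commute (H.jacHom hI x) ε := by
        induction x using Jac.induction with
        | hs c => rw [AlgHom.commutes]; exact Algebra.commutes c ε
        | hv e => rw [H.jacHom_vertexIdem]; exact H.comm_v e
        | ha e f h => rw [H.jacHom_arrowJ]; exact H.comm_α e f h
        | hadd x y h1 h2 => rw [map_add]; exact h1.add_left h2
        | hmul x y h1 h2 => rw [map_mul]; exact h1.mul_left h2
      rw [DualNumber.lift_apply_apply]
      exact (Algebra.commute_algebraMap_right _ _).add_right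
        ((Algebra.commute_algebraMap_right _ _).mul_right hx))).comp (JacD.equiv T).toAlgHom

lemma GenRel.hom_idemD (hI : NoInternalTriangle T) (H : GenRel v α ε) (e : T) :
    H.hom hI (idemD T e) = v e := by
  simp [GenRel.hom, idemD, H.jacHom_vertexIdem hI]

lemma GenRel.hom_arrowD (hI : NoInternalTriangle T) (H : GenRel v α ε) (e f : T)
    (h : Arrow T e f) : H.hom hI (arrowD e f h) = α e f h := by
  simp [GenRel.hom, arrowD, H.jacHom_arrowJ hI]

lemma GenRel.hom_epsD (hI : NoInternalTriangle T) (H : GenRel v α ε) :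
    H.hom hI (epsD T) = ε := by
  simp [GenRel.hom, epsD]

end Generators

/-! ### Homomorphisms, submodules and simple characters via generators -/

section Linear

variable {n : ℕ} {T : Finset (Sym2 (Fin (n + 3)))} {X Y : Type} [AddCommGroup X] [Module ℂ X]
  [Module (JacD T) X] [IsScalarTower ℂ (JacD T) X] [AddCommGroup Y] [Module ℂ Y]
  [Module (JacD T) Y] [IsScalarTower ℂ (JacD T) Y]

/-- A linear map that commutes with the generators is a module homomorphism. -/
def linOfGen (f : X →ₗ[ℂ] Y) (hv : ∀ (e : T) x, f (idemD T e • x) = idemD T e • f x)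
    (ha : ∀ (e e' : T) h x, f (arrowD e e' h • x) = arrowD e e' h • f x)
    (he : ∀ x, f (epsD T • x) = epsD T • f x) : X →ₗ[JacD T] Y where
  toFun := f
  map_add' := map_add f
  map_smul' a x := by
    dsimp only [RingHom.id_apply]
    induction a using JacD.induction generalizing x with
    | hs c => simp only [algebraMap_smul, map_smul]
    | hv e => exact hv e x
    | ha e f h => exact ha e f h x
    | he => exact he x
    | hadd a b h1 h2 => rw [add_smul, map_add, h1, h2, add_smul]
    | hmul a b h1 h2 => rw [mul_smul, h1, h2, mul_smul]

/-- A subspace that is stable under the generators is a submodule. -/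
def subOfGen (N : Submodule ℂ X) (hv : ∀ e : T, ∀ x ∈ N, idemD T e • x ∈ N)
    (ha : ∀ (e f : T) h, ∀ x ∈ N, arrowD e f h • x ∈ N) (he : ∀ x ∈ N, epsD T • x ∈ N) :
    Submodule (JacD T) X where
  carrier := N
  add_mem' := N.add_mem
  zero_mem' := N.zero_mem
  smul_mem' a x hx := by
    change a • x ∈ N
    replace hx : x ∈ N := hx
    induction a using JacD.induction generalizing x with
    | hs c => rw [algebraMap_smul]; exact N.smul_mem c hx
    | hv e => exact hv e x hx
    | ha e f h => exact ha e f h x hx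
    | he => exact he x hx
    | hadd a b h1 h2 => rw [add_smul]; exact N.add_mem (h1 _ hx) (h2 _ hx)
    | hmul a b h1 h2 => rw [mul_smul]; exact h1 _ (h2 _ hx)

/-- The character of the simple module at the vertex `i`. -/
def chiD (i : T) : JacD T →ₐ[ℂ] ℂ := (simpleChar i).comp (killEps T)

lemma killEps_symm_tmul (x : Jac T) (y : DualNumber ℂ) :
    killEps T ((JacD.equiv T).symm (x ⊗ₜ y)) = x * algebraMap ℂ _ y.fst := by
  unfold killEps
  rw [AlgHom.comp_apply]
  refine (Algebra.TensorProduct.lift_tmul (f := AlgHom.id ℂ (Jac T))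
    (g := (Algebra.ofId ℂ (Jac T)).comp (TrivSqZeroExt.fstHom ℂ ℂ ℂ)) ?_ x y)

lemma killEps_epsD : killEps T (epsD T) = 0 := by
  rw [epsD, killEps_symm_tmul, DualNumber.fst_eps, map_zero, mul_zero]

lemma killEps_incl (x : Jac T) : killEps T (JacD.incl x) = x :=
  (killEps_symm_tmul x 1).trans (by rw [TrivSqZeroExt.fst_one, map_one, mul_one])

lemma killEps_idemD (e : T) : killEps T (idemD T e) = vertexIdem T e := killEps_incl _

lemma killEps_arrowD (e f : T) (h : Arrow T e f) : killEps T (arrowD e f h) = arrowJ e f h :=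
  killEps_incl _

lemma chiD_idemD_self (i : T) : chiD i (idemD T i) = 1 := by
  rw [chiD, AlgHom.comp_apply, killEps_idemD]
  exact (Jac.lift_mk ..).trans (by simp [preVertex])

lemma chiD_idemD_of_ne {i e : T} (h : e ≠ i) : chiD i (idemD T e) = 0 := by
  rw [chiD, AlgHom.comp_apply, killEps_idemD]
  exact (Jac.lift_mk ..).trans (by simp [preVertex, h])

lemma chiD_arrowD (i e f : T) (h : Arrow T e f) : chiD i (arrowD e f h) = 0 := by
  rw [chiD, AlgHom.comp_apply, killEps_arrowD]
  exact (Jac.lift_mk ..).trans (by simp [preArrow])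

lemma chiD_epsD (i : T) : chiD i (epsD T) = 0 := by
  simp [chiD, killEps_epsD]

end Linear

/-! ### The augmentation ideals -/

section AugIdeal

variable {n : ℕ} {T : Finset (Sym2 (Fin (n + 3)))} {X : Type} [AddCommGroup X] [Module ℂ X]
  [Module (JacD T) X] [IsScalarTower ℂ (JacD T) X]

/-- The kernel of the character of the simple module at `i`. -/
abbrev augIdeal (i : T) : Ideal (JacD T) := RingHom.ker (chiD i)

lemma one_sub_idemD_mem (i : T) : 1 - idemD T i ∈ augIdeal i := by
  simp [RingHom.mem_ker, chiD_idemD_self]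

lemma idemD_mul_epsD_mem (i : T) : idemD T i * epsD T ∈ augIdeal i := by
  simp [RingHom.mem_ker, chiD_epsD]

lemma arrowD_mem (i e f : T) (h : Arrow T e f) : arrowD e f h ∈ augIdeal i := by
  simp [RingHom.mem_ker, chiD_arrowD]

/-- A vector at the vertex `i` that is killed by `ε` and by all arrows out of `i` spans a quotient
of `S_i`. -/
lemma smul_eq_chiD_smul {i : T} {y : X} (hv : idemD T i • y = y) (he : epsD T • y = 0)
    (ha : ∀ f (h : Arrow T i f), arrowD i f h • y = 0) (a : JacD T) : a • y = chiD i a • y := by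
  induction a using JacD.induction with
  | hs c => rw [AlgHom.commutes, algebraMap_smul, Algebra.algebraMap_self_apply]
  | hv e =>
    by_cases h : e = i
    · rw [h, hv, chiD_idemD_self, one_smul]
    · rw [chiD_idemD_of_ne h, zero_smul, ← hv, ← mul_smul, idemD_mul_of_ne h, zero_smul]
  | ha e f h =>
    rw [chiD_arrowD, zero_smul]
    by_cases hi : e = i
    · subst hi; exact ha f h
    · rw [← hv, ← mul_smul, arrowD_mul_idemD_of_ne h hi, zero_smul]
  | he => rw [he, chiD_epsD, zero_smul]
  | hadd a b h1 h2 => rw [add_smul, h1, h2, map_add, add_smul]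
  | hmul a b h1 h2 => rw [mul_smul, h2, smul_comm, h1, map_mul, mul_comm, mul_smul]

/-- In the quotient of the algebra by `L`, the class of `e_i` satisfies the conditions of
`smul_eq_chiD_smul`, so the augmentation ideal kills it. Hence the three families of elements
generate the augmentation ideal as a left ideal. -/
lemma augIdeal_le {i : T} {L : Ideal (JacD T)} (h1 : 1 - idemD T i ∈ L)
    (h2 : idemD T i * epsD T ∈ L) (h3 : ∀ f (h : Arrow T i f), arrowD i f h ∈ L) :
    augIdeal i ≤ L := by
  intro j hj
  have hmk : ∀ x : JacD T, x ∈ L ↔ (Submodule.Quotient.mk x : JacD T ⧸ L) = 0 := fun x =>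
    (Submodule.Quotient.mk_eq_zero L).symm
  have hcomm : epsD T * idemD T i = idemD T i * epsD T := commute_epsD_incl _
  have key := smul_eq_chiD_smul (X := JacD T ⧸ L) (i := i)
    (y := Submodule.Quotient.mk (idemD T i))
    (by rw [← Submodule.Quotient.mk_smul, smul_eq_mul, idemD_mul_self])
    (by rw [← Submodule.Quotient.mk_smul, smul_eq_mul, ← hmk, hcomm]; exact h2)
    (fun f h => by
      rw [← Submodule.Quotient.mk_smul, smul_eq_mul, ← hmk, arrowD_mul_idemD]; exact h3 f h) j
  rw [show chiD i j = 0 from hj, zero_smul, ← Submodule.Quotient.mk_smul, ← hmk,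
    smul_eq_mul] at key
  have : j = j * (1 - idemD T i) + j * idemD T i := by rw [← mul_add, sub_add_cancel, mul_one]
  rw [this]
  exact L.add_mem (L.smul_mem j h1) key

variable (X) in
/-- The parameters `(x, z, y)` of a homomorphism from the augmentation ideal at `i` to `X`: its
values at `1 - e_i`, at `e_i ε` and at the arrows with source `i`. -/
def augParam (i : T) : Submodule ℂ (X × X × ({f : T // Arrow T i f} → X)) where
  carrier := {p | idemD T i • p.1 = 0 ∧ (idemD T i • p.2.1 = p.2.1 ∧ epsD T • p.2.1 = 0) ∧
    ∀ f, idemD T f.1 • p.2.2 f = p.2.2 f ∧ epsD T • p.2.2 f = arrowD i f.1 f.2 • p.2.1}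
  zero_mem' := by simp
  add_mem' := by
    rintro p p' ⟨h1, ⟨h2, h3⟩, h4⟩ ⟨h1', ⟨h2', h3'⟩, h4'⟩
    refine ⟨?_, ⟨?_, ?_⟩, fun f => ⟨?_, ?_⟩⟩
    · simp [h1, h1']
    · simp [h2, h2']
    · simp [h3, h3']
    · simp [(h4 f).1, (h4' f).1]
    · simp [(h4 f).2, (h4' f).2]
  smul_mem' := by
    rintro c p ⟨h1, ⟨h2, h3⟩, h4⟩
    refine ⟨?_, ⟨?_, ?_⟩, fun f => ⟨?_, ?_⟩⟩
    · simp [smul_comm _ c, h1]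
    · simp [smul_comm _ c, h2]
    · simp [smul_comm _ c, h3]
    · simp [smul_comm _ c, (h4 f).1]
    · simp [smul_comm _ c, (h4 f).2]

variable (X) in
/-- The values of a homomorphism from the augmentation ideal at the generators. -/
def augEval (i : T) : (augIdeal i →ₗ[JacD T] X) →ₗ[ℂ] augParam X i where
  toFun φ := ⟨(φ ⟨_, one_sub_idemD_mem i⟩, φ ⟨_, idemD_mul_epsD_mem i⟩,
      fun f => φ ⟨_, arrowD_mem i i f.1 f.2⟩), by
    refine ⟨?_, ⟨?_, ?_⟩, fun f => ⟨?_, ?_⟩⟩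
    · dsimp only; rw [← map_smul, ← map_zero φ]; congr 1; ext
      simp [mul_sub, idemD_mul_self]
    · dsimp only; rw [← map_smul]; congr 1; ext
      simp [← mul_assoc, idemD_mul_self]
    · dsimp only; rw [← map_smul, ← map_zero φ]; congr 1; ext
      have : epsD T * idemD T i = idemD T i * epsD T := commute_epsD_incl _
      simp [← mul_assoc, this, mul_assoc _ (epsD T), epsD_mul_epsD]
    · dsimp only; rw [← map_smul]; congr 1; ext
      simp [idemD_mul_arrowD]
    · dsimp only; rw [← map_smul, ← map_smul]; congr 1; ext
      have : epsD T * arrowD i f.1 f.2 = arrowD i f.1 f.2 * epsD T := commute_epsD_incl _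
      simp [← mul_assoc, arrowD_mul_idemD, this]⟩
  map_add' _ _ := rfl
  map_smul' _ _ := rfl

/-- A homomorphism is determined by its values on the generators provided by `augIdeal_le`. -/
lemma augEval_injective (i : T) : Function.Injective (augEval X i) := by
  rw [injective_iff_map_eq_zero]
  intro φ hφ
  have h1 : φ ⟨_, one_sub_idemD_mem i⟩ = 0 := congrArg (fun p => p.1.1) hφ
  have h2 : φ ⟨_, idemD_mul_epsD_mem i⟩ = 0 := congrArg (fun p => p.1.2.1) hφ
  have h3 : ∀ f h, φ ⟨_, arrowD_mem i i f h⟩ = 0 := fun f h =>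
    congrArg (fun p => p.1.2.2 ⟨f, h⟩) hφ
  have := augIdeal_le (i := i) (L := (LinearMap.ker φ).map (augIdeal i).subtype)
    ⟨_, h1, rfl⟩ ⟨_, h2, rfl⟩ (fun f h => ⟨_, h3 f h, rfl⟩)
  ext j
  obtain ⟨j', hj', e⟩ := this j.2
  have : j' = j := Subtype.ext e
  rw [← this]
  exact hj'

/-! ### Extensions of a simple module realised on `X × ℂ` -/

section Extension

open Classical in
/-- The vertices on the extension of the simple module at `i` by `X`. -/
def extV (X : Type) [AddCommGroup X] [Module ℂ X]
  [Module (JacD T) X] [IsScalarTower ℂ (JacD T) X] (i e : T) : Module.End ℂ (X × ℂ) where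
  toFun p := (idemD T e • p.1, if e = i then p.2 else 0)
  map_add' p p' := by ext <;> by_cases h : e = i <;> simp [h]
  map_smul' c p := by ext <;> by_cases h : e = i <;> simp [h, smul_comm _ c]

open Classical in
/-- The arrows on the extension of the simple module at `i` by `X`. -/
def extA (i : T) (y : {f : T // Arrow T i f} → X) (e f : T) (h : Arrow T e f) :
    Module.End ℂ (X × ℂ) where
  toFun p := (arrowD e f h • p.1 + if he : e = i then p.2 • y ⟨f, he ▸ h⟩ else 0, 0)
  map_add' p p' := by
    by_cases hi : e = i
    · ext <;> simp [hi, add_smul]; abel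
    · ext <;> simp [hi]
  map_smul' c p := by
    by_cases hi : e = i
    · ext <;> simp [hi, mul_smul, smul_comm _ c]
    · ext <;> simp [hi, smul_comm _ c]

/-- The action of `ε` on the extension of the simple module at `i` by `X`. -/
def extE (z : X) : Module.End ℂ (X × ℂ) where
  toFun p := (epsD T • p.1 + p.2 • z, 0)
  map_add' p p' := by ext <;> simp [add_smul]; abel
  map_smul' c p := by ext <;> simp [mul_smul, smul_comm _ c]

/-- The action on `X × ℂ` extends that on `X`, sending the extra basis vector to `z` under `ε` and
to `y f` under the arrows. The conditions on `z` and `y` are what the relations involving this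
vector require. -/
lemma extGenRel {i : T} {z : X} {y : {f : T // Arrow T i f} → X}
    (hz : idemD T i • z = z) (hz' : epsD T • z = 0)
    (hy : ∀ f, idemD T f.1 • y f = y f ∧ epsD T • y f = arrowD i f.1 f.2 • z) :
    GenRel (B := Module.End ℂ (X × ℂ)) (extV X i) (extA i y) (extE (T := T) z) where
  idem e := by
    ext p
    · simp [extV, ← mul_smul, idemD_mul_self]
    · by_cases h : e = i <;> simp [extV, h]
    · simp [extV]
    · by_cases h : e = i <;> simp [extV, h]
  orth e f h := by
    ext p
    · simp [extV, ← mul_smul, idemD_mul_of_ne h]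
    · by_cases h : e = i <;> simp [extV]
    · simp [extV]
    · by_cases h' : e = i
      · have : f ≠ i := fun h'' => h (h'.trans h''.symm)
        simp [extV, this]
      · simp [extV, h']
  unit := by
    have h := sum_idemD (T := T)
    rw [Finset.univ_eq_attach] at h
    ext p
    · simp [extV, Prod.fst_sum, ← Finset.sum_smul, h]
    · simp [extV, Prod.snd_sum]
    · simp [extV, Prod.fst_sum]
    · simp [extV, Prod.snd_sum]
  target e f h := by
    ext p
    · simp [extV, extA, ← mul_smul, idemD_mul_arrowD]
    · simp [extV, extA]
    · by_cases hi : e = i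
      · subst hi
        simp [extV, extA, (hy ⟨f, h⟩).1]
      · simp [extV, extA, hi]
    · simp [extV, extA]
  source e f h := by
    ext p
    · simp [extV, extA, ← mul_smul, arrowD_mul_idemD]
    · simp [extA]
    · by_cases hi : e = i
      · subst hi
        simp [extV, extA]
      · simp [extV, extA, hi]
    · simp [extA]
  sq := by
    ext p
    · simp [extE, ← mul_smul, epsD_mul_epsD]
    · simp [extE]
    · simp [extE, hz']
    · simp [extE]
  comm_v e := by
    have : epsD T * idemD T e = idemD T e * epsD T := commute_epsD_incl _
    ext p
    · simp [extE, extV, ← mul_smul, this]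
    · simp [extE, extV]
    · by_cases h : e = i
      · subst h; simp [extE, extV, hz]
      · have : idemD T e • z = 0 := by rw [← hz, ← mul_smul, idemD_mul_of_ne h, zero_smul]
        simp [extE, extV, h, this]
    · simp [extE, extV]
  comm_α e f h := by
    have : epsD T * arrowD e f h = arrowD e f h * epsD T := commute_epsD_incl _
    ext p
    · simp [extE, extA, ← mul_smul, this]
    · simp [extE, extA]
    · by_cases hi : e = i
      · subst hi; simp [extE, extA, (hy ⟨f, h⟩).2]
      · have : arrowD e f h • z = 0 := by
          rw [← hz, ← mul_smul, arrowD_mul_idemD_of_ne h hi, zero_smul]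
        simp [extE, extA, hi, this]
    · simp [extE, extA]

end Extension

/-- Given parameters define an extension of `S_i` by `X`. An element of the augmentation ideal sends
the extra basis vector into `X`, and this is the required homomorphism up to the value at `1 - e_i`,
which is corrected by adding `j ↦ j • x`. -/
lemma augEval_surjective (hI : NoInternalTriangle T) (i : T) :
    Function.Surjective (augEval X i) := by
  rintro ⟨⟨x, z, y⟩, hx, ⟨hz, hz'⟩, hy⟩
  dsimp only at hx hz hz' hy
  set ρ := (extGenRel hz hz' hy).hom hI with hρ
  have h1 : ∀ (a : JacD T) (x : X), ρ a (x, 0) = (a • x, 0) := by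
    intro a
    induction a using JacD.induction with
    | hs c => intro x; rw [AlgHom.commutes]; simp
    | hv e => intro x; rw [GenRel.hom_idemD]; simp [extV]
    | ha e f h => intro x; rw [GenRel.hom_arrowD]; simp [extA]
    | he => intro x; rw [GenRel.hom_epsD]; simp [extE]
    | hadd a b h1 h2 => intro x; rw [map_add, LinearMap.add_apply, h1, h2]; simp [add_smul]
    | hmul a b h1 h2 =>
      intro x; rw [map_mul, Module.End.mul_apply, h2, h1]; simp [mul_smul]
  have h2 : ∀ (a : JacD T) (p : X × ℂ), (ρ a p).2 = chiD i a * p.2 := by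
    intro a
    induction a using JacD.induction with
    | hs c => intro p; rw [AlgHom.commutes, AlgHom.commutes]; simp
    | hv e =>
      intro p; rw [GenRel.hom_idemD]
      by_cases h : e = i
      · simp [extV, h, chiD_idemD_self]
      · simp [extV, h, chiD_idemD_of_ne h]
    | ha e f h => intro p; rw [GenRel.hom_arrowD, chiD_arrowD]; simp [extA]
    | he => intro p; rw [GenRel.hom_epsD, chiD_epsD]; simp [extE]
    | hadd a b h1 h2 => intro p; rw [map_add, LinearMap.add_apply, Prod.snd_add, h1, h2, map_add,
        add_mul]
    | hmul a b h1 h2 => intro p; rw [map_mul, Module.End.mul_apply, h1, h2, map_mul, mul_assoc]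
  -- Linearity uses that the second coordinate of `ρ j (0, 1)` is the character of `j`, which
  -- vanishes on the ideal.
  let φ : augIdeal i →ₗ[JacD T] X :=
    { toFun := fun j => j.1 • x + (ρ j.1 (0, 1)).1
      map_add' := fun j j' => by
        simp only [Submodule.coe_add, add_smul, map_add, LinearMap.add_apply, Prod.fst_add]; abel
      map_smul' := fun a j => by
        have h3 : ρ j.1 (0, 1) = ((ρ j.1 (0, 1)).1, 0) := by
          ext
          · rfl
          · rw [h2, show chiD i j.1 = 0 from j.2]; simp
        rw [Submodule.coe_smul, smul_eq_mul, map_mul, Module.End.mul_apply, h3, h1, mul_smul,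
          RingHom.id_apply, smul_add] }
  refine ⟨φ, Subtype.ext (Prod.ext ?_ (Prod.ext ?_ (funext fun f => ?_)))⟩
  · change (1 - idemD T i) • x + (ρ (1 - idemD T i) (0, 1)).1 = x
    rw [map_sub, map_one, GenRel.hom_idemD]
    simp [extV, sub_smul, hx]
  · change (idemD T i * epsD T) • x + (ρ (idemD T i * epsD T) (0, 1)).1 = z
    have : epsD T * idemD T i = idemD T i * epsD T := commute_epsD_incl _
    rw [map_mul, GenRel.hom_idemD, GenRel.hom_epsD, ← this, mul_smul, hx]
    simp [extV, extE, hz]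
  · change arrowD i f.1 f.2 • x + (ρ (arrowD i f.1 f.2) (0, 1)).1 = y f
    rw [GenRel.hom_arrowD, ← arrowD_mul_idemD, mul_smul, hx]
    simp [extA]

/-- Homomorphisms from an augmentation ideal. -/
def augEquiv (hI : NoInternalTriangle T) (i : T) :
    (augIdeal i →ₗ[JacD T] X) ≃ₗ[ℂ] augParam X i :=
  LinearEquiv.ofBijective (augEval X i) ⟨augEval_injective i, augEval_surjective hI i⟩

end AugIdeal

/-! ### Dimensions of extension spaces -/

section ExtDim

variable {A : Type} [Ring A] [Algebra ℂ A]

-- Dimension count in the long exact sequence `0 → Hom(S₃) → Hom(S₂) → Hom(S₁) → Ext¹(S₃) → 0`,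
-- which ends there because `S₂` is projective.
open Abelian Module in
lemma finrank_ext_one_add {S : ShortComplex (ModuleCat.{0} A)} (hS : S.ShortExact)
    [Projective S.X₂] (Y : ModuleCat.{0} A) [FiniteDimensional ℂ (S.X₁ ⟶ Y)]
    [FiniteDimensional ℂ (S.X₂ ⟶ Y)] :
    finrank ℂ (Ext S.X₃ Y 1) + finrank ℂ (S.X₂ ⟶ Y) =
      finrank ℂ (S.X₁ ⟶ Y) + finrank ℂ (S.X₃ ⟶ Y) := by
  have := hS.epi_g
  have h1 := (Ext.linearEquiv₀ (R := ℂ) (X := S.X₁) (Y := Y))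
  have h2 := (Ext.linearEquiv₀ (R := ℂ) (X := S.X₂) (Y := Y))
  have h3 := (Ext.linearEquiv₀ (R := ℂ) (X := S.X₃) (Y := Y))
  have : FiniteDimensional ℂ (Ext S.X₁ Y 0) := h1.symm.finiteDimensional
  have : FiniteDimensional ℂ (Ext S.X₂ Y 0) := h2.symm.finiteDimensional
  let δ := Ext.precompOfLinear hS.extClass ℂ Y (a := 0) (b := 1) (by omega)
  let f := Ext.precompOfLinear (Ext.mk₀ S.f) ℂ Y (a := 0) (b := 0) (by omega)
  let g := Ext.precompOfLinear (Ext.mk₀ S.g) ℂ Y (a := 0) (b := 0) (by omega)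
  have hδ : LinearMap.range δ = ⊤ := by
    rw [LinearMap.range_eq_top]
    intro x
    exact Ext.contravariant_sequence_exact₃ hS _ x (Ext.eq_zero_of_projective _) (by omega)
  have hf : LinearMap.ker δ = LinearMap.range f := by
    ext x
    constructor
    · intro hx
      exact Ext.contravariant_sequence_exact₁ hS _ x (by omega) hx
    · rintro ⟨y, rfl⟩
      simp [δ, f]
  have hg : LinearMap.ker f = LinearMap.range g := by
    ext x
    constructor
    · intro hx
      exact Ext.contravariant_sequence_exact₂ hS _ x hx
    · rintro ⟨y, rfl⟩
      simp [f, g]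
  have hg' : Function.Injective g := Ext.precomp_mk₀_injective_of_epi Y S.g
  have e1 := LinearMap.finrank_range_add_finrank_ker δ
  have e2 := LinearMap.finrank_range_add_finrank_ker f
  have e3 := LinearMap.finrank_range_of_inj hg'
  rw [hδ, finrank_top, hf, h1.finrank_eq] at e1
  rw [hg, h2.finrank_eq, e3, h3.finrank_eq] at e2
  omega

variable {X Y : Type} [AddCommGroup X] [Module A X] [AddCommGroup Y] [Module ℂ Y] [Module A Y]
  [IsScalarTower ℂ A Y]

/-- The complex structure on the morphisms in the category of modules. -/
abbrev catHomModule (M N : ModuleCat.{0} A) : Module ℂ (M ⟶ N) := inferInstance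

variable (A X Y) in
/-- Morphisms in the category of modules are linear maps, compatibly with complex scalars. -/
def moduleHomEquiv :
    letI := catHomModule (ModuleCat.of A X) (ModuleCat.of A Y)
    (ModuleCat.of A X ⟶ ModuleCat.of A Y) ≃ₗ[ℂ] (X →ₗ[A] Y) :=
  letI := catHomModule (ModuleCat.of A X) (ModuleCat.of A Y)
  { ModuleCat.homAddEquiv with
    map_smul' := fun c f => by
      ext x
      exact algebraMap_smul A c (f.hom x) }

open Module in
lemma finrank_ext_one_add_of_exact {K P N : Type} [AddCommGroup K] [Module A K] [AddCommGroup P]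
    [Module A P] [AddCommGroup N] [Module A N] (f : K →ₗ[A] P) (g : P →ₗ[A] N)
    (hf : Function.Injective f) (hg : Function.Surjective g) (hfg : Function.Exact f g)
    [Module.Projective A P] [FiniteDimensional ℂ (K →ₗ[A] Y)] [FiniteDimensional ℂ (P →ₗ[A] Y)] :
    finrank ℂ (Abelian.Ext (ModuleCat.of A N) (ModuleCat.of A Y) 1) + finrank ℂ (P →ₗ[A] Y) =
      finrank ℂ (K →ₗ[A] Y) + finrank ℂ (N →ₗ[A] Y) := by
  let S : ShortComplex (ModuleCat.{0} A) := ShortComplex.mk (ModuleCat.ofHom f)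
    (ModuleCat.ofHom g) (by ext x; exact hfg.apply_apply_eq_zero x)
  have hS : S.ShortExact :=
    { exact := (ShortComplex.ShortExact.moduleCat_exact_iff_function_exact S).2 hfg
      mono_f := (ModuleCat.mono_iff_injective _).2 hf
      epi_g := (ModuleCat.epi_iff_surjective _).2 hg }
  have : Projective S.X₂ := ModuleCat.projective_of_categoryTheory_projective (ModuleCat.of A P)
  let := catHomModule S.X₁ (ModuleCat.of A Y)
  let := catHomModule S.X₂ (ModuleCat.of A Y)
  let := catHomModule S.X₃ (ModuleCat.of A Y)
  have : FiniteDimensional ℂ (S.X₁ ⟶ ModuleCat.of A Y) :=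
    (moduleHomEquiv A K Y).symm.finiteDimensional
  have : FiniteDimensional ℂ (S.X₂ ⟶ ModuleCat.of A Y) :=
    (moduleHomEquiv A P Y).symm.finiteDimensional
  have h := finrank_ext_one_add hS (ModuleCat.of A Y)
  have h1 := (moduleHomEquiv A K Y).finrank_eq
  have h2 := (moduleHomEquiv A P Y).finrank_eq
  have h3 := (moduleHomEquiv A N Y).finrank_eq
  rw [← h1, ← h2, ← h3]
  exact h

end ExtDim

/-! ### The antisymmetrized form on semisimple modules -/

section Antisym

open Module

variable {n : ℕ} {T : Finset (Sym2 (Fin (n + 3)))}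

lemma simple_smul (i : T) (a : JacD T) (x : Simple i) : a • x = chiD i a • x := rfl

instance (i : T) : FiniteDimensional ℂ (Simple i) :=
  inferInstanceAs (FiniteDimensional ℂ ℂ)

lemma finrank_simple (i : T) : finrank ℂ (Simple i) = 1 := finrank_self ℂ

variable {X : Type} [AddCommGroup X] [Module ℂ X] [Module (JacD T) X]
  [IsScalarTower ℂ (JacD T) X]

lemma finiteDimensional_augHom (hI : NoInternalTriangle T) [FiniteDimensional ℂ X] (i : T) :
    FiniteDimensional ℂ (augIdeal i →ₗ[JacD T] X) :=
  (augEquiv hI i).symm.finiteDimensional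

-- With values in `S_j`, the parameter `x` vanishes if `i = j` and `z` vanishes otherwise, so both
-- together contribute one dimension; `y` contributes one for an arrow `i ⟶ j`. The first
-- contribution is independent of `j` because the regular module, not its summand at `i`, is used to
-- cover `S_i`.
open Classical in
lemma finrank_augHom_simple (hI : NoInternalTriangle T) (i j : T) :
    finrank ℂ (augIdeal i →ₗ[JacD T] Simple j) = 1 + if Arrow T i j then 1 else 0 := by
  rw [(augEquiv hI i).finrank_eq]
  let F : augParam (Simple j) i →ₗ[ℂ] Simple j × ({f : {f : T // Arrow T i f} // f.1 = j} → Simple j) :=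
    { toFun := fun p => (p.1.1 + p.1.2.1, fun f => p.1.2.2 f.1)
      map_add' := fun p p' => by
        refine Prod.ext ?_ rfl
        change p.1.1 + p'.1.1 + (p.1.2.1 + p'.1.2.1) = _
        exact add_add_add_comm _ _ _ _
      map_smul' := fun c p => by
        refine Prod.ext ?_ rfl
        exact (smul_add c p.1.1 p.1.2.1).symm }
  have hF : Function.Bijective F := by
    constructor
    · rw [injective_iff_map_eq_zero]
      rintro ⟨⟨x, z, y⟩, hx, ⟨hz, hz'⟩, hy⟩ h
      have h1 : x + z = 0 := congrArg Prod.fst h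
      have h2 : ∀ f, f.1 = j → y f = 0 := fun f hf => congrFun (congrArg Prod.snd h) ⟨f, hf⟩
      dsimp only at hx hz hy
      have hy' : y = 0 := by
        funext f
        by_cases hf : f.1 = j
        · exact h2 f hf
        · rw [← (hy f).1, simple_smul, chiD_idemD_of_ne hf, zero_smul]; rfl
      have : x = 0 ∧ z = 0 := by
        by_cases hij : i = j
        · subst hij
          rw [simple_smul, chiD_idemD_self, one_smul] at hx
          rw [hx, zero_add] at h1
          exact ⟨hx, h1⟩
        · rw [simple_smul, chiD_idemD_of_ne hij, zero_smul] at hz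
          rw [← hz, add_zero] at h1
          exact ⟨h1, hz.symm⟩
      obtain ⟨rfl, rfl⟩ := this
      subst hy'
      rfl
    · rintro ⟨x, y⟩
      refine ⟨⟨(if i = j then 0 else x, if i = j then x else 0,
        fun f => if h : f.1 = j then y ⟨f, h⟩ else 0), ?_, ⟨?_, ?_⟩, fun f => ⟨?_, ?_⟩⟩, ?_⟩
      · by_cases hij : i = j
        · simp [hij]
        · simp [hij, simple_smul, chiD_idemD_of_ne hij]
      · by_cases hij : i = j
        · subst hij; simp [simple_smul, chiD_idemD_self]
        · simp [hij]
      · simp [simple_smul, chiD_epsD]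
      · by_cases hf : f.1 = j
        · simp [hf, simple_smul, chiD_idemD_self]
        · simp [hf]
      · simp [simple_smul, chiD_epsD, chiD_arrowD]
      · refine Prod.ext ?_ ?_
        · by_cases hij : i = j <;> simp [F, hij]
        · funext f; simp [F, f.2]
  rw [(LinearEquiv.ofBijective F hF).finrank_eq, finrank_prod, finrank_simple, finrank_pi_fintype]
  simp only [finrank_simple, Finset.sum_const, smul_eq_mul, mul_one, Finset.card_univ]
  congr 1
  by_cases h : Arrow T i j
  · rw [if_pos h, Fintype.card_eq_one_iff]
    exact ⟨⟨⟨j, h⟩, rfl⟩, fun f => Subtype.ext (Subtype.ext f.2)⟩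
  · rw [if_neg h, Fintype.card_eq_zero_iff]
    exact ⟨fun f => h (f.2 ▸ f.1.2)⟩

/-! ### Homomorphisms from and to direct sums -/

section Products

variable {d : T → ℕ} {M : T → Type} [∀ j, AddCommGroup (M j)] [∀ j, Module ℂ (M j)]
  [∀ j, Module (JacD T) (M j)] [∀ j, IsScalarTower ℂ (JacD T) (M j)]

open Classical in
/-- Homomorphisms out of a direct sum. -/
def homOfProd (X : Type) [AddCommGroup X] [Module ℂ X] [Module (JacD T) X]
    [IsScalarTower ℂ (JacD T) X] : (((j : T) → Fin (d j) → M j) →ₗ[JacD T] X) ≃ₗ[ℂ]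
      ((j : T) → Fin (d j) → M j →ₗ[JacD T] X) :=
  (LinearMap.lsum (JacD T) (fun j : T => Fin (d j) → M j) ℂ).symm.trans
    (LinearEquiv.piCongrRight fun j =>
      (LinearMap.lsum (JacD T) (fun _ : Fin (d j) => M j) ℂ).symm)

/-- Homomorphisms into a direct product. -/
def homToProd (X : Type) [AddCommGroup X] [Module ℂ X] [Module (JacD T) X]
    [IsScalarTower ℂ (JacD T) X] : (X →ₗ[JacD T] ((j : T) → Fin (d j) → M j)) ≃ₗ[ℂ]
      ((j : T) → Fin (d j) → X →ₗ[JacD T] M j) :=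
  (LinearEquiv.linearMapPi (R := JacD T) ℂ).symm.trans
    (LinearEquiv.piCongrRight fun _ => (LinearEquiv.linearMapPi (R := JacD T) ℂ).symm)

lemma finrank_homOfProd [∀ j, FiniteDimensional ℂ (M j →ₗ[JacD T] X)] :
    finrank ℂ (((j : T) → Fin (d j) → M j) →ₗ[JacD T] X) =
      ∑ j, d j * finrank ℂ (M j →ₗ[JacD T] X) := by
  rw [(homOfProd X).finrank_eq, finrank_pi_fintype]
  refine Finset.sum_congr rfl fun j _ => ?_
  rw [finrank_pi_fintype]; simp

lemma finrank_homToProd [∀ j, FiniteDimensional ℂ (X →ₗ[JacD T] M j)] :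
    finrank ℂ (X →ₗ[JacD T] ((j : T) → Fin (d j) → M j)) =
      ∑ j, d j * finrank ℂ (X →ₗ[JacD T] M j) := by
  rw [(homToProd X).finrank_eq, finrank_pi_fintype]
  refine Finset.sum_congr rfl fun j _ => ?_
  rw [finrank_pi_fintype]; simp

end Products

/-- The projective cover of the simple module at `i`, up to direct summands. -/
def toSimple (i : T) : JacD T →ₗ[JacD T] Simple i :=
  LinearMap.toSpanSingleton (JacD T) (Simple i) (show Simple i from (1 : ℂ))

lemma toSimple_apply (i : T) (a : JacD T) : toSimple i a = (show Simple i from chiD i a) :=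
  mul_one (chiD i a)

lemma toSimple_surjective (i : T) : Function.Surjective (toSimple i) := fun c =>
  ⟨algebraMap ℂ _ (show ℂ from c), by
    rw [toSimple_apply, AlgHom.commutes]; rfl⟩

lemma exact_toSimple (i : T) : Function.Exact (augIdeal i).subtype (toSimple i) := fun a => by
  rw [toSimple_apply]
  constructor
  · intro h; exact ⟨⟨a, h⟩, rfl⟩
  · rintro ⟨b, rfl⟩; exact b.2

lemma finiteDimensional_homSelf [FiniteDimensional ℂ X] :
    FiniteDimensional ℂ (JacD T →ₗ[JacD T] X) :=
  (LinearMap.ringLmapEquivSelf (JacD T) ℂ X).symm.finiteDimensional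

lemma finiteDimensional_homSimple [FiniteDimensional ℂ X] (i : T) :
    FiniteDimensional ℂ (Simple i →ₗ[JacD T] X) := by
  have := finiteDimensional_homSelf (T := T) (X := X)
  exact FiniteDimensional.of_injective (LinearMap.lcomp ℂ X (toSimple i)) (fun f g h =>
    LinearMap.ext fun x => by
      obtain ⟨a, rfl⟩ := toSimple_surjective i x
      exact LinearMap.congr_fun h a)

/-- The augmentation ideal is the kernel of the projective cover up to summands, and `Hom` from the
regular module to `X` is `X`. -/
lemma finrank_ext_simple (hI : NoInternalTriangle T) [FiniteDimensional ℂ X] (i : T) :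
    finrank ℂ (Abelian.Ext (ModuleCat.of (JacD T) (Simple i)) (ModuleCat.of (JacD T) X) 1) +
      finrank ℂ X = finrank ℂ (augIdeal i →ₗ[JacD T] X) + finrank ℂ (Simple i →ₗ[JacD T] X) := by
  have := finiteDimensional_homSelf (T := T) (X := X)
  have := finiteDimensional_augHom (X := X) hI i
  rw [← (LinearMap.ringLmapEquivSelf (JacD T) ℂ X).finrank_eq]
  exact finrank_ext_one_add_of_exact (augIdeal i).subtype (toSimple i)
    Subtype.val_injective (toSimple_surjective i) (exact_toSimple i)

/-- The same sequence for a direct sum of simple modules: sums of the presentations of the summands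
form a presentation with projective middle term. -/
lemma finrank_ext_simples (hI : NoInternalTriangle T) [FiniteDimensional ℂ X] (d : T → ℕ) :
    finrank ℂ (Abelian.Ext (ModuleCat.of (JacD T) ((j : T) → Fin (d j) → Simple j))
      (ModuleCat.of (JacD T) X) 1) + ∑ j, d j * finrank ℂ X =
    ∑ j, d j * finrank ℂ (augIdeal j →ₗ[JacD T] X) +
      ∑ j, d j * finrank ℂ (Simple j →ₗ[JacD T] X) := by
  have h1 := finiteDimensional_homSelf (T := T) (X := X)
  have h2 := fun i => finiteDimensional_augHom (X := X) hI i
  have h3 := fun i => finiteDimensional_homSimple (T := T) (X := X) i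
  have : FiniteDimensional ℂ (((j : T) → Fin (d j) → JacD T) →ₗ[JacD T] X) :=
    (homOfProd X).symm.finiteDimensional
  have : FiniteDimensional ℂ (((j : T) → Fin (d j) → augIdeal j) →ₗ[JacD T] X) :=
    (homOfProd X).symm.finiteDimensional
  have h := finrank_ext_one_add_of_exact (Y := X)
    (LinearMap.piMap fun j => LinearMap.piMap fun _ : Fin (d j) => (augIdeal j).subtype)
    (LinearMap.piMap fun j => LinearMap.piMap fun _ : Fin (d j) => toSimple j)
    (fun a b h => funext fun j => funext fun l => Subtype.val_injective
      (congrFun (congrFun h j) l))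
    (fun x => by
      choose y hy using fun j l => toSimple_surjective j (x j l)
      exact ⟨y, funext fun j => funext fun l => hy j l⟩)
    (fun x => by
      constructor
      · intro h
        choose y hy using fun j l => (exact_toSimple j (x j l)).1 (congrFun (congrFun h j) l)
        exact ⟨y, funext fun j => funext fun l => hy j l⟩
      · rintro ⟨y, rfl⟩
        exact funext fun j => funext fun l => (exact_toSimple j _).2 ⟨y j l, rfl⟩)
  rw [finrank_homOfProd, finrank_homOfProd, finrank_homOfProd,
    (LinearMap.ringLmapEquivSelf (JacD T) ℂ X).finrank_eq] at h
  exact h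

lemma finrank_homSimple_comm (i j : T) :
    finrank ℂ (Simple i →ₗ[JacD T] Simple j) = finrank ℂ (Simple j →ₗ[JacD T] Simple i) := by
  by_cases h : i = j
  · subst h; rfl
  · have key : ∀ {i j : T}, i ≠ j → finrank ℂ (Simple i →ₗ[JacD T] Simple j) = 0 := by
      intro i j h
      have : Subsingleton (Simple i →ₗ[JacD T] Simple j) := by
        refine ⟨fun f g => LinearMap.ext fun x => ?_⟩
        have hz : ∀ f : Simple i →ₗ[JacD T] Simple j, f x = 0 := fun f => by
          have h1 := f.map_smul (idemD T i) x
          rw [simple_smul, simple_smul, chiD_idemD_self, chiD_idemD_of_ne h, one_smul,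
            zero_smul] at h1
          exact h1
        rw [hz, hz]
      exact finrank_zero_of_subsingleton
    rw [key h, key (Ne.symm h)]

-- By the dimension formulas, `Ext¹` between simple modules counts arrows plus `dim Hom`, the latter
-- coming from `ε`. The `Hom` terms are symmetric and cancel, so only the signed number of arrows
-- remains.
open Classical in
lemma antisymForm_simples (hI : NoInternalTriangle T) (i : T) (d : T → ℕ) :
    antisymForm (ModuleCat.of (JacD T) (Simple i))
      (ModuleCat.of (JacD T) ((j : T) → Fin (d j) → Simple j)) =
    ∑ j, (d j : ℤ) * ((if Arrow T j i then 1 else 0) - if Arrow T i j then 1 else 0) := by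
  have h3 := fun i : T => finiteDimensional_homSimple (T := T) (X := Simple i)
  have h4 := fun i j : T => finiteDimensional_augHom (X := Simple i) hI j
  let := catHomModule (ModuleCat.of (JacD T) (Simple i))
    (ModuleCat.of (JacD T) ((j : T) → Fin (d j) → Simple j))
  let := catHomModule (ModuleCat.of (JacD T) ((j : T) → Fin (d j) → Simple j))
    (ModuleCat.of (JacD T) (Simple i))
  have e1 := (moduleHomEquiv (JacD T) (Simple i) ((j : T) → Fin (d j) → Simple j)).finrank_eq
  have e2 := (moduleHomEquiv (JacD T) ((j : T) → Fin (d j) → Simple j) (Simple i)).finrank_eq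
  have e3 := finrank_ext_simple (X := (j : T) → Fin (d j) → Simple j) hI i
  have e4 := finrank_ext_simples (X := Simple i) hI d
  have e5 : finrank ℂ ((j : T) → Fin (d j) → Simple j) = ∑ j, d j := by
    rw [finrank_pi_fintype]
    refine Finset.sum_congr rfl fun j _ => ?_
    rw [finrank_pi_fintype]; simp [finrank_simple]
  rw [finrank_homToProd] at e1
  rw [finrank_homOfProd] at e2
  rw [finrank_homToProd, finrank_homToProd, e5] at e3
  simp only [finrank_augHom_simple hI, finrank_simple] at e3 e4
  simp only [finrank_homSimple_comm i] at e1 e3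
  unfold antisymForm
  rw [← e2] at e1
  zify at e1 e3 e4
  simp only [mul_add, mul_one, Finset.sum_add_distrib] at e3 e4
  simp only [mul_sub, Finset.sum_sub_distrib]
  erw [e1]
  linarith

end Antisym

/-! ### Socles and minimal injective resolutions -/

section Socle

open Module

variable {n : ℕ} {T : Finset (Sym2 (Fin (n + 3)))} {X Y C : Type} [AddCommGroup X] [Module ℂ X]
  [Module (JacD T) X] [IsScalarTower ℂ (JacD T) X] [AddCommGroup Y] [Module ℂ Y]
  [Module (JacD T) Y] [IsScalarTower ℂ (JacD T) Y] [AddCommGroup C] [Module ℂ C]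
  [Module (JacD T) C] [IsScalarTower ℂ (JacD T) C]

variable (Y) in
/-- The part at the vertex `i` of the socle of `Y`. -/
def soc (i : T) : Submodule ℂ Y where
  carrier := {y | ∀ j ∈ augIdeal i, j • y = 0}
  zero_mem' := fun _ _ => smul_zero _
  add_mem' := fun h h' j hj => by rw [smul_add, h j hj, h' j hj, add_zero]
  smul_mem' := fun c y h j hj => by rw [smul_comm, h j hj, smul_zero]

lemma smul_of_mem_soc {i : T} {y : Y} (h : y ∈ soc Y i) (a : JacD T) : a • y = chiD i a • y := by
  have : a - algebraMap ℂ _ (chiD i a) ∈ augIdeal i := by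
    rw [RingHom.mem_ker, map_sub, AlgHom.commutes]; simp
  have h1 := h _ this
  rwa [sub_smul, algebraMap_smul, sub_eq_zero] at h1

/-- Starting with a nonzero element killed by `ε` at one vertex, arrows are applied as long as some
arrow does not kill it. The height drops at each application, so the process stops at a socle
element. -/
lemma exists_mem_soc {ht : T → ℕ} (hht : ∀ e f, Arrow T e f → ht f < ht e)
    {N : Submodule (JacD T) Y} (hN : N ≠ ⊥) : ∃ i : T, ∃ y ∈ N, y ≠ 0 ∧ y ∈ soc Y i := by
  obtain ⟨y, hy, hy0⟩ := Submodule.exists_mem_ne_zero_of_ne_bot hN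
  obtain ⟨y, hy, hy0, he⟩ : ∃ y ∈ N, y ≠ 0 ∧ epsD T • y = 0 := by
    by_cases h : epsD T • y = 0
    · exact ⟨y, hy, hy0, h⟩
    · exact ⟨_, N.smul_mem _ hy, h, by rw [← mul_smul, epsD_mul_epsD, zero_smul]⟩
  obtain ⟨i, hi⟩ : ∃ i, idemD T i • y ≠ 0 := by
    by_contra! h
    apply hy0
    rw [← one_smul (JacD T) y, ← sum_idemD, Finset.sum_smul]
    exact Finset.sum_eq_zero fun i _ => h i
  have key : ∀ k, ∀ i, ht i = k → ∀ y ∈ N, y ≠ 0 → epsD T • y = 0 → idemD T i • y = y →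
      ∃ i : T, ∃ y ∈ N, y ≠ 0 ∧ y ∈ soc Y i := by
    intro k
    induction k using Nat.strong_induction_on with
    | _ k ih =>
      intro i hi y hy hy0 he hv
      by_cases h : ∀ f (h : Arrow T i f), arrowD i f h • y = 0
      · refine ⟨i, y, hy, hy0, fun j hj => ?_⟩
        rw [smul_eq_chiD_smul hv he h, show chiD i j = 0 from hj, zero_smul]
      · push Not at h
        obtain ⟨f, h, hf⟩ := h
        have hc : epsD T * arrowD i f h = arrowD i f h * epsD T := commute_epsD_incl _
        exact ih _ (hi ▸ hht i f h) f rfl _ (N.smul_mem _ hy) hf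
          (by rw [← mul_smul, hc, mul_smul, he, smul_zero])
          (by rw [← mul_smul, idemD_mul_arrowD])
  have hc : epsD T * idemD T i = idemD T i * epsD T := commute_epsD_incl _
  exact key _ i rfl _ (N.smul_mem _ hy) hi (by rw [← mul_smul, hc, mul_smul, he, smul_zero])
    (by rw [← mul_smul, idemD_mul_self])

/-- A socle element spans a simple or zero submodule, which an essential submodule must contain. -/
lemma soc_le_of_isEssential {N : Submodule (JacD T) Y} (hN : IsEssential N) {i : T} {y : Y}
    (hy : y ∈ soc Y i) : y ∈ N := by
  by_contra h
  have h1 : Submodule.span (JacD T) {y} ⊓ N = ⊥ := by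
    rw [Submodule.eq_bot_iff]
    rintro z ⟨hz, hzN⟩
    obtain ⟨a, rfl⟩ := Submodule.mem_span_singleton.1 hz
    rw [smul_of_mem_soc hy] at hzN ⊢
    by_cases hc : chiD i a = 0
    · rw [hc, zero_smul]
    · exfalso
      apply h
      have := (N.restrictScalars ℂ).smul_mem (chiD i a)⁻¹ hzN
      rwa [smul_smul, inv_mul_cancel₀ hc, one_smul] at this
  have h2 := hN _ h1
  rw [Submodule.span_singleton_eq_bot] at h2
  exact h (h2 ▸ N.zero_mem)

variable (T) in
/-- The injective module with multiplicities `a`. -/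
abbrev InjSum (a : T → ℕ) : Type := (i : T) → Fin (a i) → injModule (idemD T i)

/-- An element of an injective module as a functional. -/
def injEv {e : JacD T} (f : injModule e) : Module.Dual ℂ (JacD T) := f.1

lemma injEv_smul {e : JacD T} (f : injModule e) (a b : JacD T) :
    injEv (b • f) a = injEv f (a * b) := rfl

lemma injEv_idem {e : JacD T} (f : injModule e) (a : JacD T) : injEv f (e * a) = injEv f a := f.2 a

lemma injEv_injective {e : JacD T} {f g : injModule e} (h : ∀ a, injEv f a = injEv g a) : f = g :=
  Subtype.ext (LinearMap.ext (f := injEv f) (g := injEv g) h)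

/-- The element of the injective module given by a functional. -/
def injMk (k : T) (g : Module.Dual ℂ (JacD T)) : injModule (idemD T k) :=
  ⟨toModule (dualAction (JacD T)) (g ∘ₗ LinearMap.mulLeft ℂ (idemD T k)), fun a => by
    change g (idemD T k * (idemD T k * a)) = g (idemD T k * a)
    rw [← mul_assoc, idemD_mul_self]⟩

lemma injEv_injMk (k : T) (g : Module.Dual ℂ (JacD T)) (a : JacD T) :
    injEv (injMk k g) a = g (idemD T k * a) := rfl

lemma injEv_of_mem_soc {a : T → ℕ} {i : T} {m : InjSum T a} (hm : m ∈ soc (InjSum T a) i) (k : T)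
    (l : Fin (a k)) (b : JacD T) : injEv (m k l) b = chiD i b * injEv (m k l) 1 := by
  have h := congrArg (fun m : InjSum T a => injEv (m k l) 1) (smul_of_mem_soc hm b)
  have h1 : injEv (m k l) (1 * b) = chiD i b * injEv (m k l) 1 := h
  rwa [one_mul] at h1

-- A functional in the socle at `i` is a multiple of the character of `S_i`, hence determined by its
-- value at `1`. That value vanishes in the injective modules at all other vertices.
open Classical in
lemma exists_socEquiv (a : T → ℕ) (i : T) :
    Nonempty (soc (InjSum T a) i ≃ₗ[ℂ] (Fin (a i) → ℂ)) := by
  let F : soc (InjSum T a) i →ₗ[ℂ] (Fin (a i) → ℂ) :=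
    { toFun := fun m l => injEv (m.1 i l) 1
      map_add' := fun _ _ => rfl
      map_smul' := fun _ _ => rfl }
  refine ⟨LinearEquiv.ofBijective F ⟨?_, fun c => ?_⟩⟩
  · rw [injective_iff_map_eq_zero]
    intro m hm
    refine Subtype.ext (funext fun k => funext fun l => injEv_injective fun b => ?_)
    rw [injEv_of_mem_soc m.2]
    have : injEv (m.1 k l) 1 = 0 := by
      by_cases h : k = i
      · subst h; exact congrFun hm l
      · rw [← injEv_idem, mul_one, injEv_of_mem_soc m.2, chiD_idemD_of_ne h, zero_mul]
    rw [this, mul_zero]; rfl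
  · refine ⟨⟨fun k l => if h : k = i then c (Fin.cast (by rw [h]) l) •
      injMk k (chiD i).toLinearMap else 0, fun j hj => ?_⟩, funext fun l => ?_⟩
    · funext k l
      rw [Pi.smul_apply, Pi.smul_apply]
      by_cases h : k = i
      · rw [dif_pos h, smul_comm]
        have : j • injMk k (chiD i).toLinearMap = 0 := injEv_injective fun b => by
          rw [injEv_smul, injEv_injMk, AlgHom.toLinearMap_apply, map_mul, map_mul,
            show chiD i j = 0 from hj, mul_zero, mul_zero]; rfl
        rw [this, smul_zero]; rfl
      · rw [dif_neg h, smul_zero]; rfl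
    · change injEv (dite _ _ _) 1 = _
      rw [dif_pos rfl]
      change c l * injEv (injMk i _) 1 = c l
      rw [injEv_injMk, mul_one, AlgHom.toLinearMap_apply, chiD_idemD_self, mul_one]

instance (a : T → ℕ) (i : T) : FiniteDimensional ℂ (soc (InjSum T a) i) :=
  (exists_socEquiv a i).some.symm.finiteDimensional

lemma finrank_soc_injSum (a : T → ℕ) (i : T) : finrank ℂ (soc (InjSum T a) i) = a i := by
  rw [(exists_socEquiv a i).some.finrank_eq, finrank_fin_fun]

/-- The extension property of Baer's criterion. A map from an ideal to `D(eA)` is determined by the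
functional `j ↦ φ(j)(1)`, which extends linearly to the whole algebra. -/
lemma exists_extension {a : T → ℕ} (J : Ideal (JacD T)) (φ : J →ₗ[JacD T] InjSum T a) :
    ∃ m : InjSum T a, ∀ j : J, j.1 • m = φ j := by
  have key : ∀ k l, ∃ m : injModule (idemD T k), ∀ j : J, j.1 • m = φ j k l := by
    intro k l
    let g : J.restrictScalars ℂ →ₗ[ℂ] ℂ :=
      { toFun := fun j => injEv (φ j k l) 1
        map_add' := fun x y => by
          change injEv (φ ((show J from x) + (show J from y)) k l) 1 = _
          rw [map_add]; rfl
        map_smul' := fun c x => by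
          change injEv (φ (c • (show J from x)) k l) 1 = _
          rw [LinearMap.map_smul_of_tower]; rfl }
    obtain ⟨G, hG⟩ := LinearMap.exists_extend g
    refine ⟨injMk k G, fun j => injEv_injective fun b => ?_⟩
    have h1 : ∀ x : J, G x.1 = injEv (φ x k l) 1 := fun x =>
      LinearMap.congr_fun hG (show J.restrictScalars ℂ from x)
    have h2 := h1 ((idemD T k * b) • j)
    rw [map_smul] at h2
    have h3 : G (idemD T k * b * j.1) = injEv (φ j k l) (1 * (idemD T k * b)) := h2
    rw [injEv_smul, injEv_injMk, ← mul_assoc, h3, one_mul, injEv_idem]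
  choose m hm using key
  exact ⟨m, fun j => funext fun k => funext fun l => hm k l j⟩

/-- Coordinates on the socle of `Y` extend to functionals on `Y` and define the map. Its kernel
contains no socle element, so it is zero. The image contains the socle of the target by equality of
dimensions, so it is essential. -/
lemma exists_embedding {ht : T → ℕ} (hht : ∀ e f, Arrow T e f → ht f < ht e)
    [∀ i : T, FiniteDimensional ℂ (soc Y i)] :
    ∃ u : Y →ₗ[JacD T] InjSum T (fun i => finrank ℂ (soc Y i)),
      Function.Injective u ∧ IsEssential (LinearMap.range u) := by
  choose g hg using fun (i : T) (l : Fin (finrank ℂ (soc Y i))) =>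
    LinearMap.exists_extend ((finBasis ℂ (soc Y i)).coord l)
  let u : Y →ₗ[JacD T] InjSum T (fun i => finrank ℂ (soc Y i)) :=
    { toFun := fun y i l => injMk i
        (g i l ∘ₗ (LinearMap.toSpanSingleton (JacD T) Y y).restrictScalars ℂ)
      map_add' := fun x y => funext fun i => funext fun l => injEv_injective fun b => by
        change g i l ((idemD T i * b) • (x + y)) =
          g i l ((idemD T i * b) • x) + g i l ((idemD T i * b) • y)
        rw [smul_add, map_add]
      map_smul' := fun a y => funext fun i => funext fun l => injEv_injective fun b => by
        change g i l ((idemD T i * b) • a • y) = g i l ((idemD T i * (b * a)) • y)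
        rw [← mul_smul, mul_assoc] }
  have hu : ∀ y i l, injEv (u y i l) 1 = g i l (idemD T i • y) := fun y i l => by
    change g i l ((idemD T i * 1) • y) = _
    rw [mul_one]
  have hinj : Function.Injective u := by
    rw [← LinearMap.ker_eq_bot]
    by_contra h
    obtain ⟨i, y, hy, hy0, hs⟩ := exists_mem_soc hht h
    apply hy0
    have h1 : (⟨y, hs⟩ : soc Y i) = 0 := by
      refine (finBasis ℂ (soc Y i)).ext_elem fun l => ?_
      have h2 := hu y i l
      rw [smul_of_mem_soc hs, chiD_idemD_self, one_smul, LinearMap.mem_ker.1 hy] at h2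
      have h3 : (finBasis ℂ (soc Y i)).coord l ⟨y, hs⟩ = g i l y := by rw [← hg i l]; rfl
      rw [map_zero, Finsupp.zero_apply, ← Basis.coord_apply, h3, ← h2]
      rfl
    exact congrArg Subtype.val h1
  refine ⟨u, hinj, fun Z hZ => ?_⟩
  by_contra h
  obtain ⟨i, z, hz, hz0, hs⟩ := exists_mem_soc hht h
  let us : soc Y i →ₗ[ℂ] soc (InjSum T (fun i => finrank ℂ (soc Y i))) i :=
    (u.restrictScalars ℂ).restrict fun y hy j hj => by
      rw [LinearMap.restrictScalars_apply, ← map_smul, hy j hj, map_zero]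
  have hus : Function.Surjective us := by
    refine (LinearMap.injective_iff_surjective_of_finrank_eq_finrank ?_).1 fun x y hxy => ?_
    · rw [finrank_soc_injSum]
    · exact Subtype.ext (hinj (congrArg Subtype.val hxy))
  obtain ⟨y, hy⟩ := hus ⟨z, hs⟩
  have : z ∈ Z ⊓ LinearMap.range u := ⟨hz, y.1, congrArg Subtype.val hy⟩
  rw [hZ] at this
  exact hz0 this

/-- The elements whose image under `π` lies in the socle at `i`. -/
abbrev socComap (π : Y →ₗ[JacD T] C) (i : T) : Submodule ℂ Y :=
  (soc C i).comap (π.restrictScalars ℂ)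

/-- An element `m` of the injective module has socle image in the cokernel iff `j ↦ j • m` takes
values in `u(X)`. All homomorphisms from the augmentation ideal to `X` arise in this way by
`exists_extension`, and `m` is determined up to the socle of the injective module, of dimension `a
i`. Cardinal ranks appear since the injective modules are not assumed finite dimensional. -/
lemma rank_socComap (hI : NoInternalTriangle T) [FiniteDimensional ℂ X] {a : T → ℕ}
    {u : X →ₗ[JacD T] InjSum T a} (hu : Function.Injective u) {π : InjSum T a →ₗ[JacD T] C}
    (hπ : LinearMap.ker π = LinearMap.range u) (i : T) :
    Module.rank ℂ (socComap π i) =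
      (finrank ℂ (augIdeal i →ₗ[JacD T] X) + a i : ℕ) := by
  have := finiteDimensional_augHom (X := X) hI i
  let Φ : InjSum T a →ₗ[ℂ] (augIdeal i →ₗ[JacD T] InjSum T a) :=
    { toFun := fun m => LinearMap.toSpanSingleton (JacD T) _ m ∘ₗ (augIdeal i).subtype
      map_add' := fun m m' => LinearMap.ext fun j => smul_add j.1 m m'
      map_smul' := fun c m => LinearMap.ext fun j => smul_comm j.1 c m }
  let U : (augIdeal i →ₗ[JacD T] X) →ₗ[ℂ] (augIdeal i →ₗ[JacD T] InjSum T a) :=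
    { toFun := fun φ => u ∘ₗ φ
      map_add' := fun φ ψ => LinearMap.ext fun j => map_add u _ _
      map_smul' := fun c φ => LinearMap.ext fun j => LinearMap.map_smul_of_tower u c (φ j) }
  have hU : Function.Injective U := fun φ ψ h => LinearMap.ext fun j =>
    hu (LinearMap.congr_fun h j)
  have hr : LinearMap.range (Φ.domRestrict (socComap π i)) = LinearMap.range U := by
    ext ψ
    constructor
    · rintro ⟨m, rfl⟩
      have hm : ∀ j : augIdeal i, Φ m.1 j ∈ LinearMap.range u := fun j => by
        rw [← hπ, LinearMap.mem_ker]
        change π (j.1 • m.1) = 0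
        rw [map_smul]
        exact m.2 j.1 j.2
      refine ⟨(LinearEquiv.ofInjective u hu).symm.toLinearMap ∘ₗ
        (Φ m.1).codRestrict (LinearMap.range u) hm, LinearMap.ext fun j => ?_⟩
      change u ((LinearEquiv.ofInjective u hu).symm _) = _
      have := LinearEquiv.apply_symm_apply (LinearEquiv.ofInjective u hu)
        ((Φ m.1).codRestrict (LinearMap.range u) hm j)
      exact congrArg Subtype.val this
    · rintro ⟨φ, rfl⟩
      obtain ⟨m, hm⟩ := exists_extension (augIdeal i) (u ∘ₗ φ)
      refine ⟨⟨m, fun j hj => ?_⟩, LinearMap.ext hm⟩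
      have : j • m ∈ LinearMap.ker π := by
        rw [hπ, hm ⟨j, hj⟩]; exact ⟨_, rfl⟩
      rw [LinearMap.restrictScalars_apply, ← map_smul]; exact this
  have hk : LinearMap.ker (Φ.domRestrict (socComap π i)) =
      (soc (InjSum T a) i).comap (socComap π i).subtype := by
    ext m
    constructor
    · intro h j hj
      exact LinearMap.congr_fun (LinearMap.mem_ker.1 h) ⟨j, hj⟩
    · intro h
      exact LinearMap.mem_ker.2 (LinearMap.ext fun j => h j.1 j.2)
  have hle : soc (InjSum T a) i ≤ socComap π i := fun m hm j hj => by
    rw [LinearMap.restrictScalars_apply, ← map_smul, hm j hj, map_zero]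
  have h := LinearMap.rank_range_add_rank_ker (Φ.domRestrict (socComap π i))
  rw [hr, hk, (Submodule.comapSubtypeEquivOfLe hle).rank_eq, rank_range_of_injective U hU,
    ← finrank_eq_rank, ← finrank_eq_rank, finrank_soc_injSum] at h
  rw [← h]; push_cast; rfl

/-- Under the hypothesis `v` maps the preimage of the socle onto the socle, with kernel `u(X)`. -/
lemma rank_socComap_of_soc_le {u : X →ₗ[JacD T] Y} (hu : Function.Injective u)
    {v : Y →ₗ[JacD T] C} (hv : LinearMap.ker v = LinearMap.range u) {i : T}
    (hle : ∀ y ∈ soc C i, y ∈ LinearMap.range v) :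
    Module.rank ℂ (socComap v i) = Module.rank ℂ (soc C i) + Module.rank ℂ X := by
  let V : socComap v i →ₗ[ℂ] soc C i := (v.restrictScalars ℂ).restrict fun _ h => h
  have hr : LinearMap.range V = ⊤ := by
    rw [LinearMap.range_eq_top]
    rintro ⟨y, hy⟩
    obtain ⟨m, rfl⟩ := hle y hy
    exact ⟨⟨m, hy⟩, rfl⟩
  have hle : (LinearMap.range u).restrictScalars ℂ ≤ socComap v i := fun m hm j hj => by
    have : m ∈ LinearMap.ker v := by rw [hv]; exact hm
    rw [LinearMap.restrictScalars_apply, LinearMap.mem_ker.1 this, smul_zero]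
  have hk : LinearMap.ker V =
      ((LinearMap.range u).restrictScalars ℂ).comap (socComap v i).subtype := by
    ext m
    rw [← hv]
    exact ⟨fun h => congrArg Subtype.val h, fun h => Subtype.ext h⟩
  have h := LinearMap.rank_range_add_rank_ker V
  have e : X ≃ₗ[ℂ] (LinearMap.range u).restrictScalars ℂ :=
    (LinearEquiv.ofInjective u hu).restrictScalars ℂ
  rw [hr, hk, (Submodule.comapSubtypeEquivOfLe hle).rank_eq, ← e.rank_eq, rank_top] at h
  exact h.symm

lemma finiteDimensional_soc {v : Y →ₗ[JacD T] C} (hv : Function.Surjective v) {i : T} {k : ℕ}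
    (h : Module.rank ℂ (socComap v i) = k) : FiniteDimensional ℂ (soc C i) := by
  have : FiniteDimensional ℂ (socComap v i) :=
    Module.rank_lt_aleph0_iff.1 (by rw [h]; exact Cardinal.natCast_lt_aleph0)
  refine Module.Finite.of_surjective ((v.restrictScalars ℂ).restrict
    (p := socComap v i) (q := soc C i) fun _ h => h) ?_
  rintro ⟨y, hy⟩
  obtain ⟨m, rfl⟩ := hv y
  exact ⟨⟨m, hy⟩, rfl⟩

lemma exists_embedding_quotient {ht : T → ℕ} (hht : ∀ e f, Arrow T e f → ht f < ht e)
    (N : Submodule (JacD T) Y) (h : ∀ i : T, FiniteDimensional ℂ (soc (Y ⧸ N) i)) :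
    ∃ (b : T → ℕ) (v : Y →ₗ[JacD T] InjSum T b), LinearMap.ker v = N ∧
      IsEssential (LinearMap.range v) := by
  obtain ⟨v, hv, hess⟩ := exists_embedding (Y := Y ⧸ N) hht
  refine ⟨_, v ∘ₗ N.mkQ, ?_, ?_⟩
  · rw [LinearMap.ker_comp, LinearMap.ker_eq_bot.2 hv]; exact N.ker_mkQ
  · rwa [LinearMap.range_comp, Submodule.range_mkQ, Submodule.map_top]

/-- The preimage of the socle of `N¹` at `i` is measured twice: as `dim Hom(J_i, X) + a i`, where
`J_i` is the augmentation ideal, and as `b i + dim X`, since the essential image of `v` contains the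
socle. -/
lemma isIndex_eq (hI : NoInternalTriangle T) [FiniteDimensional ℂ X] {g : T → ℤ}
    (h : IsIndex (idemD T) X g) (i : T) :
    g i = (finrank ℂ (augIdeal i →ₗ[JacD T] X) : ℤ) - finrank ℂ X := by
  obtain ⟨a, b, u, v, hu, -, hv, hess, hg⟩ := h
  have h1 := rank_socComap hI hu hv i
  rw [rank_socComap_of_soc_le hu hv fun y hy => soc_le_of_isEssential hess hy,
    ← finrank_eq_rank, ← finrank_eq_rank, finrank_soc_injSum, ← Nat.cast_add, Nat.cast_inj] at h1
  rw [hg]; omega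

/-- After the first embedding the cokernel has finite-dimensional socles by `rank_socComap`, so
`exists_embedding` applies to it again. -/
lemma exists_isIndex (hI : NoInternalTriangle T) {ht : T → ℕ}
    (hht : ∀ e f, Arrow T e f → ht f < ht e) [FiniteDimensional ℂ X] :
    ∃ g, IsIndex (idemD T) X g := by
  obtain ⟨u, hu, hess⟩ := exists_embedding (Y := X) hht
  obtain ⟨b, v, hv, hess'⟩ := exists_embedding_quotient hht (LinearMap.range u) fun i =>
    finiteDimensional_soc (LinearMap.range u).mkQ_surjective
      (rank_socComap hI hu (LinearMap.range u).ker_mkQ i)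
  exact ⟨_, _, b, u, v, hu, hess, hv, hess', fun i => rfl⟩

lemma index_eq (hI : NoInternalTriangle T) {ht : T → ℕ}
    (hht : ∀ e f, Arrow T e f → ht f < ht e) [FiniteDimensional ℂ X] (i : T) :
    index (idemD T) X i = (finrank ℂ (augIdeal i →ₗ[JacD T] X) : ℤ) - finrank ℂ X :=
  isIndex_eq hI (Classical.epsilon_spec (exists_isIndex (X := X) hI hht)) i

end Socle

/-! ### Coordinates on induced modules -/

section Coordinates

open Module

variable {n : ℕ} {T : Finset (Sym2 (Fin (n + 3)))}

section General

variable {V : Type} [AddCommGroup V] [Module ℂ V] (ρ : Jac T →ₐ[ℂ] Module.End ℂ V)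

/-- The coordinates `(x₀, x₁)` of the element `x₀ ⊗ 1 + x₁ ⊗ ε`. -/
def dualCoord (V : Type) [AddCommGroup V] [Module ℂ V] : V ⊗[ℂ] DualNumber ℂ ≃ₗ[ℂ] V × V :=
  (TensorProduct.prodRight ℂ ℂ V ℂ ℂ).trans
    ((TensorProduct.rid ℂ V).prodCongr (TensorProduct.rid ℂ V))

lemma dualCoord_tmul (m : V) (y : DualNumber ℂ) :
    dualCoord V (m ⊗ₜ[ℂ] y) = (y.fst • m, y.snd • m) := rfl

/-- The coordinates on an induced module. -/
def indCoord : AsModule (inducedRep ρ) ≃ₗ[ℂ] V × V := dualCoord V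

lemma indCoord_tmul (m : V) (y : DualNumber ℂ) :
    indCoord ρ (toModule (inducedRep ρ) (m ⊗ₜ[ℂ] y)) = (y.fst • m, y.snd • m) := rfl

lemma indCoord_incl_smul (a : Jac T) (x : AsModule (inducedRep ρ)) :
    indCoord ρ (JacD.incl a • x) = (ρ a (indCoord ρ x).1, ρ a (indCoord ρ x).2) := by
  have : (dualCoord V).toLinearMap ∘ₗ inducedRep ρ (JacD.incl a) =
      (ρ a).prodMap (ρ a) ∘ₗ (dualCoord V).toLinearMap := TensorProduct.ext' fun m y => by
    have : inducedRep ρ (JacD.incl a) (m ⊗ₜ[ℂ] y) = (ρ a m) ⊗ₜ[ℂ] (1 * y) := rfl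
    simp [this, dualCoord_tmul]
  exact LinearMap.congr_fun this (show V ⊗[ℂ] DualNumber ℂ from x)

lemma indCoord_epsD_smul (x : AsModule (inducedRep ρ)) :
    indCoord ρ (epsD T • x) = (0, (indCoord ρ x).1) := by
  have : (dualCoord V).toLinearMap ∘ₗ inducedRep ρ (epsD T) =
      LinearMap.inr ℂ V V ∘ₗ LinearMap.fst ℂ V V ∘ₗ (dualCoord V).toLinearMap :=
    TensorProduct.ext' fun m y => by
      have : inducedRep ρ (epsD T) (m ⊗ₜ[ℂ] y) = (ρ 1 m) ⊗ₜ[ℂ] (DualNumber.eps * y) := rfl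
      simp [this, dualCoord_tmul]
  exact LinearMap.congr_fun this (show V ⊗[ℂ] DualNumber ℂ from x)

end General

variable (hI : NoInternalTriangle T) (γ : Sym2 (Fin (n + 3)))

lemma arcRep_vertexIdem (e : T) : arcRep hI γ (vertexIdem T e) = vertexMap γ e :=
  (Jac.lift_mk ..).trans (by simp [preVertex])

lemma arcRep_arrowJ (e f : T) (h : Arrow T e f) : arcRep hI γ (arrowJ e f h) = arrowMap γ e f :=
  (Jac.lift_mk ..).trans (by simp [preArrow])

lemma indCoord_idemD_smul (e : T) (x : IndModule hI γ) :
    indCoord _ (idemD T e • x) =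
      (vertexMap γ e (indCoord _ x).1, vertexMap γ e (indCoord _ x).2) := by
  rw [← JacD.incl_vertexIdem, indCoord_incl_smul, arcRep_vertexIdem]

lemma indCoord_arrowD_smul (e f : T) (h : Arrow T e f) (x : IndModule hI γ) :
    indCoord _ (arrowD e f h • x) =
      (arrowMap γ e f (indCoord _ x).1, arrowMap γ e f (indCoord _ x).2) := by
  rw [← JacD.incl_arrowJ, indCoord_incl_smul, arcRep_arrowJ]

lemma vertexMap_eq_self_iff {e : T} {w : ArcSpace T γ} :
    vertexMap γ e w = w ↔ ∀ g, g.1 ≠ e → w g = 0 := by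
  constructor
  · intro h g hg
    rw [← h]; simp [vertexMap, hg]
  · intro h
    funext g
    by_cases hg : g.1 = e
    · simp [vertexMap, hg]
    · simp [vertexMap, hg, h g hg]

lemma vertexMap_eq_zero_iff {e : T} {w : ArcSpace T γ} :
    vertexMap γ e w = 0 ↔ ∀ g, g.1 = e → w g = 0 := by
  constructor
  · intro h g hg
    have := congrFun h g
    simpa [vertexMap, hg] using this
  · intro h
    funext g
    by_cases hg : g.1 = e
    · simp [vertexMap, h g hg]
    · simp [vertexMap, hg]

open Classical in
instance : Fintype {e : T // Crosses e.1 γ} := inferInstance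

open Classical in
instance : FiniteDimensional ℂ (IndModule hI γ) :=
  (indCoord (arcRep hI γ)).symm.finiteDimensional

open Classical in
/-- The dimension of `M_γ` at `e`. -/
def arcDim (e : T) : ℕ := if Crosses e.1 γ then 1 else 0

open Classical in
lemma card_eq_arcDim (e : T) :
    Fintype.card {g : {e : T // Crosses e.1 γ} // g.1 = e} = arcDim γ e := by
  unfold arcDim
  split_ifs with h
  · rw [Fintype.card_eq_one_iff]
    exact ⟨⟨⟨e, h⟩, rfl⟩, fun g => Subtype.ext (Subtype.ext g.2)⟩
  · rw [Fintype.card_eq_zero_iff]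
    exact ⟨fun g => h (g.2 ▸ g.1.2)⟩

-- Count of the parameters of `augEquiv`. The value `x` is free away from `i`; `z` has only its
-- `ε`-coordinate at `i`; and `ε y_f = α z` forces the first coordinate of `y_f` and leaves the
-- second one free.
open Classical in
lemma finrank_augHom_indModule (i : T) :
    finrank ℂ (augIdeal i →ₗ[JacD T] IndModule hI γ) + arcDim γ i =
      finrank ℂ (IndModule hI γ) + ∑ f : {f : T // Arrow T i f}, arcDim γ f.1 := by
  rw [(augEquiv hI i).finrank_eq]
  set κ := indCoord (arcRep hI γ) with hκ
  let F : augParam (IndModule hI γ) i →ₗ[ℂ]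
      ({g : {e : T // Crosses e.1 γ} // ¬ g.1 = i} → ℂ × ℂ) ×
      ({g : {e : T // Crosses e.1 γ} // g.1 = i} → ℂ) ×
      ((f : {f : T // Arrow T i f}) → ({g : {e : T // Crosses e.1 γ} // g.1 = f.1} → ℂ)) :=
    { toFun := fun p => (fun g => ((κ p.1.1).1 g, (κ p.1.1).2 g), fun g => (κ p.1.2.1).2 g,
        fun f g => (κ (p.1.2.2 f)).2 g)
      map_add' := fun p p' => by
        refine Prod.ext (funext fun g => ?_) (Prod.ext (funext fun g => ?_)
          (funext fun f => funext fun g => ?_)) <;> simp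
      map_smul' := fun c p => by
        refine Prod.ext (funext fun g => ?_) (Prod.ext (funext fun g => ?_)
          (funext fun f => funext fun g => ?_)) <;> simp }
  have hF : Function.Bijective F := by
    constructor
    · rw [injective_iff_map_eq_zero]
      rintro ⟨⟨x, z, y⟩, hx, ⟨hz, hz'⟩, hy⟩ h
      have h1 : ∀ g, g.1 ≠ i → ((κ x).1 g, (κ x).2 g) = 0 := fun g hg =>
        congrFun (congrArg Prod.fst h) ⟨g, hg⟩
      have h2 : ∀ g, g.1 = i → (κ z).2 g = 0 := fun g hg =>
        congrFun (congrArg (fun p => p.2.1) h) ⟨g, hg⟩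
      have h3 : ∀ f g, g.1 = f.1 → (κ (y f)).2 g = 0 := fun f g hg =>
        congrFun (congrFun (congrArg (fun p => p.2.2) h) f) ⟨g, hg⟩
      dsimp only at hx hz hz' hy
      replace hx := congrArg κ hx
      replace hz := congrArg κ hz
      replace hz' := congrArg κ hz'
      rw [hκ, indCoord_idemD_smul, map_zero] at hx
      rw [hκ, indCoord_idemD_smul] at hz
      rw [hκ, indCoord_epsD_smul, map_zero] at hz'
      have hx1 := (vertexMap_eq_zero_iff γ).1 (congrArg Prod.fst hx)
      have hx2 := (vertexMap_eq_zero_iff γ).1 (congrArg Prod.snd hx)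
      have hz1 : (κ z).1 = 0 := congrArg Prod.snd hz'
      have hz2 := (vertexMap_eq_self_iff γ).1 (congrArg Prod.snd hz)
      have ex : x = 0 := by
        rw [← κ.map_eq_zero_iff]
        refine Prod.ext (funext fun g => ?_) (funext fun g => ?_) <;> by_cases hg : g.1 = i
        · exact hx1 g hg
        · exact congrArg Prod.fst (h1 g hg)
        · exact hx2 g hg
        · exact congrArg Prod.snd (h1 g hg)
      have ez : z = 0 := by
        rw [← κ.map_eq_zero_iff]
        refine Prod.ext hz1 (funext fun g => ?_)
        by_cases hg : g.1 = i
        · exact h2 g hg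
        · exact hz2 g hg
      have ey : y = 0 := by
        funext f
        obtain ⟨hy1, hy2⟩ := hy f
        replace hy1 := congrArg κ hy1
        replace hy2 := congrArg κ hy2
        rw [hκ, indCoord_idemD_smul] at hy1
        rw [hκ, indCoord_epsD_smul, ez, smul_zero, map_zero] at hy2
        have hy3 : (κ (y f)).1 = 0 := congrArg Prod.snd hy2
        have hy4 := (vertexMap_eq_self_iff γ).1 (congrArg Prod.snd hy1)
        change y f = 0
        rw [← κ.map_eq_zero_iff]
        refine Prod.ext hy3 (funext fun g => ?_)
        by_cases hg : g.1 = f.1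
        · exact h3 f g hg
        · exact hy4 g hg
      subst ex ez ey
      rfl
    · rintro ⟨x, z, y⟩
      let zz : ArcSpace T γ := fun g => if h : g.1 = i then z ⟨g, h⟩ else 0
      refine ⟨⟨(κ.symm (fun g => if h : g.1 = i then 0 else (x ⟨g, h⟩).1,
          fun g => if h : g.1 = i then 0 else (x ⟨g, h⟩).2), κ.symm (0, zz),
          fun f => κ.symm (arrowMap γ i f.1 zz, fun g => if h : g.1 = f.1 then y f ⟨g, h⟩ else 0)),
          ?_, ⟨?_, ?_⟩, fun f => ⟨?_, ?_⟩⟩, ?_⟩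
      · apply κ.injective
        rw [hκ, indCoord_idemD_smul, LinearEquiv.apply_symm_apply, map_zero]
        refine Prod.ext ((vertexMap_eq_zero_iff γ).2 fun g hg => ?_)
          ((vertexMap_eq_zero_iff γ).2 fun g hg => ?_) <;> simp [hg]
      · apply κ.injective
        rw [hκ, indCoord_idemD_smul, LinearEquiv.apply_symm_apply]
        refine Prod.ext (map_zero _) ((vertexMap_eq_self_iff γ).2 fun g hg => ?_)
        simp [zz, hg]
      · apply κ.injective
        rw [hκ, indCoord_epsD_smul, LinearEquiv.apply_symm_apply, map_zero]; rfl
      · apply κ.injective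
        rw [hκ, indCoord_idemD_smul, LinearEquiv.apply_symm_apply]
        refine Prod.ext ((vertexMap_eq_self_iff γ).2 fun g hg => ?_)
          ((vertexMap_eq_self_iff γ).2 fun g hg => ?_)
        · simp [arrowMap, hg]
        · simp [hg]
      · apply κ.injective
        rw [hκ, indCoord_epsD_smul, LinearEquiv.apply_symm_apply, indCoord_arrowD_smul,
          LinearEquiv.apply_symm_apply]
        exact Prod.ext (map_zero _).symm rfl
      · refine Prod.ext (funext fun g => ?_) (Prod.ext (funext fun g => ?_)
          (funext fun f => funext fun g => ?_))
        · simp [F, g.2]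
        · simp [F, zz, g.2]
        · simp [F, g.2]
  have hc := Fintype.card_subtype_compl (fun g : {e : T // Crosses e.1 γ} => g.1 = i)
  have hc' := Fintype.card_subtype_le (fun g : {e : T // Crosses e.1 γ} => g.1 = i)
  rw [(LinearEquiv.ofBijective F hF).finrank_eq, κ.finrank_eq]
  simp only [finrank_prod, finrank_pi_fintype, finrank_self, Finset.sum_const, smul_eq_mul,
    mul_one, Finset.card_univ, hc, card_eq_arcDim] at hc' ⊢
  omega

open Classical in
lemma index_indModule {ht : T → ℕ} (hht : ∀ e f, Arrow T e f → ht f < ht e) (i : T) :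
    index (idemD T) (IndModule hI γ) i =
      ∑ f : T, (if Arrow T i f then (arcDim γ f : ℤ) else 0) - arcDim γ i := by
  rw [index_eq hI hht]
  have h := finrank_augHom_indModule hI γ i
  zify at h
  rw [← Finset.sum_filter]
  rw [Finset.sum_subtype (p := fun f => Arrow T i f) (F := inferInstance) _ (by simp)]
  linarith

end Coordinates

/-! ### Submodules of an induced module -/

section Submodules

open Module

variable {n : ℕ} {T : Finset (Sym2 (Fin (n + 3)))}

/-- The stable subspaces of a nilpotent Jordan block of size two form the chain `0 ⊂ ℂε ⊂ ℂ²`, so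
the dimension alone determines the subspace. All uniqueness of submodules comes from this. -/
lemma mem_iff_of_eps_stable {P : Submodule ℂ (ℂ × ℂ)} (hP : ∀ x ∈ P, ((0 : ℂ), x.1) ∈ P)
    (x : ℂ × ℂ) : x ∈ P ↔ (finrank ℂ P = 0 → x = 0) ∧ (finrank ℂ P = 1 → x.1 = 0) := by
  by_cases h : ∃ y ∈ P, y.1 ≠ 0
  · obtain ⟨y, hy, hy0⟩ := h
    have htop : P = ⊤ := by
      rw [eq_top_iff]
      rintro z -
      have : z = (z.1 / y.1) • y + ((z.2 - z.1 / y.1 * y.2) / y.1) • ((0 : ℂ), y.1) := by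
        ext
        · simp [hy0]
        · simp [hy0]
      rw [this]
      exact P.add_mem (P.smul_mem _ hy) (P.smul_mem _ (hP _ hy))
    subst htop
    simp
  · push Not at h
    by_cases h' : ∃ y ∈ P, y ≠ 0
    · obtain ⟨y, hy, hy0⟩ := h'
      have hy1 := h y hy
      have hy2 : y.2 ≠ 0 := fun h2 => hy0 (Prod.ext hy1 h2)
      have hspan : P = Submodule.span ℂ {y} := by
        refine le_antisymm (fun z hz => ?_) (by rwa [Submodule.span_singleton_le_iff_mem])
        rw [Submodule.mem_span_singleton]
        refine ⟨z.2 / y.2, ?_⟩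
        ext
        · simp [hy1, h z hz]
        · simp [hy2]
      have hf : finrank ℂ P = 1 := by rw [hspan, finrank_span_singleton hy0]
      rw [hf]
      constructor
      · intro hx; exact ⟨by simp, fun _ => h x hx⟩
      · rintro ⟨-, hx⟩
        rw [hspan, Submodule.mem_span_singleton]
        refine ⟨x.2 / y.2, ?_⟩
        ext
        · simp [hy1, hx rfl]
        · simp [hy2]
    · push Not at h'
      have hb : P = ⊥ := (Submodule.eq_bot_iff P).2 h'
      subst hb
      simp

variable {hI : NoInternalTriangle T} {γ : Sym2 (Fin (n + 3))}

open Classical in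
variable (hI) in
/-- The inclusion of the space of an induced module at an arc. -/
def indSingle (g : {e : T // Crosses e.1 γ}) : ℂ × ℂ →ₗ[ℂ] IndModule hI γ :=
  (indCoord (arcRep hI γ)).symm.toLinearMap ∘ₗ
    (LinearMap.single ℂ (fun _ => ℂ) g).prodMap (LinearMap.single ℂ (fun _ => ℂ) g)

open Classical in
lemma indCoord_indSingle (g : {e : T // Crosses e.1 γ}) (a : ℂ × ℂ) :
    indCoord _ (indSingle hI g a) = (Pi.single g a.1, Pi.single g a.2) := by
  rw [indSingle, LinearMap.comp_apply, LinearEquiv.coe_coe, LinearEquiv.apply_symm_apply]; rfl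

lemma indSingle_injective (g : {e : T // Crosses e.1 γ}) :
    Function.Injective (indSingle hI g) := fun a b h => by
  have h1 := congrArg (indCoord _) h
  rw [indCoord_indSingle, indCoord_indSingle] at h1
  exact Prod.ext (Pi.single_injective _ (congrArg Prod.fst h1))
    (Pi.single_injective _ (congrArg Prod.snd h1))

lemma idemD_smul_eq_indSingle (g : {e : T // Crosses e.1 γ}) (x : IndModule hI γ) :
    idemD T g.1 • x = indSingle hI g ((indCoord _ x).1 g, (indCoord _ x).2 g) := by
  classical
  apply (indCoord _).injective
  rw [indCoord_idemD_smul, indCoord_indSingle]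
  refine Prod.ext (funext fun g' => ?_) (funext fun g' => ?_) <;> by_cases h : g' = g
  · subst h; simp [vertexMap]
  · have : g'.1 ≠ g.1 := fun h' => h (Subtype.ext h')
    simp [vertexMap, h, this]
  · subst h; simp [vertexMap]
  · have : g'.1 ≠ g.1 := fun h' => h (Subtype.ext h')
    simp [vertexMap, h, this]

lemma idemD_smul_eq_zero {e : T} (he : ¬ Crosses e.1 γ) (x : IndModule hI γ) :
    idemD T e • x = 0 := by
  apply (indCoord _).injective
  rw [indCoord_idemD_smul, map_zero]
  have h : ∀ g : {e : T // Crosses e.1 γ}, g.1 ≠ e := fun g hg => he (hg ▸ g.2)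
  refine Prod.ext (funext fun g' => ?_) (funext fun g' => ?_) <;> simp [vertexMap, h g']

lemma epsD_smul_indSingle (g : {e : T // Crosses e.1 γ}) (a : ℂ × ℂ) :
    epsD T • indSingle hI g a = indSingle hI g (0, a.1) := by
  classical
  apply (indCoord _).injective
  rw [indCoord_epsD_smul, indCoord_indSingle, indCoord_indSingle]
  simp

lemma arrowD_smul_indSingle {g g' : {e : T // Crosses e.1 γ}} (h : Arrow T g.1 g'.1) (a : ℂ × ℂ) :
    arrowD g.1 g'.1 h • indSingle hI g a = indSingle hI g' a := by
  classical
  apply (indCoord _).injective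
  rw [indCoord_arrowD_smul, indCoord_indSingle, indCoord_indSingle]
  refine Prod.ext (funext fun x => ?_) (funext fun x => ?_) <;> by_cases hx : x = g'
  · subst hx; simp [arrowMap, g.2]
  · have : x.1 ≠ g'.1 := fun h' => hx (Subtype.ext h')
    simp [arrowMap, this, hx]
  · subst hx; simp [arrowMap, g.2]
  · have : x.1 ≠ g'.1 := fun h' => hx (Subtype.ext h')
    simp [arrowMap, this, hx]

lemma mem_iff_idemD_smul_mem {X : Type} [AddCommGroup X] [Module (JacD T) X]
    {N : Submodule (JacD T) X} {x : X} : x ∈ N ↔ ∀ e : T, idemD T e • x ∈ N := by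
  refine ⟨fun h e => N.smul_mem _ h, fun h => ?_⟩
  rw [← one_smul (JacD T) x, ← sum_idemD, Finset.sum_smul]
  exact N.sum_mem fun e _ => h e

lemma mem_vertexSpace {X : Type} [AddCommGroup X] [Module ℂ X] [Module (JacD T) X]
    [IsScalarTower ℂ (JacD T) X] {e : T} {x : X} :
    x ∈ vertexSpace (idemD T) X e ↔ idemD T e • x = x := by
  constructor
  · rintro ⟨y, rfl⟩
    change idemD T e • idemD T e • y = idemD T e • y
    rw [← mul_smul, idemD_mul_self]
  · intro h; exact ⟨x, h⟩

lemma finrank_vertexPart (N : Submodule (JacD T) (IndModule hI γ))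
    (g : {e : T // Crosses e.1 γ}) : finrank ℂ (vertexPart (idemD T) N g.1) =
      finrank ℂ ((N.restrictScalars ℂ).comap (indSingle hI g)) := by
  have hs : ∀ a, indSingle hI g a ∈ vertexSpace (idemD T) (IndModule hI γ) g.1 := fun a => by
    classical
    rw [mem_vertexSpace, idemD_smul_eq_indSingle, indCoord_indSingle]; simp
  let F : (N.restrictScalars ℂ).comap (indSingle hI g) →ₗ[ℂ] vertexPart (idemD T) N g.1 :=
    ((indSingle hI g).codRestrict _ hs).restrict fun _ h => h
  refine (LinearEquiv.ofBijective F ⟨fun a b h => ?_, ?_⟩).finrank_eq.symm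
  · exact Subtype.ext (indSingle_injective g
      (congrArg (fun x : vertexPart (idemD T) N g.1 => x.1.1) h))
  · rintro ⟨⟨x, hx⟩, hxN⟩
    rw [mem_vertexSpace, idemD_smul_eq_indSingle] at hx
    exact ⟨⟨_, show indSingle hI g _ ∈ N by rw [hx]; exact hxN⟩,
      Subtype.ext (Subtype.ext hx)⟩

lemma finrank_vertexPart_of_not (N : Submodule (JacD T) (IndModule hI γ)) {e : T}
    (he : ¬ Crosses e.1 γ) : finrank ℂ (vertexPart (idemD T) N e) = 0 := by
  have : Subsingleton (vertexPart (idemD T) N e) := by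
    refine ⟨fun x y => Subtype.ext (Subtype.ext ?_)⟩
    have hx := mem_vertexSpace.1 x.1.2
    have hy := mem_vertexSpace.1 y.1.2
    rw [idemD_smul_eq_zero he] at hx hy
    rw [← hx, ← hy]
  exact finrank_zero_of_subsingleton

/-- The dimension vectors of the submodules of the induced module of `γ`. -/
structure GoodVec (γ : Sym2 (Fin (n + 3))) (d : T → ℕ) : Prop where
  supp : ∀ e : T, ¬ Crosses e.1 γ → d e = 0
  le : ∀ e, d e ≤ 2
  arrow : ∀ e f, Arrow T e f → Crosses e.1 γ → Crosses f.1 γ → d e ≤ d f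

/-- The conditions that define the submodule with dimension vector `d`. -/
def InStd (d : T → ℕ) (x : ArcSpace T γ × ArcSpace T γ) : Prop :=
  ∀ g, (d g.1 = 0 → x.1 g = 0 ∧ x.2 g = 0) ∧ (d g.1 = 1 → x.1 g = 0)

lemma HasDimVec.comap_indSingle {N : Submodule (JacD T) (IndModule hI γ)} {d : T → ℕ}
    (h : HasDimVec (idemD T) N d) (g : {e : T // Crosses e.1 γ}) (a : ℂ × ℂ) :
    indSingle hI g a ∈ N ↔ (d g.1 = 0 → a = 0) ∧ (d g.1 = 1 → a.1 = 0) := by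
  rw [← h g.1, finrank_vertexPart]
  refine mem_iff_of_eps_stable (P := (N.restrictScalars ℂ).comap (indSingle hI g))
    (fun x hx => ?_) a
  change indSingle hI g _ ∈ N
  rw [← epsD_smul_indSingle]
  exact N.smul_mem _ hx

/-- Membership is tested at one arc at a time, and the space at an arc is a single Jordan block for
`ε`. -/
lemma HasDimVec.mem_iff {N : Submodule (JacD T) (IndModule hI γ)} {d : T → ℕ}
    (h : HasDimVec (idemD T) N d) (x : IndModule hI γ) :
    x ∈ N ↔ InStd d (indCoord _ x) := by
  rw [mem_iff_idemD_smul_mem]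
  constructor
  · intro hx g
    have h1 := hx g.1
    rw [idemD_smul_eq_indSingle, h.comap_indSingle] at h1
    exact ⟨fun h0 => ⟨congrArg Prod.fst (h1.1 h0), congrArg Prod.snd (h1.1 h0)⟩, h1.2⟩
  · intro hx e
    by_cases he : Crosses e.1 γ
    · rw [idemD_smul_eq_indSingle ⟨e, he⟩, h.comap_indSingle]
      have h1 := hx ⟨e, he⟩
      exact ⟨fun h0 => Prod.ext (h1.1 h0).1 (h1.1 h0).2, h1.2⟩
    · rw [idemD_smul_eq_zero he]; exact N.zero_mem

/-- Arrows between crossed arcs act by the identity of `ℂ²`, so stability under an arrow is an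
inclusion of subspaces. -/
lemma HasDimVec.goodVec {N : Submodule (JacD T) (IndModule hI γ)} {d : T → ℕ}
    (h : HasDimVec (idemD T) N d) : GoodVec γ d where
  supp e he := by rw [← h e, finrank_vertexPart_of_not N he]
  le e := by
    by_cases he : Crosses e.1 γ
    · rw [← h e, finrank_vertexPart N ⟨e, he⟩]
      exact (Submodule.finrank_le _).trans (by simp)
    · rw [← h e, finrank_vertexPart_of_not N he]; omega
  arrow e f ha he hf := by
    rw [← h e, ← h f, finrank_vertexPart N ⟨e, he⟩, finrank_vertexPart N ⟨f, hf⟩]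
    refine Submodule.finrank_mono fun x hx => ?_
    change indSingle hI _ x ∈ N
    rw [← arrowD_smul_indSingle (g := ⟨e, he⟩) (g' := ⟨f, hf⟩) ha]
    exact N.smul_mem _ hx

variable (hI) in
/-- The submodule with a given dimension vector. -/
def stdSub {d : T → ℕ} (hd : GoodVec γ d) : Submodule (JacD T) (IndModule hI γ) :=
  subOfGen
    { carrier := {x | InStd d (indCoord _ x)}
      zero_mem' := fun g => by simp
      add_mem' := fun {x y} hx hy g => by
        rw [map_add]
        refine ⟨fun h => ⟨?_, ?_⟩, fun h => ?_⟩
        · simp [((hx g).1 h).1, ((hy g).1 h).1]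
        · simp [((hx g).1 h).2, ((hy g).1 h).2]
        · simp [(hx g).2 h, (hy g).2 h]
      smul_mem' := fun c x hx g => by
        rw [map_smul]
        refine ⟨fun h => ⟨?_, ?_⟩, fun h => ?_⟩
        · simp [((hx g).1 h).1]
        · simp [((hx g).1 h).2]
        · simp [(hx g).2 h] }
    (fun e x hx g => by
      rw [indCoord_idemD_smul]
      refine ⟨fun h => ⟨?_, ?_⟩, fun h => ?_⟩
      · simp [vertexMap, ((hx g).1 h).1]
      · simp [vertexMap, ((hx g).1 h).2]
      · simp [vertexMap, (hx g).2 h])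
    (fun e f ha x hx g => by
      rw [indCoord_arrowD_smul]
      by_cases hg : g.1 = f
      · by_cases he : Crosses e.1 γ
        · have h1 := hd.arrow e f ha he (hg ▸ g.2)
          rw [← hg] at h1
          have h2 := hx ⟨e, he⟩
          refine ⟨fun h => ?_, fun h => ?_⟩
          · have := h2.1 (by dsimp only; omega)
            simp [arrowMap, hg, he, this]
          · have h3 : (indCoord (arcRep hI γ) x).1 ⟨e, he⟩ = 0 := by
              have : d e = 0 ∨ d e = 1 := by omega
              rcases this with h4 | h4
              · exact (h2.1 h4).1
              · exact h2.2 h4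
            simp [arrowMap, hg, he, h3]
        · simp [arrowMap, he]
      · simp [arrowMap, hg])
    (fun x hx g => by
      rw [indCoord_epsD_smul]
      exact ⟨fun h => ⟨rfl, ((hx g).1 h).1⟩, fun _ => rfl⟩)

lemma mem_stdSub {d : T → ℕ} {hd : GoodVec γ d} {x : IndModule hI γ} :
    x ∈ stdSub hI hd ↔ InStd d (indCoord _ x) := Iff.rfl

lemma hasDimVec_stdSub {d : T → ℕ} (hd : GoodVec γ d) :
    HasDimVec (idemD T) (stdSub hI hd) d := by
  classical
  intro e
  by_cases he : Crosses e.1 γ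
  · rw [finrank_vertexPart _ ⟨e, he⟩]
    have key : ∀ a : ℂ × ℂ, indSingle hI ⟨e, he⟩ a ∈ stdSub hI hd ↔
        (d e = 0 → a = 0) ∧ (d e = 1 → a.1 = 0) := by
      intro a
      rw [mem_stdSub, indCoord_indSingle]
      constructor
      · intro h
        have h1 := h ⟨e, he⟩
        simp only [Pi.single_eq_same] at h1
        exact ⟨fun h0 => Prod.ext (h1.1 h0).1 (h1.1 h0).2, h1.2⟩
      · intro h g
        by_cases hg : g = ⟨e, he⟩
        · subst hg
          simp only [Pi.single_eq_same]
          exact ⟨fun h0 => by rw [h.1 h0]; exact ⟨rfl, rfl⟩, h.2⟩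
        · simp [hg]
    have hle := hd.le e
    have h3 : d e = 0 ∨ d e = 1 ∨ d e = 2 := by omega
    rcases h3 with h3 | h3 | h3
    · have : ((stdSub hI hd).restrictScalars ℂ).comap (indSingle hI ⟨e, he⟩) = ⊥ := by
        rw [Submodule.eq_bot_iff]; intro a ha; exact ((key a).1 ha).1 h3
      rw [this, finrank_bot, h3]
    · have : ((stdSub hI hd).restrictScalars ℂ).comap (indSingle hI ⟨e, he⟩) =
          Submodule.span ℂ {((0 : ℂ), (1 : ℂ))} := by
        ext a
        rw [Submodule.mem_span_singleton]
        refine (key a).trans ?_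
        rw [h3]
        constructor
        · rintro ⟨-, h⟩; exact ⟨a.2, Prod.ext (by simp [h rfl]) (by simp)⟩
        · rintro ⟨c, rfl⟩; simp
      rw [this, finrank_span_singleton (by simp), h3]
    · have : ((stdSub hI hd).restrictScalars ℂ).comap (indSingle hI ⟨e, he⟩) = ⊤ := by
        rw [eq_top_iff]; intro a _; refine (key a).2 ?_; rw [h3]; simp
      rw [this, finrank_top, h3]; simp
  · rw [finrank_vertexPart_of_not _ he, hd.supp e he]

lemma HasDimVec.eq_stdSub {N : Submodule (JacD T) (IndModule hI γ)} {d : T → ℕ}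
    (h : HasDimVec (idemD T) N d) : N = stdSub hI h.goodVec :=
  Submodule.ext fun x => h.mem_iff x

end Submodules

/-! ### The Euler characteristic of a point -/

section Euler

open Module

/-- A point is totally disconnected, so its singular homology is concentrated in degree zero, where
it is one copy of the coefficients. -/
lemma eulerChar_of_unique (Y : Type) [TopologicalSpace Y] [Unique Y] : eulerChar Y = 1 := by
  have : TotallyDisconnectedSpace (TopCat.of Y) :=
    inferInstanceAs (TotallyDisconnectedSpace Y)
  let : Unique (TopCat.of Y) := inferInstanceAs (Unique Y)
  unfold eulerChar
  rw [HomologicalComplex.homologyEulerChar_eq_sum_finSet_of_finrankSupport_subset _ {0}]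
  · rw [Finset.sum_singleton]
    have e : (((AlgebraicTopology.singularHomologyFunctor (ModuleCat.{0} ℚ) 0).obj
        (ModuleCat.of ℚ ℚ)).obj (TopCat.of Y)) ≅ ModuleCat.of ℚ ℚ :=
      AlgebraicTopology.singularHomologyFunctorZeroOfTotallyDisconnectedSpace _ _ _ ≪≫
        Limits.coproductUniqueIso _
    have h : finrank ℚ ((((AlgebraicTopology.singularChainComplexFunctor (ModuleCat.{0} ℚ)).obj
        (ModuleCat.of ℚ ℚ)).obj (TopCat.of Y)).homology 0) = 1 :=
      e.toLinearEquiv.finrank_eq.trans (finrank_self ℚ)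
    rw [h]; simp
  · rw [GradedObject.finrankSupport_subset_iff]
    intro i hi
    have h := (AlgebraicTopology.singularChainComplexFunctor_exactAt_of_totallyDisconnectedSpace
      (ModuleCat.{0} ℚ) i (ModuleCat.of ℚ ℚ) (TopCat.of Y) (by simpa using hi)).isZero_homology
    have := ModuleCat.subsingleton_of_isZero h
    exact finrank_zero_of_subsingleton

variable {n : ℕ} {T : Finset (Sym2 (Fin (n + 3)))} {hI : NoInternalTriangle T}
  {γ : Sym2 (Fin (n + 3))}

lemma eulerChar_subGr {d : T → ℕ} (hd : GoodVec γ d) :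
    eulerChar (SubGr (idemD T) (IndModule hI γ) d) = 1 := by
  let : Unique (SubGr (idemD T) (IndModule hI γ) d) :=
    { default := ⟨stdSub hI hd, hasDimVec_stdSub hd⟩
      uniq := fun N => Subtype.ext (HasDimVec.eq_stdSub N.2) }
  exact eulerChar_of_unique _

end Euler

/-! ### The quotient by the largest induced submodule -/

section FModules

open Module

variable {n : ℕ} {T : Finset (Sym2 (Fin (n + 3)))} {hI : NoInternalTriangle T}
  {γ : Sym2 (Fin (n + 3))}

lemma arcModule_idemD_smul (e : T) (x : ArcModule hI γ) :
    idemD T e • x = toModule _ (vertexMap γ e (show ArcSpace T γ from x)) := by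
  change arcRep hI γ (killEps T (idemD T e)) (show ArcSpace T γ from x) = _
  rw [killEps_idemD, arcRep_vertexIdem]; rfl

lemma arcModule_arrowD_smul (e f : T) (h : Arrow T e f) (x : ArcModule hI γ) :
    arrowD e f h • x = toModule _ (arrowMap γ e f (show ArcSpace T γ from x)) := by
  change arcRep hI γ (killEps T (arrowD e f h)) (show ArcSpace T γ from x) = _
  rw [killEps_arrowD, arcRep_arrowJ]; rfl

lemma arcModule_epsD_smul (x : ArcModule hI γ) : epsD T • x = 0 := by
  change arcRep hI γ (killEps T (epsD T)) (show ArcSpace T γ from x) = _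
  rw [killEps_epsD, map_zero]; rfl

lemma GoodVec.two {d : T → ℕ} (hd : GoodVec γ d) :
    GoodVec γ (fun e => if d e = 2 then 2 else 0) where
  supp e he := by simp [hd.supp e he]
  le e := by split_ifs <;> omega
  arrow e f h he hf := by
    have := hd.arrow e f h he hf
    have := hd.le f
    split_ifs <;> omega

/-- An element `m ⊗ ε` lies in `Nε` exactly if `m` occurs as a first coordinate in `N`, that is, if
`m` is supported where the dimension is two. -/
lemma inducedPart_stdSub {d : T → ℕ} (hd : GoodVec γ d) :
    inducedPart (arcRep hI γ) (stdSub hI hd) = stdSub hI hd.two := by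
  apply le_antisymm
  · rw [inducedPart, Submodule.span_le]
    rintro x ⟨m, rfl, y, hy, hym⟩
    have h1 := congrArg (indCoord _) hym
    rw [indCoord_epsD_smul, indCoord_tmul] at h1
    have h2 : (indCoord _ y).1 = m := by simpa using congrArg Prod.snd h1
    rw [SetLike.mem_coe, mem_stdSub, indCoord_tmul]
    intro g
    simp only [TrivSqZeroExt.fst_one, one_smul, TrivSqZeroExt.snd_one, zero_smul]
    rw [← h2]
    have h3 := hy g
    have h4 := hd.le g.1
    have h5 : d g.1 = 0 ∨ d g.1 = 1 ∨ d g.1 = 2 := by omega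
    rcases h5 with h5 | h5 | h5
    · exact ⟨fun _ => ⟨(h3.1 h5).1, rfl⟩, fun _ => (h3.1 h5).1⟩
    · exact ⟨fun _ => ⟨h3.2 h5, rfl⟩, fun _ => h3.2 h5⟩
    · simp [h5]
  · intro x hx
    have key : ∀ m : ArcSpace T γ, (∀ g, d g.1 ≠ 2 → m g = 0) →
        toModule (inducedRep (arcRep hI γ)) (m ⊗ₜ[ℂ] 1) ∈
          inducedPart (arcRep hI γ) (stdSub hI hd) := by
      intro m hm
      refine Submodule.subset_span ⟨m, rfl, (indCoord _).symm (m, 0), ?_, ?_⟩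
      · rw [mem_stdSub, LinearEquiv.apply_symm_apply]
        intro g
        exact ⟨fun h => ⟨hm g (by omega), rfl⟩, fun h => hm g (by omega)⟩
      · apply (indCoord _).injective
        rw [indCoord_epsD_smul, LinearEquiv.apply_symm_apply, indCoord_tmul]; simp
    have h1 : ∀ g : {e : T // Crosses e.1 γ}, d g.1 ≠ 2 →
        (indCoord _ x).1 g = 0 ∧ (indCoord _ x).2 g = 0 := fun g hg => (hx g).1 (if_neg hg)
    have hx' : x = toModule _ ((indCoord _ x).1 ⊗ₜ[ℂ] 1) +
        epsD T • toModule _ ((indCoord _ x).2 ⊗ₜ[ℂ] 1) := by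
      apply (indCoord _).injective
      rw [map_add, indCoord_epsD_smul, indCoord_tmul, indCoord_tmul]
      refine Prod.ext ?_ ?_ <;> simp
    rw [hx']
    exact Submodule.add_mem _ (key _ fun g hg => (h1 g hg).1)
      (Submodule.smul_mem _ _ (key _ fun g hg => (h1 g hg).2))

/-- The arcs `γ' k` cut out the connected components of the set of arcs where `d` is one. -/
structure IsCut {ι : Type} (γ : Sym2 (Fin (n + 3))) (d : T → ℕ) (γ' : ι → Sym2 (Fin (n + 3))) :
    Prop where
  sub : ∀ k (e : T), Crosses e.1 (γ' k) → Crosses e.1 γ ∧ d e = 1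
  cover : ∀ e : T, Crosses e.1 γ → d e = 1 → ∃ k, Crosses e.1 (γ' k)
  disj : ∀ k k' (e : T), Crosses e.1 (γ' k) → Crosses e.1 (γ' k') → k = k'
  arrow : ∀ k (e f : T), Arrow T e f → Crosses e.1 γ → d e = 1 → Crosses f.1 (γ' k) →
    Crosses e.1 (γ' k)

-- The isomorphism takes the `ε`-coordinates on the arcs of dimension one, sorted by component. Its
-- kernel consists of the elements supported where the dimension is two, which is the induced part.
open Classical in
lemma IsCut.nonempty_equiv {ι : Type} {d : T → ℕ} (hd : GoodVec γ d)
    {γ' : ι → Sym2 (Fin (n + 3))} (H : IsCut γ d γ') :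
    Nonempty (FMod (arcRep hI γ) (stdSub hI hd) ≃ₗ[JacD T] ((k : ι) → ArcModule hI (γ' k))) := by
  set κ := indCoord (arcRep hI γ) with hκ
  let P0 : stdSub hI hd →ₗ[ℂ] ((k : ι) → ArcModule hI (γ' k)) :=
    { toFun := fun x k => toModule _ fun g => (κ x.1).2 ⟨g.1, (H.sub k g.1 g.2).1⟩
      map_add' := fun x y => by
        funext k
        change (fun g => (κ (x.1 + y.1)).2 _) = _
        rw [map_add]; rfl
      map_smul' := fun c x => by
        funext k
        change (fun g => (κ (c • x.1)).2 _) = _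
        rw [map_smul]; rfl }
  let P : stdSub hI hd →ₗ[JacD T] ((k : ι) → ArcModule hI (γ' k)) := linOfGen P0
    (fun e x => by
      funext k
      rw [Pi.smul_apply, arcModule_idemD_smul]
      change (fun g => (κ (idemD T e • x.1)).2 _) = _
      rw [hκ, indCoord_idemD_smul]
      funext g
      simp [vertexMap, toModule, P0, hκ]
      rfl)
    (fun e f h x => by
      funext k
      rw [Pi.smul_apply, arcModule_arrowD_smul]
      change (fun g => (κ (arrowD e f h • x.1)).2 _) = _
      rw [hκ, indCoord_arrowD_smul]
      funext g
      by_cases hg : g.1 = f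
      · by_cases he : Crosses e.1 γ
        · by_cases he' : Crosses e.1 (γ' k)
          · simp [arrowMap, toModule, P0, hκ, hg, he, he']
            rfl
          · have hg2 := g.2
            rw [hg] at hg2
            -- An arrow into a component that starts outside it starts where `d` is not one. Since
            -- `d e ≤ d f = 1`, it starts where the submodule vanishes and contributes nothing.
            have h1 : d e ≠ 1 := fun h1 => he' (H.arrow k e f h he h1 hg2)
            have h2 := hd.arrow e f h he (H.sub k f hg2).1
            rw [(H.sub k f hg2).2] at h2
            have h3 := (x.2 ⟨e, he⟩).1 (by dsimp only; omega)
            simp [arrowMap, toModule, hg, he, he', h3.2]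
        · have he' : ¬ Crosses e.1 (γ' k) := fun h' => he (H.sub k e h').1
          simp [arrowMap, toModule, he, he']
      · simp [arrowMap, toModule, hg])
    (fun x => by
      funext k
      rw [Pi.smul_apply, arcModule_epsD_smul]
      change (fun g => (κ (epsD T • x.1)).2 _) = _
      rw [hκ, indCoord_epsD_smul]
      funext g
      exact (x.2 ⟨g.1, _⟩).2 (H.sub k g.1 g.2).2)
  have hP : ∀ (x : stdSub hI hd) (k : ι) (g : {e : T // Crosses e.1 (γ' k)}),
      (show ArcSpace T (γ' k) from P x k) g = (κ x.1).2 ⟨g.1, (H.sub k g.1 g.2).1⟩ :=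
    fun _ _ _ => rfl
  have hsurj : Function.Surjective P := by
    intro y
    refine ⟨⟨κ.symm (0, fun g => if h : ∃ k, Crosses g.1.1 (γ' k) then
      (show ArcSpace T (γ' h.choose) from y h.choose) ⟨g.1, h.choose_spec⟩ else 0), ?_⟩, ?_⟩
    · rw [mem_stdSub, LinearEquiv.apply_symm_apply]
      intro g
      refine ⟨fun h => ⟨rfl, ?_⟩, fun _ => rfl⟩
      dsimp only
      rw [dif_neg]
      rintro ⟨k, hk⟩
      have := (H.sub k g.1 hk).2
      omega
    · funext k
      refine funext (f := (show ArcSpace T (γ' k) from _)) (g := (show ArcSpace T (γ' k) from _))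
        fun g => ?_
      rw [hP]
      dsimp only
      rw [LinearEquiv.apply_symm_apply]
      have hex : ∃ k, Crosses g.1.1 (γ' k) := ⟨k, g.2⟩
      dsimp only
      rw [dif_pos hex]
      have hk : hex.choose = k := H.disj _ _ g.1 hex.choose_spec g.2
      have key : ∀ (k' : ι) (h' : Crosses g.1.1 (γ' k')), k' = k →
          (show ArcSpace T (γ' k') from y k') ⟨g.1, h'⟩ =
            (show ArcSpace T (γ' k) from y k) g := by
        rintro k' h' rfl; rfl
      exact key _ _ hk
  have hker : (inducedPart (arcRep hI γ) (stdSub hI hd)).comap (stdSub hI hd).subtype =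
      LinearMap.ker P := by
    rw [inducedPart_stdSub]
    ext x
    rw [Submodule.mem_comap, LinearMap.mem_ker, Submodule.subtype_apply, mem_stdSub, ← hκ]
    constructor
    · intro h
      funext k
      refine funext (f := (show ArcSpace T (γ' k) from _)) (g := (show ArcSpace T (γ' k) from _))
        fun g => ?_
      rw [hP]
      have h1 := (H.sub k g.1 g.2).2
      exact ((h ⟨g.1, (H.sub k g.1 g.2).1⟩).1 (by dsimp only; rw [if_neg (by omega)])).2
    · intro h g
      have h4 := hd.le g.1
      have h3 := x.2 g
      have h5 : d g.1 = 0 ∨ d g.1 = 1 ∨ d g.1 = 2 := by omega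
      rcases h5 with h5 | h5 | h5
      · exact ⟨fun _ => h3.1 h5, fun _ => (h3.1 h5).1⟩
      · obtain ⟨k, hk⟩ := H.cover g.1 g.2 h5
        have h6 := hP x k ⟨g.1, hk⟩
        rw [h] at h6
        exact ⟨fun _ => ⟨h3.2 h5, h6.symm⟩, fun _ => h3.2 h5⟩
      · simp [h5]
  exact ⟨(Submodule.quotEquivOfEq _ _ hker).trans (P.quotKerEquivOfSurjective hsurj)⟩

end FModules

/-! ### Uniqueness of decompositions into string modules -/

section Decomposition

open Module

variable {n : ℕ} {T : Finset (Sym2 (Fin (n + 3)))} {hI : NoInternalTriangle T}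
  {γ : Sym2 (Fin (n + 3))} {ι ι' : Type} [Fintype ι] [Fintype ι']
  {γ' : ι → Sym2 (Fin (n + 3))} {γ'' : ι' → Sym2 (Fin (n + 3))}

open Classical in
lemma finrank_vertexSpace_prod (e : T) :
    finrank ℂ (vertexSpace (idemD T) ((k : ι) → ArcModule hI (γ' k)) e) =
      ∑ k, arcDim (γ' k) e := by
  let F : vertexSpace (idemD T) ((k : ι) → ArcModule hI (γ' k)) e →ₗ[ℂ]
      ((k : ι) → {g : {e : T // Crosses e.1 (γ' k)} // g.1 = e} → ℂ) :=
    { toFun := fun x k g => (show ArcSpace T (γ' k) from x.1 k) g.1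
      map_add' := fun _ _ => rfl
      map_smul' := fun _ _ => rfl }
  have hmem : ∀ x : (k : ι) → ArcModule hI (γ' k), x ∈ vertexSpace (idemD T) _ e ↔
      ∀ k, ∀ g : {e : T // Crosses e.1 (γ' k)}, g.1 ≠ e →
        (show ArcSpace T (γ' k) from x k) g = 0 := fun x => by
    rw [mem_vertexSpace, funext_iff]
    refine forall_congr' fun k => ?_
    rw [Pi.smul_apply, arcModule_idemD_smul]
    exact vertexMap_eq_self_iff (γ' k)
  have hF : Function.Bijective F := by
    constructor
    · rw [injective_iff_map_eq_zero]
      intro x hx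
      refine Subtype.ext (funext fun k => ?_)
      refine funext (f := (show ArcSpace T (γ' k) from _)) (g := (show ArcSpace T (γ' k) from _))
        fun g => ?_
      by_cases hg : g.1 = e
      · exact congrFun (congrFun hx k) ⟨g, hg⟩
      · exact (hmem _).1 x.2 k g hg
    · intro y
      refine ⟨⟨fun k => toModule _ fun g => if h : g.1 = e then y k ⟨g, h⟩ else 0,
        (hmem _).2 fun k g hg => dif_neg hg⟩, funext fun k => funext fun g => ?_⟩
      exact dif_pos g.2
  rw [(LinearEquiv.ofBijective F hF).finrank_eq, finrank_pi_fintype]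
  refine Finset.sum_congr rfl fun k _ => ?_
  rw [finrank_fintype_fun_eq_card, card_eq_arcDim]

lemma finrank_vertexSpace_congr {X Y : Type} [AddCommGroup X] [Module ℂ X] [Module (JacD T) X]
    [IsScalarTower ℂ (JacD T) X] [AddCommGroup Y] [Module ℂ Y] [Module (JacD T) Y]
    [IsScalarTower ℂ (JacD T) Y] (φ : X ≃ₗ[JacD T] Y) (e : T) :
    finrank ℂ (vertexSpace (idemD T) X e) = finrank ℂ (vertexSpace (idemD T) Y e) := by
  have h : (vertexSpace (idemD T) X e).map (φ.restrictScalars ℂ).toLinearMap =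
      vertexSpace (idemD T) Y e := by
    ext y
    constructor
    · rintro ⟨x, hx, rfl⟩
      rw [SetLike.mem_coe, mem_vertexSpace] at hx
      rw [mem_vertexSpace]
      change idemD T e • φ x = φ x
      rw [← map_smul, hx]
    · intro hy
      rw [mem_vertexSpace] at hy
      refine ⟨φ.symm y, ?_, φ.apply_symm_apply y⟩
      rw [SetLike.mem_coe, mem_vertexSpace, ← map_smul, hy]
  rw [← h]
  exact (LinearEquiv.finrank_map_eq (φ.restrictScalars ℂ) _).symm

lemma sum_arcDim_congr
    (φ : ((k : ι) → ArcModule hI (γ' k)) ≃ₗ[JacD T] ((k : ι') → ArcModule hI (γ'' k))) (e : T) :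
    ∑ k, arcDim (γ' k) e = ∑ k, arcDim (γ'' k) e := by
  rw [← finrank_vertexSpace_prod (hI := hI), ← finrank_vertexSpace_prod (hI := hI),
    finrank_vertexSpace_congr φ]

open Classical in
-- On the summand crossing both arcs the arrow acts nontrivially, a property preserved by
-- isomorphisms. On the other side it can act nontrivially only inside one summand.
lemma exists_crosses_congr
    (φ : ((k : ι) → ArcModule hI (γ' k)) ≃ₗ[JacD T] ((k : ι') → ArcModule hI (γ'' k)))
    {e f : T} (h : Arrow T e f) {k : ι} (he : Crosses e.1 (γ' k)) (hf : Crosses f.1 (γ' k)) :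
    ∃ k', Crosses e.1 (γ'' k') ∧ Crosses f.1 (γ'' k') := by
  let x : (k : ι) → ArcModule hI (γ' k) := fun _ => toModule _ (fun _ => 1)
  have hx : arrowD e f h • x ≠ 0 := by
    intro h0
    have h1 := congrFun h0 k
    rw [Pi.smul_apply, arcModule_arrowD_smul] at h1
    have h2 : arrowMap (γ' k) e f (fun _ => 1) ⟨f, hf⟩ = 0 := congrFun h1 ⟨f, hf⟩
    simp [arrowMap, he] at h2
  have hy : arrowD e f h • φ x ≠ 0 := by
    rw [← map_smul]; exact fun h0 => hx ((φ.map_eq_zero_iff).1 h0)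
  by_contra! hcon
  apply hy
  funext k'
  rw [Pi.smul_apply, arcModule_arrowD_smul]
  refine funext (f := (show ArcSpace T (γ'' k') from _)) (g := (show ArcSpace T (γ'' k') from _))
    fun g => ?_
  change arrowMap (γ'' k') e f _ g = 0
  by_cases hg : g.1 = f
  · have : ¬ Crosses e.1 (γ'' k') := fun h1 => hcon k' h1 (hg ▸ g.2)
    simp [arrowMap, this]
  · simp [arrowMap, hg]

lemma arcDim_eq_one {γ : Sym2 (Fin (n + 3))} {e : T} : arcDim γ e = 1 ↔ Crosses e.1 γ := by
  unfold arcDim; split_ifs with h <;> simp [h]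

lemma arcDim_eq_zero {γ : Sym2 (Fin (n + 3))} {e : T} : arcDim γ e = 0 ↔ ¬ Crosses e.1 γ := by
  unfold arcDim; split_ifs with h <;> simp [h]

lemma exists_of_sum_arcDim {e : T} (h : ∑ k, arcDim (γ' k) e ≠ 0) :
    ∃ k, Crosses e.1 (γ' k) := by
  obtain ⟨k, -, hk⟩ := Finset.exists_ne_zero_of_sum_ne_zero h
  exact ⟨k, by by_contra h'; exact hk (arcDim_eq_zero.2 h')⟩

-- A substitute for the Krull–Schmidt theorem: the dimensions at the vertices give disjointness and
-- covering, and the action of the arrows shows that no arc of the second family stops inside a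
-- component.
open Classical in
lemma IsCut.of_equiv {d : T → ℕ} (H : IsCut γ d γ')
    (φ : ((k : ι) → ArcModule hI (γ' k)) ≃ₗ[JacD T] ((k : ι') → ArcModule hI (γ'' k))) :
    IsCut γ d γ'' := by
  have hsum := sum_arcDim_congr φ
  have h1 : ∀ e : T, ∑ k, arcDim (γ' k) e ≤ 1 := fun e => by
    by_cases h : ∃ k, Crosses e.1 (γ' k)
    · obtain ⟨k, hk⟩ := h
      rw [Finset.sum_eq_single k (fun k' _ hk' => arcDim_eq_zero.2 fun h' =>
        hk' (H.disj _ _ e h' hk)) (by simp), arcDim_eq_one.2 hk]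
    · push Not at h
      rw [Finset.sum_eq_zero fun k _ => arcDim_eq_zero.2 (h k)]; omega
  have hle : ∀ (e : T) (k : ι'), Crosses e.1 (γ'' k) → ∃ k, Crosses e.1 (γ' k) := fun e k hk => by
    apply exists_of_sum_arcDim
    rw [hsum]
    have := Finset.single_le_sum (f := fun k => arcDim (γ'' k) e) (fun _ _ => Nat.zero_le _)
      (Finset.mem_univ k)
    simp only [arcDim_eq_one.2 hk] at this
    omega
  have hdisj : ∀ k k' (e : T), Crosses e.1 (γ'' k) → Crosses e.1 (γ'' k') → k = k' := by
    intro k k' e hk hk'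
    by_contra hne
    have h2 : ∑ j ∈ ({k, k'} : Finset ι'), arcDim (γ'' j) e ≤ ∑ j, arcDim (γ'' j) e :=
      Finset.sum_le_sum_of_subset (Finset.subset_univ _)
    rw [Finset.sum_pair hne, arcDim_eq_one.2 hk, arcDim_eq_one.2 hk', ← hsum] at h2
    have := h1 e
    omega
  refine ⟨fun k e hk => ?_, fun e he hd => ?_, hdisj, fun k e f h he hd hf => ?_⟩
  · obtain ⟨k', hk'⟩ := hle e k hk
    exact H.sub k' e hk'
  · obtain ⟨k, hk⟩ := H.cover e he hd
    apply exists_of_sum_arcDim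
    rw [← hsum]
    have := Finset.single_le_sum (f := fun k => arcDim (γ' k) e) (fun _ _ => Nat.zero_le _)
      (Finset.mem_univ k)
    simp only [arcDim_eq_one.2 hk] at this
    omega
  · obtain ⟨k', hk'⟩ := hle f k hf
    obtain ⟨k'', h1, h2⟩ := exists_crosses_congr φ h (H.arrow k' e f h he hd hk') hk'
    rw [hdisj k k'' f hf h2]
    exact h1

end Decomposition

/-! ### The odd element attached to an arc -/

section MuArc

variable {R : Type*} [Field R] [LinearOrder R] [IsStrictOrderedRing R]
  {n : ℕ} {w : ℕ → Bool} {T : Finset (Sym2 (Fin (n + 3)))} {src : Fin (n + 3)}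

lemma simpleChar_eq (i : T) (x : Jac T) : simpleChar i x = chiD i (JacD.incl x) := by
  rw [chiD, AlgHom.comp_apply, killEps_incl]

lemma mul_vertexIdem_eq {e : T} (he : ∀ f, ¬ Arrow T e f) (a : Jac T) :
    a * vertexIdem T e = simpleChar e a • vertexIdem T e := by
  induction a using Jac.induction with
  | hs c => rw [AlgHom.commutes, Algebra.smul_def]; rfl
  | hv f =>
    rw [simpleChar_eq, JacD.incl_vertexIdem]
    by_cases h : f = e
    · rw [h, chiD_idemD_self, vertexIdem_mul_self, one_smul]
    · rw [chiD_idemD_of_ne h, vertexIdem_mul_of_ne h, zero_smul]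
  | ha f g h =>
    rw [simpleChar_eq, JacD.incl_arrowJ, chiD_arrowD, zero_smul]
    have : f ≠ e := fun hf => he g (hf ▸ h)
    rw [← arrowJ_mul_vertexIdem, mul_assoc, vertexIdem_mul_of_ne this, mul_zero]
  | hadd a b h1 h2 => rw [add_mul, h1, h2, map_add, add_smul]
  | hmul a b h1 h2 =>
    rw [mul_assoc, h2, mul_smul_comm, h1, map_mul, mul_comm (simpleChar e a), mul_smul]

/-- Without arrows out of `e`, the algebra acts on the trivial path by scalars, so the projective
module is one-dimensional. -/
lemma projSimple_of_no_arrow {e : T} (he : ∀ f, ¬ Arrow T e f) : ProjSimple T e := by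
  have hne : vertexIdem T e ≠ 0 := fun h => by
    have := simpleChar_eq e (vertexIdem T e)
    rw [JacD.incl_vertexIdem, chiD_idemD_self, h, map_zero] at this
    exact zero_ne_one this
  have hmem : ∀ x ∈ Submodule.span (Jac T) {vertexIdem T e}, ∃ c : ℂ, x = c • vertexIdem T e := by
    intro x hx
    obtain ⟨a, rfl⟩ := Submodule.mem_span_singleton.1 hx
    exact ⟨_, mul_vertexIdem_eq he a⟩
  rw [ProjSimple, isSimpleModule_iff_toSpanSingleton_surjective]
  refine ⟨⟨⟨⟨_, Submodule.mem_span_singleton_self _⟩, 0, fun h => hne (congrArg Subtype.val h)⟩⟩, ?_⟩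
  rintro ⟨x, hx⟩ hx0 ⟨y, hy⟩
  obtain ⟨c, rfl⟩ := hmem x hx
  obtain ⟨c', rfl⟩ := hmem y hy
  have hc : c ≠ 0 := fun h => hx0 (Subtype.ext (by simp [h]))
  refine ⟨algebraMap ℂ _ (c' / c), Subtype.ext ?_⟩
  change algebraMap ℂ (Jac T) (c' / c) * (c • vertexIdem T e) = c' • vertexIdem T e
  rw [← Algebra.smul_def, smul_smul, div_mul_cancel₀ _ hc]

/-- The arrow generates a nonzero submodule of the projective module, and a proper one because the
character of `S_e` kills it but not the trivial path. -/
lemma not_projSimple {e f : T} (h : Arrow T e f) (h0 : arrowJ e f h ≠ 0) : ¬ ProjSimple T e := by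
  intro hs
  unfold ProjSimple at hs
  have hα : arrowJ e f h ∈ Submodule.span (Jac T) {vertexIdem T e} :=
    Submodule.mem_span_singleton.2 ⟨arrowJ e f h, arrowJ_mul_vertexIdem e f h⟩
  rcases eq_bot_or_eq_top ((Submodule.span (Jac T) {arrowJ e f h}).comap
    (Submodule.span (Jac T) {vertexIdem T e}).subtype) with hb | ht
  · have : (⟨_, hα⟩ : Submodule.span (Jac T) {vertexIdem T e}) ∈
        (Submodule.span (Jac T) {arrowJ e f h}).comap
          (Submodule.span (Jac T) {vertexIdem T e}).subtype :=
      Submodule.mem_span_singleton_self _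
    rw [hb, Submodule.mem_bot] at this
    exact h0 (congrArg Subtype.val this)
  · have : (⟨_, Submodule.mem_span_singleton_self _⟩ : Submodule.span (Jac T) {vertexIdem T e}) ∈
        (Submodule.span (Jac T) {arrowJ e f h}).comap
          (Submodule.span (Jac T) {vertexIdem T e}).subtype := by rw [ht]; trivial
    obtain ⟨b, hb⟩ := Submodule.mem_span_singleton.1 this
    have h1 := congrArg (simpleChar e) (show b * arrowJ e f h = vertexIdem T e from hb)
    rw [map_mul, simpleChar_eq e (arrowJ e f h), simpleChar_eq e (vertexIdem T e),
      JacD.incl_vertexIdem, chiD_idemD_self, JacD.incl_arrowJ, chiD_arrowD, mul_zero] at h1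
    exact zero_ne_one h1

/-- The arcs of a zigzag, as elements of the triangulation. -/
abbrev IsZig.arc (Z : IsZig T src w) {k : ℕ} (h1 : 1 ≤ k) (h2 : k ≤ n) : T :=
  ⟨gm src w k, Z.gm_mem h1 h2⟩

/-- The only possible neighbour of the first arc in the quiver is the second one, and the arrow
between them leaves the first arc iff `w 1` is `false`. For `n = 1` the letter `w 1` is the last
one, hence `true`. -/
lemma IsZig.projSimple_iff (Z : IsZig T src w) (hI : NoInternalTriangle T) {e : T}
    (he : e.1 = s(src - 1, src + 1)) : ProjSimple T e ↔ w 1 = true := by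
  have hn := Z.one_le
  rw [← gm_one Z.first] at he
  constructor
  · intro hs
    by_contra hw
    rw [Bool.not_eq_true] at hw
    have hn2 : 2 ≤ n := by
      by_contra h
      have h1 : n = 1 := by omega
      have := Z.last
      rw [h1, hw] at this
      cases this
    have ha : Arrow T e (Z.arc (k := 2) (by omega) hn2) :=
      (Z.arrow_iff (a := 1) (b := 2) (by omega) hn (by omega) hn2 _ _ he rfl).2 (Or.inr ⟨rfl, hw⟩)
    -- The arrow is nonzero in the algebra, as it acts nontrivially on the string module of `ar 0
    -- 2`, which crosses both arcs.
    refine not_projSimple ha (fun h0 => ?_) hs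
    have h1 := arcRep_arrowJ hI (ar src w 0 2) e _ ha
    rw [h0, map_zero] at h1
    have c1 : Crosses e.1 (ar src w 0 2) := by
      rw [he, Z.crosses_ar_iff (by omega) (by omega) hn2]; omega
    have c2 : Crosses (Z.arc (k := 2) (by omega) hn2).1 (ar src w 0 2) := by
      rw [Z.crosses_ar_iff (by omega) (by omega) hn2]; omega
    have h2 := congrFun (LinearMap.congr_fun h1 (fun _ => 1)) ⟨_, c2⟩
    simp [arrowMap, c1] at h2
  · intro hw
    refine projSimple_of_no_arrow fun f hf => ?_
    obtain ⟨k, h1, h2, hk⟩ := (Z.mem_iff _).1 f.2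
    rw [Z.arrow_iff (a := 1) (b := k) le_rfl hn h1 h2 e f he hk] at hf
    rcases hf with ⟨h, -⟩ | ⟨-, h⟩
    · omega
    · rw [hw] at h; cases h

/-- The even element of a run from `p` to `q`. -/
def runMu {M : Type*} [AddCommGroup M] [Module R M] (w : ℕ → Bool) (η : ℕ → Od R M) (p q : ℕ) :
    Ev R M :=
  algebraMap R (Ev R M) (tau R w p) * (oddPairing R M).om (η p) (η q)

lemma coe_runMu {M : Type*} [AddCommGroup M] [Module R M] (w : ℕ → Bool) (η : ℕ → Od R M)
    (p q : ℕ) : (runMu w η p q : ExteriorAlgebra R M) = tau R w p • ((η p).1 * (η q).1) := by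
  rw [Algebra.smul_def]; rfl

lemma IsZig.deltaGT_iff (Z : IsZig T src w) (hI : NoInternalTriangle T) {j k : ℕ} (hj : j ≤ n)
    (hk : k ≤ n) : DeltaGT (T := T) src (tg src w j) (tg src w k) ↔
      (w 1 = true ∧ zp n w j < zp n w k) ∨
      (w 1 = false ∧ 2 ≤ zp n w j ∧ (zp n w j < zp n w k ∨ zp n w k = 1)) := by
  have hn := Z.one_le
  constructor
  · rintro ⟨e₁, a, b, he, ha, hb, h⟩
    rw [Z.isDelta_iff hj] at ha
    rw [Z.isDelta_iff hk] at hb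
    rw [Z.projSimple_iff hI he, Bool.not_eq_true] at h
    subst ha hb
    exact h
  · intro h
    refine ⟨Z.arc le_rfl hn, _, _, gm_one Z.first, (Z.isDelta_iff hj).2 rfl,
      (Z.isDelta_iff hk).2 rfl, ?_⟩
    rwa [Z.projSimple_iff hI (gm_one Z.first), Bool.not_eq_true]

/-- If the lower end moves at step `p`, the apex `zp p` lies below all later apexes, otherwise
above. So `w p` alone decides the order of the labels of the triangles `p` and `q`. -/
lemma IsZig.zp_cases (Z : IsZig T src w) {p q : ℕ} (hpq : p < q) (hq : q ≤ n) :
    zp n w 0 = 1 ∧ 2 ≤ zp n w q ∧ (1 ≤ p → 2 ≤ zp n w p) ∧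
      ((w p = true ∧ zp n w p < zp n w q) ∨ (w p = false ∧ zp n w q < zp n w p)) := by
  have h1 := Z.zp_bounds hq
  have h2 := Z.zp_bounds (k := p) (by omega)
  have h3 := Z.rp_pos (k := q) (by omega)
  have h4 := rp_bounds (w := w) (show p + 1 ≤ q by omega)
  have h5 := step_cases (n := n) (w := w) p
  refine ⟨by simp [zp, Z.first, rp_zero], by omega, fun h => ?_, ?_⟩
  · have := Z.rp_pos h; omega
  · rcases h5 with ⟨h5, h6, h7, -⟩ | ⟨h5, h6, h7, -⟩
    · exact Or.inl ⟨h5, by omega⟩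
    · exact Or.inr ⟨h5, by omega⟩

/-- The prescribed order of the two odd variables is compared with their order along the path; the
resulting sign is the product of the transfer sign of step `p` and the sign of the ear. The second
alternative in the definition of the order moves `θ_1` to the end, which matches the sign of the ear
for `p = 0` and `w 1 = false`. -/
lemma IsZig.isMuArc_iff (Z : IsZig T src w) (hI : NoInternalTriangle T) {p q : ℕ} (hpq : p < q)
    (hq : q ≤ n) (z : Super T R) : IsMuArc src (ar src w p q) z ↔
      z = (runMu w (etaOd T R src w) p q).1 := by
  obtain ⟨z0, z1, z2, z3⟩ := Z.zp_cases hpq hq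
  have hη : ∀ k, k ≤ n → (etaOd T R src w k).1 = sgn0 R w k • (thetaOd T R src w k).1 := by
    intro k _
    rw [etaOd, coe_smul_od, sgn0, sgn0]
    split_ifs <;> simp
  have hsq : sgn0 R w q = 1 := if_neg (by omega)
  have hz : (runMu w (etaOd T R src w) p q).1 = (tau R w p * sgn0 R w p) •
      (theta ⟨tg src w p, Z.isTriangle_tg (by omega)⟩ * theta ⟨tg src w q, Z.isTriangle_tg hq⟩) := by
    rw [coe_runMu, hη p (by omega), hη q hq, hsq, one_smul, Z.thetaOd_eq hq,
      Z.thetaOd_eq (k := p) (by omega), smul_mul_assoc, smul_smul]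
  have hswap : (theta ⟨tg src w q, Z.isTriangle_tg hq⟩ *
      theta ⟨tg src w p, Z.isTriangle_tg (by omega)⟩ : Super T R) =
      -(theta ⟨tg src w p, Z.isTriangle_tg (by omega)⟩ * theta ⟨tg src w q, Z.isTriangle_tg hq⟩) :=
    odd_swap (CliffordAlgebra.ι_mem_evenOdd_one _ _) (CliffordAlgebra.ι_mem_evenOdd_one _ _)
  have hd1 := Z.deltaGT_iff hI (j := p) (k := q) (by omega) hq
  have hd2 := Z.deltaGT_iff hI (j := q) (k := p) hq (by omega)
  have hmain : (DeltaGT (T := T) src (tg src w p) (tg src w q) ∧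
      ¬ DeltaGT (T := T) src (tg src w q) (tg src w p) ∧ tau R w p * sgn0 R w p = 1) ∨
      (DeltaGT (T := T) src (tg src w q) (tg src w p) ∧
      ¬ DeltaGT (T := T) src (tg src w p) (tg src w q) ∧ tau R w p * sgn0 R w p = -1) := by
    rw [hd1, hd2, tau, sgn0]
    rcases Nat.eq_zero_or_pos p with rfl | hp
    · rw [z0, Z.first]
      cases hw : w 1
      · right
        refine ⟨Or.inr ⟨rfl, z1, Or.inr rfl⟩, by simp, by simp⟩
      · left
        refine ⟨Or.inl ⟨rfl, by omega⟩, ?_, by simp⟩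
        simp; omega
    · have z2 := z2 hp
      rw [if_neg (by omega : ¬ (p = 0 ∧ w 1 = false)), mul_one]
      rcases z3 with ⟨h, hlt⟩ | ⟨h, hlt⟩
      · left
        rw [h]
        refine ⟨?_, ?_, by simp⟩
        · cases hw : w 1
          · exact Or.inr ⟨rfl, z2, Or.inl hlt⟩
          · exact Or.inl ⟨rfl, hlt⟩
        · rintro (⟨-, h⟩ | ⟨-, -, h | h⟩) <;> omega
      · right
        rw [h]
        refine ⟨?_, ?_, by simp⟩
        · cases hw : w 1
          · exact Or.inr ⟨rfl, z1, Or.inl hlt⟩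
          · exact Or.inl ⟨rfl, hlt⟩
        · rintro (⟨-, h⟩ | ⟨-, -, h | h⟩) <;> omega
  have hirr : ∀ k, k ≤ n → ¬ DeltaGT (T := T) src (tg src w k) (tg src w k) := by
    intro k hk
    rw [Z.deltaGT_iff hI hk hk]
    rintro (⟨-, h⟩ | ⟨-, h, h' | h'⟩) <;> omega
  constructor
  · rintro ⟨⟨t, ht⟩, ⟨t', ht'⟩, h1, h2, h3, rfl⟩
    obtain ⟨j, hj, rfl⟩ := (Z.isTriangle_iff t).1 ht
    obtain ⟨k, hk, rfl⟩ := (Z.isTriangle_iff t').1 ht'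
    rw [Z.onTriangle_ar_iff hj hpq hq] at h1
    rw [Z.onTriangle_ar_iff hk hpq hq] at h2
    dsimp only at h3
    rw [hz]
    rcases h1 with rfl | rfl <;> rcases h2 with rfl | rfl
    · exact absurd h3 (hirr _ hj)
    · rcases hmain with ⟨-, -, h⟩ | ⟨-, h, -⟩
      · rw [h, one_smul]
      · exact absurd h3 h
    · rcases hmain with ⟨-, h, -⟩ | ⟨-, -, h⟩
      · exact absurd h3 h
      · rw [h, hswap, neg_one_smul]
    · exact absurd h3 (hirr _ hj)
  · rintro rfl
    rw [hz]
    have o1 := (Z.onTriangle_ar_iff (m := p) (by omega) hpq hq).2 (Or.inl rfl)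
    have o2 := (Z.onTriangle_ar_iff hq hpq hq).2 (Or.inr rfl)
    rcases hmain with ⟨h, -, h'⟩ | ⟨h, -, h'⟩
    · exact ⟨⟨_, Z.isTriangle_tg (by omega)⟩, ⟨_, Z.isTriangle_tg hq⟩, o1, o2, h, by
        rw [h', one_smul]⟩
    · exact ⟨⟨_, Z.isTriangle_tg hq⟩, ⟨_, Z.isTriangle_tg (by omega)⟩, o2, o1, h, by
        rw [h', hswap, neg_one_smul]⟩

end MuArc

/-! ### Runs of a path -/

section Runs

variable {R : Type*} [Field R] [LinearOrder R] [IsStrictOrderedRing R]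
  {M : Type*} [AddCommGroup M] [Module R M]

/-- The last position up to `b` at which `e` is not one. -/
def runStart (e : ℕ → ℕ) (b : ℕ) : ℕ := Nat.findGreatest (fun a => e a ≠ 1) b

lemma runStart_of_ne {e : ℕ → ℕ} {b : ℕ} (h : e b ≠ 1) : runStart e b = b :=
  Nat.findGreatest_eq h

lemma runStart_succ {e : ℕ → ℕ} {b : ℕ} (h : e (b + 1) = 1) :
    runStart e (b + 1) = runStart e b :=
  Nat.findGreatest_of_not (by simpa using h)

lemma runStart_eq {e : ℕ → ℕ} {a b : ℕ} (hab : a ≤ b) (ha : e a ≠ 1)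
    (h : ∀ m, a < m → m ≤ b → e m = 1) : runStart e b = a := by
  induction b, hab using Nat.le_induction with
  | base => exact runStart_of_ne ha
  | succ b hb ih =>
    rw [runStart_succ (h _ (by omega) le_rfl), ih fun m h1 h2 => h m h1 (by omega)]

lemma runStart_spec {e : ℕ → ℕ} {p b : ℕ} (hp : e p ≠ 1) (hb : p ≤ b) :
    p ≤ runStart e b ∧ runStart e b ≤ b ∧ e (runStart e b) ≠ 1 ∧
      ∀ m, runStart e b < m → m ≤ b → e m = 1 := by
  refine ⟨Nat.le_findGreatest hb hp, Nat.findGreatest_le b,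
    Nat.findGreatest_spec (P := fun a => e a ≠ 1) hb hp, fun m h1 h2 => ?_⟩
  have := Nat.findGreatest_is_greatest h1 h2
  simpa using this

/-- The ends of the runs of ones of `e` between `p` and `k`. -/
def runEnds (e : ℕ → ℕ) (p k : ℕ) : Finset ℕ :=
  (Finset.Ico p k).filter fun b => e b = 1 ∧ e (b + 1) ≠ 1

lemma mem_runEnds {e : ℕ → ℕ} {p k b : ℕ} :
    b ∈ runEnds e p k ↔ (p ≤ b ∧ b < k) ∧ e b = 1 ∧ e (b + 1) ≠ 1 := by
  rw [runEnds, Finset.mem_filter, Finset.mem_Ico]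

lemma prod_runEnds_succ {E : Type*} [CommMonoid E] (f : ℕ → E) (e : ℕ → ℕ) {p k : ℕ} (hk : p ≤ k) :
    ∏ b ∈ runEnds e p (k + 1), f b =
      (∏ b ∈ runEnds e p k, f b) * if e k = 1 ∧ e (k + 1) ≠ 1 then f k else 1 := by
  rw [runEnds, runEnds, Finset.prod_filter, Finset.prod_filter, Finset.prod_Ico_succ_top hk]

lemma pathOdd_succ (w : ℕ → Bool) (η : ℕ → Od R M) (p j : ℕ) (e : ℕ → ℕ) :
    pathOdd w η p (j + 1) e =
      pathOdd w η p j e * oddf w η (p + j) (e (p + j)) (e (p + j + 1)) := by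
  simp [pathOdd, List.range_succ]

/-- The induction carries the even product of the finished runs together with one odd factor for a
run that is still open. -/
lemma pathOdd_eq_aux (w : ℕ → Bool) (η : ℕ → Od R M) {p : ℕ} {e : ℕ → ℕ} (hp : e p ≠ 1) (j : ℕ) :
    pathOdd w η p j e = (∏ b ∈ runEnds e p (p + j), runMu w η (runStart e b) b : Ev R M).1 *
      if e (p + j) = 1 then tau R w (runStart e (p + j)) • (η (runStart e (p + j))).1 else 1 := by
  induction j with
  | zero => simp [pathOdd, runEnds, hp]
  | succ j ih =>
    rw [pathOdd_succ, ih, ← add_assoc, prod_runEnds_succ _ _ (Nat.le_add_right p j), oddf]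
    by_cases h1 : e (p + j) = 1 <;> by_cases h2 : e (p + j + 1) = 1
    · simp [h1, h2, runStart_succ h2]
    · simp [h1, h2, coe_runMu, mul_assoc]
    · simp [h1, h2, runStart_succ h2, runStart_of_ne h1]
    · simp [h1, h2]

lemma pathOdd_eq (w : ℕ → Bool) (η : ℕ → Od R M) {p j : ℕ} {e : ℕ → ℕ} (hp : e p ≠ 1)
    (hj : e (p + j) ≠ 1) : pathOdd w η p j e =
      (∏ b ∈ runEnds e p (p + j), runMu w η (runStart e b) b : Ev R M).1 := by
  rw [pathOdd_eq_aux w η hp, if_neg hj, mul_one]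

end Runs

/-! ### The odd element of a dimension vector -/

section MuDim

variable {R : Type*} [Field R] [LinearOrder R] [IsStrictOrderedRing R]
  {n : ℕ} {w : ℕ → Bool} {T : Finset (Sym2 (Fin (n + 3)))} {src : Fin (n + 3)}

lemma IsZig.isArc_ar (Z : IsZig T src w) {p q : ℕ} (hpq : p < q) (hq : q ≤ n) :
    IsArc (ar src w p q) := by
  obtain ⟨-, h2, h3, -, h5, h6⟩ := Z.ar_bounds hpq hq
  have h2 := h2 q hpq (by omega)
  have h3 := h3 q le_rfl
  have h4 := Z.lp_lt (k := q) (by omega)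
  have p1 := pos_vtx src h5
  have p2 := pos_vtx src h6
  refine ⟨fun h => ?_, fun h => ?_⟩
  · rw [ar, Sym2.mk_isDiag_iff] at h
    rw [h] at p1
    omega
  · rw [ar, isSide_iff_pos src, p1, p2] at h
    omega

lemma IsZig.ar_notMem (Z : IsZig T src w) (hT : IsTriangulation T) {p q : ℕ} (hpq : p < q)
    (hq : q ≤ n) : ar src w p q ∉ T := fun h =>
  hT.noncrossing _ (Z.gm_mem (k := q) (by omega) hq) _ h
    ((Z.crosses_ar_iff (by omega) hpq hq).2 ⟨hpq, le_rfl⟩)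

/-- The path `e` describes the dimension vector `d` of a submodule of the induced module of the arc
`ar p k`. -/
structure IsZig.Describes (Z : IsZig T src w) (p k : ℕ) (d : T → ℕ) (e : ℕ → ℕ) : Prop where
  lt : p < k
  le : k ≤ n
  start : e p ≠ 1
  final : e (k + 1) ≠ 1
  out : ∀ m, m < p ∨ k + 1 < m → e m ≠ 1
  eq : ∀ m (h1 : 1 ≤ m) (h2 : m ≤ n), p < m → m ≤ k → d (Z.arc h1 h2) = e m

variable {p k : ℕ} {d : T → ℕ} {e : ℕ → ℕ}

lemma IsZig.Describes.mem_of_eq_one {Z : IsZig T src w} (D : Z.Describes p k d e) {m : ℕ}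
    (h : e m = 1) : p < m ∧ m ≤ k := by
  have h1 := D.start
  have h2 := D.final
  have h3 := D.out m
  have : m ≠ p := by rintro rfl; exact h1 h
  have : m ≠ k + 1 := by rintro rfl; exact h2 h
  by_contra hc
  exact h3 (by omega) h

lemma IsZig.Describes.crosses_iff {Z : IsZig T src w} (D : Z.Describes p k d e) {m : ℕ}
    (h1 : 1 ≤ m) (h2 : m ≤ n) :
    (Crosses (Z.arc h1 h2).1 (ar src w p k) ∧ d (Z.arc h1 h2) = 1) ↔ e m = 1 := by
  rw [Z.crosses_ar_iff (by omega) D.lt D.le]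
  constructor
  · rintro ⟨⟨h3, h4⟩, h⟩
    rw [← D.eq m h1 h2 h3 h4, h]
  · intro h
    obtain ⟨h3, h4⟩ := D.mem_of_eq_one h
    exact ⟨⟨h3, h4⟩, by rw [D.eq m h1 h2 h3 h4, h]⟩

lemma IsZig.exists_arc (Z : IsZig T src w) (f : T) :
    ∃ (m : ℕ) (h1 : 1 ≤ m) (h2 : m ≤ n), f = Z.arc h1 h2 := by
  obtain ⟨m, h1, h2, h⟩ := (Z.mem_iff _).1 f.2
  exact ⟨m, h1, h2, Subtype.ext h⟩

lemma IsZig.arrow_arc_iff (Z : IsZig T src w) {a b : ℕ} (ha : 1 ≤ a) (ha' : a ≤ n) (hb : 1 ≤ b)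
    (hb' : b ≤ n) : Arrow T (Z.arc ha ha') (Z.arc hb hb') ↔
      (b + 1 = a ∧ w b = true) ∨ (a + 1 = b ∧ w a = false) :=
  Z.arrow_iff ha ha' hb hb' _ _ rfl rfl

/-- The arcs of the runs cut out the components. -/
lemma IsZig.Describes.isCut {Z : IsZig T src w} (D : Z.Describes p k d e) :
    IsCut (ι := runEnds e p (k + 1)) (ar src w p k) d
      (fun b => ar src w (runStart e b) b) := by
  have hlt := D.lt
  have hle := D.le
  have hb : ∀ b : runEnds e p (k + 1), p < b.1 ∧ b.1 ≤ k ∧ e (b.1 + 1) ≠ 1 ∧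
      runStart e b < b.1 ∧ e (runStart e b) ≠ 1 ∧
      ∀ m, runStart e b < m → m ≤ b.1 → e m = 1 := by
    intro b
    obtain ⟨⟨h1, h2⟩, h3, h4⟩ := mem_runEnds.1 b.2
    obtain ⟨h5, h6⟩ := D.mem_of_eq_one h3
    obtain ⟨h7, h8, h9, h10⟩ := runStart_spec D.start h1
    refine ⟨h5, h6, h4, lt_of_le_of_ne h8 fun h => ?_, h9, h10⟩
    rw [h] at h9; exact h9 h3
  have hcr : ∀ (b : runEnds e p (k + 1)) (m : ℕ), 1 ≤ m → m ≤ n →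
      (Crosses (gm src w m) (ar src w (runStart e b) b) ↔ runStart e b < m ∧ m ≤ b.1) := by
    intro b m h1 h2
    obtain ⟨h3, h4, -, h5, -⟩ := hb b
    exact Z.crosses_ar_iff (by omega) h5 (by omega)
  have hstart : ∀ (b : runEnds e p (k + 1)) (m : ℕ), runStart e b < m → m ≤ b.1 →
      runStart e m = runStart e b := by
    intro b m h1 h2
    obtain ⟨-, -, -, -, h3, h4⟩ := hb b
    exact runStart_eq (by omega) h3 fun j h5 h6 => h4 j h5 (by omega)
  have huniq : ∀ (b b' : runEnds e p (k + 1)) (m : ℕ), m ≤ b.1 → m ≤ b'.1 → runStart e b < m →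
      runStart e b' < m → b = b' := by
    have key : ∀ (b b' : runEnds e p (k + 1)) (m : ℕ), m ≤ b.1 → m ≤ b'.1 → runStart e b < m →
      runStart e b' < m → b'.1 ≤ b.1 := by
      intro b b' m h1 h2 h3 h4
      by_contra hc
      obtain ⟨-, -, h5, -⟩ := hb b
      obtain ⟨-, -, -, -, -, h6⟩ := hb b'
      exact h5 (h6 (b.1 + 1) (by omega) (by omega))
    intro b b' m h1 h2 h3 h4
    exact Subtype.ext (le_antisymm (key b' b m h2 h1 h4 h3) (key b b' m h1 h2 h3 h4))
  refine ⟨fun b f hf => ?_, fun f hf hd => ?_, fun b b' f hf hf' => ?_,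
    fun b f g ha hf hd hg => ?_⟩
  · obtain ⟨m, h1, h2, rfl⟩ := Z.exists_arc f
    rw [hcr b m h1 h2] at hf
    rw [D.crosses_iff h1 h2]
    exact (hb b).2.2.2.2.2 m hf.1 hf.2
  · obtain ⟨m, h1, h2, rfl⟩ := Z.exists_arc f
    have hm := (D.crosses_iff h1 h2).1 ⟨hf, hd⟩
    -- The component of `m` ends at the first such `b`, found with `Nat.find`.
    have hex : ∃ b, m ≤ b ∧ e (b + 1) ≠ 1 := ⟨k, (D.mem_of_eq_one hm).2, D.final⟩
    classical
    obtain ⟨h3, h4⟩ := Nat.find_spec hex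
    have hmin : ∀ j, m ≤ j → j ≤ Nat.find hex → e j = 1 := by
      intro j hj hj'
      induction j, hj using Nat.le_induction with
      | base => exact hm
      | succ j hj ih =>
        by_contra hc
        exact Nat.find_min hex (m := j) (by omega) ⟨hj, hc⟩
    have hb1 := hmin _ h3 le_rfl
    have hbk := (D.mem_of_eq_one hb1)
    refine ⟨⟨Nat.find hex, mem_runEnds.2 ⟨⟨by omega, by omega⟩, hb1, h4⟩⟩, ?_⟩
    rw [hcr _ m h1 h2]
    refine ⟨?_, h3⟩
    by_contra hc
    exact (runStart_spec D.start (b := Nat.find hex) (by omega)).2.2.1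
      (hmin _ (not_lt.1 hc) (Nat.findGreatest_le _))
  · obtain ⟨m, h1, h2, rfl⟩ := Z.exists_arc f
    rw [hcr b m h1 h2] at hf
    rw [hcr b' m h1 h2] at hf'
    exact huniq b b' m hf.2 hf'.2 hf.1 hf'.1
  · obtain ⟨m, h1, h2, rfl⟩ := Z.exists_arc f
    obtain ⟨m', h1', h2', rfl⟩ := Z.exists_arc g
    have hm := (D.crosses_iff h1 h2).1 ⟨hf, hd⟩
    rw [Z.arrow_arc_iff] at ha
    rw [hcr b m' h1' h2'] at hg
    rw [hcr b m h1 h2]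
    obtain ⟨-, -, h3, h4, h5, h6⟩ := hb b
    have e1 : m ≠ b.1 + 1 := by rintro rfl; exact h3 hm
    have e2 : m ≠ runStart e b := by rintro h; exact h5 (h ▸ hm)
    clear hb hcr hstart huniq
    omega

/-- Every family of arcs that cuts out the components consists of the arcs of the runs. -/
lemma IsZig.Describes.prod_eq {Z : IsZig T src w} (D : Z.Describes p k d e) {E : Type*}
    [CommMonoid E] (f : ℕ → ℕ → E) {ι : Type} [Fintype ι] {P Q : ι → ℕ} (hPQ : ∀ i, P i < Q i)
    (hQ : ∀ i, Q i ≤ n) (H : IsCut (ar src w p k) d (fun i => ar src w (P i) (Q i))) :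
    ∏ i, f (P i) (Q i) = ∏ b ∈ runEnds e p (k + 1), f (runStart e b) b := by
  have hlt := D.lt
  have hle := D.le
  have hcr : ∀ (i : ι) (m : ℕ), 1 ≤ m → m ≤ n →
      (Crosses (gm src w m) (ar src w (P i) (Q i)) ↔ P i < m ∧ m ≤ Q i) :=
    fun i m h1 h2 => Z.crosses_ar_iff (by omega) (hPQ i) (hQ i)
  have hsub : ∀ i m, P i < m → m ≤ Q i → e m = 1 := fun i m h1 h2 => by
    have := hQ i
    exact (D.crosses_iff (by omega) (by omega)).1
      (H.sub i (Z.arc (k := m) (by omega) (by omega)) ((hcr i m (by omega) (by omega)).2 ⟨h1, h2⟩))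
  have hcov : ∀ m, e m = 1 → ∃ i, P i < m ∧ m ≤ Q i := fun m hm => by
    obtain ⟨h1, h2⟩ := D.mem_of_eq_one hm
    obtain ⟨h3, h4⟩ := (D.crosses_iff (m := m) (by omega) (by omega)).2 hm
    obtain ⟨i, hi⟩ := H.cover _ h3 h4
    exact ⟨i, (hcr i m (by omega) (by omega)).1 hi⟩
  have hdisj : ∀ i i' m, P i < m → m ≤ Q i → P i' < m → m ≤ Q i' → i = i' :=
    fun i i' m h1 h2 h3 h4 => by
      have := hQ i
      exact H.disj i i' (Z.arc (k := m) (by omega) (by omega))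
        ((hcr i m (by omega) (by omega)).2 ⟨h1, h2⟩) ((hcr i' m (by omega) (by omega)).2 ⟨h3, h4⟩)
  -- Consecutive arcs are joined by an arrow in one direction or the other, and the `arrow`
  -- condition of `IsCut` at its target keeps both in the same member of the family. Therefore the
  -- members are exactly the maximal runs.
  have hstep : ∀ m, e m = 1 → e (m + 1) = 1 → ∃ i, P i < m ∧ m + 1 ≤ Q i := by
    intro m hm hm'
    obtain ⟨h1, h2⟩ := D.mem_of_eq_one hm
    obtain ⟨h1', h2'⟩ := D.mem_of_eq_one hm'
    obtain ⟨h3, h4⟩ := (D.crosses_iff (m := m) (by omega) (by omega)).2 hm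
    obtain ⟨h3', h4'⟩ := (D.crosses_iff (m := m + 1) (by omega) (by omega)).2 hm'
    cases hw : w m with
    | true =>
      obtain ⟨i, hi⟩ := hcov m hm
      have := H.arrow i _ _ ((Z.arrow_arc_iff (a := m + 1) (b := m) (by omega) (by omega) (by omega)
        (by omega)).2 (Or.inl ⟨rfl, hw⟩)) h3' h4' ((hcr i m (by omega) (by omega)).2 hi)
      rw [hcr i _ (by omega) (by omega)] at this
      exact ⟨i, hi.1, this.2⟩
    | false =>
      obtain ⟨i, hi⟩ := hcov _ hm'
      have := H.arrow i _ _ ((Z.arrow_arc_iff (a := m) (b := m + 1) (by omega) (by omega) (by omega)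
        (by omega)).2 (Or.inr ⟨rfl, hw⟩)) h3 h4 ((hcr i _ (by omega) (by omega)).2 hi)
      rw [hcr i _ (by omega) (by omega)] at this
      exact ⟨i, this.1, hi.2⟩
  have hQ1 : ∀ i, e (Q i) = 1 := fun i => hsub i _ (hPQ i) le_rfl
  have hQ2 : ∀ i, e (Q i + 1) ≠ 1 := fun i h => by
    obtain ⟨i', h1, h2⟩ := hstep _ (hQ1 i) h
    have := hdisj i i' (Q i) (hPQ i) le_rfl h1 (by omega)
    subst this
    omega
  have hP1 : ∀ i, e (P i) ≠ 1 := fun i h => by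
    obtain ⟨i', h1, h2⟩ := hstep _ h (hsub i _ (by omega) (hPQ i))
    have := hdisj i i' (P i + 1) (by omega) (hPQ i) (by omega) h2
    subst this
    omega
  have hstart : ∀ i, runStart e (Q i) = P i := fun i =>
    runStart_eq (hPQ i).le (hP1 i) (hsub i)
  refine Finset.prod_bij (fun i _ => Q i) (fun i _ => ?_) (fun i _ i' _ h => ?_) (fun b hb => ?_)
    (fun i _ => by rw [hstart])
  · have := D.mem_of_eq_one (hQ1 i)
    exact mem_runEnds.2 ⟨⟨by omega, by omega⟩, hQ1 i, hQ2 i⟩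
  · have h1 := hPQ i
    have h2 := hPQ i'
    exact hdisj i i' (Q i) h1 le_rfl (by omega) (by omega)
  · obtain ⟨-, h1, h2⟩ := mem_runEnds.1 hb
    obtain ⟨i, h3, h4⟩ := hcov b h1
    refine ⟨i, Finset.mem_univ _, ?_⟩
    by_contra hc
    exact h2 (hsub i (b + 1) (by omega) (by omega))

lemma coe_list_prod {M : Type*} [AddCommGroup M] [Module R M] {m : ℕ} (f : Fin m → Ev R M) :
    (List.ofFn fun i => (f i : ExteriorAlgebra R M)).prod = (∏ i, f i : Ev R M).1 := by
  rw [← List.prod_ofFn]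
  have h := map_list_prod (CliffordAlgebra.even (0 : QuadraticForm R M)).val (List.ofFn f)
  rw [List.map_ofFn] at h
  exact h.symm

/-- The definition of `muDim` chooses a submodule and a decomposition. The submodule is unique,
every decomposition cuts out the runs, and the factors are even and commute, so the value does not
depend on the choices. -/
lemma IsZig.Describes.muDim_eq {Z : IsZig T src w} (D : Z.Describes p k d e)
    (hT : IsTriangulation T) (hI : NoInternalTriangle T) (hd : GoodVec (ar src w p k) d) :
    (muDim hI src (ar src w p k) d : Super T R) =
      (∏ b ∈ runEnds e p (k + 1), runMu w (etaOd T R src w) (runStart e b) b : EvT T R).1 := by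
  classical
  have hlt := D.lt
  have hle := D.le
  have hcut := D.isCut
  obtain ⟨φ⟩ := hcut.nonempty_equiv (hI := hI) hd
  have hb : ∀ b : runEnds e p (k + 1), runStart e b < b.1 ∧ b.1 ≤ n := by
    intro b
    obtain ⟨⟨h1, h2⟩, h3, h4⟩ := mem_runEnds.1 b.2
    obtain ⟨h5, h6⟩ := D.mem_of_eq_one h3
    obtain ⟨h7, h8, h9, h10⟩ := runStart_spec D.start h1
    refine ⟨lt_of_le_of_ne h8 fun h => ?_, by omega⟩
    rw [h] at h9; exact h9 h3
  have hex : ∃ (y : Super T R) (N : Submodule (JacD T) (IndModule hI (ar src w p k))),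
      HasDimVec (idemD T) N d ∧ IsMu hI src (FMod (arcRep hI (ar src w p k)) N) y := by
    let σ := (Fintype.equivFin (runEnds e p (k + 1))).symm
    refine ⟨_, stdSub hI hd, hasDimVec_stdSub hd, _, fun i => ar src w (runStart e (σ i)) (σ i),
      fun i => (runMu w (etaOd T R src w) (runStart e (σ i)) (σ i)).1, fun i => ⟨?_, ?_, ?_⟩,
      ⟨φ.trans (LinearEquiv.piCongrLeft (JacD T)
        (fun b : runEnds e p (k + 1) => ArcModule hI (ar src w (runStart e b) b)) σ).symm⟩, rfl⟩
    · exact Z.isArc_ar (hb _).1 (hb _).2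
    · exact Z.ar_notMem hT (hb _).1 (hb _).2
    · exact (Z.isMuArc_iff hI (hb _).1 (hb _).2 _).2 rfl
  rw [muDim, dif_pos hex]
  obtain ⟨N, hN, m, γ, z, hz, ⟨ψ⟩, hy⟩ := hex.choose_spec
  rw [hy]
  have hN' : N = stdSub hI hd := hN.eq_stdSub
  subst hN'
  choose P Q hPQ hQ hγ using fun i => Z.exists_ar (hz i).1 (hz i).2.1
  have hγ' : γ = fun i => ar src w (P i) (Q i) := funext hγ
  subst hγ'
  have hcut' := hcut.of_equiv (φ.symm.trans ψ)
  have hz' : z = fun i => (runMu w (etaOd T R src w) (P i) (Q i)).1 := funext fun i =>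
    (Z.isMuArc_iff hI (hPQ i) (hQ i) _).1 (hz i).2.2
  rw [hz', coe_list_prod]
  exact congrArg Subtype.val (D.prod_eq (runMu w (etaOd T R src w)) hPQ hQ hcut')

lemma muDim_of_not_goodVec {hI : NoInternalTriangle T} {γ : Sym2 (Fin (n + 3))}
    (hd : ¬ GoodVec γ d) : (muDim hI src γ d : Super T R) = 0 := by
  rw [muDim, dif_neg]
  rintro ⟨y, N, hN, -⟩
  exact hd hN.goodVec

end MuDim

/-! ### The exponents of the expression and the weights of paths -/

section Exponents

variable {R : Type*} [Field R] [LinearOrder R] [IsStrictOrderedRing R]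
  {n : ℕ} {w : ℕ → Bool} {T : Finset (Sym2 (Fin (n + 3)))} {src : Fin (n + 3)}

/-- The number of an arc of a zigzag. -/
def IsZig.idx (Z : IsZig T src w) (f : T) : ℕ := (Z.exists_arc f).choose

lemma IsZig.idx_arc (Z : IsZig T src w) {m : ℕ} (h1 : 1 ≤ m) (h2 : m ≤ n) :
    Z.idx (Z.arc h1 h2) = m := by
  obtain ⟨h3, h4, h5⟩ := (Z.exists_arc (Z.arc h1 h2)).choose_spec
  exact (Z.gm_inj (by omega) (Nat.le_succ_of_le h4) (congrArg Subtype.val h5)).symm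

lemma IsZig.prod_arc {M : Type*} [CommMonoid M] (Z : IsZig T src w) {f : T → M} {F : ℕ → M}
    (h : ∀ m (h1 : 1 ≤ m) (h2 : m ≤ n), f (Z.arc h1 h2) = F m) :
    ∏ i, f i = ∏ m ∈ Finset.range n, F (m + 1) := by
  symm
  refine Finset.prod_bij (fun m hm => Z.arc (Nat.succ_pos m) (Finset.mem_range.1 hm))
    (fun _ _ => Finset.mem_univ _) (fun a ha b hb hab => ?_) (fun f _ => ?_) (fun m hm => ?_)
  · have := congrArg Z.idx hab
    rw [Z.idx_arc, Z.idx_arc] at this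
    exact Nat.succ_injective this
  · obtain ⟨m, h1, h2, rfl⟩ := Z.exists_arc f
    obtain ⟨m, rfl⟩ : ∃ m', m = m' + 1 := ⟨m - 1, by omega⟩
    exact ⟨m, Finset.mem_range.2 (by omega), rfl⟩
  · exact (h _ _ _).symm

lemma IsZig.sum_arc {M : Type*} [AddCommMonoid M] (Z : IsZig T src w) {f : T → M} {F : ℕ → M}
    (h : ∀ m (h1 : 1 ≤ m) (h2 : m ≤ n), f (Z.arc h1 h2) = F m) :
    ∑ i, f i = ∑ m ∈ Finset.range n, F (m + 1) :=
  Z.prod_arc (M := Multiplicative M) h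

/-- Only the arcs `c` and `c + 2` are adjacent to `c + 1` in the quiver. The vanishing of `F`
outside `1, …, n` covers the missing neighbours at the two ends. -/
lemma sum_neighbours (w : ℕ → Bool) {F : ℕ → ℤ} (h0 : F 0 = 0) (hn : ∀ m, n < m → F m = 0)
    (c : ℕ) : ∑ b ∈ Finset.range n, (if (b + 1 + 1 = c + 1 ∧ w (b + 1) = true) ∨
        (c + 1 + 1 = b + 1 ∧ w (c + 1) = false) then F (b + 1) else 0) =
      (if w c then F c else 0) + if w (c + 1) then 0 else F (c + 2) := by
  have h : ∀ b ∈ Finset.range n, (if (b + 1 + 1 = c + 1 ∧ w (b + 1) = true) ∨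
        (c + 1 + 1 = b + 1 ∧ w (c + 1) = false) then F (b + 1) else 0) =
      (if b + 1 = c then (if w c then F c else 0) else 0) +
        if b = c + 1 then (if w (c + 1) then 0 else F (c + 2)) else 0 := by
    intro b _
    by_cases h1 : b + 1 = c
    · subst h1
      rw [if_pos rfl, if_neg (show ¬ b = b + 1 + 1 by omega), add_zero]
      refine if_congr ⟨fun h => ?_, fun h => Or.inl ⟨rfl, h⟩⟩ rfl rfl
      rcases h with h | h
      · exact h.2
      · omega
    · by_cases h2 : b = c + 1
      · subst h2
        rw [if_neg h1, if_pos rfl, zero_add]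
        cases h : w (c + 1)
        · rw [if_pos (Or.inr ⟨rfl, rfl⟩), if_neg (by simp)]
        · rw [if_neg (by rintro (⟨h, -⟩ | ⟨-, h⟩) <;> first | omega | simp at h), if_pos rfl]
      · rw [if_neg (by omega), if_neg h1, if_neg h2, add_zero]
  rw [Finset.sum_congr rfl h, Finset.sum_add_distrib]
  congr 1
  · cases c with
    | zero => simp [h0]
    | succ c =>
      simp only [Nat.add_right_cancel_iff, Finset.sum_ite_eq', Finset.mem_range]
      by_cases hc : c < n
      · rw [if_pos hc]
      · rw [if_neg hc, hn _ (by omega), ite_self]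
  · simp only [Finset.sum_ite_eq', Finset.mem_range]
    by_cases hc : c + 1 < n
    · rw [if_pos hc]
    · rw [if_neg hc, hn _ (by omega), ite_self]

/-- The height is the sum of the positions of the two ends. An arrow joins consecutive arcs in the
direction in which the moving end comes down by one, so the height drops by one. -/
lemma IsZig.exists_height (Z : IsZig T src w) :
    ∃ ht : T → ℕ, ∀ e f : T, Arrow T e f → ht f < ht e := by
  refine ⟨fun f => rp w (Z.idx f) + lp n w (Z.idx f), fun e f h => ?_⟩
  obtain ⟨a, h1, h2, rfl⟩ := Z.exists_arc e
  obtain ⟨b, h3, h4, rfl⟩ := Z.exists_arc f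
  simp only [Z.idx_arc, lp]
  rcases (Z.arrow_arc_iff h1 h2 h3 h4).1 h with ⟨rfl, hw⟩ | ⟨rfl, hw⟩
  · rw [rp_succ_true hw]; omega
  · rw [rp_succ_false hw]; omega

/-- The exponent of the root of the `b`-th arc that comes from the `b`-th triangle. -/
def lowExp (w : ℕ → Bool) (m d : ℕ → ℤ) (b : ℕ) : ℤ :=
  if w b then d (b + 1) else 2 * m (b + 1) - d (b + 1)

/-- The exponent of the root of the `(b + 1)`-st arc that comes from the `b`-th triangle. -/
def highExp (w : ℕ → Bool) (m d : ℕ → ℤ) (b : ℕ) : ℤ :=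
  if w b then 2 * m b - d b else d b

/-- The neighbours of arc `c + 1` are reached through the triangles `c` and `c + 1` on its two
sides. Sorting the arrows by triangle splits the exponent into `highExp` at `c`, `lowExp` at `c +
1`, and a term for the arc itself. -/
lemma IsZig.exponent_eq (Z : IsZig T src w) (hI : NoInternalTriangle T) (γ : Sym2 (Fin (n + 3)))
    (d : T → ℕ) {m δ : ℕ → ℤ} (hm0 : m 0 = 0) (hmn : ∀ b, n < b → m b = 0) (hδ0 : δ 0 = 0)
    (hδn : ∀ b, n < b → δ b = 0)
    (hm : ∀ b (h1 : 1 ≤ b) (h2 : b ≤ n), (arcDim γ (Z.arc h1 h2) : ℤ) = m b)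
    (hδ : ∀ b (h1 : 1 ≤ b) (h2 : b ≤ n), (d (Z.arc h1 h2) : ℤ) = δ b) {c : ℕ} (h1 : 1 ≤ c + 1)
    (h2 : c + 1 ≤ n) :
    2 * index (idemD T) (IndModule hI γ) (Z.arc h1 h2) +
      antisymForm (ModuleCat.of (JacD T) (Simple (Z.arc h1 h2)))
        (ModuleCat.of (JacD T) ((j : T) → Fin (d j) → Simple j)) =
      lowExp w m δ (c + 1) + highExp w m δ c - 2 * m (c + 1) := by
  classical
  obtain ⟨ht, hht⟩ := Z.exists_height
  have e1 : ∑ f : T, (if Arrow T (Z.arc h1 h2) f then (arcDim γ f : ℤ) else 0) =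
      (if w c then m c else 0) + if w (c + 1) then 0 else m (c + 2) := by
    rw [← sum_neighbours w hm0 hmn]
    refine Z.sum_arc (F := fun b => if (b + 1 = c + 1 ∧ w b = true) ∨
      (c + 1 + 1 = b ∧ w (c + 1) = false) then m b else 0) fun b h3 h4 => ?_
    simp only [Z.arrow_arc_iff h1 h2 h3 h4, hm b h3 h4]
  have e2 : ∑ j : T, (d j : ℤ) * (if Arrow T (Z.arc h1 h2) j then 1 else 0) =
      (if w c then δ c else 0) + if w (c + 1) then 0 else δ (c + 2) := by
    rw [← sum_neighbours w hδ0 hδn]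
    refine Z.sum_arc (F := fun b => if (b + 1 = c + 1 ∧ w b = true) ∨
      (c + 1 + 1 = b ∧ w (c + 1) = false) then δ b else 0) fun b h3 h4 => ?_
    simp only [Z.arrow_arc_iff h1 h2 h3 h4, hδ b h3 h4, mul_ite, mul_one, mul_zero]
  have e3 : ∑ j : T, (d j : ℤ) * (if Arrow T j (Z.arc h1 h2) then 1 else 0) =
      (if w c then 0 else δ c) + if w (c + 1) then δ (c + 2) else 0 := by
    have := sum_neighbours (fun b => !w b) hδ0 hδn c
    rw [show (if w c then 0 else δ c) + (if w (c + 1) then δ (c + 2) else 0) =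
      (if (!w c) = true then δ c else 0) + if (!w (c + 1)) = true then 0 else δ (c + 2) by
        cases w c <;> cases w (c + 1) <;> simp, ← this]
    refine Z.sum_arc (F := fun b => if (b + 1 = c + 1 ∧ (!w b) = true) ∨
      (c + 1 + 1 = b ∧ (!w (c + 1)) = false) then δ b else 0) fun b h3 h4 => ?_
    simp only [Z.arrow_arc_iff h3 h4 h1 h2, hδ b h3 h4, mul_ite, mul_one, mul_zero,
      Bool.not_eq_true', Bool.not_eq_false']
    exact if_congr or_comm rfl rfl
  rw [index_indModule hI γ hht, antisymForm_simples hI, e1, hm _ h1 h2]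
  simp only [mul_sub, Finset.sum_sub_distrib, e2, e3, lowExp, highExp]
  cases w c <;> cases w (c + 1) <;> simp <;> ring

/-- A product over arcs is regrouped as a product over triangles. Shifting the index costs only
factors at the numbers `0` and `n + 1`, whose roots are one, and triangles outside `p, …, k`
contribute nothing. -/
lemma prod_bonds {Q : ℕ → R} (hQ : ∀ b, 0 < Q b) (h0 : Q 0 = 1) (hn : Q (n + 1) = 1)
    {p k : ℕ} (hk : k ≤ n) {m l h : ℕ → ℤ} (hm : ∀ b, b ≤ p ∨ k < b → m b = 0)
    (hl : ∀ b, b < p ∨ k < b → l b = 0) (hh : ∀ b, b < p ∨ k < b → h b = 0) :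
    ∏ c ∈ Finset.range n, Q (c + 1) ^ (l (c + 1) + h c - 2 * m (c + 1)) =
      ∏ j ∈ Finset.range (k + 1 - p),
        (Q (p + j) ^ (-2 * m (p + j))) * (Q (p + j + 1) ^ h (p + j) * Q (p + j) ^ l (p + j)) := by
  have e1 : ∏ c ∈ Finset.range n, Q (c + 1) ^ (l (c + 1) + h c - 2 * m (c + 1)) =
      ∏ b ∈ Finset.range (n + 1),
        (Q b ^ (-2 * m b)) * (Q (b + 1) ^ h b * Q b ^ l b) := by
    rw [Finset.prod_mul_distrib, Finset.prod_mul_distrib, Finset.prod_range_succ' (fun b => Q b ^ _),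
      Finset.prod_range_succ (fun b => Q (b + 1) ^ _), Finset.prod_range_succ' (fun b => Q b ^ _),
      h0, hn, one_zpow, one_zpow, one_zpow, mul_one, mul_one, mul_one, ← Finset.prod_mul_distrib,
      ← Finset.prod_mul_distrib]
    refine Finset.prod_congr rfl fun c _ => ?_
    rw [← zpow_add₀ (hQ _).ne', ← zpow_add₀ (hQ _).ne']
    congr 1
    ring
  rw [e1, ← Finset.prod_Ico_eq_prod_range
    (fun b => (Q b ^ (-2 * m b)) * (Q (b + 1) ^ h b * Q b ^ l b))]
  symm
  refine Finset.prod_subset (fun b hb => ?_) fun b _ hb => ?_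
  · rw [Finset.mem_Ico] at hb
    rw [Finset.mem_range]
    omega
  · rw [Finset.mem_Ico] at hb
    rw [hm b (by omega), hl b (by omega), hh b (by omega)]
    simp

end Exponents

/-! ### The expression as a sum over paths -/

section Main

variable {R : Type*} [Field R] [LinearOrder R] [IsStrictOrderedRing R]
  {n : ℕ} {w : ℕ → Bool} {T : Finset (Sym2 (Fin (n + 3)))} {src : Fin (n + 3)} {p k : ℕ}
  {e : ℕ → ℕ}

/-- The dimension vector described by a path. -/
def IsZig.dimOf (Z : IsZig T src w) (p k : ℕ) (e : ℕ → ℕ) (f : T) : ℕ :=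
  if p < Z.idx f ∧ Z.idx f ≤ k then e (Z.idx f) else 0

lemma IsZig.dimOf_arc (Z : IsZig T src w) {m : ℕ} (h1 : 1 ≤ m) (h2 : m ≤ n) :
    Z.dimOf p k e (Z.arc h1 h2) = if p < m ∧ m ≤ k then e m else 0 := by
  rw [dimOf, Z.idx_arc]

open Classical in
/-- The paths between the two ends of the arc `ar p k`. -/
def arcPaths (w : ℕ → Bool) (p k : ℕ) : Finset (ℕ → ℕ) :=
  (paths w p (k + 1 - p)).filter fun e => e (p + (k + 1 - p)) = rb w k

lemma mem_arcPaths (hpk : p < k) : e ∈ arcPaths w p k ↔ e p = lb w p ∧ e (k + 1) = rb w k ∧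
    (∀ m, p < m → m ≤ k → e m ≤ 2) ∧ ∀ m, m < p ∨ k + 1 < m → e m = 0 := by
  rw [arcPaths, Finset.mem_filter, mem_paths, show p + (k + 1 - p) = k + 1 by omega]
  constructor
  · rintro ⟨⟨h1, h2, h3⟩, h4⟩
    exact ⟨h1, h4, fun m a b => h2 m a (by omega), h3⟩
  · rintro ⟨h1, h4, h2, h3⟩
    refine ⟨⟨h1, fun m a b => ?_, h3⟩, h4⟩
    by_cases hm : m = k + 1
    · subst hm
      rw [h4, rb]
      split_ifs <;> omega
    · exact h2 m a (by omega)

/-- Inside the path, admissibility is monotonicity along the arrow between consecutive arcs. At the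
two ends it holds automatically because `lb` and `rb` are extreme states on the right side. -/
lemma IsZig.goodVec_dimOf_iff (Z : IsZig T src w) (hpk : p < k) (hk : k ≤ n)
    (he : e ∈ arcPaths w p k) : GoodVec (ar src w p k) (Z.dimOf p k e) ↔
      ∀ b, p ≤ b → b ≤ k → Adm w b (e b) (e (b + 1)) := by
  obtain ⟨h1, h2, h3, h4⟩ := (mem_arcPaths hpk).1 he
  have hcr : ∀ m (a1 : 1 ≤ m) (a2 : m ≤ n), Crosses (Z.arc a1 a2).1 (ar src w p k) ↔
      p < m ∧ m ≤ k := fun m a1 a2 => Z.crosses_ar_iff (by omega) hpk hk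
  constructor
  · intro hd b hb hb'
    rcases hb.eq_or_lt with rfl | hb
    · have := h3 (p + 1) (by omega) (by omega)
      rw [h1, Adm, lb]
      split_ifs <;> omega
    rcases hb'.eq_or_lt with rfl | hb'
    · have := h3 b hb le_rfl
      rw [h2, Adm, rb]
      split_ifs <;> omega
    have a1 : 1 ≤ b := by omega
    have a2 : b ≤ n := by omega
    have a3 : 1 ≤ b + 1 := by omega
    have a4 : b + 1 ≤ n := by omega
    have c1 := (hcr b a1 a2).2 (by omega)
    have c2 := (hcr (b + 1) a3 a4).2 (by omega)
    rw [Adm]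
    cases hw : w b
    · have := hd.arrow _ _ ((Z.arrow_arc_iff a1 a2 a3 a4).2 (Or.inr ⟨rfl, hw⟩)) c1 c2
      rw [Z.dimOf_arc, Z.dimOf_arc, if_pos (by omega), if_pos (by omega)] at this
      simpa using this
    · have := hd.arrow _ _ ((Z.arrow_arc_iff a3 a4 a1 a2).2 (Or.inl ⟨rfl, hw⟩)) c2 c1
      rw [Z.dimOf_arc, Z.dimOf_arc, if_pos (by omega), if_pos (by omega)] at this
      simpa using this
  · intro hA
    refine ⟨fun f hf => ?_, fun f => ?_, fun f g ha hf hg => ?_⟩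
    · obtain ⟨m, a1, a2, rfl⟩ := Z.exists_arc f
      rw [hcr] at hf
      rw [Z.dimOf_arc, if_neg hf]
    · obtain ⟨m, a1, a2, rfl⟩ := Z.exists_arc f
      rw [Z.dimOf_arc]
      split_ifs with h
      · exact h3 m h.1 h.2
      · omega
    · obtain ⟨m, a1, a2, rfl⟩ := Z.exists_arc f
      obtain ⟨m', a3, a4, rfl⟩ := Z.exists_arc g
      rw [hcr] at hf hg
      rw [Z.dimOf_arc, Z.dimOf_arc, if_pos hf, if_pos hg]
      rcases (Z.arrow_arc_iff a1 a2 a3 a4).1 ha with ⟨rfl, hw⟩ | ⟨rfl, hw⟩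
      · simpa [Adm, hw] using hA m' (by omega) (by omega)
      · simpa [Adm, hw] using hA m (by omega) (by omega)

/-- A dimension vector gives the inner states; the states at `p` and `k + 1` are forced, and the
rest is zero. -/
lemma IsZig.exists_path (Z : IsZig T src w) (hpk : p < k) (hk : k ≤ n) {d : T → ℕ}
    (hd : GoodVec (ar src w p k) d) : ∃ e ∈ arcPaths w p k, Z.dimOf p k e = d := by
  refine ⟨fun m => if m = p then lb w p else if m = k + 1 then rb w k else
    if h : p < m ∧ m ≤ k then d (Z.arc (k := m) (by omega) (by omega)) else 0,
    (mem_arcPaths hpk).2 ⟨?_, ?_, fun m a b => ?_, fun m a => ?_⟩, funext fun f => ?_⟩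
  · rw [if_pos rfl]
  · rw [if_neg (by omega), if_pos rfl]
  · rw [if_neg (by omega), if_neg (by omega), dif_pos ⟨a, b⟩]
    exact hd.le _
  · rw [if_neg (by omega), if_neg (by omega), dif_neg (by omega)]
  · obtain ⟨m, a1, a2, rfl⟩ := Z.exists_arc f
    rw [Z.dimOf_arc]
    by_cases h : p < m ∧ m ≤ k
    · rw [if_pos h, if_neg (by omega), if_neg (by omega), dif_pos h]
    · rw [if_neg h, hd.supp]
      rwa [show (Z.arc a1 a2).1 = gm src w m from rfl, Z.crosses_ar_iff (by omega) hpk hk]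

lemma IsZig.dimOf_injOn (Z : IsZig T src w) (hpk : p < k) (hk : k ≤ n) {e' : ℕ → ℕ}
    (he : e ∈ arcPaths w p k) (he' : e' ∈ arcPaths w p k) (h : Z.dimOf p k e = Z.dimOf p k e') :
    e = e' := by
  obtain ⟨h1, h2, -, h4⟩ := (mem_arcPaths hpk).1 he
  obtain ⟨h1', h2', -, h4'⟩ := (mem_arcPaths hpk).1 he'
  funext m
  by_cases hm : m = p
  · rw [hm, h1, h1']
  by_cases hm' : m = k + 1
  · rw [hm', h2, h2']
  by_cases hm'' : p < m ∧ m ≤ k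
  · have := congrFun h (Z.arc (k := m) (by omega) (by omega))
    rwa [Z.dimOf_arc, Z.dimOf_arc, if_pos hm'', if_pos hm''] at this
  · rw [h4 m (by omega), h4' m (by omega)]

lemma IsZig.describes (Z : IsZig T src w) (hpk : p < k) (hk : k ≤ n)
    (he : e ∈ arcPaths w p k) : Z.Describes p k (Z.dimOf p k e) e := by
  obtain ⟨h1, h2, h3, h4⟩ := (mem_arcPaths hpk).1 he
  refine ⟨hpk, hk, ?_, ?_, fun m hm => ?_, fun m a1 a2 b1 b2 => ?_⟩
  · rw [h1, lb]; split_ifs <;> omega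
  · rw [h2, rb]; split_ifs <;> omega
  · rw [h4 m hm]; omega
  · rw [Z.dimOf_arc, if_pos ⟨b1, b2⟩]

/-- After `prod_bonds` the two sides agree triangle by triangle: `lowExp` and `highExp` are the
exponents in `bw`, and the arc term is the factor `1 / q²` of each step but the first. -/
lemma IsZig.prod_exponents (Z : IsZig T src w) (hI : NoInternalTriangle T) (hpk : p < k)
    (hk : k ≤ n) {q : T → R} (hq : ∀ i, 0 < q i) (he : e ∈ arcPaths w p k)
    (hA : ∀ b, p ≤ b → b ≤ k → Adm w b (e b) (e (b + 1))) :
    (∏ i : T, (q i ^ 2) ^ (index (idemD T) (IndModule hI (ar src w p k)) i)) *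
      ∏ i : T, q i ^ antisymForm (ModuleCat.of (JacD T) (Simple i))
        (ModuleCat.of (JacD T) ((j : T) → Fin (Z.dimOf p k e j) → Simple j)) =
      pathScalar w (arcRoot src w q) p (k + 1 - p) e := by
  obtain ⟨h1, h2, h3, -⟩ := (mem_arcPaths hpk).1 he
  set m : ℕ → ℤ := fun b => if p < b ∧ b ≤ k then 1 else 0 with hm
  set δ : ℕ → ℤ := fun b => if p < b ∧ b ≤ k then (e b : ℤ) else 0 with hδ
  have hm' : ∀ b, b ≤ p ∨ k < b → m b = 0 := fun b hb => if_neg (by omega)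
  have hδ' : ∀ b, b ≤ p ∨ k < b → δ b = 0 := fun b hb => if_neg (by omega)
  have hm1 : ∀ b, p < b → b ≤ k → m b = 1 := fun b hb hb' => if_pos ⟨hb, hb'⟩
  have hδ1 : ∀ b, p < b → b ≤ k → δ b = e b := fun b hb hb' => if_pos ⟨hb, hb'⟩
  have hexp : ∀ (c : ℕ) (a1 : 1 ≤ c + 1) (a2 : c + 1 ≤ n), _ := fun c a1 a2 =>
    Z.exponent_eq hI (ar src w p k) (Z.dimOf p k e) (hm' 0 (by omega))
      (fun b hb => hm' b (by omega)) (hδ' 0 (by omega)) (fun b hb => hδ' b (by omega))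
      (fun b a1 a2 => by
        by_cases hb : p < b ∧ b ≤ k
        · rw [arcDim_eq_one.2 ((Z.crosses_ar_iff (by omega) hpk hk).2 hb), hm1 b hb.1 hb.2]; rfl
        · rw [arcDim_eq_zero.2 (mt (Z.crosses_ar_iff (by omega) hpk hk).1 hb), hm' b (by omega)]; rfl)
      (fun b a1 a2 => by rw [Z.dimOf_arc]; split_ifs with h <;> simp [hδ, h]) a1 a2
  rw [← Finset.prod_mul_distrib, Z.prod_arc (F := fun c => arcRoot src w q c ^
    (lowExp w m δ c + highExp w m δ (c - 1) - 2 * m c)) (fun c a1 a2 => ?_)]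
  swap
  · obtain ⟨c, rfl⟩ : ∃ c', c = c' + 1 := ⟨c - 1, by omega⟩
    rw [Nat.add_sub_cancel, ← hexp c a1 a2, Z.arcRoot_eq a1 a2, zpow_add₀ (hq _).ne', zpow_mul,
      zpow_ofNat]
  have hQ := arcRoot_pos (src := src) (w := w) hq
  simp only [Nat.add_sub_cancel]
  rw [prod_bonds hQ (arcRoot_of_lt (Or.inl rfl)) (arcRoot_of_lt (Or.inr (by omega))) hk hm'
    (fun b hb => ?_) (fun b hb => ?_), pathScalar]
  · refine Finset.prod_congr rfl fun j hj => ?_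
    rw [Finset.mem_range] at hj
    rw [if_pos (hA _ (by omega) (by omega))]
    congr 1
    · by_cases hj0 : j = 0
      · rw [if_pos hj0, hm' _ (by omega)]; simp
      · rw [if_neg hj0, hm1 _ (by omega) (by omega), mul_one, zpow_neg, zpow_ofNat]
    · rw [bw]
      have hlow : arcRoot src w q (p + j) ^ lowExp w m δ (p + j) = arcRoot src w q (p + j) ^
          (if w (p + j) then e (p + j + 1) else 2 - e (p + j + 1)) := by
        rw [← zpow_natCast]
        congr 1
        -- At the last triangle the following arc is not crossed and its exponent must be zero. The
        -- state `rb` is chosen so that the weight of the step agrees; `lb` plays the same role at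
        -- the first triangle.
        by_cases hjk : p + j = k
        · rw [lowExp, hm' _ (by omega), hδ' _ (by omega), hjk, h2, rb]
          split_ifs <;> simp
        · have := h3 (p + j + 1) (by omega) (by omega)
          rw [lowExp, hm1 _ (by omega) (by omega), hδ1 _ (by omega) (by omega)]
          split_ifs <;> push_cast [this] <;> ring
      have hhigh : arcRoot src w q (p + j + 1) ^ highExp w m δ (p + j) =
          arcRoot src w q (p + j + 1) ^ (if w (p + j) then 2 - e (p + j) else e (p + j)) := by
        rw [← zpow_natCast]
        congr 1
        by_cases hj0 : j = 0
        · subst hj0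
          rw [add_zero, highExp, hm' _ (by omega), hδ' _ (by omega), h1, lb]
          split_ifs <;> simp
        · have := h3 (p + j) (by omega) (by omega)
          rw [highExp, hm1 _ (by omega) (by omega), hδ1 _ (by omega) (by omega)]
          split_ifs <;> push_cast [this] <;> ring
      rw [hlow, hhigh]
      split_ifs <;> rfl
  · rw [lowExp, hm' _ (by omega), hδ' _ (by omega)]; simp
  · rw [highExp, hm' _ (by omega), hδ' _ (by omega)]; simp

lemma pathScalar_eq_zero {q : ℕ → R} (hpk : p < k)
    (hA : ¬ ∀ b, p ≤ b → b ≤ k → Adm w b (e b) (e (b + 1))) :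
    pathScalar w q p (k + 1 - p) e = 0 := by
  push Not at hA
  obtain ⟨b, h1, h2, h3⟩ := hA
  refine Finset.prod_eq_zero (i := b - p) (Finset.mem_range.2 (by omega)) ?_
  rw [show p + (b - p) = b by omega, if_neg h3]

/-- Paths correspond to candidate dimension vectors. An admissible path gives a Grassmannian that is
a point, so the weights agree factor by factor; for any other path both the scalar weight and
`muDim` vanish. -/
lemma IsZig.superCC_eq (Z : IsZig T src w) (hT : IsTriangulation T) (hI : NoInternalTriangle T)
    (hpk : p < k) (hk : k ≤ n) {q : T → R} (hq : ∀ i, 0 < q i) :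
    superCC hI src q (ar src w p k) = ∑ e ∈ arcPaths w p k,
      pathScalar w (arcRoot src w q) p (k + 1 - p) e •
        pathOdd w (etaOd T R src w) p (k + 1 - p) e := by
  classical
  rw [superCC, finsum_eq_sum_of_support_subset (s := (arcPaths w p k).image (Z.dimOf p k)),
    Finset.sum_image fun e he e' he' h => Z.dimOf_injOn hpk hk he he' h, Finset.smul_sum]
  · refine Finset.sum_congr rfl fun e he => ?_
    by_cases hA : ∀ b, p ≤ b → b ≤ k → Adm w b (e b) (e (b + 1))
    · have hd := (Z.goodVec_dimOf_iff hpk hk he).2 hA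
      have D := Z.describes hpk hk he
      rw [eulerChar_subGr hd, Int.cast_one, one_mul, smul_smul, Z.prod_exponents hI hpk hk hq he hA,
        D.muDim_eq hT hI hd, pathOdd_eq _ _ D.start (by
          rw [show p + (k + 1 - p) = k + 1 by omega]; exact D.final),
        show p + (k + 1 - p) = k + 1 by omega]
    · rw [pathScalar_eq_zero hpk hA, muDim_of_not_goodVec (mt (Z.goodVec_dimOf_iff hpk hk he).1 hA),
        smul_zero, smul_zero, zero_smul]
  · intro d hd
    rw [Finset.coe_image, Set.mem_image]
    refine Z.exists_path hpk hk ?_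
    by_contra hc
    exact hd (by simp only [muDim_of_not_goodVec hc, smul_zero])

lemma isSuperLambdaLength_iff_eq_superCC (hT : IsTriangulation T) (hI : NoInternalTriangle T)
    (hsrc : s(src - 1, src + 1) ∈ T) (hR : ∀ a : R, 0 ≤ a → IsSquare a) {q : T → R}
    (hq : ∀ i, 0 < q i) {γ : Sym2 (Fin (n + 3))} (hγ : IsArc γ) (hγT : γ ∉ T) (y : Super T R) :
    IsSuperLambdaLength src q γ y ↔ y = superCC hI src q γ := by
  classical
  have Z := isZig_zigWord hT hI hsrc
  obtain ⟨p, k, hpk, hk, rfl⟩ := Z.exists_ar hγ hγT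
  have hQ := arcRoot_pos (src := src) (w := zigWord T src) hq
  obtain ⟨g, hg⟩ := exists_zVec n (zigWord T src) hQ (arcRoot_of_lt (Or.inl rfl))
    (etaOd T R src (zigWord T src))
  have hs := tstate_eq_sum hg hQ (p := p) (j := k + 1 - p) (x := rb (zigWord T src) k) (by omega)
    (by omega) (by rw [Finset.mem_range, rb]; split_ifs <;> omega)
  rw [Z.isSuperLambdaLength_iff hT hR hq hg hpk hk hγ.2, Z.superCC_eq hT hI hpk hk hq]
  refine Eq.congr_right ?_
  refine (br_eq_tstate (q := arcRoot src (zigWord T src) q) (by omega)).trans ?_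
  rw [arcPaths, ← hs, show p + (k + 1 - p) = k + 1 by omega]

end Main

end SuperCC

end

theorem theorem5p9 (n : ℕ) (T : Finset (Sym2 (Fin (n + 3))))
    (hT : SuperCC.IsTriangulation T) (hI : SuperCC.NoInternalTriangle T)
    (src : Fin (n + 3)) (hsrc : s(src - 1, src + 1) ∈ T)
    (R : Type*) [Field R] [LinearOrder R] [IsStrictOrderedRing R]
    (hR : ∀ a : R, 0 ≤ a → IsSquare a)
    (q : T → R) (hq : ∀ i, 0 < q i)
    (γ : Sym2 (Fin (n + 3))) (hγ : SuperCC.IsArc γ) (hγT : γ ∉ T) :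
    ∀ y : SuperCC.Super T R,
      SuperCC.IsSuperLambdaLength src q γ y ↔ y = SuperCC.superCC hI src q γ := by
  exact SuperCC.isSuperLambdaLength_iff_eq_superCC hT hI hsrc hR hq hγ hγT
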